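/- Let $n\ge 53$. Write $\mathbb R^n_+=\{x=(\bar x,x_n): \bar x\in\mathbb R^{n-1},\,x_n\ge 0\}$; indices $i,j,k,l$ run over $1,\dots,n-1$, indices $a,b,c,d$ over $1,\dots,n$, and repeated indices are summed. **Setting.** Let $f(s)=a_0+a_1s$ with $a_1=-1$ and $$a_0=\frac{(n+3)(n-6)}{2(n-7)(n-8)}\left\{3+\sqrt{9-\frac{8(n-7)(n-8)^2(n+7)}{(n+3)(n-6)(n-9)(n-10)}}\right\}.$$ Define $\alpha_0,\alpha_1,\alpha_2$ and $\beta_0,\beta_1$ by $$\sum_{q=0}^{2}\alpha_qs^q=(n+1)f(s)^2+4sf(s)f'(s)+2s^2f'(s)^2,\qquad \sum_{q=0}^{1}\beta_qs^q=2f(s)f'(s)+sf'(s)^2,$$ and set $$I(s)=\sum_{q=0}^{2}\frac{\alpha_q}{n-6-2q}\left\{\prod_{j=0}^{q}\frac{n-1+2j}{n-5-2j}\right\}s^{q+2},\qquad J(s)=\sum_{q=0}^{1}\frac{\beta_q}{n-6-2q}\left\{\prod_{j=0}^{q}\frac{n+3+2j}{n-5-2j}\right\}s^{q+2}.$$ Let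 $W_{abcd}$ be a multilinear form on $\mathbb R^n$ with the algebraic symmetries of the Weyl tensor (antisymmetric in the first and in the second pair of indices, symmetric under exchange of the pairs, first Bianchi identity, all traces zero). Put $H_{ij}(x)=W_{ikjl}x_kx_l$ and $\bar H_{ij}(x)=f(|\bar x|^2)H_{ij}(x)$. Assume that $H$ is trace-free, $\sum_{i}H_{ii}\equiv 0$, and that $\sum_{i,j,k,l}(W_{ikjl}+W_{iljk})^2>0$. For $(\xi,\varepsilon)\in\mathbb R^{n-1}\times(0,\infty)$ let $$u_{(\xi,\varepsilon)}(x)=\left(\frac{\varepsilon}{D}\right)^{\frac{n-2}{2}},\qquad D=(\varepsilon+x_n)^2+|\bar x-\xi|^2,$$ $$\phi_{(\xi,\varepsilon,n)}(x)=\left(\frac{\varepsilon}{D}\right)^{\frac n2}\frac{\varepsilon^2-x_n^2-|\bar x-\xi|^2}{D},\qquad \phi_{(\xi,\varepsilon,k)}(x)=\left(\frac{\varepsilon}{D}\right)^{\frac n2}\frac{2\varepsilon(x_k-\xi_k)}{D}.$$ Let $\Sigma$ be the space of all $w\in L^{\frac{2n}{n-2}}(\mathbb R^n_+)\cap L^{\frac{2(n-1)}{n-2}}(\partial\mathbb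 R^n_+)\cap H^1_{loc}(\mathbb R^n_+)$ with $\int_{\mathbb R^n_+}|dw|^2<\infty$ (boundary values in the sense of traces), and let $\Sigma_{(\xi,\varepsilon)}$ be the space of all $w\in\Sigma$ with $\int_{\partial\mathbb R^n_+}\phi_{(\xi,\varepsilon,a)}w=0$ for $a=1,\dots,n$. Let $z_{(\xi,\varepsilon)}$ be the unique element of $\Sigma_{(\xi,\varepsilon)}$ such that $$\int_{\mathbb R^n_+}\langle dz_{(\xi,\varepsilon)},d\psi\rangle-\int_{\partial\mathbb R^n_+}n\,u_{(\xi,\varepsilon)}^{\frac{2}{n-2}}z_{(\xi,\varepsilon)}\psi=-\int_{\mathbb R^n_+}\bar H_{ij}\,\partial_i\partial_ju_{(\xi,\varepsilon)}\,\psi\qquad\text{for all }\psi\in\Sigma_{(\xi,\varepsilon)},$$ and define $$F(\xi,\varepsilon)=\frac12\int_{\mathbb R^n_+}\bar H_{il}\bar H_{jl}\,\partial_iu_{(\xi,\varepsilon)}\,\partial_ju_{(\xi,\varepsilon)}-\frac{n-2}{16(n-1)}\int_{\mathbb R^n_+}\sum_{i,j,l}(\partial_l\bar H_{ij})^2u_{(\xi,\varepsilon)}^2+\int_{\mathbb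 R^n_+}\bar H_{ij}\,\partial_i\partial_ju_{(\xi,\varepsilon)}\,z_{(\xi,\varepsilon)}.$$ **Claim.** $I'(1)=0$, $I''(1)<0$ and $J(1)<0$. In particular, $F$ has a strict local minimum at $(\xi,\varepsilon)=(0,1)$: there is a neighbourhood $U$ of $(0,1)$ in $\mathbb R^{n-1}\times(0,\infty)$ such that $F(0,1)<F(\xi,\varepsilon)$ for all $(\xi,\varepsilon)\in U\setminus\{(0,1)\}$. -/

import Mathlib

open Filter Topology MeasureTheory Polynomial
open scoped ContDiff

noncomputable section

namespace HalfSpaceBubble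

/-! Throughout, `n` is the dimension. A point of `ℝⁿ = ℝⁿ⁻¹ × ℝ` is written `x = (x̄, xₙ)`, so that
the half-space is `{xₙ ≥ 0}` and its boundary is `ℝⁿ⁻¹`. The measure on the product is Lebesgue
measure on `ℝⁿ`. Only measures and the topology of the product are used, never its sup norm;
the Euclidean inner product of `ℝⁿ` is `dot`. -/

/-- The boundary hyperplane `ℝⁿ⁻¹` with its Euclidean norm. -/
abbrev Bdry (n : ℕ) : Type := EuclideanSpace ℝ (Fin (n - 1))

/-- `ℝⁿ`, as `ℝⁿ⁻¹ × ℝ`. -/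
abbrev Space (n : ℕ) : Type := Bdry n × ℝ

/-- The half-space `ℝⁿ₊ = {xₙ ≥ 0}`. -/
def halfSpace (n : ℕ) : Set (Space n) := {x | 0 ≤ x.2}

/-- The Euclidean inner product of `ℝⁿ`. -/
def dot {n : ℕ} (v w : Space n) : ℝ := inner ℝ v.1 w.1 + v.2 * w.2

/-- The partial derivative `∂ᵢ`, for a tangential index `1 ≤ i ≤ n - 1`. -/
def pd {n : ℕ} (i : Fin (n - 1)) (φ : Space n → ℝ) (x : Space n) : ℝ :=
  fderiv ℝ φ x (EuclideanSpace.single i 1, 0)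

/-! ### The bubbles and the space `Σ` -/

/-- The denominator `(ε + xₙ)² + |x̄ - ξ|²`. -/
def den {n : ℕ} (ξ : Bdry n) (ε : ℝ) (x : Space n) : ℝ := (ε + x.2) ^ 2 + ‖x.1 - ξ‖ ^ 2

/-- The bubble `u_(ξ,ε)`. -/
def bubble {n : ℕ} (ξ : Bdry n) (ε : ℝ) (x : Space n) : ℝ :=
  (ε / den ξ ε x) ^ (((n : ℝ) - 2) / 2)

/-- The function `φ_(ξ,ε,n)`. -/
def phiNormal {n : ℕ} (ξ : Bdry n) (ε : ℝ) (x : Space n) : ℝ :=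
  (ε / den ξ ε x) ^ ((n : ℝ) / 2) * ((ε ^ 2 - x.2 ^ 2 - ‖x.1 - ξ‖ ^ 2) / den ξ ε x)

/-- The function `φ_(ξ,ε,k)`, for `1 ≤ k ≤ n - 1`. -/
def phiTangential {n : ℕ} (ξ : Bdry n) (ε : ℝ) (k : Fin (n - 1)) (x : Space n) : ℝ :=
  (ε / den ξ ε x) ^ ((n : ℝ) / 2) * (2 * ε * (x.1 k - ξ k) / den ξ ε x)

/-- `dw` is the weak gradient of `w` in the open half-space. -/
def HasWeakGradient {n : ℕ} (w : Space n → ℝ) (dw : Space n → Space n) : Prop :=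
  ∀ φ : Space n → ℝ, ContDiff ℝ ∞ φ → HasCompactSupport φ → tsupport φ ⊆ {x | 0 < x.2} →
    ∀ v : Space n,
      ∫ x in halfSpace n, w x * fderiv ℝ φ x v = -∫ x in halfSpace n, dot (dw x) v * φ x

/-- `tw` is the boundary trace of `w`, where `dw` is the weak gradient of `w`: Green's formula
holds for all smooth `φ` with compact support in the closed half-space. -/
def HasTrace {n : ℕ} (w : Space n → ℝ) (dw : Space n → Space n) (tw : Bdry n → ℝ) : Prop :=
  ∀ φ : Space n → ℝ, ContDiff ℝ ∞ φ → HasCompactSupport φ →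
    ∀ v : Space n,
      ∫ x in halfSpace n, w x * fderiv ℝ φ x v =
        -(∫ x in halfSpace n, dot (dw x) v * φ x) - v.2 * ∫ y : Bdry n, tw y * φ (y, 0)

/-- `w` belongs to `Σ`, with weak gradient `dw` and boundary trace `tw`. As `2n/(n-2) ≥ 2`, the
first, third and fourth conditions give `w ∈ H¹_loc` up to the boundary. -/
structure MemSigma {n : ℕ} (w : Space n → ℝ) (dw : Space n → Space n) (tw : Bdry n → ℝ) :
    Prop where
  memLp : MemLp w (ENNReal.ofReal (2 * n / (n - 2))) (volume.restrict (halfSpace n))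
  memLp_trace : MemLp tw (ENNReal.ofReal (2 * (n - 1) / (n - 2))) volume
  memLp_gradient : MemLp dw 2 (volume.restrict (halfSpace n))
  weakGradient : HasWeakGradient w dw
  trace : HasTrace w dw tw

/-- `w` belongs to `Σ_(ξ,ε)`, with weak gradient `dw` and boundary trace `tw`. -/
structure MemSigmaAt {n : ℕ} (ξ : Bdry n) (ε : ℝ)
    (w : Space n → ℝ) (dw : Space n → Space n) (tw : Bdry n → ℝ) : Prop
    extends MemSigma w dw tw where
  orth_normal : ∫ y : Bdry n, phiNormal ξ ε (y, 0) * tw y = 0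
  orth_tangential : ∀ k, ∫ y : Bdry n, phiTangential ξ ε k (y, 0) * tw y = 0

/-! ### The tensor `H̄` -/

/-- The components `W_{abcd}` of a multilinear form on `ℝⁿ` with the algebraic properties of the
Weyl tensor. -/
structure IsWeyl {n : ℕ} (W : Fin n → Fin n → Fin n → Fin n → ℝ) : Prop where
  antisymm_left : ∀ a b c d, W a b c d = -W b a c d
  antisymm_right : ∀ a b c d, W a b c d = -W a b d c
  pair_symm : ∀ a b c d, W a b c d = W c d a b
  bianchi : ∀ a b c d, W a b c d + W a c d b + W a d b c = 0
  traceFree : ∀ b d, ∑ a, W a b a d = 0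

/-- A tangential index `1 ≤ i ≤ n - 1` viewed as an index `1 ≤ a ≤ n`. -/
def tan {n : ℕ} (i : Fin (n - 1)) : Fin n := Fin.castLE (Nat.sub_le n 1) i

/-- `∑ (W_{ikjl} + W_{iljk})²`, summed over the tangential indices. -/
def tangentialNormSq {n : ℕ} (W : Fin n → Fin n → Fin n → Fin n → ℝ) : ℝ :=
  ∑ i : Fin (n - 1), ∑ j : Fin (n - 1), ∑ k : Fin (n - 1), ∑ l : Fin (n - 1),
    (W (tan i) (tan k) (tan j) (tan l) + W (tan i) (tan l) (tan j) (tan k)) ^ 2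

/-- `H_{ij}(x) = W_{ikjl} xᵏ xˡ`, for tangential indices (the components `H_{nb}` vanish). -/
def tensorH {n : ℕ} (W : Fin n → Fin n → Fin n → Fin n → ℝ) (i j : Fin (n - 1))
    (x : Space n) : ℝ :=
  ∑ k : Fin (n - 1), ∑ l : Fin (n - 1), W (tan i) (tan k) (tan j) (tan l) * x.1 k * x.1 l

/-- The polynomial `f(s) = ∑_{j ≤ d} a_j sʲ`. -/
def fPoly (d : ℕ) (a : ℕ → ℝ) : ℝ[X] := ∑ j ∈ Finset.range (d + 1), C (a j) * X ^ j

/-- `H̄_{ij}(x) = f(|x̄|²) H_{ij}(x)`. -/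
def tensorHbar {n : ℕ} (W : Fin n → Fin n → Fin n → Fin n → ℝ) (d : ℕ) (a : ℕ → ℝ)
    (i j : Fin (n - 1)) (x : Space n) : ℝ :=
  (fPoly d a).eval (‖x.1‖ ^ 2) * tensorH W i j x

/-! ### The auxiliary function `F` -/

/-- The function `H̄_{ij} ∂ᵢ∂ⱼ u_(ξ,ε)`. -/
def source {n : ℕ} (W : Fin n → Fin n → Fin n → Fin n → ℝ) (d : ℕ) (a : ℕ → ℝ)
    (ξ : Bdry n) (ε : ℝ) (x : Space n) : ℝ :=
  ∑ i, ∑ j, tensorHbar W d a i j x * pd i (pd j (bubble ξ ε)) x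

/-- `z` is an element of `Σ_(ξ,ε)` that satisfies
`∫ ⟨dz, dψ⟩ - ∫_∂ n u^{2/(n-2)} z ψ = -∫ H̄_{ij} ∂ᵢ∂ⱼu ψ` for all `ψ ∈ Σ_(ξ,ε)`. -/
def IsCorrector {n : ℕ} (W : Fin n → Fin n → Fin n → Fin n → ℝ) (d : ℕ) (a : ℕ → ℝ)
    (ξ : Bdry n) (ε : ℝ) (z : Space n → ℝ) : Prop :=
  ∃ (dz : Space n → Space n) (tz : Bdry n → ℝ), MemSigmaAt ξ ε z dz tz ∧
    ∀ (ψ : Space n → ℝ) (dψ : Space n → Space n) (tψ : Bdry n → ℝ), MemSigmaAt ξ ε ψ dψ tψ →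
      (∫ x in halfSpace n, dot (dz x) (dψ x)) -
          ∫ y : Bdry n, n * bubble ξ ε (y, 0) ^ (2 / ((n : ℝ) - 2)) * tz y * tψ y =
        -∫ x in halfSpace n, source W d a ξ ε x * ψ x

open Classical in
/-- The function `z_(ξ,ε)`, which is determined by `IsCorrector` up to null sets. -/
def corrector {n : ℕ} (W : Fin n → Fin n → Fin n → Fin n → ℝ) (d : ℕ) (a : ℕ → ℝ)
    (ξ : Bdry n) (ε : ℝ) : Space n → ℝ :=
  if h : ∃ z, IsCorrector W d a ξ ε z then h.choose else 0

/-- The auxiliary function `F(ξ, ε)`, with `c_n = (n-2)/(4(n-1))`. -/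
def auxF {n : ℕ} (W : Fin n → Fin n → Fin n → Fin n → ℝ) (d : ℕ) (a : ℕ → ℝ)
    (ξ : Bdry n) (ε : ℝ) : ℝ :=
  1 / 2 * (∫ x in halfSpace n, ∑ i, ∑ j, ∑ l, tensorHbar W d a i l x * tensorHbar W d a j l x *
      pd i (bubble ξ ε) x * pd j (bubble ξ ε) x)
  - ((n : ℝ) - 2) / (4 * (n - 1)) / 4 * (∫ x in halfSpace n,
      (∑ i, ∑ j, ∑ l, pd l (tensorHbar W d a i j) x ^ 2) * bubble ξ ε x ^ 2)
  + ∫ x in halfSpace n, source W d a ξ ε x * corrector W d a ξ ε x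

/-! ### The polynomials `I` and `J` -/

/-- The polynomial `∑ α_q s^q = (n+1) f(s)² + 4 s f(s) f'(s) + 2 s² f'(s)²`. -/
def alphaPoly (n d : ℕ) (a : ℕ → ℝ) : ℝ[X] :=
  C ((n : ℝ) + 1) * fPoly d a ^ 2 + 4 * X * fPoly d a * derivative (fPoly d a)
    + 2 * X ^ 2 * derivative (fPoly d a) ^ 2

/-- The polynomial `∑ β_q s^q = 2 f(s) f'(s) + s f'(s)²`. -/
def betaPoly (d : ℕ) (a : ℕ → ℝ) : ℝ[X] :=
  2 * fPoly d a * derivative (fPoly d a) + X * derivative (fPoly d a) ^ 2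

/-- `I(s) = ∑_{q=0}^{2d} α_q / (n-6-2q) ∏_{j=0}^{q} (n-1+2j)/(n-5-2j) s^{q+2}`. -/
def polyI (n d : ℕ) (a : ℕ → ℝ) (s : ℝ) : ℝ :=
  ∑ q ∈ Finset.range (2 * d + 1), (alphaPoly n d a).coeff q / ((n : ℝ) - 6 - 2 * q) *
    (∏ j ∈ Finset.range (q + 1), ((n : ℝ) - 1 + 2 * j) / ((n : ℝ) - 5 - 2 * j)) * s ^ (q + 2)

/-- `J(s) = ∑_{q=0}^{2d-1} β_q s^{q+2} / (n-6-2q) ∏_{j=0}^{q} (n+3+2j)/(n-5-2j)`. -/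
def polyJ (n d : ℕ) (a : ℕ → ℝ) (s : ℝ) : ℝ :=
  ∑ q ∈ Finset.range (2 * d), (betaPoly d a).coeff q * s ^ (q + 2) / ((n : ℝ) - 6 - 2 * q) *
    ∏ j ∈ Finset.range (q + 1), ((n : ℝ) + 3 + 2 * j) / ((n : ℝ) - 5 - 2 * j)

end HalfSpaceBubble

end

noncomputable section

namespace HalfSpaceBubble

/-! ### The polynomials `I` and `J` for `d = 1` -/

/-! The function F is expanded in ξ at ξ = 0, uniformly for ε in [1/2, 2]. Translating x̄ by ξ
centres the bubble and gives F(ξ,ε) = Z(ε) + S(ξ,ε) + O(|ξ|³), with S quadratic in ξ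
(`exists_abs_auxF_sub_le`); the linear term has an integrand odd in x̄ and vanishes. So F(ξ,ε) -
F(0,1) ≥ Z(ε) - Z(1) + (δ - C|ξ|)|ξ|² as soon as S ≥ δ|ξ|², and it remains to find a strict local
minimum of Z at 1 and to see that S is positive definite near ε = 1 (`eventually_auxF_lt`).

Leading terms. Write D for the denominator. Since H_{ij}(x) x_j = 0, the first integral in F is of
second order in ξ, and Z comes from the gradient of H̄ alone. Rotation invariance in x̄ reduces all
integrals to moments ∫ |x̄|^k D^(-β), which are powers of ε and satisfy two-term recurrences. The
outcome is that Z(ε) is a negative constant times I(ε²) (`auxZero_eq`), so I'(1) = 0 and I''(1) < 0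
give the strict minimum. Likewise S is a positive multiple of A(ε) T(ξ) + B(ε) N |ξ|²
(`auxSecond_eq`), where T ≥ 0 is a quadratic form, N > 0 is the norm of the symmetrized tangential
tensor, and A(1) = -4(n-5)/(n+3) J(1) > 0; the same lower bound for a₀ gives B(1) > 0.

Numerical facts. I'(1) = 0 is a quadratic equation with larger root a₀. I''(1) < 0 and J(1) < 0 are
lower bounds for a₀: the first holds because a₀ lies beyond the midpoint of the two roots, the
second amounts to the square root in a₀ exceeding 6/(n+3). The latter holds for n = 53 and fails for
n = 52.

Corrector. With y = x̄ - ξ and Q(y) = H_{ij}(ξ) y_i y_j, the source is a multiple of Q(y) f(|x̄|²)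
D^(-n/2-1), hence O(|ξ|²). Because |x̄|² = |ξ|² + 2ξ·y + |y|², only the harmonic polynomials Q(y)
and (ξ·y) Q(y) occur, with factors depending on |y|². For each one the Poisson equation with the
Robin condition ∂ₙz = -(nε/D) z is solved explicitly by k(y) g(|y|², ε + xₙ), with g made of powers
of D and one tail integral. Such boundary values are spherical harmonics of degree two and three
times radial functions, hence orthogonal to the φ's, which have degree zero and one. Green's formula
makes these solutions correctors; they are O(|ξ|²) uniformly (`exists_uniform_solution`), so the
last integral in F is O(|ξ|⁴) (`exists_abs_integral_source_mul_corrector_le`). No abstract existence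
theory is needed. -/

theorem fPoly_one (a : ℕ → ℝ) : fPoly 1 a = C (a 0) + C (a 1) * Polynomial.X := by
  simp [fPoly, Finset.sum_range_succ]

theorem derivative_fPoly_one (a : ℕ → ℝ) : derivative (fPoly 1 a) = C (a 1) := by
  simp [fPoly_one]

theorem alphaPoly_one (n : ℕ) (a : ℕ → ℝ) :
    alphaPoly n 1 a = C (((n : ℝ) + 1) * a 0 ^ 2) + C ((2 * (n : ℝ) + 6) * (a 0 * a 1)) * Polynomial.X
      + C (((n : ℝ) + 7) * a 1 ^ 2) * Polynomial.X ^ 2 := by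
  rw [alphaPoly, derivative_fPoly_one, fPoly_one]
  simp only [map_add, map_mul, map_pow, map_one, map_ofNat]
  ring

theorem betaPoly_one (a : ℕ → ℝ) :
    betaPoly 1 a = C (2 * (a 0 * a 1)) + C (3 * a 1 ^ 2) * Polynomial.X := by
  rw [betaPoly, derivative_fPoly_one, fPoly_one]
  simp only [map_mul, map_pow, map_ofNat]
  ring

theorem coeff_quadratic_poly (a b c : ℝ) :
    (C a + C b * Polynomial.X + C c * Polynomial.X ^ 2).coeff 0 = a ∧
    (C a + C b * Polynomial.X + C c * Polynomial.X ^ 2).coeff 1 = b ∧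
    (C a + C b * Polynomial.X + C c * Polynomial.X ^ 2).coeff 2 = c := by
  simp only [coeff_add, coeff_C_mul, coeff_C, coeff_X, coeff_X_pow]
  norm_num

theorem polyI_one (n : ℕ) (a : ℕ → ℝ) : polyI n 1 a = fun s =>
    ((n : ℝ) + 1) * a 0 ^ 2 / (n - 6) * ((n - 1) / (n - 5)) * s ^ 2
    + (2 * (n : ℝ) + 6) * (a 0 * a 1) / (n - 8) * ((n - 1) / (n - 5) * ((n + 1) / (n - 7))) * s ^ 3
    + ((n : ℝ) + 7) * a 1 ^ 2 / (n - 10) *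
      ((n - 1) / (n - 5) * ((n + 1) / (n - 7)) * ((n + 3) / (n - 9))) * s ^ 4 := by
  funext s
  obtain ⟨h0, h1, h2⟩ := coeff_quadratic_poly (((n : ℝ) + 1) * a 0 ^ 2)
    ((2 * (n : ℝ) + 6) * (a 0 * a 1)) (((n : ℝ) + 7) * a 1 ^ 2)
  rw [← alphaPoly_one] at h0 h1 h2
  simp only [polyI, Finset.sum_range_succ, Finset.prod_range_succ, Finset.sum_range_zero,
    Finset.prod_range_zero, h0, h1, h2, one_mul, zero_add]
  push_cast
  ring_nf

theorem polyJ_one (n : ℕ) (a : ℕ → ℝ) : polyJ n 1 a 1 =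
    2 * (a 0 * a 1) / (n - 6) * ((n + 3) / (n - 5))
    + 3 * a 1 ^ 2 / (n - 8) * ((n + 3) / (n - 5) * ((n + 5) / (n - 7))) := by
  have h0 : (betaPoly 1 a).coeff 0 = 2 * (a 0 * a 1) := by
    rw [betaPoly_one, coeff_add, coeff_C_mul, coeff_C, coeff_X]; norm_num
  have h1 : (betaPoly 1 a).coeff 1 = 3 * a 1 ^ 2 := by
    rw [betaPoly_one, coeff_add, coeff_C_mul, coeff_C, coeff_X]; norm_num
  simp only [polyJ, Finset.sum_range_succ, Finset.prod_range_succ, Finset.sum_range_zero,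
    Finset.prod_range_zero, h0, h1, one_mul, zero_add, mul_one, one_pow]
  push_cast
  ring_nf

theorem hasDerivAt_polyI_one (n : ℕ) (a : ℕ → ℝ) (s : ℝ) : HasDerivAt (polyI n 1 a)
    (((n : ℝ) + 1) * a 0 ^ 2 / (n - 6) * ((n - 1) / (n - 5)) * (2 * s)
    + (2 * (n : ℝ) + 6) * (a 0 * a 1) / (n - 8) * ((n - 1) / (n - 5) * ((n + 1) / (n - 7)))
      * (3 * s ^ 2)
    + ((n : ℝ) + 7) * a 1 ^ 2 / (n - 10) *
      ((n - 1) / (n - 5) * ((n + 1) / (n - 7)) * ((n + 3) / (n - 9))) * (4 * s ^ 3)) s := by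
  rw [polyI_one]
  have h2 := (hasDerivAt_pow 2 s).const_mul (((n : ℝ) + 1) * a 0 ^ 2 / (n - 6) * ((n - 1) / (n - 5)))
  have h3 := (hasDerivAt_pow 3 s).const_mul ((2 * (n : ℝ) + 6) * (a 0 * a 1) / (n - 8) *
    ((n - 1) / (n - 5) * ((n + 1) / (n - 7))))
  have h4 := (hasDerivAt_pow 4 s).const_mul (((n : ℝ) + 7) * a 1 ^ 2 / (n - 10) *
      ((n - 1) / (n - 5) * ((n + 1) / (n - 7)) * ((n + 3) / (n - 9))))
  refine ((h2.add h3).add h4).congr_deriv ?_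
  norm_num

theorem deriv_deriv_polyI_one (n : ℕ) (a : ℕ → ℝ) : deriv (deriv (polyI n 1 a)) 1 =
    ((n : ℝ) + 1) * a 0 ^ 2 / (n - 6) * ((n - 1) / (n - 5)) * 2
    + (2 * (n : ℝ) + 6) * (a 0 * a 1) / (n - 8) * ((n - 1) / (n - 5) * ((n + 1) / (n - 7))) * 6
    + ((n : ℝ) + 7) * a 1 ^ 2 / (n - 10) *
      ((n - 1) / (n - 5) * ((n + 1) / (n - 7)) * ((n + 3) / (n - 9))) * 12 := by
  have h : deriv (polyI n 1 a) = _ := funext fun s => (hasDerivAt_polyI_one n a s).deriv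
  rw [h]
  have h2 := (hasDerivAt_id (1 : ℝ)).const_mul
    (2 * (((n : ℝ) + 1) * a 0 ^ 2 / (n - 6) * ((n - 1) / (n - 5))))
  have h3 := (hasDerivAt_pow 2 (1 : ℝ)).const_mul (3 * ((2 * (n : ℝ) + 6) * (a 0 * a 1) / (n - 8) *
    ((n - 1) / (n - 5) * ((n + 1) / (n - 7)))))
  have h4 := (hasDerivAt_pow 3 (1 : ℝ)).const_mul (4 * (((n : ℝ) + 7) * a 1 ^ 2 / (n - 10) *
      ((n - 1) / (n - 5) * ((n + 1) / (n - 7)) * ((n + 3) / (n - 9)))))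
  have := (h2.add h3).add h4
  refine HasDerivAt.deriv ((this.congr_deriv ?_).congr_of_eventuallyEq (Eventually.of_forall ?_))
  · norm_num; ring
  · intro x; simp; ring

/-! ### The choice of `a₀` -/

/-- `a₀` is the larger root of a quadratic equation. -/
theorem leading_coeff_facts (n a : ℝ) (hn : 53 ≤ n)
    (ha : a = (n + 3) * (n - 6) / (2 * (n - 7) * (n - 8)) *
      (3 + Real.sqrt (9 - 8 * (n - 7) * (n - 8) ^ 2 * (n + 7) /
        ((n + 3) * (n - 6) * (n - 9) * (n - 10))))) :
    a ^ 2 - 3 * ((n + 3) * (n - 6)) / ((n - 7) * (n - 8)) * a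
      + 2 * (n + 7) * (n + 3) * (n - 6) / ((n - 7) * (n - 9) * (n - 10)) = 0 ∧
    4 / 3 * ((n + 7) * (n - 8)) / ((n - 9) * (n - 10)) < a ∧
    3 / 2 * ((n + 5) * (n - 6)) / ((n - 7) * (n - 8)) < a := by
  -- The shift turns the inequalities for n ≥ 53 into polynomial inequalities in m ≥ 0.
  obtain ⟨m, rfl⟩ : ∃ m, n = m + 53 := ⟨n - 53, by ring⟩
  have hm : 0 ≤ m := by linarith
  set r := Real.sqrt (9 - 8 * (m + 53 - 7) * (m + 53 - 8) ^ 2 * (m + 53 + 7) /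
        ((m + 53 + 3) * (m + 53 - 6) * (m + 53 - 9) * (m + 53 - 10))) with hr
  have h3 : 0 < m + 53 + 3 := by linarith
  have h6 : 0 < m + 53 - 6 := by linarith
  have h7 : 0 < m + 53 - 7 := by linarith
  have h8 : 0 < m + 53 - 8 := by linarith
  have h9 : 0 < m + 53 - 9 := by linarith
  have h10 : 0 < m + 53 - 10 := by linarith
  -- The bound 6/(n+3) for the root is exactly what the last assertion requires: it reads (n+3)(3+r)
  -- > 3(n+5), that is r(n+3) > 6.
  have hdisc : (6 / (m + 53 + 3)) ^ 2 < 9 - 8 * (m + 53 - 7) * (m + 53 - 8) ^ 2 * (m + 53 + 7) /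
        ((m + 53 + 3) * (m + 53 - 6) * (m + 53 - 9) * (m + 53 - 10)) := by
    rw [div_pow, lt_sub_iff_add_lt, div_add_div _ _ (by positivity) (by positivity),
      div_lt_iff₀ (by positivity)]
    ring_nf
    nlinarith [pow_nonneg hm 2, pow_nonneg hm 3, pow_nonneg hm 4, pow_nonneg hm 5, pow_nonneg hm 6]
  have hr2 : r ^ 2 = 9 - 8 * (m + 53 - 7) * (m + 53 - 8) ^ 2 * (m + 53 + 7) /
        ((m + 53 + 3) * (m + 53 - 6) * (m + 53 - 9) * (m + 53 - 10)) :=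
    Real.sq_sqrt (le_trans (sq_nonneg _) hdisc.le)
  have hrpos : 6 / (m + 53 + 3) < r := by
    rw [hr]; exact Real.lt_sqrt_of_sq_lt hdisc
  have hr0 : 0 < r := lt_trans (by positivity) hrpos
  refine ⟨?_, ?_, ?_⟩
  -- Completing the square: a = c(3 + r), where 3c is the midpoint of the two roots.
  · have e1 : a ^ 2 - 3 * ((m + 53 + 3) * (m + 53 - 6)) / ((m + 53 - 7) * (m + 53 - 8)) * a
        = ((m + 53 + 3) * (m + 53 - 6) / (2 * (m + 53 - 7) * (m + 53 - 8))) ^ 2 * (r ^ 2 - 9) := by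
      rw [ha]; field_simp; ring
    rw [e1, hr2]; field_simp; ring
  -- The right-hand side is the midpoint of the two roots, and the inequality is a rearrangement of
  -- the positivity of the discriminant. The larger root lies beyond the midpoint.
  · have : 4 / 3 * ((m + 53 + 7) * (m + 53 - 8)) / ((m + 53 - 9) * (m + 53 - 10))
        < (m + 53 + 3) * (m + 53 - 6) / (2 * (m + 53 - 7) * (m + 53 - 8)) * 3 := by
      have h := (sq_nonneg (6 / (m + 53 + 3))).trans_lt hdisc
      rw [sub_pos, div_lt_iff₀ (by positivity)] at h
      rw [div_mul_eq_mul_div ((m + 53 + 3) * (m + 53 - 6)), div_lt_div_iff₀ (by positivity) (by positivity)]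
      nlinarith
    refine this.trans ?_
    rw [ha]
    gcongr
    linarith
  · rw [ha]
    have h : 6 < r * (m + 53 + 3) := by rwa [div_lt_iff₀ h3] at hrpos
    have e : (m + 53 + 3) * (m + 53 - 6) / (2 * (m + 53 - 7) * (m + 53 - 8)) * (3 + r)
      = ((m + 53 + 3) * 3 + r * (m + 53 + 3)) * (m + 53 - 6) / (2 * ((m + 53 - 7) * (m + 53 - 8))) := by
      field_simp
    rw [e, div_lt_div_iff₀ (by positivity) (by positivity)]
    have h67 : 0 < (m + 53 - 6) * ((m + 53 - 7) * (m + 53 - 8)) := by positivity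
    nlinarith

/-- `I'(1) = 0`, `I''(1) < 0` and `J(1) < 0`, with the two inequalities for `a₀` behind them. -/
theorem polyI_polyJ_facts (n : ℕ) (hn : 53 ≤ n) (a : ℕ → ℝ) (ha₁ : a 1 = -1)
    (ha₀ : a 0 = ((n : ℝ) + 3) * (n - 6) / (2 * (n - 7) * (n - 8)) *
      (3 + Real.sqrt (9 - 8 * ((n : ℝ) - 7) * (n - 8) ^ 2 * (n + 7) /
        ((n + 3) * (n - 6) * (n - 9) * (n - 10))))) :
    deriv (polyI n 1 a) 1 = 0 ∧ deriv (deriv (polyI n 1 a)) 1 < 0 ∧ polyJ n 1 a 1 < 0 ∧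
    3 / 2 * (((n : ℝ) + 5) * (n - 6)) / ((n - 7) * (n - 8)) < a 0 := by
  have hn' : (53 : ℝ) ≤ n := by exact_mod_cast hn
  obtain ⟨q1, q2, q3⟩ := leading_coeff_facts n (a 0) hn' ha₀
  have h1 : 0 < (n : ℝ) - 1 := by linarith
  have h5 : 0 < (n : ℝ) - 5 := by linarith
  have h6 : 0 < (n : ℝ) - 6 := by linarith
  have h7 : 0 < (n : ℝ) - 7 := by linarith
  have h8 : 0 < (n : ℝ) - 8 := by linarith
  have h9 : 0 < (n : ℝ) - 9 := by linarith
  have h10 : 0 < (n : ℝ) - 10 := by linarith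
  have d1 : deriv (polyI n 1 a) 1 = 0 := by
    rw [(hasDerivAt_polyI_one n a 1).deriv, ha₁]
    have : ((n : ℝ) + 1) * a 0 ^ 2 / (n - 6) * ((n - 1) / (n - 5)) * (2 * 1)
        + (2 * (n : ℝ) + 6) * (a 0 * -1) / (n - 8) * ((n - 1) / (n - 5) * ((n + 1) / (n - 7)))
          * (3 * 1 ^ 2)
        + ((n : ℝ) + 7) * (-1) ^ 2 / (n - 10) *
          ((n - 1) / (n - 5) * ((n + 1) / (n - 7)) * ((n + 3) / (n - 9))) * (4 * 1 ^ 3)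
        = 2 * (n + 1) * (n - 1) / ((n - 6) * (n - 5)) *
          (a 0 ^ 2 - 3 * ((n + 3) * (n - 6)) / ((n - 7) * (n - 8)) * a 0
      + 2 * (n + 7) * (n + 3) * (n - 6) / ((n - 7) * (n - 9) * (n - 10))) := by
      field_simp; ring
    rw [this, q1, mul_zero]
  refine ⟨d1, ?_, ?_, q3⟩
  · rw [(hasDerivAt_polyI_one n a 1).deriv] at d1
    rw [deriv_deriv_polyI_one]
    -- Subtracting I'(1) = 0 from I''(1) removes the term in a₀² and leaves an expression linear in
    -- a₀.
    have e : ((n : ℝ) + 1) * a 0 ^ 2 / (n - 6) * ((n - 1) / (n - 5)) * 2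
        + (2 * (n : ℝ) + 6) * (a 0 * a 1) / (n - 8) * ((n - 1) / (n - 5) * ((n + 1) / (n - 7))) * 6
        + ((n : ℝ) + 7) * a 1 ^ 2 / (n - 10) *
          ((n - 1) / (n - 5) * ((n + 1) / (n - 7)) * ((n + 3) / (n - 9))) * 12
        = 6 * (n + 3) * (n - 1) * (n + 1) / ((n - 8) * (n - 5) * (n - 7)) *
          (4 / 3 * ((n + 7) * (n - 8)) / ((n - 9) * (n - 10)) - a 0) := by
      rw [← sub_zero (_ + _), ← d1, ha₁]
      field_simp; ring
    rw [e]
    exact mul_neg_of_pos_of_neg (by positivity) (by linarith)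
  · rw [polyJ_one, ha₁]
    have e : 2 * (a 0 * -1) / ((n : ℝ) - 6) * ((n + 3) / (n - 5))
        + 3 * (-1) ^ 2 / (n - 8) * ((n + 3) / (n - 5) * ((n + 5) / (n - 7)))
        = 2 * (n + 3) / ((n - 6) * (n - 5)) *
          (3 / 2 * (((n : ℝ) + 5) * (n - 6)) / ((n - 7) * (n - 8)) - a 0) := by
      field_simp; ring
    rw [e]
    exact mul_neg_of_pos_of_neg (by positivity) (by linarith)

/-! ### Moments of rotationally invariant densities -/

/-- `μ` and the density `ρ` are invariant under lifts of all linear isometries of `ℝᵈ`, where the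
position in `ℝᵈ` is read off by `Y`. -/
structure IsRotationInvariant {X : Type*} [MeasurableSpace X] {d : ℕ} (μ : Measure X)
    (Y : X → EuclideanSpace ℝ (Fin d)) (ρ : X → ℝ) : Prop where
  exists_lift : ∀ A : EuclideanSpace ℝ (Fin d) ≃ₗᵢ[ℝ] EuclideanSpace ℝ (Fin d),
    ∃ T : X ≃ᵐ X, MeasurePreserving T μ μ ∧ (∀ x, Y (T x) = A (Y x)) ∧ ∀ x, ρ (T x) = ρ x
  measurable_pos : Measurable Y
  measurable_density : AEStronglyMeasurable ρ μ

namespace IsRotationInvariant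

variable {X : Type*} [MeasurableSpace X] {d : ℕ} {μ : Measure X}
  {Y : X → EuclideanSpace ℝ (Fin d)} {ρ : X → ℝ}

/-- A change of variables by a measurable equivalence; it holds for every F, integrable or not. -/
theorem integral_comp (h : IsRotationInvariant μ Y ρ)
    (A : EuclideanSpace ℝ (Fin d) ≃ₗᵢ[ℝ] EuclideanSpace ℝ (Fin d))
    (F : EuclideanSpace ℝ (Fin d) → ℝ) :
    ∫ x, F (A (Y x)) * ρ x ∂μ = ∫ x, F (Y x) * ρ x ∂μ := by
  obtain ⟨T, hT, hY, hρ⟩ := h.exists_lift A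
  rw [← hT.integral_comp' (g := fun x => F (Y x) * ρ x)]
  simp only [hY, hρ]

theorem integral_odd (h : IsRotationInvariant μ Y ρ) {F : EuclideanSpace ℝ (Fin d) → ℝ}
    (hF : ∀ y, F (-y) = -F y) : ∫ x, F (Y x) * ρ x ∂μ = 0 := by
  have := h.integral_comp (LinearIsometryEquiv.neg ℝ) F
  simp only [LinearIsometryEquiv.coe_neg, hF, neg_mul, integral_neg] at this
  linarith

/-- Powers of the radius can be absorbed into the density, so the moment formulas of degree two and
four cover all weights that occur. -/
theorem mul_radial (h : IsRotationInvariant μ Y ρ) (k : ℕ) :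
    IsRotationInvariant μ Y (fun x => ‖Y x‖ ^ k * ρ x) where
  exists_lift A := by
    obtain ⟨T, hT, hY, hρ⟩ := h.exists_lift A
    exact ⟨T, hT, hY, fun x => by simp [hY, hρ]⟩
  measurable_pos := h.measurable_pos
  measurable_density := (h.measurable_pos.norm.pow_const k).aestronglyMeasurable.mul
    h.measurable_density

/-- A reflection carries v to a multiple of the unit vector e, so the integral depends on v only
through its length. -/
theorem integral_inner_pow (h : IsRotationInvariant μ Y ρ) (k : ℕ)
    {e : EuclideanSpace ℝ (Fin d)} (he : ‖e‖ = 1) (v : EuclideanSpace ℝ (Fin d)) :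
    ∫ x, inner ℝ v (Y x) ^ k * ρ x ∂μ = ‖v‖ ^ k * ∫ x, inner ℝ e (Y x) ^ k * ρ x ∂μ := by
  have hn : ‖v‖ = ‖‖v‖ • e‖ := by simp [norm_smul, he]
  set A := (ℝ ∙ (v - ‖v‖ • e))ᗮ.reflection with hA
  have hAv : A v = ‖v‖ • e := Submodule.reflection_sub hn
  have := h.integral_comp A (fun y => inner ℝ (‖v‖ • e) y ^ k)
  simp only [← hAv, LinearIsometryEquiv.inner_map_map] at this
  rw [this, hAv, ← integral_const_mul]
  congr 1; ext x
  rw [real_inner_smul_left]; ring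

theorem integrable_coord_mul_coord (h : IsRotationInvariant μ Y ρ)
    (hi : Integrable (fun x => ‖Y x‖ ^ 2 * ρ x) μ) (v w : EuclideanSpace ℝ (Fin d)) :
    Integrable (fun x => inner ℝ v (Y x) * inner ℝ w (Y x) * ρ x) μ := by
  have hv : ∀ v : EuclideanSpace ℝ (Fin d), Measurable fun x => inner ℝ v (Y x) := fun v =>
    h.measurable_pos.const_inner
  refine (hi.norm.const_mul (‖v‖ * ‖w‖)).mono'
    (((hv v).mul (hv w)).aestronglyMeasurable.mul h.measurable_density) (ae_of_all _ fun x => ?_)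
  simp only [norm_mul, norm_pow, norm_norm]
  have h1 := norm_inner_le_norm (𝕜 := ℝ) v (Y x)
  have h2 := norm_inner_le_norm (𝕜 := ℝ) w (Y x)
  calc _ ≤ (‖v‖ * ‖Y x‖) * (‖w‖ * ‖Y x‖) * ‖ρ x‖ := by gcongr
    _ = _ := by ring

theorem integrable_coord_mul_coord_mul_coord_mul_coord (h : IsRotationInvariant μ Y ρ)
    (hi : Integrable (fun x => ‖Y x‖ ^ 4 * ρ x) μ) (v₁ v₂ v₃ v₄ : EuclideanSpace ℝ (Fin d)) :
    Integrable (fun x => inner ℝ v₁ (Y x) * inner ℝ v₂ (Y x) * inner ℝ v₃ (Y x) *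
      inner ℝ v₄ (Y x) * ρ x) μ := by
  have hv : ∀ v : EuclideanSpace ℝ (Fin d), Measurable fun x => inner ℝ v (Y x) := fun v =>
    h.measurable_pos.const_inner
  refine (hi.norm.const_mul (‖v₁‖ * ‖v₂‖ * ‖v₃‖ * ‖v₄‖)).mono'
    (((((hv v₁).mul (hv v₂)).mul (hv v₃)).mul (hv v₄)).aestronglyMeasurable.mul
      h.measurable_density) (ae_of_all _ fun x => ?_)
  simp only [norm_mul, norm_pow, norm_norm]
  have h1 := norm_inner_le_norm (𝕜 := ℝ) v₁ (Y x)
  have h2 := norm_inner_le_norm (𝕜 := ℝ) v₂ (Y x)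
  have h3 := norm_inner_le_norm (𝕜 := ℝ) v₃ (Y x)
  have h4 := norm_inner_le_norm (𝕜 := ℝ) v₄ (Y x)
  calc _ ≤ (‖v₁‖ * ‖Y x‖) * (‖v₂‖ * ‖Y x‖) * (‖v₃‖ * ‖Y x‖) * (‖v₄‖ * ‖Y x‖) * ‖ρ x‖ := by gcongr
    _ = _ := by ring

theorem norm_sq_eq_sum_inner (y : EuclideanSpace ℝ (Fin d)) :
    ‖y‖ ^ 2 = ∑ i, inner ℝ (EuclideanSpace.single i (1 : ℝ)) y ^ 2 := by
  simp [EuclideanSpace.norm_sq_eq, EuclideanSpace.inner_single_left]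

/-- Polarization of the pure squares; the constant is found by summing over an orthonormal basis. -/
theorem integral_inner_mul_inner (h : IsRotationInvariant μ Y ρ) (hd : 0 < d)
    (hi : Integrable (fun x => ‖Y x‖ ^ 2 * ρ x) μ) (v w : EuclideanSpace ℝ (Fin d)) :
    ∫ x, inner ℝ v (Y x) * inner ℝ w (Y x) * ρ x ∂μ =
      inner ℝ v w / d * ∫ x, ‖Y x‖ ^ 2 * ρ x ∂μ := by
  have hd' : (d : ℝ) ≠ 0 := by positivity
  set e : EuclideanSpace ℝ (Fin d) := EuclideanSpace.single ⟨0, hd⟩ 1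
  have he : ‖e‖ = 1 := by simp [e]
  set κ := ∫ x, inner ℝ e (Y x) ^ 2 * ρ x ∂μ
  have key : ∀ v : EuclideanSpace ℝ (Fin d), ∫ x, inner ℝ v (Y x) ^ 2 * ρ x ∂μ = ‖v‖ ^ 2 * κ :=
    h.integral_inner_pow 2 he
  have hint : ∀ v : EuclideanSpace ℝ (Fin d),
      Integrable (fun x => inner ℝ v (Y x) ^ 2 * ρ x) μ := fun v => by
    simpa only [sq] using h.integrable_coord_mul_coord hi v v
  have hκ : ∫ x, ‖Y x‖ ^ 2 * ρ x ∂μ = d * κ := by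
    simp only [norm_sq_eq_sum_inner, Finset.sum_mul]
    rw [integral_finsetSum _ fun i _ => hint _]
    simp [key]
  have hp : ∀ x, inner ℝ v (Y x) * inner ℝ w (Y x) * ρ x =
      (1 / 4) * (inner ℝ (v + w) (Y x) ^ 2 * ρ x) - (1 / 4) * (inner ℝ (v - w) (Y x) ^ 2 * ρ x) :=
    fun x => by rw [inner_add_left, inner_sub_left]; ring
  simp only [hp]
  rw [integral_sub ((hint _).const_mul _) ((hint _).const_mul _), integral_const_mul,
    integral_const_mul, key, key, hκ, @norm_add_sq_real, @norm_sub_sq_real]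
  field_simp; ring

theorem integral_quadratic (h : IsRotationInvariant μ Y ρ) (hd : 0 < d)
    (hi : Integrable (fun x => ‖Y x‖ ^ 2 * ρ x) μ) (c : Fin d → Fin d → ℝ) :
    ∫ x, (∑ i, ∑ j, c i j * Y x i * Y x j) * ρ x ∂μ =
      (∑ i, c i i) / d * ∫ x, ‖Y x‖ ^ 2 * ρ x ∂μ := by
  have hint := fun i j : Fin d => h.integrable_coord_mul_coord hi (EuclideanSpace.single i (1 : ℝ))
    (EuclideanSpace.single j (1 : ℝ))
  have hval := fun i j : Fin d => h.integral_inner_mul_inner hd hi (EuclideanSpace.single i (1 : ℝ))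
    (EuclideanSpace.single j (1 : ℝ))
  simp only [EuclideanSpace.inner_single_left, map_one, one_mul] at hint hval
  simp only [Finset.sum_mul]
  have hint' : ∀ i j : Fin d, Integrable (fun x => c i j * Y x i * Y x j * ρ x) μ := fun i j =>
    ((hint i j).const_mul (c i j)).congr (ae_of_all _ fun x => by ring)
  rw [integral_finsetSum _ fun i _ => integrable_finsetSum _ fun j _ => hint' i j]
  simp only [integral_finsetSum _ fun j _ => hint' _ j]
  have : ∀ i j : Fin d, ∫ x, c i j * Y x i * Y x j * ρ x ∂μ =
      (if i = j then c i j else 0) / d * ∫ x, ‖Y x‖ ^ 2 * ρ x ∂μ := fun i j => by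
    rw [integral_congr_ae (ae_of_all _ fun x => show c i j * Y x i * Y x j * ρ x =
      c i j * (Y x i * Y x j * ρ x) by ring), integral_const_mul, hval]
    simp only [PiLp.single_apply]
    split_ifs <;> ring
  simp only [this, ← Finset.sum_mul, ← Finset.sum_div]
  simp

/-- The pairing formula for fourth moments. Pure fourth powers are multiples of ‖v‖⁴ by reflection,
polarization gives the sum over the three pairings, and a trace fixes the constant. -/
theorem integral_inner_pow_four (h : IsRotationInvariant μ Y ρ) (hd : 0 < d)
    (hi : Integrable (fun x => ‖Y x‖ ^ 4 * ρ x) μ) (v₁ v₂ v₃ v₄ : EuclideanSpace ℝ (Fin d)) :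
    ∫ x, inner ℝ v₁ (Y x) * inner ℝ v₂ (Y x) * inner ℝ v₃ (Y x) * inner ℝ v₄ (Y x) * ρ x ∂μ =
      (inner ℝ v₁ v₂ * inner ℝ v₃ v₄ + inner ℝ v₁ v₃ * inner ℝ v₂ v₄
        + inner ℝ v₁ v₄ * inner ℝ v₂ v₃) / (d * (d + 2)) * ∫ x, ‖Y x‖ ^ 4 * ρ x ∂μ := by
  have hd' : (d : ℝ) ≠ 0 := by positivity
  have hd2 : (d : ℝ) + 2 ≠ 0 := by positivity
  set e : EuclideanSpace ℝ (Fin d) := EuclideanSpace.single ⟨0, hd⟩ 1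
  have he : ‖e‖ = 1 := by simp [e]
  set κ := ∫ x, inner ℝ e (Y x) ^ 4 * ρ x ∂μ
  have key : ∀ v : EuclideanSpace ℝ (Fin d), ∫ x, inner ℝ v (Y x) ^ 4 * ρ x ∂μ = ‖v‖ ^ 4 * κ :=
    h.integral_inner_pow 4 he
  have hint : ∀ v : EuclideanSpace ℝ (Fin d),
      Integrable (fun x => inner ℝ v (Y x) ^ 4 * ρ x) μ := fun v =>
    (h.integrable_coord_mul_coord_mul_coord_mul_coord hi v v v v).congr
      (ae_of_all _ fun x => by ring)
  have pol : ∀ v₁ v₂ v₃ v₄ : EuclideanSpace ℝ (Fin d),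
      ∫ x, inner ℝ v₁ (Y x) * inner ℝ v₂ (Y x) * inner ℝ v₃ (Y x) * inner ℝ v₄ (Y x) * ρ x ∂μ =
      (inner ℝ v₁ v₂ * inner ℝ v₃ v₄ + inner ℝ v₁ v₃ * inner ℝ v₂ v₄
        + inner ℝ v₁ v₄ * inner ℝ v₂ v₃) / 3 * κ := by
    intro v₁ v₂ v₃ v₄
    -- Polarization over the eight sign patterns with the sign of v₁ fixed; the divisor below is 192
    -- = 8 · 4!.
    set w : Fin 8 → EuclideanSpace ℝ (Fin d) := ![v₁ + v₂ + v₃ + v₄, v₁ + v₂ + v₃ - v₄,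
      v₁ + v₂ - v₃ + v₄, v₁ + v₂ - v₃ - v₄, v₁ - v₂ + v₃ + v₄, v₁ - v₂ + v₃ - v₄,
      v₁ - v₂ - v₃ + v₄, v₁ - v₂ - v₃ - v₄] with hw
    set c : Fin 8 → ℝ := ![1, -1, -1, 1, -1, 1, 1, -1] with hc
    have hp : ∀ x, inner ℝ v₁ (Y x) * inner ℝ v₂ (Y x) * inner ℝ v₃ (Y x) * inner ℝ v₄ (Y x) * ρ x =
        ∑ k, c k / 192 * (inner ℝ (w k) (Y x) ^ 4 * ρ x) := fun x => by
      simp only [Fin.sum_univ_eight, hw, hc, Matrix.cons_val, inner_add_left, inner_sub_left]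
      ring
    have hn : ∀ v : EuclideanSpace ℝ (Fin d), ‖v‖ ^ 4 = inner ℝ v v ^ 2 := fun v => by
      rw [real_inner_self_eq_norm_sq]; ring
    rw [integral_congr_ae (ae_of_all _ hp), integral_finsetSum _ fun k _ => (hint (w k)).const_mul _]
    simp only [integral_const_mul, key, hn]
    simp only [Fin.sum_univ_eight, hw, hc, Matrix.cons_val, inner_add_left, inner_sub_left,
        inner_add_right, inner_sub_right,
        real_inner_comm v₁ v₂, real_inner_comm v₁ v₃, real_inner_comm v₁ v₄,
        real_inner_comm v₂ v₃, real_inner_comm v₂ v₄, real_inner_comm v₃ v₄]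
    ring
  -- Since ‖y‖⁴ = ∑ᵢⱼ yᵢ² yⱼ², the pairing formula contributes (d² + 2d)/3 times κ.
  have hκ : ∫ x, ‖Y x‖ ^ 4 * ρ x ∂μ = d * (d + 2) / 3 * κ := by
    have e4 : ∀ x, ‖Y x‖ ^ 4 * ρ x = ∑ i, ∑ j,
        inner ℝ (EuclideanSpace.single i (1 : ℝ)) (Y x) * inner ℝ (EuclideanSpace.single i (1 : ℝ)) (Y x)
        * inner ℝ (EuclideanSpace.single j (1 : ℝ)) (Y x) *
          inner ℝ (EuclideanSpace.single j (1 : ℝ)) (Y x) * ρ x := fun x => by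
      rw [show ‖Y x‖ ^ 4 = ‖Y x‖ ^ 2 * ‖Y x‖ ^ 2 by ring, norm_sq_eq_sum_inner, Finset.sum_mul_sum,
        Finset.sum_mul]
      refine Finset.sum_congr rfl fun i _ => ?_
      rw [Finset.sum_mul]
      refine Finset.sum_congr rfl fun j _ => by ring
    simp only [e4]
    rw [integral_finsetSum _ fun i _ => integrable_finsetSum _ fun j _ =>
      h.integrable_coord_mul_coord_mul_coord_mul_coord hi _ _ _ _]
    have e5 : ∀ i : Fin d, ∫ x, ∑ j,
        inner ℝ (EuclideanSpace.single i (1 : ℝ)) (Y x) * inner ℝ (EuclideanSpace.single i (1 : ℝ)) (Y x)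
        * inner ℝ (EuclideanSpace.single j (1 : ℝ)) (Y x) *
          inner ℝ (EuclideanSpace.single j (1 : ℝ)) (Y x) * ρ x ∂μ = (d + 2) / 3 * κ := fun i => by
      rw [integral_finsetSum _ fun j _ =>
        h.integrable_coord_mul_coord_mul_coord_mul_coord hi _ _ _ _]
      simp only [pol]
      simp only [← Finset.sum_mul, ← Finset.sum_div, Finset.sum_add_distrib,
        EuclideanSpace.inner_single_left, PiLp.single_apply, map_one, one_mul]
      simp
      left
      ring
    simp only [e5, Finset.sum_const, Finset.card_univ, Fintype.card_fin, nsmul_eq_mul]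
    ring
  rw [pol, hκ]
  field_simp

theorem integral_quartic (h : IsRotationInvariant μ Y ρ) (hd : 0 < d)
    (hi : Integrable (fun x => ‖Y x‖ ^ 4 * ρ x) μ) (c : Fin d → Fin d → Fin d → Fin d → ℝ) :
    ∫ x, (∑ i, ∑ j, ∑ k, ∑ l, c i j k l * Y x i * Y x j * Y x k * Y x l) * ρ x ∂μ =
      (∑ i, ∑ j, (c i i j j + c i j i j + c i j j i)) / (d * (d + 2)) * ∫ x, ‖Y x‖ ^ 4 * ρ x ∂μ := by
  have hint := fun i j k l : Fin d => h.integrable_coord_mul_coord_mul_coord_mul_coord hi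
    (EuclideanSpace.single i (1 : ℝ)) (EuclideanSpace.single j (1 : ℝ))
    (EuclideanSpace.single k (1 : ℝ)) (EuclideanSpace.single l (1 : ℝ))
  have hval := fun i j k l : Fin d => h.integral_inner_pow_four hd hi
    (EuclideanSpace.single i (1 : ℝ)) (EuclideanSpace.single j (1 : ℝ))
    (EuclideanSpace.single k (1 : ℝ)) (EuclideanSpace.single l (1 : ℝ))
  simp only [EuclideanSpace.inner_single_left, map_one, one_mul] at hint hval
  simp only [Finset.sum_mul]
  have hint' : ∀ i j k l : Fin d,
      Integrable (fun x => c i j k l * Y x i * Y x j * Y x k * Y x l * ρ x) μ := fun i j k l =>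
    ((hint i j k l).const_mul (c i j k l)).congr (ae_of_all _ fun x => by ring)
  rw [integral_finsetSum _ fun i _ => integrable_finsetSum _ fun j _ => integrable_finsetSum _
    fun k _ => integrable_finsetSum _ fun l _ => hint' i j k l]
  simp only [integral_finsetSum _ fun j _ => integrable_finsetSum _
    fun k _ => integrable_finsetSum _ fun l _ => hint' _ j k l]
  simp only [integral_finsetSum _ fun k _ => integrable_finsetSum _ fun l _ => hint' _ _ k l]
  simp only [integral_finsetSum _ fun l _ => hint' _ _ _ l]
  have : ∀ i j k l : Fin d, ∫ x, c i j k l * Y x i * Y x j * Y x k * Y x l * ρ x ∂μ =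
      ((if i = j then (if k = l then c i j k l else 0) else 0)
        + (if i = k then (if j = l then c i j k l else 0) else 0)
        + (if i = l then (if j = k then c i j k l else 0) else 0))
        / (d * (d + 2)) * ∫ x, ‖Y x‖ ^ 4 * ρ x ∂μ := fun i j k l => by
    rw [integral_congr_ae (ae_of_all _ fun x => show c i j k l * Y x i * Y x j * Y x k * Y x l * ρ x =
      c i j k l * (Y x i * Y x j * Y x k * Y x l * ρ x) by ring), integral_const_mul, hval]
    simp only [PiLp.single_apply]
    split_ifs <;> ring
  simp only [this, ← Finset.sum_mul, ← Finset.sum_div, Finset.sum_add_distrib]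
  have h1 : (∑ i, ∑ j, ∑ k, ∑ l, if i = j then if k = l then c i j k l else 0 else 0)
      = ∑ i, ∑ j, c i i j j := by
    refine Finset.sum_congr rfl fun i _ => ?_
    rw [Finset.sum_eq_single i (fun j _ hj => by simp [Ne.symm hj]) (by simp)]
    simp
  have h2 : (∑ i, ∑ j, ∑ k, ∑ l, if i = k then if j = l then c i j k l else 0 else 0)
      = ∑ i, ∑ j, c i j i j := by
    refine Finset.sum_congr rfl fun i _ => Finset.sum_congr rfl fun j _ => ?_
    rw [Finset.sum_eq_single i (fun k _ hk => by simp [Ne.symm hk]) (by simp)]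
    simp
  have h3 : (∑ i, ∑ j, ∑ k, ∑ l, if i = l then if j = k then c i j k l else 0 else 0)
      = ∑ i, ∑ j, c i j j i := by
    refine Finset.sum_congr rfl fun i _ => Finset.sum_congr rfl fun j _ => ?_
    rw [Finset.sum_eq_single j
      (fun k _ hk => Finset.sum_eq_zero fun l _ => by simp [Ne.symm hk]) (by simp)]
    simp
  rw [h1, h2, h3]

end IsRotationInvariant

/-! ### Integrals over the half-space -/

instance isAddHaarMeasure_volume_space (n : ℕ) : (volume : Measure (Space n)).IsAddHaarMeasure :=
  inferInstanceAs ((volume : Measure (Bdry n)).prod (volume : Measure ℝ)).IsAddHaarMeasure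

theorem finrank_space {n : ℕ} (hn : 1 ≤ n) : Module.finrank ℝ (Space n) = n := by simp [hn]

theorem measurableSet_halfSpace (n : ℕ) : MeasurableSet (halfSpace n) :=
  measurableSet_le measurable_const measurable_snd

theorem halfSpace_eq_prod (n : ℕ) : halfSpace n = Set.univ ×ˢ Set.Ici 0 := by
  ext x; simp [halfSpace]

theorem volume_restrict_halfSpace (n : ℕ) : (volume : Measure (Space n)).restrict (halfSpace n) =
    (volume : Measure (Bdry n)).prod ((volume : Measure ℝ).restrict (Set.Ici 0)) := by
  rw [halfSpace_eq_prod, Measure.volume_eq_prod, ← Measure.prod_restrict, Measure.restrict_univ]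

/-- All integrability questions below are reduced to comparison with a power of 1 + ‖x‖, where only
the dimension and the exponent matter. -/
theorem memLp_of_decay {E G : Type*} [NormedAddCommGroup E] [NormedSpace ℝ E]
    [FiniteDimensional ℝ E] [MeasurableSpace E] [BorelSpace E] [NormedAddCommGroup G]
    {μ : Measure E} [μ.IsAddHaarMeasure] {s : Set E} (hs : MeasurableSet s) {g : E → G} {C r p : ℝ}
    (hp : 0 < p) (hr : (Module.finrank ℝ E : ℝ) < r * p)
    (hg : AEStronglyMeasurable g (μ.restrict s))
    (hb : ∀ x ∈ s, ‖g x‖ ≤ C * (1 + ‖x‖) ^ (-r)) : MemLp g (ENNReal.ofReal p) (μ.restrict s) := by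
  have h1 : MemLp (fun x : E => (1 + ‖x‖) ^ (-r)) (ENNReal.ofReal p) μ := by
    rw [← integrable_norm_rpow_iff (Measurable.aestronglyMeasurable (by fun_prop))
      (by simpa using hp) ENNReal.ofReal_ne_top]
    refine (integrable_one_add_norm (μ := μ) hr).congr (ae_of_all _ fun x => ?_)
    have : (0 : ℝ) ≤ 1 + ‖x‖ := by positivity
    simp only [ENNReal.toReal_ofReal hp.le, Real.norm_eq_abs, abs_of_nonneg (Real.rpow_nonneg this _)]
    rw [← Real.rpow_mul this, neg_mul]
  exact ((h1.restrict s).const_mul C).mono' hg ((ae_restrict_iff' hs).2 (ae_of_all _ hb))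

theorem integrableOn_of_decay {E G : Type*} [NormedAddCommGroup E] [NormedSpace ℝ E]
    [FiniteDimensional ℝ E] [MeasurableSpace E] [BorelSpace E] [NormedAddCommGroup G]
    {μ : Measure E} [μ.IsAddHaarMeasure] {s : Set E} (hs : MeasurableSet s) {g : E → G} {C r : ℝ}
    (hr : (Module.finrank ℝ E : ℝ) < r) (hg : AEStronglyMeasurable g (μ.restrict s))
    (hb : ∀ x ∈ s, ‖g x‖ ≤ C * (1 + ‖x‖) ^ (-r)) : IntegrableOn g s μ := by
  have := memLp_of_decay (p := 1) hs one_pos (by simpa using hr) hg hb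
  rw [ENNReal.ofReal_one] at this
  exact memLp_one_iff_integrable.1 this

/-! ### The denominator -/

section Den

variable {n : ℕ} {ξ : Bdry n} {ε : ℝ} {x : Space n}

theorem den_pos (hε : 0 < ε) (hx : 0 ≤ x.2) : 0 < den ξ ε x := by
  unfold den; positivity

theorem den_pos_of_neg_lt (hx : -ε < x.2) : 0 < den ξ ε x := by
  have : 0 < ε + x.2 := by linarith
  unfold den; positivity

theorem continuous_den : Continuous (den ξ ε : Space n → ℝ) := by
  unfold den; fun_prop

theorem contDiff_den : ContDiff ℝ ∞ (den ξ ε : Space n → ℝ) := by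
  unfold den
  exact ((contDiff_const.add contDiff_snd).pow 2).add ((contDiff_fst.sub contDiff_const).norm_sq ℝ)

/-- Here ‖x‖ is the sup norm of the product, used only as a measure of size. The constant 25 is not
sharp; what matters is that it serves for all |ξ| ≤ 1 and ε ≥ 1/2. -/
theorem one_add_norm_sq_le_den (hξ : ‖ξ‖ ≤ 1) (hε : 1 / 2 ≤ ε) (hx : 0 ≤ x.2) :
    (1 + ‖x‖) ^ 2 ≤ 25 * den ξ ε x := by
  obtain ⟨y, t⟩ := x
  simp only at hx
  have h1 : ‖y‖ ≤ ‖y - ξ‖ + 1 := by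
    have := norm_sub_norm_le y ξ; linarith
  have hm : ‖((y, t) : Space n)‖ ≤ max (‖y - ξ‖ + 1) t := by
    rw [Prod.norm_def, Real.norm_eq_abs]
    exact max_le_max h1 (abs_of_nonneg hx).le
  have h0 : 0 ≤ ‖((y, t) : Space n)‖ := norm_nonneg _
  have hy0 := norm_nonneg (y - ξ)
  simp only [den]
  rcases le_total (‖y - ξ‖ + 1) t with h | h
  · rw [max_eq_right h] at hm
    nlinarith
  · rw [max_eq_left h] at hm
    have h2 : (1 + ‖((y, t) : Space n)‖) ^ 2 ≤ (2 + ‖y - ξ‖) ^ 2 :=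
      pow_le_pow_left₀ (by positivity) (by linarith) 2
    nlinarith [sq_nonneg (‖y - ξ‖ - 1 / 4)]

theorem den_rpow_neg_le (hξ : ‖ξ‖ ≤ 1) (hε : 1 / 2 ≤ ε) (hx : 0 ≤ x.2) {β : ℝ} (hβ : 0 ≤ β) :
    den ξ ε x ^ (-β) ≤ 25 ^ β * (1 + ‖x‖) ^ (-(2 * β)) := by
  have hd : 0 < den ξ ε x := den_pos (by linarith) hx
  have h0 : 0 < 1 + ‖x‖ := by positivity
  have h1 : (1 + ‖x‖) ^ (2 * β) ≤ 25 ^ β * den ξ ε x ^ β := by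
    rw [Real.rpow_mul h0.le, Real.rpow_two, ← Real.mul_rpow (by norm_num) hd.le]
    exact Real.rpow_le_rpow (by positivity) (one_add_norm_sq_le_den hξ hε hx) hβ
  rw [Real.rpow_neg hd.le, Real.rpow_neg h0.le, ← div_eq_mul_inv, le_div_iff₀ (by positivity),
    inv_mul_le_iff₀ (by positivity), mul_comm (den ξ ε x ^ β)]
  exact h1

theorem continuousOn_den_rpow (hε : 0 < ε) (β : ℝ) :
    ContinuousOn (fun x : Space n => den ξ ε x ^ β) (halfSpace n) :=
  continuous_den.continuousOn.rpow_const fun _ hx => Or.inl (den_pos hε hx).ne'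

/-- Functions of at most polynomial growth are integrable against large powers of `1 / den`. -/
theorem integrableOn_mul_den_rpow (hn : 1 ≤ n) (hε : 1 / 2 ≤ ε) {p : Bdry n → ℝ}
    (hp : Continuous p) {C : ℝ} {k : ℕ} (hb : ∀ y, |p y| ≤ C * (1 + ‖y‖) ^ k) {β : ℝ}
    (hβ : (n : ℝ) + k < 2 * β) :
    IntegrableOn (fun x : Space n => p x.1 * den 0 ε x ^ (-β)) (halfSpace n) := by
  have hβ0 : 0 ≤ β := by linarith [(Nat.cast_nonneg n : (0 : ℝ) ≤ n), (Nat.cast_nonneg k : (0 : ℝ) ≤ k)]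
  refine integrableOn_of_decay (C := C * 25 ^ β) (r := 2 * β - k) (measurableSet_halfSpace n)
    (by rw [finrank_space hn]; linarith)
    (ContinuousOn.aestronglyMeasurable
      ((hp.comp continuous_fst).continuousOn.mul (continuousOn_den_rpow (by linarith) _))
      (measurableSet_halfSpace n)) fun x hx => ?_
  have h0 : 0 < 1 + ‖x‖ := by positivity
  have hd : 0 < den 0 ε x := den_pos (by linarith) hx
  have hC : 0 ≤ C := by
    have := (abs_nonneg _).trans (hb 0); simpa using this
  have hx1 : ‖x.1‖ ≤ ‖x‖ := norm_fst_le x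
  rw [norm_mul, Real.norm_eq_abs, Real.norm_eq_abs, abs_of_nonneg (Real.rpow_nonneg hd.le _)]
  calc _ ≤ (C * (1 + ‖x‖) ^ k) * (25 ^ β * (1 + ‖x‖) ^ (-(2 * β))) := by
        gcongr
        · exact (hb _).trans (by gcongr)
        · exact den_rpow_neg_le (by simp) hε hx hβ0
    _ = C * 25 ^ β * ((1 + ‖x‖) ^ (k : ℝ) * (1 + ‖x‖) ^ (-(2 * β))) := by
        rw [Real.rpow_natCast]; ring
    _ = _ := by rw [← Real.rpow_add h0]; congr 2; ring

/-- Rotations act on x̄ and leave xₙ fixed. They preserve the denominator only when it is centred at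
0, which is why F is translated by ξ before it is expanded. -/
theorem isRotationInvariant_den (β : ℝ) :
    IsRotationInvariant ((volume : Measure (Space n)).restrict (halfSpace n)) Prod.fst
      (fun x => den 0 ε x ^ (-β)) where
  exists_lift A := by
    refine ⟨MeasurableEquiv.prodCongr A.toMeasurableEquiv (MeasurableEquiv.refl ℝ), ?_, ?_, ?_⟩
    · rw [volume_restrict_halfSpace]
      exact A.measurePreserving.prod (MeasurePreserving.id _)
    · intro x; rfl
    · intro x
      have : den 0 ε ((MeasurableEquiv.prodCongr A.toMeasurableEquiv (MeasurableEquiv.refl ℝ)) x)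
          = den 0 ε x := by
        simp [den, MeasurableEquiv.prodCongr]
      simp only [this]
  measurable_pos := measurable_fst
  measurable_density := (continuous_den.measurable.pow_const _).aestronglyMeasurable

end Den

/-! ### Radial moments -/

theorem integrable_norm_pow_mul_rpow {E : Type*} [NormedAddCommGroup E] [NormedSpace ℝ E]
    [FiniteDimensional ℝ E] [MeasurableSpace E] [BorelSpace E] (μ : Measure E) [μ.IsAddHaarMeasure]
    (k : ℕ) {β : ℝ} (h : (Module.finrank ℝ E : ℝ) + k < 2 * β) :
    Integrable (fun y : E => ‖y‖ ^ k * (1 + ‖y‖ ^ 2) ^ (-β)) μ := by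
  refine (integrable_rpow_neg_one_add_norm_sq (μ := μ) (r := 2 * β - k) (by linarith)).mono'
    (Measurable.aestronglyMeasurable (by fun_prop)) (ae_of_all _ fun y => ?_)
  have h1 : (0 : ℝ) < 1 + ‖y‖ ^ 2 := by positivity
  rw [Real.norm_of_nonneg (by positivity)]
  calc ‖y‖ ^ k * (1 + ‖y‖ ^ 2) ^ (-β) ≤ (1 + ‖y‖ ^ 2) ^ ((k : ℝ) / 2) * (1 + ‖y‖ ^ 2) ^ (-β) := by
        gcongr
        rw [← Real.rpow_natCast, div_eq_inv_mul, Real.rpow_mul h1.le, ← one_div, ← Real.sqrt_eq_rpow]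
        exact Real.rpow_le_rpow (norm_nonneg _) (Real.le_sqrt_of_sq_le (by linarith)) (by positivity)
    _ = _ := by rw [← Real.rpow_add h1]; congr 1; ring

theorem hasDerivAt_pow_mul_rpow (p : ℕ) (β r : ℝ) :
    HasDerivAt (fun r : ℝ => r ^ (p + 1) * (1 + r ^ 2) ^ (-β))
      ((p + 1) * (r ^ p * (1 + r ^ 2) ^ (-β)) - 2 * β * (r ^ (p + 2) * (1 + r ^ 2) ^ (-(β + 1)))) r := by
  have h1 : (0 : ℝ) < 1 + r ^ 2 := by positivity
  have h := (hasDerivAt_pow (p + 1) r).mul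
    (((hasDerivAt_pow 2 r).const_add 1).rpow_const (p := -β) (Or.inl h1.ne'))
  refine h.congr_deriv ?_
  rw [show -(β + 1) = -β - 1 by ring]
  push_cast
  ring

/-- Integrate the derivative of r^(p+1) (1+r²)^(-β) over the half-line; both boundary values vanish.
-/
theorem integral_pow_mul_rpow_succ (p : ℕ) {β : ℝ} (hβ : (p : ℝ) + 2 < 2 * β) :
    (p + 1) * ∫ r in Set.Ioi (0 : ℝ), r ^ p * (1 + r ^ 2) ^ (-β) =
      2 * β * ∫ r in Set.Ioi (0 : ℝ), r ^ (p + 2) * (1 + r ^ 2) ^ (-(β + 1)) := by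
  have hint : ∀ (k : ℕ) (γ : ℝ), (k : ℝ) + 1 < 2 * γ →
      IntegrableOn (fun r : ℝ => r ^ k * (1 + r ^ 2) ^ (-γ)) (Set.Ioi 0) := fun k γ h => by
    have := (integrable_norm_pow_mul_rpow (volume : Measure ℝ) k (β := γ)
      (by simp; linarith)).integrableOn (s := Set.Ioi 0)
    refine this.congr_fun (fun r hr => ?_) measurableSet_Ioi
    simp only [Real.norm_eq_abs, abs_of_pos (Set.mem_Ioi.1 hr)]
  have i1 := (hint p β (by linarith)).const_mul ((p : ℝ) + 1)
  have i2 := (hint (p + 2) (β + 1) (by push_cast; linarith)).const_mul (2 * β)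
  have i3 := hint (p + 1) β (by push_cast; linarith)
  have hd := fun r (_ : r ∈ Set.Ici (0 : ℝ)) => hasDerivAt_pow_mul_rpow p β r
  have := integral_Ioi_of_hasDerivAt_of_tendsto' hd (i1.sub i2)
    (tendsto_zero_of_hasDerivAt_of_integrableOn_Ioi
      (fun r hr => hd r (Set.mem_Ici.2 (le_of_lt hr))) (i1.sub i2) i3)
  rw [integral_sub i1 i2, integral_const_mul, integral_const_mul] at this
  simp only [ne_eq, Nat.add_eq_zero_iff, one_ne_zero, and_false, not_false_eq_true, zero_pow,
    zero_mul, sub_zero] at this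
  linarith

/-- The moments `∫ |y|^k (1 + |y|²)^(-β)` over `ℝᵈ`. -/
def radialMoment (d k : ℕ) (β : ℝ) : ℝ :=
  ∫ y : EuclideanSpace ℝ (Fin d), ‖y‖ ^ k * (1 + ‖y‖ ^ 2) ^ (-β)

/-- Polar coordinates reduce this to the half-line identity with p = d - 1 + k. -/
theorem radialMoment_succ {d k : ℕ} (hd : 1 ≤ d) {β : ℝ} (hβ : (d : ℝ) + k + 1 < 2 * β) :
    (d + k) * radialMoment d k β = 2 * β * radialMoment d (k + 2) (β + 1) := by
  obtain ⟨d, rfl⟩ : ∃ e, d = e + 1 := ⟨d - 1, by omega⟩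
  have h := integral_pow_mul_rpow_succ (d + k) (β := β) (by push_cast at hβ ⊢; linarith)
  have hm : ∀ (j : ℕ) (γ : ℝ), radialMoment (d + 1) j γ = ((d + 1 : ℕ) : ℝ) *
      (volume.real (Metric.ball (0 : EuclideanSpace ℝ (Fin (d + 1))) 1) *
        ∫ r in Set.Ioi (0 : ℝ), r ^ (d + j) * (1 + r ^ 2) ^ (-γ)) := fun j γ => by
    rw [radialMoment, integral_fun_norm_addHaar volume (fun r : ℝ => r ^ j * (1 + r ^ 2) ^ (-γ))]
    simp only [finrank_euclideanSpace, Fintype.card_fin, Nat.add_sub_cancel, nsmul_eq_mul, smul_eq_mul]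
    congr 2
    refine integral_congr_ae (ae_of_all _ fun r => ?_)
    simp only [pow_add]; ring
  rw [hm, hm, ← add_assoc]
  push_cast at h ⊢
  linear_combination ((d : ℝ) + 1) * volume.real (Metric.ball (0 : EuclideanSpace ℝ (Fin (d + 1))) 1) * h

/-- Splitting off one factor 1 + |y|² expresses the moment with exponent β - 1 by two moments with
exponent β; the previous recurrence then relates these two. -/
theorem radialMoment_add_two {d k : ℕ} (hd : 1 ≤ d) {β : ℝ} (hβ : (d : ℝ) + k + 3 < 2 * β) :
    (2 * β - d - k - 2) * radialMoment d (k + 2) β = (d + k) * radialMoment d k β := by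
  have h := radialMoment_succ (k := k) hd (β := β - 1) (by linarith)
  have hs : radialMoment d k (β - 1) = radialMoment d k β + radialMoment d (k + 2) β := by
    rw [radialMoment, radialMoment, radialMoment, ← integral_add
      (integrable_norm_pow_mul_rpow _ _ (by simp; linarith))
      (integrable_norm_pow_mul_rpow _ _ (by simp; linarith))]
    refine integral_congr_ae (ae_of_all _ fun y => ?_)
    have h1 : (0 : ℝ) < 1 + ‖y‖ ^ 2 := by positivity
    simp only
    rw [show -(β - 1) = -β + 1 by ring, Real.rpow_add_one h1.ne']
    ring
  rw [hs, sub_add_cancel] at h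
  linear_combination -h

theorem radialMoment_pos {d : ℕ} (hd : 1 ≤ d) {k : ℕ} {β : ℝ} (hβ : (d : ℝ) + k < 2 * β) :
    0 < radialMoment d k β := by
  have hi := integrable_norm_pow_mul_rpow (volume : Measure (EuclideanSpace ℝ (Fin d))) k (β := β)
    (by simpa using hβ)
  refine (integral_pos_iff_support_of_nonneg (fun y => by positivity) hi).2 ?_
  have : Nontrivial (EuclideanSpace ℝ (Fin d)) := by
    have : Nonempty (Fin d) := ⟨⟨0, hd⟩⟩
    infer_instance
  have hsub : ({0}ᶜ : Set (EuclideanSpace ℝ (Fin d))) ⊆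
      Function.support fun y => ‖y‖ ^ k * (1 + ‖y‖ ^ 2) ^ (-β) := fun y hy => by
    have h1 : (0 : ℝ) < 1 + ‖y‖ ^ 2 := by positivity
    have h2 : 0 < ‖y‖ := norm_pos_iff.2 hy
    exact (by positivity : (0 : ℝ) < ‖y‖ ^ k * (1 + ‖y‖ ^ 2) ^ (-β)).ne'
  refine lt_of_lt_of_le ?_ (measure_mono hsub)
  exact isOpen_compl_singleton.measure_pos _ ⟨_, (exists_ne (0 : EuclideanSpace ℝ (Fin d))).choose_spec⟩

theorem integral_add_rpow {ε γ : ℝ} (hε : 0 < ε) (hγ : γ < -1) :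
    ∫ t in Set.Ici (0 : ℝ), (ε + t) ^ γ = ε ^ (γ + 1) / (-γ - 1) := by
  have h := (measurePreserving_add_left (volume : Measure ℝ) ε).setIntegral_preimage_emb
    (measurableEmbedding_addLeft ε) (fun t => t ^ γ) (Set.Ioi ε)
  rw [Set.preimage_const_add_Ioi, sub_self, integral_Ioi_rpow_of_lt hγ hε] at h
  rw [integral_Ici_eq_integral_Ioi, h, show -γ - 1 = -(γ + 1) by ring, div_neg, neg_div]

/-- On the slice at height t the substitution y ↦ (ε + t) y separates the variables, leaving a power
of ε + t to be integrated. -/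
theorem integral_halfSpace_norm_pow_mul_den {n : ℕ} (hn : 2 ≤ n) {ε : ℝ} (hε : 1 / 2 ≤ ε) (k : ℕ) {β : ℝ}
    (hβ : (n : ℝ) + k < 2 * β) :
    ∫ x in halfSpace n, ‖x.1‖ ^ k * den 0 ε x ^ (-β) =
      ε ^ ((n : ℝ) + k - 2 * β) / (2 * β - n - k) * radialMoment (n - 1) k β := by
  have hε0 : 0 < ε := by linarith
  have hint : IntegrableOn (fun x : Space n => ‖x.1‖ ^ k * den 0 ε x ^ (-β)) (halfSpace n) :=
    integrableOn_mul_den_rpow (by omega) hε (p := fun y => ‖y‖ ^ k) (by fun_prop) (C := 1)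
      (fun y => by
        rw [abs_of_nonneg (by positivity), one_mul]; gcongr; linarith) hβ
  have hcast : ((n - 1 : ℕ) : ℝ) = n - 1 := by
    rw [Nat.cast_sub (by omega)]; simp
  rw [IntegrableOn, volume_restrict_halfSpace] at hint
  rw [volume_restrict_halfSpace, integral_prod_symm _ hint]
  have hin : ∀ t ∈ Set.Ici (0 : ℝ), ∫ y : Bdry n, ‖y‖ ^ k * den 0 ε (y, t) ^ (-β) =
      (ε + t) ^ ((n : ℝ) - 1 + k - 2 * β) * radialMoment (n - 1) k β := fun t ht => by
    have hτ : 0 < ε + t := by have := Set.mem_Ici.1 ht; linarith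
    have := Measure.integral_comp_smul (volume : Measure (Bdry n))
      (fun y : Bdry n => ‖y‖ ^ k * den 0 ε (y, t) ^ (-β)) (ε + t)
    have e : ∀ y : Bdry n, ‖(ε + t) • y‖ ^ k * den 0 ε ((ε + t) • y, t) ^ (-β) =
        (ε + t) ^ ((k : ℝ) - 2 * β) * (‖y‖ ^ k * (1 + ‖y‖ ^ 2) ^ (-β)) := fun y => by
      have h1 : (0 : ℝ) < 1 + ‖y‖ ^ 2 := by positivity
      have h2 : den 0 ε ((ε + t) • y, t) = (ε + t) ^ 2 * (1 + ‖y‖ ^ 2) := by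
        simp only [den, sub_zero, norm_smul, Real.norm_eq_abs, abs_of_pos hτ]; ring
      rw [h2, Real.mul_rpow (by positivity) h1.le, norm_smul, Real.norm_of_nonneg hτ.le, mul_pow,
        ← Real.rpow_natCast (ε + t) 2, ← Real.rpow_mul hτ.le, sub_eq_add_neg, Real.rpow_add hτ,
        Real.rpow_natCast]
      push_cast
      rw [show (2 : ℝ) * -β = -(2 * β) by ring]
      ring
    simp only [e] at this
    rw [integral_const_mul, ← radialMoment, finrank_euclideanSpace, Fintype.card_fin, smul_eq_mul,
      abs_of_nonneg (by positivity)] at this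
    have h3 : (ε + t) ^ ((n : ℝ) - 1 + k - 2 * β) =
        (ε + t) ^ (n - 1) * (ε + t) ^ ((k : ℝ) - 2 * β) := by
      rw [← Real.rpow_natCast (ε + t) (n - 1), ← Real.rpow_add hτ, hcast]; congr 1; ring
    rw [h3, mul_assoc, this, ← mul_assoc, mul_inv_cancel₀ (by positivity), one_mul]
  rw [setIntegral_congr_fun measurableSet_Ici hin, integral_mul_const,
    integral_add_rpow hε0 (by linarith)]
  rw [show (n : ℝ) - 1 + k - 2 * β + 1 = n + k - 2 * β by ring,
    show -((n : ℝ) - 1 + k - 2 * β) - 1 = 2 * β - n - k by ring]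

/-! ### Green's formula on the half-space -/

/-- Hölder's inequality; the condition on r says that r times the conjugate exponent of p exceeds
the dimension. -/
theorem integrableOn_mul_of_decay {E : Type*} [NormedAddCommGroup E] [NormedSpace ℝ E]
    [FiniteDimensional ℝ E] [MeasurableSpace E] [BorelSpace E]
    {μ : Measure E} [μ.IsAddHaarMeasure] {s : Set E} (hs : MeasurableSet s) {w g : E → ℝ} {C r p : ℝ}
    (hp : 1 < p) (hr : (Module.finrank ℝ E : ℝ) * (p - 1) < r * p)
    (hw : MemLp w (ENNReal.ofReal p) (μ.restrict s))
    (hg : AEStronglyMeasurable g (μ.restrict s))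
    (hb : ∀ x ∈ s, |g x| ≤ C * (1 + ‖x‖) ^ (-r)) : IntegrableOn (fun x => w x * g x) s μ := by
  have hpq := Real.HolderConjugate.conjExponent hp
  have := hpq.ennrealOfReal
  have h1 : 0 < p - 1 := by linarith
  refine MemLp.integrable_mul hw (memLp_of_decay hs (p := p.conjExponent) (C := C) (r := r) ?_ ?_ hg hb)
  · exact hpq.symm.pos
  · rw [Real.conjExponent, mul_div_assoc', lt_div_iff₀ h1]
    exact hr

section

variable {n : ℕ} {w : Space n → ℝ} {dw : Space n → Space n} {tw : Bdry n → ℝ} {r C : ℝ}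

theorem continuous_dot_const (v : Space n) : Continuous fun a : Space n => dot a v := by
  unfold dot; fun_prop

theorem abs_dot_le (a v : Space n) : |dot a v| ≤ (‖v.1‖ + |v.2|) * ‖a‖ := by
  unfold dot
  have h1 := abs_real_inner_le_norm a.1 v.1
  have h2 : ‖a.1‖ ≤ ‖a‖ := norm_fst_le a
  have h3 : |a.2| ≤ ‖a‖ := norm_snd_le a
  calc _ ≤ |inner ℝ a.1 v.1| + |a.2 * v.2| := abs_add_le _ _
    _ ≤ ‖a‖ * ‖v.1‖ + ‖a‖ * |v.2| := by
      rw [abs_mul]; gcongr; exact h1.trans (by gcongr)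
    _ = _ := by ring

namespace MemSigma

/-- The conjugate exponent of 2n/(n-2) is 2n/(n+2), so a decay rate r > (n+2)/2 suffices. The
boundary trace and the gradient only require r > n/2, so this one condition serves throughout. -/
theorem integrableOn_mul (hw : MemSigma w dw tw) (hn : 3 ≤ n) (hr : (n : ℝ) + 2 < 2 * r)
    {g : Space n → ℝ} (hg : AEStronglyMeasurable g (volume.restrict (halfSpace n)))
    (hb : ∀ x ∈ halfSpace n, |g x| ≤ C * (1 + ‖x‖) ^ (-r)) :
    IntegrableOn (fun x => w x * g x) (halfSpace n) := by
  have hn' : (3 : ℝ) ≤ n := by exact_mod_cast hn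
  have h2 : 0 < (n : ℝ) - 2 := by linarith
  refine integrableOn_mul_of_decay (measurableSet_halfSpace n) ?_ ?_ hw.memLp hg hb
  · rw [lt_div_iff₀ h2]; linarith
  · rw [finrank_space (by omega), div_sub_one h2.ne', mul_div_assoc', mul_div_assoc',
      div_lt_div_iff_of_pos_right h2]
    nlinarith

theorem integrable_trace_mul (hw : MemSigma w dw tw) (hn : 3 ≤ n) (hr : (n : ℝ) + 2 < 2 * r)
    {g : Bdry n → ℝ} (hg : AEStronglyMeasurable g volume)
    (hb : ∀ y, |g y| ≤ C * (1 + ‖y‖) ^ (-r)) :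
    Integrable (fun y => tw y * g y) := by
  have hn' : (3 : ℝ) ≤ n := by exact_mod_cast hn
  have h2 : 0 < (n : ℝ) - 2 := by linarith
  rw [← integrableOn_univ]
  refine integrableOn_mul_of_decay (C := C) (r := r) (p := 2 * (n - 1) / (n - 2)) MeasurableSet.univ
    ?_ ?_ (by simpa using hw.memLp_trace) (by simpa using hg) (fun y _ => hb y)
  · rw [lt_div_iff₀ h2]; linarith
  · rw [finrank_euclideanSpace, Fintype.card_fin, Nat.cast_sub (by omega), Nat.cast_one,
      div_sub_one h2.ne', mul_div_assoc', mul_div_assoc', div_lt_div_iff_of_pos_right h2]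
    nlinarith

theorem integrableOn_dot_mul (hw : MemSigma w dw tw) (hn : 3 ≤ n) (hr : (n : ℝ) + 2 < 2 * r)
    (v : Space n) {g : Space n → ℝ} (hg : AEStronglyMeasurable g (volume.restrict (halfSpace n)))
    (hb : ∀ x ∈ halfSpace n, |g x| ≤ C * (1 + ‖x‖) ^ (-r)) :
    IntegrableOn (fun x => dot (dw x) v * g x) (halfSpace n) := by
  have hn' : (3 : ℝ) ≤ n := by exact_mod_cast hn
  have hm : MemLp (fun x => dot (dw x) v) (ENNReal.ofReal 2) (volume.restrict (halfSpace n)) := by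
    rw [ENNReal.ofReal_ofNat]
    exact hw.memLp_gradient.of_le_mul
      ((continuous_dot_const v).comp_aestronglyMeasurable hw.memLp_gradient.1)
      (ae_of_all _ fun x => abs_dot_le _ _)
  refine integrableOn_mul_of_decay (measurableSet_halfSpace n) (by norm_num) ?_ hm hg hb
  rw [finrank_space (by omega)]
  linarith

/-- Green's formula for test functions that decay fast enough. -/
theorem integral_mul_fderiv (hw : MemSigma w dw tw) (hn : 3 ≤ n) (hr : (n : ℝ) + 2 < 2 * r)
    {G : Space n → ℝ} (hG : ContDiff ℝ ∞ G) (v : Space n)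
    (hb : ∀ x ∈ halfSpace n, |G x| ≤ C * (1 + ‖x‖) ^ (-r))
    (hb' : ∀ x ∈ halfSpace n, |fderiv ℝ G x v| ≤ C * (1 + ‖x‖) ^ (-r)) :
    ∫ x in halfSpace n, w x * fderiv ℝ G x v =
      -(∫ x in halfSpace n, dot (dw x) v * G x) - v.2 * ∫ y : Bdry n, tw y * G (y, 0) := by
  have hH := measurableSet_halfSpace n
  let b : ContDiffBump (0 : Space n) := ⟨1, 2, one_pos, by norm_num⟩
  have hbd : ContDiff ℝ ∞ (b : Space n → ℝ) := b.contDiff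
  have hGd : Differentiable ℝ G := hG.differentiable (by simp)
  have hGc : Continuous fun x => fderiv ℝ G x v :=
    (hG.continuous_fderiv (by simp)).clm_apply continuous_const
  have hbc : Continuous fun x => fderiv ℝ (b : Space n → ℝ) x v :=
    (hbd.continuous_fderiv (by simp)).clm_apply continuous_const
  obtain ⟨K, hK⟩ := hbc.bounded_above_of_compact_support
    (b.hasCompactSupport.fderiv_apply ℝ v)
  have hK0 : 0 ≤ K := (norm_nonneg _).trans (hK 0)
  -- The cutoffs χ k (x) = b(x/(k+1)) tend to 1 with gradients of order 1/k. Dominated convergence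
  -- extends the trace identity from compact support to the decay required here.
  set c : ℕ → ℝ := fun k => ((k : ℝ) + 1)⁻¹
  have hc0 : ∀ k, 0 < c k := fun k => by positivity
  have hc1 : ∀ k, c k ≤ 1 := fun k => inv_le_one_of_one_le₀ (by
    have : (0 : ℝ) ≤ k := Nat.cast_nonneg k
    linarith)
  have hclim : Tendsto c atTop (𝓝 0) := by
    simpa [c, one_div] using tendsto_one_div_add_atTop_nhds_zero_nat (𝕜 := ℝ)
  set χ : ℕ → Space n → ℝ := fun k x => b (c k • x)
  have hχd : ∀ k, ContDiff ℝ ∞ (χ k) := fun k => hbd.comp (contDiff_const_smul _)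
  have hχ1 : ∀ k x, |χ k x| ≤ 1 := fun k x => by
    rw [abs_of_nonneg b.nonneg]; exact b.le_one
  have hχf : ∀ k x, fderiv ℝ (χ k) x v = c k * fderiv ℝ (b : Space n → ℝ) (c k • x) v := fun k x => by
    have := fderiv_comp_smul (f := (b : Space n → ℝ)) (x := x) (c k) (𝕜 := ℝ)
    simp only [χ, this]; simp
  have hχcs : ∀ k, HasCompactSupport (χ k) := fun k =>
    b.hasCompactSupport.comp_smul (hc0 k).ne'
  have hχlim : ∀ x, Tendsto (fun k => χ k x) atTop (𝓝 1) := fun x => by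
    have h0 : Tendsto (fun k => c k • x) atTop (𝓝 0) := by simpa using hclim.smul_const x
    have := (b.continuous.tendsto 0).comp h0
    rwa [b.one_of_mem_closedBall (Metric.mem_closedBall_self b.rIn_pos.le)] at this
  have hχflim : ∀ x, Tendsto (fun k => fderiv ℝ (χ k) x v) atTop (𝓝 0) := fun x => by
    simp only [hχf]
    refine squeeze_zero_norm (fun k => ?_) (by simpa using hclim.mul_const K)
    rw [norm_mul, Real.norm_of_nonneg (hc0 k).le]
    exact mul_le_mul_of_nonneg_left (hK _) (hc0 k).le
  have hmain := fun k => hw.trace (fun x => G x * χ k x) (hG.mul (hχd k)) ((hχcs k).mul_left) v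
  have hfd : ∀ k x, fderiv ℝ (fun x => G x * χ k x) x v =
      G x * fderiv ℝ (χ k) x v + fderiv ℝ G x v * χ k x := fun k x => by
    rw [fderiv_fun_mul (hGd x) ((hχd k).differentiable (by simp) x)]
    simp [mul_comm]
  simp only [hfd] at hmain
  have hwm := hw.memLp.1
  have hdm : AEStronglyMeasurable (fun x => dot (dw x) v) (volume.restrict (halfSpace n)) :=
    (continuous_dot_const v).comp_aestronglyMeasurable hw.memLp_gradient.1
  have hdec : Continuous fun x : Space n => (1 + ‖x‖) ^ (-r) :=
    (continuous_const.add continuous_norm).rpow_const fun x =>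
      Or.inl (by positivity : (0 : ℝ) < 1 + ‖x‖).ne'
  have hC0 : 0 ≤ C := by
    have := (abs_nonneg _).trans (hb 0 (by simp [halfSpace]))
    simpa using this
  have L1 : Tendsto (fun k => ∫ x in halfSpace n,
      w x * (G x * fderiv ℝ (χ k) x v + fderiv ℝ G x v * χ k x)) atTop
      (𝓝 (∫ x in halfSpace n, w x * fderiv ℝ G x v)) := by
    have hi := (hw.integrableOn_mul hn hr (g := fun x => (K + 1) * C * (1 + ‖x‖) ^ (-r))
      (C := (K + 1) * C) (hdec.const_smul ((K + 1) * C)).aestronglyMeasurable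
      (fun x _ => by rw [abs_of_nonneg (by positivity)])).norm
    refine tendsto_integral_of_dominated_convergence _ (fun k => ?_) hi (fun k => ?_) ?_
    · refine hwm.mul (Continuous.aestronglyMeasurable ?_)
      exact (hG.continuous.mul (((hχd k).continuous_fderiv (by simp)).clm_apply
        continuous_const)).add (hGc.mul (hχd k).continuous)
    · refine (ae_restrict_iff' hH).2 (ae_of_all _ fun x hx => ?_)
      rw [norm_mul, norm_mul]
      gcongr
      have hk : |fderiv ℝ (χ k) x v| ≤ K := by
        rw [hχf, abs_mul, abs_of_pos (hc0 k)]
        calc _ ≤ 1 * K := mul_le_mul (hc1 k) (hK _) (abs_nonneg _) zero_le_one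
          _ = K := one_mul K
      calc ‖G x * fderiv ℝ (χ k) x v + fderiv ℝ G x v * χ k x‖
          ≤ |G x| * |fderiv ℝ (χ k) x v| + |fderiv ℝ G x v| * |χ k x| := by
            rw [← abs_mul, ← abs_mul]; exact abs_add_le _ _
        _ ≤ (C * (1 + ‖x‖) ^ (-r)) * K + (C * (1 + ‖x‖) ^ (-r)) * 1 := by
            gcongr
            · exact hb x hx
            · exact hb' x hx
            · exact hχ1 k x
        _ = (K + 1) * C * (1 + ‖x‖) ^ (-r) := by ring
        _ ≤ _ := le_abs_self _
    · refine ae_of_all _ fun x => Tendsto.const_mul _ ?_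
      simpa using ((hχflim x).const_mul (G x)).add ((hχlim x).const_mul (fderiv ℝ G x v))
  have L2 : Tendsto (fun k => ∫ x in halfSpace n, dot (dw x) v * (G x * χ k x)) atTop
      (𝓝 (∫ x in halfSpace n, dot (dw x) v * G x)) := by
    have hi := (hw.integrableOn_dot_mul hn hr v hG.continuous.aestronglyMeasurable hb).norm
    refine tendsto_integral_of_dominated_convergence _ (fun k => ?_) hi (fun k => ?_) ?_
    · exact hdm.mul (hG.continuous.mul (hχd k).continuous).aestronglyMeasurable
    · refine ae_of_all _ fun x => ?_
      rw [← mul_assoc, norm_mul _ (χ k x)]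
      exact mul_le_of_le_one_right (norm_nonneg _) (hχ1 k x)
    · refine ae_of_all _ fun x => Tendsto.const_mul _ ?_
      simpa using (hχlim x).const_mul (G x)
  have hG0 : Continuous fun y : Bdry n => G (y, 0) := hG.continuous.comp (by fun_prop)
  have hb0 : ∀ y : Bdry n, |G (y, 0)| ≤ C * (1 + ‖y‖) ^ (-r) := fun y => by
    have := hb (y, 0) (by simp [halfSpace])
    simpa [Prod.norm_def] using this
  have L3 : Tendsto (fun k => ∫ y : Bdry n, tw y * (G (y, 0) * χ k (y, 0))) atTop
      (𝓝 (∫ y : Bdry n, tw y * G (y, 0))) := by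
    have hi := (hw.integrable_trace_mul hn hr hG0.aestronglyMeasurable hb0).norm
    refine tendsto_integral_of_dominated_convergence _ (fun k => ?_) hi (fun k => ?_) ?_
    · exact hw.memLp_trace.1.mul
        (hG0.mul ((hχd k).continuous.comp (by fun_prop))).aestronglyMeasurable
    · refine ae_of_all _ fun x => ?_
      rw [← mul_assoc, norm_mul _ (χ k _)]
      exact mul_le_of_le_one_right (norm_nonneg _) (hχ1 k _)
    · refine ae_of_all _ fun x => Tendsto.const_mul _ ?_
      simpa using (hχlim (x, 0)).const_mul (G (x, 0))
  refine tendsto_nhds_unique L1 ?_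
  simp only [hmain]
  exact L2.neg.sub (L3.const_mul _)

end MemSigma

/-! ### Smooth decaying functions as elements of Σ -/

/-- The direction is split: a tangential derivative integrates to zero on every horizontal slice,
and the normal one is integrated along vertical half-lines. -/
theorem integral_fderiv_halfSpace {g : Space n → ℝ} (hg : ContDiff ℝ 1 g)
    (hc : HasCompactSupport g) (v : Space n) :
    ∫ x in halfSpace n, fderiv ℝ g x v = -(v.2 * ∫ y : Bdry n, g (y, 0)) := by
  have hd : Differentiable ℝ g := hg.differentiable (by simp)
  have hcont : ∀ v, Continuous fun x => fderiv ℝ g x v := fun v =>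
    (hg.continuous_fderiv (by simp)).clm_apply continuous_const
  have hint : ∀ v, Integrable (fun x => fderiv ℝ g x v)
      ((volume : Measure (Bdry n)).prod ((volume : Measure ℝ).restrict (Set.Ici 0))) := fun v => by
    rw [← volume_restrict_halfSpace]
    exact ((hcont v).integrable_of_hasCompactSupport (hc.fderiv_apply ℝ v)).integrableOn
  have hsl1 : ∀ t : ℝ, HasCompactSupport fun y : Bdry n => g (y, t) := fun t =>
    HasCompactSupport.intro (hc.isCompact.image continuous_fst) fun y hy => by
      by_contra h
      exact hy ⟨(y, t), subset_tsupport _ h, rfl⟩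
  have hsl2 : ∀ y : Bdry n, HasCompactSupport fun t : ℝ => g (y, t) := fun y =>
    HasCompactSupport.intro (hc.isCompact.image continuous_snd) fun t ht => by
      by_contra h
      exact ht ⟨(y, t), subset_tsupport _ h, rfl⟩
  have h1 : ∀ u : Bdry n, ∫ x in halfSpace n, fderiv ℝ g x (u, 0) = 0 := fun u => by
    rw [volume_restrict_halfSpace, integral_prod_symm _ (hint _)]
    refine integral_eq_zero_of_ae (ae_of_all _ fun t => ?_)
    have hs : ContDiff ℝ 1 fun y : Bdry n => g (y, t) :=
      hg.comp (contDiff_id.prodMk contDiff_const)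
    have hf : ∀ y : Bdry n, fderiv ℝ (fun y : Bdry n => g (y, t)) y u = fderiv ℝ g (y, t) (u, 0) :=
      fun y => by
        have h0 : HasFDerivAt (fun y : Bdry n => (y, t))
            (ContinuousLinearMap.inl ℝ (Bdry n) ℝ) y := hasFDerivAt_prodMk_left y t
        have := HasFDerivAt.comp (g := g) y (hd (y, t)).hasFDerivAt h0
        rw [show (fun y : Bdry n => g (y, t)) = g ∘ fun y => (y, t) from rfl, this.fderiv]
        simp
    have hcs : Continuous fun y => fderiv ℝ (fun y : Bdry n => g (y, t)) y u :=
      (hs.continuous_fderiv (by simp)).clm_apply continuous_const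
    have := integral_mul_fderiv_eq_neg_fderiv_mul_of_integrable (μ := (volume : Measure (Bdry n)))
      (f := fun _ => (1 : ℝ)) (g := fun y => g (y, t)) (v := u) (by simp)
      (by simpa using hcs.integrable_of_hasCompactSupport ((hsl1 t).fderiv_apply ℝ u))
      (by simpa using hs.continuous.integrable_of_hasCompactSupport (hsl1 t))
      (fun y _ => by fun_prop) (fun y _ => hs.differentiable (by simp) y)
    simpa [hf] using this
  have h2 : ∫ x in halfSpace n, fderiv ℝ g x (0, 1) = -∫ y : Bdry n, g (y, 0) := by
    rw [volume_restrict_halfSpace, integral_prod _ (hint _), ← integral_neg]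
    congr 1; ext y
    have hs : ContDiff ℝ 1 fun t : ℝ => g (y, t) := hg.comp (contDiff_const.prodMk contDiff_id)
    rw [integral_Ici_eq_integral_Ioi, ← (hsl2 y).integral_Ioi_deriv_eq hs 0]
    congr 1; ext t
    have := (hd (y, t)).hasFDerivAt.comp_hasDerivAt t ((hasDerivAt_const t y).prodMk (hasDerivAt_id t))
    exact this.deriv.symm
  have hv : v = (v.1, 0) + v.2 • ((0, 1) : Space n) := by ext <;> simp
  have hsplit : ∀ x, fderiv ℝ g x v = fderiv ℝ g x (v.1, 0) + v.2 * fderiv ℝ g x (0, 1) := fun x => by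
    conv_lhs => rw [hv]
    rw [map_add, map_smul, smul_eq_mul]
  have hi := hint
  rw [← volume_restrict_halfSpace] at hi
  simp only [hsplit]
  rw [integral_add (hi _) ((hi _).const_mul _), integral_const_mul, h1, h2]
  ring

/-- The classical gradient. -/
def grad (E : Space n → ℝ) (x : Space n) : Space n :=
  (WithLp.toLp 2 fun i => pd i E x, fderiv ℝ E x (0, 1))

theorem fderiv_eq_sum (E : Space n → ℝ) (x v : Space n) :
    fderiv ℝ E x v = ∑ i, v.1 i * pd i E x + v.2 * fderiv ℝ E x (0, 1) := by
  have hv : v = ∑ i, v.1 i • ((EuclideanSpace.single i 1, 0) : Space n) + v.2 • (0, 1) := by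
    refine Prod.ext ?_ ?_
    · ext j
      simp [Prod.fst_sum, Pi.single_apply]
    · simp [Prod.snd_sum]
  conv_lhs => rw [hv]
  simp only [map_add, map_sum, map_smul, smul_eq_mul, pd]

theorem dot_grad (E : Space n → ℝ) (x v : Space n) : dot (grad E x) v = fderiv ℝ E x v := by
  rw [fderiv_eq_sum, dot, grad]
  simp [PiLp.inner_apply, mul_comm]

theorem dot_comm (a b : Space n) : dot a b = dot b a := by
  unfold dot; rw [real_inner_comm, mul_comm]

theorem dot_eq_sum (a b : Space n) : dot a b =
    ∑ i, dot a (EuclideanSpace.single i 1, 0) * b.1 i + dot a (0, 1) * b.2 := by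
  simp [dot, PiLp.inner_apply, mul_comm]

theorem norm_single_zero (i : Fin (n - 1)) :
    ‖((EuclideanSpace.single i 1, 0) : Space n)‖ = 1 := by
  simp [Prod.norm_def]

theorem norm_zero_one : ‖((0, 1) : Space n)‖ = 1 := by
  simp [Prod.norm_def]

theorem abs_pd_le (E : Space n → ℝ) (x : Space n) (i : Fin (n - 1)) : |pd i E x| ≤ ‖fderiv ℝ E x‖ := by
  have := (fderiv ℝ E x).le_opNorm (EuclideanSpace.single i 1, 0)
  rwa [norm_single_zero, mul_one] at this

theorem abs_fderiv_normal_le (E : Space n → ℝ) (x : Space n) :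
    |fderiv ℝ E x (0, 1)| ≤ ‖fderiv ℝ E x‖ := by
  have := (fderiv ℝ E x).le_opNorm (0, 1)
  rwa [norm_zero_one, mul_one] at this

theorem norm_grad_le (hn : 1 ≤ n) (E : Space n → ℝ) (x : Space n) : ‖grad E x‖ ≤ n * ‖fderiv ℝ E x‖ := by
  have hn1 : (1 : ℝ) ≤ n := by exact_mod_cast hn
  have h0 := norm_nonneg (fderiv ℝ E x)
  rw [grad, Prod.norm_def]
  refine max_le ?_ ?_
  · have : ‖(WithLp.toLp 2 fun i => pd i E x : Bdry n)‖ ≤ ∑ i : Fin (n - 1), |pd i E x| := by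
      have hs : (WithLp.toLp 2 fun i => pd i E x : Bdry n) =
          ∑ i, pd i E x • (EuclideanSpace.single i (1 : ℝ)) := by
        ext j; simp [Pi.single_apply]
      rw [hs]
      refine (norm_sum_le _ _).trans (Finset.sum_le_sum fun i _ => ?_)
      rw [norm_smul]; simp
    refine this.trans ((Finset.sum_le_sum fun i _ => abs_pd_le E x i).trans ?_)
    simp only [Finset.sum_const, Finset.card_univ, Fintype.card_fin, nsmul_eq_mul]
    gcongr
    omega
  · exact (abs_fderiv_normal_le E x).trans (le_mul_of_one_le_left h0 hn1)

/-- Apply the divergence formula to the product E φ, which has compact support although E need not.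
-/
theorem hasTrace_of_contDiff {E : Space n → ℝ} (hE : ContDiff ℝ ∞ E) :
    HasTrace E (grad E) (fun y => E (y, 0)) := by
  intro φ hφ hc v
  have h := integral_fderiv_halfSpace (g := fun x => E x * φ x) ((hE.mul hφ).of_le (by simp))
    hc.mul_left v
  have hfd : ∀ x, fderiv ℝ (fun x => E x * φ x) x v =
      E x * fderiv ℝ φ x v + fderiv ℝ E x v * φ x := fun x => by
    rw [fderiv_fun_mul (hE.differentiable (by simp) x) (hφ.differentiable (by simp) x)]
    simp [mul_comm]
  simp only [hfd] at h
  rw [integral_add] at h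
  · simp only [dot_grad]
    linarith
  · exact ((hE.continuous.mul ((hφ.continuous_fderiv (by simp)).clm_apply
      continuous_const)).integrable_of_hasCompactSupport (hc.fderiv_apply ℝ v).mul_left).integrableOn
  · exact ((((hE.continuous_fderiv (by simp)).clm_apply continuous_const).mul
      hφ.continuous).integrable_of_hasCompactSupport hc.mul_left).integrableOn

theorem HasTrace.hasWeakGradient (h : HasTrace w dw tw) : HasWeakGradient w dw := by
  intro φ hφ hc hs v
  have h0 : ∀ y : Bdry n, φ (y, 0) = 0 := fun y => by
    by_contra hne
    exact lt_irrefl (0 : ℝ) (hs (subset_tsupport φ hne))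
  rw [h φ hφ hc v]
  simp [h0]

theorem memSigma_of_decay (hn : 3 ≤ n) (hr : (n : ℝ) + 2 < 2 * r) {E : Space n → ℝ}
    (hE : ContDiff ℝ ∞ E) (hb : ∀ x ∈ halfSpace n, |E x| ≤ C * (1 + ‖x‖) ^ (-r))
    (hb' : ∀ x ∈ halfSpace n, ‖fderiv ℝ E x‖ ≤ C * (1 + ‖x‖) ^ (-r)) :
    MemSigma E (grad E) (fun y => E (y, 0)) := by
  have hH := measurableSet_halfSpace n
  have hn' : (3 : ℝ) ≤ n := by exact_mod_cast hn
  have h2 : 0 < (n : ℝ) - 2 := by linarith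
  have ht := hasTrace_of_contDiff hE
  have hgc : Continuous (grad E) := by
    have hc : ∀ v, Continuous fun x => fderiv ℝ E x v := fun v =>
      (hE.continuous_fderiv (by simp)).clm_apply continuous_const
    exact ((PiLp.continuous_toLp 2 _).comp (continuous_pi fun i => hc _)).prodMk (hc _)
  refine ⟨?_, ?_, ?_, ht.hasWeakGradient, ht⟩
  · refine memLp_of_decay hH (by positivity) ?_ hE.continuous.aestronglyMeasurable hb
    rw [finrank_space (by omega), mul_div_assoc', lt_div_iff₀ h2]
    nlinarith
  · have hc0 : Continuous fun y : Bdry n => E (y, 0) := hE.continuous.comp (by fun_prop)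
    rw [← Measure.restrict_univ (μ := volume)]
    refine memLp_of_decay (C := C) (r := r) MeasurableSet.univ (div_pos (by linarith) h2) ?_
      hc0.aestronglyMeasurable fun y _ => ?_
    · rw [finrank_euclideanSpace, Fintype.card_fin, Nat.cast_sub (by omega), Nat.cast_one,
        mul_div_assoc', lt_div_iff₀ h2]
      nlinarith
    · have := hb (y, 0) (by simp [halfSpace])
      simpa [Prod.norm_def] using this
  · have h := memLp_of_decay (μ := volume) (G := Space n) (g := grad E) (p := 2) (C := n * C) (r := r) hH
      (by norm_num) ?_ hgc.aestronglyMeasurable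
      fun x hx => ?_
    · rwa [ENNReal.ofReal_ofNat] at h
    · rw [finrank_space (by omega)]; linarith
    · refine (norm_grad_le (by omega) E x).trans ?_
      rw [mul_assoc]
      exact mul_le_mul_of_nonneg_left (hb' x hx) (Nat.cast_nonneg n)

/-- The classical Laplacian. -/
def laplacian (E : Space n → ℝ) (x : Space n) : ℝ :=
  ∑ i, pd i (pd i E) x + fderiv ℝ (fun x => fderiv ℝ E x (0, 1)) x (0, 1)

/-- Green's formula for a decaying smooth function and an element of `Σ`. -/
theorem MemSigma.integral_dot_grad (hw : MemSigma w dw tw) (hn : 3 ≤ n) (hr : (n : ℝ) + 2 < 2 * r)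
    {E : Space n → ℝ} (hE : ContDiff ℝ ∞ E)
    (hb : ∀ x ∈ halfSpace n, ‖fderiv ℝ E x‖ ≤ C * (1 + ‖x‖) ^ (-r))
    (hbt : ∀ i, ∀ x ∈ halfSpace n, |pd i (pd i E) x| ≤ C * (1 + ‖x‖) ^ (-r))
    (hbn : ∀ x ∈ halfSpace n,
      |fderiv ℝ (fun x => fderiv ℝ E x (0, 1)) x (0, 1)| ≤ C * (1 + ‖x‖) ^ (-r)) :
    ∫ x in halfSpace n, dot (grad E x) (dw x) =
      -(∫ x in halfSpace n, w x * laplacian E x) - ∫ y : Bdry n, tw y * fderiv ℝ E (y, 0) (0, 1) := by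
  have hsm : ∀ v, ContDiff ℝ ∞ fun x => fderiv ℝ E x v := fun v =>
    (hE.fderiv_right (by simp)).clm_apply contDiff_const
  have hsm' : ∀ v u, Continuous fun x => fderiv ℝ (fun x => fderiv ℝ E x v) x u := fun v u =>
    ((hsm v).continuous_fderiv (by simp)).clm_apply continuous_const
  have hT := fun i => hw.integral_mul_fderiv hn hr (G := pd i E) (hsm _)
    (EuclideanSpace.single i 1, 0) (fun x hx => (abs_pd_le E x i).trans (hb x hx)) (hbt i)
  have hN := hw.integral_mul_fderiv hn hr (hsm (0, 1)) (0, 1)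
    (fun x hx => (abs_fderiv_normal_le E x).trans (hb x hx)) hbn
  have iT := fun i => hw.integrableOn_dot_mul hn hr (EuclideanSpace.single i 1, 0) (g := pd i E)
    (hsm _).continuous.aestronglyMeasurable (fun x hx => (abs_pd_le E x i).trans (hb x hx))
  have iN := hw.integrableOn_dot_mul hn hr (0, 1) (hsm (0, 1)).continuous.aestronglyMeasurable
    (fun x hx => (abs_fderiv_normal_le E x).trans (hb x hx))
  have jT := fun i => hw.integrableOn_mul hn hr (g := pd i (pd i E))
    (hsm' _ _).aestronglyMeasurable (hbt i)
  have jN := hw.integrableOn_mul hn hr (hsm' (0, 1) (0, 1)).aestronglyMeasurable hbn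
  have e1 : ∀ x, dot (grad E x) (dw x) =
      ∑ i, dot (dw x) (EuclideanSpace.single i 1, 0) * pd i E x
        + dot (dw x) (0, 1) * fderiv ℝ E x (0, 1) := fun x => by
    rw [dot_comm, dot_eq_sum]; rfl
  have e2 : ∀ x, w x * laplacian E x = ∑ i, w x * pd i (pd i E) x
      + w x * fderiv ℝ (fun x => fderiv ℝ E x (0, 1)) x (0, 1) := fun x => by
    rw [laplacian, mul_add, Finset.mul_sum]
  simp only [e1, e2]
  rw [integral_add (integrable_finsetSum _ fun i _ => iT i) iN,
    integral_finsetSum _ fun i _ => iT i,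
    integral_add (integrable_finsetSum _ fun i _ => jT i) jN,
    integral_finsetSum _ fun i _ => jT i]
  have hT' : ∀ i, ∫ x in halfSpace n, w x * pd i (pd i E) x =
      -∫ x in halfSpace n, dot (dw x) (EuclideanSpace.single i 1, 0) * pd i E x := fun i => by
    have := hT i
    simp only [zero_mul, sub_zero] at this
    exact this
  simp only [hT', Finset.sum_neg_distrib]
  simp only [one_mul] at hN
  linarith

end

/-! ### The tail integrals `∫_τ^∞ (s + σ²)^(-m) dσ` -/

/-- The normalized tail integral `∫_1^∞ (x + σ²)^(-m) dσ`. -/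
def unitTail (m x : ℝ) : ℝ := ∫ σ in Set.Ioi (1 : ℝ), (x + σ ^ 2) ^ (-m)

theorem min_mul_sq_le {x σ : ℝ} (hσ : 1 ≤ σ) : min 1 (x + 1) * σ ^ 2 ≤ x + σ ^ 2 := by
  have h1 : 1 ≤ σ ^ 2 := one_le_pow₀ hσ
  rcases le_total 1 (x + 1) with h | h
  · rw [min_eq_left h]; linarith
  · rw [min_eq_right h]; nlinarith

theorem add_sq_rpow_le {m x c σ : ℝ} (hm : 0 ≤ m) (hc : 0 < c) (hx : c ≤ min 1 (x + 1)) (hσ : 1 ≤ σ) :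
    (x + σ ^ 2) ^ (-m) ≤ c ^ (-m) * σ ^ (-(2 * m)) := by
  have hσ0 : 0 < σ := by linarith
  have h := (mul_le_mul_of_nonneg_right hx (sq_nonneg σ)).trans (min_mul_sq_le (x := x) hσ)
  calc (x + σ ^ 2) ^ (-m) ≤ (c * σ ^ 2) ^ (-m) :=
        Real.rpow_le_rpow_of_nonpos (by positivity) h (by linarith)
    _ = _ := by
      rw [Real.mul_rpow hc.le (by positivity), ← Real.rpow_natCast σ 2, ← Real.rpow_mul hσ0.le]
      congr 2; push_cast; ring

theorem add_sq_pos {x σ : ℝ} (hx : -1 < x) (hσ : 1 ≤ σ) : 0 < x + σ ^ 2 := by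
  have h1 : 1 ≤ σ ^ 2 := one_le_pow₀ hσ
  linarith

theorem aestronglyMeasurable_add_sq_rpow (m x : ℝ) (μ : Measure ℝ) :
    AEStronglyMeasurable (fun σ : ℝ => (x + σ ^ 2) ^ (-m)) μ :=
  Measurable.aestronglyMeasurable (by fun_prop)

theorem integrableOn_unitTail {m x : ℝ} (hm : 1 ≤ m) (hx : -1 < x) :
    IntegrableOn (fun σ : ℝ => (x + σ ^ 2) ^ (-m)) (Set.Ioi 1) := by
  have hc : 0 < min 1 (x + 1) := lt_min one_pos (by linarith)
  refine Integrable.mono' ((integrableOn_Ioi_rpow_of_lt (a := -(2 * m)) (by linarith)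
    one_pos).const_mul (min 1 (x + 1) ^ (-m))) (aestronglyMeasurable_add_sq_rpow _ _ _) ?_
  refine (ae_restrict_iff' measurableSet_Ioi).2 (ae_of_all _ fun σ hσ => ?_)
  have hσ' : 1 ≤ σ := le_of_lt hσ
  rw [Real.norm_of_nonneg (Real.rpow_nonneg (add_sq_pos hx hσ').le _)]
  exact add_sq_rpow_le (by linarith) hc le_rfl hσ'

theorem hasDerivAt_unitTail {m x : ℝ} (hm : 1 ≤ m) (hx : -1 < x) :
    HasDerivAt (unitTail m) (-m * unitTail (m + 1) x) x := by
  -- Half the distance to -1, so that z + 1 stays at least δ on the ball and the dominating function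
  -- does not depend on z.
  set δ := (x + 1) / 2 with hδ
  have hδ0 : 0 < δ := by linarith
  have hc : 0 < min 1 δ := lt_min one_pos hδ0
  have hball : ∀ z ∈ Metric.ball x δ, -1 < z ∧ min 1 δ ≤ min 1 (z + 1) := fun z hz => by
    rw [Metric.mem_ball, Real.dist_eq, abs_lt] at hz
    exact ⟨by linarith [hz.1], min_le_min_left _ (by linarith [hz.1])⟩
  have h := hasDerivAt_integral_of_dominated_loc_of_deriv_le (𝕜 := ℝ)
    (μ := volume.restrict (Set.Ioi (1 : ℝ)))
    (F := fun z σ : ℝ => (z + σ ^ 2) ^ (-m)) (F' := fun z σ : ℝ => -m * (z + σ ^ 2) ^ (-(m + 1)))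
    (x₀ := x) (s := Metric.ball x δ) (bound := fun σ => m * (min 1 δ ^ (-(m + 1)) * σ ^ (-(2 * (m + 1)))))
    (Metric.ball_mem_nhds x hδ0)
    (Eventually.of_forall fun z => aestronglyMeasurable_add_sq_rpow _ _ _)
    (integrableOn_unitTail hm hx)
    ((aestronglyMeasurable_add_sq_rpow _ _ _).const_mul _) ?_ ?_ ?_
  · have h2 := h.2
    simp only [integral_const_mul] at h2
    exact h2
  · refine (ae_restrict_iff' measurableSet_Ioi).2 (ae_of_all _ fun σ hσ z hz => ?_)
    have hσ' : 1 ≤ σ := le_of_lt hσ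
    obtain ⟨h1, h2⟩ := hball z hz
    rw [norm_mul, Real.norm_of_nonneg (Real.rpow_nonneg (add_sq_pos h1 hσ').le _), norm_neg,
      Real.norm_of_nonneg (by linarith)]
    exact mul_le_mul_of_nonneg_left (add_sq_rpow_le (by linarith) hc h2 hσ') (by linarith)
  · exact ((integrableOn_Ioi_rpow_of_lt (by linarith) one_pos).const_mul _).const_mul _
  · refine (ae_restrict_iff' measurableSet_Ioi).2 (ae_of_all _ fun σ hσ z hz => ?_)
    have hσ' : 1 ≤ σ := le_of_lt hσ
    have := ((hasDerivAt_id z).add_const (σ ^ 2)).rpow_const (p := -m)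
      (Or.inl (add_sq_pos (hball z hz).1 hσ').ne')
    refine this.congr_deriv ?_
    rw [show -(m + 1) = -m - 1 by ring]
    simp

/-- The derivative is a multiple of the same integral with m + 1 in place of m, hence the induction
for all m at once. -/
theorem contDiffOn_unitTail_nat (k : ℕ) : ∀ {m : ℝ}, 1 ≤ m → ContDiffOn ℝ k (unitTail m) (Set.Ioi (-1)) := by
  induction k with
  | zero =>
    intro m hm
    exact contDiffOn_zero.2 fun x hx => (hasDerivAt_unitTail hm hx).continuousAt.continuousWithinAt
  | succ k ih =>
    intro m hm
    rw [Nat.cast_succ, contDiffOn_succ_iff_deriv_of_isOpen isOpen_Ioi]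
    refine ⟨fun x hx => (hasDerivAt_unitTail hm hx).differentiableAt.differentiableWithinAt,
      by simp, ?_⟩
    refine ContDiffOn.congr (f := fun x => -m * unitTail (m + 1) x)
      (contDiffOn_const.mul (ih (by linarith))) fun x hx => (hasDerivAt_unitTail hm hx).deriv

theorem contDiffOn_unitTail {m : ℝ} (hm : 1 ≤ m) : ContDiffOn ℝ ∞ (unitTail m) (Set.Ioi (-1)) :=
  contDiffOn_infty.2 fun k => contDiffOn_unitTail_nat k hm

/-- Integrate the derivative of σ (x + σ²)^(-m) from 1 to infinity. -/
theorem unitTail_recurrence {m x : ℝ} (hm : 1 ≤ m) (hx : -1 < x) :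
    2 * m * x * unitTail (m + 1) x = (2 * m - 1) * unitTail m x - (x + 1) ^ (-m) := by
  have hd : ∀ σ ∈ Set.Ici (1 : ℝ), HasDerivAt (fun σ : ℝ => σ * (x + σ ^ 2) ^ (-m))
      ((1 - 2 * m) * (x + σ ^ 2) ^ (-m) + 2 * m * x * (x + σ ^ 2) ^ (-(m + 1))) σ := fun σ hσ => by
    have hp := add_sq_pos hx hσ
    have := (hasDerivAt_id σ).mul (((hasDerivAt_pow 2 σ).const_add x).rpow_const (p := -m) (Or.inl hp.ne'))
    refine this.congr_deriv ?_
    have e : (x + σ ^ 2) ^ (-m) = (x + σ ^ 2) ^ (-(m + 1)) * (x + σ ^ 2) := by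
      rw [← Real.rpow_add_one hp.ne']; congr 1; ring
    rw [show -m - 1 = -(m + 1) by ring]
    simp only [id, e]
    norm_num
    ring
  have i1 := (integrableOn_unitTail hm hx).const_mul (1 - 2 * m)
  have i2 := (integrableOn_unitTail (m := m + 1) (by linarith) hx).const_mul (2 * m * x)
  have hlim : Tendsto (fun σ : ℝ => σ * (x + σ ^ 2) ^ (-m)) atTop (𝓝 0) := by
    have hc : 0 < min 1 (x + 1) := lt_min one_pos (by linarith)
    have h0 : Tendsto (fun σ : ℝ => min 1 (x + 1) ^ (-m) * σ ^ (-(2 * m - 1))) atTop (𝓝 0) := by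
      simpa using (tendsto_rpow_neg_atTop (y := 2 * m - 1) (by linarith)).const_mul
        (min 1 (x + 1) ^ (-m))
    refine tendsto_of_tendsto_of_tendsto_of_le_of_le' tendsto_const_nhds h0 ?_ ?_
    · filter_upwards [eventually_ge_atTop 1] with σ hσ
      have := add_sq_pos hx hσ
      positivity
    · filter_upwards [eventually_ge_atTop 1] with σ hσ
      have hσ0 : 0 < σ := by linarith
      calc σ * (x + σ ^ 2) ^ (-m) ≤ σ * (min 1 (x + 1) ^ (-m) * σ ^ (-(2 * m))) :=
            mul_le_mul_of_nonneg_left (add_sq_rpow_le (by linarith) hc le_rfl hσ) hσ0.le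
        _ = min 1 (x + 1) ^ (-m) * (σ ^ (1 : ℝ) * σ ^ (-(2 * m))) := by rw [Real.rpow_one]; ring
        _ = _ := by rw [← Real.rpow_add hσ0]; congr 2; ring
  have h := integral_Ioi_of_hasDerivAt_of_tendsto' hd (i1.add i2) hlim
  rw [integral_add i1 i2, integral_const_mul, integral_const_mul] at h
  simp only [one_pow, one_mul, zero_sub] at h
  unfold unitTail
  linear_combination h

theorem unitTail_nonneg {m x : ℝ} (hx : -1 < x) : 0 ≤ unitTail m x :=
  setIntegral_nonneg measurableSet_Ioi fun _ hσ =>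
    Real.rpow_nonneg (add_sq_pos hx (le_of_lt hσ)).le _

/-- One factor (x + σ²)⁻¹ is bounded by σ⁻², whose integral is 1; the remaining power is largest at
σ = 1. -/
theorem unitTail_le {m x : ℝ} (hm : 1 ≤ m) (hx : 0 ≤ x) : unitTail m x ≤ (x + 1) ^ (1 - m) := by
  have hx' : -1 < x := by linarith
  have hI : ∫ σ in Set.Ioi (1 : ℝ), σ ^ (-2 : ℝ) = 1 := by
    rw [integral_Ioi_rpow_of_lt (by norm_num) one_pos]; norm_num
  have : unitTail m x ≤ ∫ σ in Set.Ioi (1 : ℝ), (x + 1) ^ (1 - m) * σ ^ (-2 : ℝ) := by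
    refine setIntegral_mono_on (integrableOn_unitTail hm hx')
      ((integrableOn_Ioi_rpow_of_lt (by norm_num) one_pos).const_mul _) measurableSet_Ioi fun σ hσ => ?_
    have hσ' : 1 ≤ σ := le_of_lt hσ
    have h1 : 1 ≤ σ ^ 2 := one_le_pow₀ hσ'
    have hp := add_sq_pos hx' hσ'
    have e : (x + σ ^ 2) ^ (-m) = (x + σ ^ 2) ^ (1 - m) * (x + σ ^ 2)⁻¹ := by
      rw [← Real.rpow_neg_one, ← Real.rpow_add hp]; congr 1; ring
    rw [e]
    refine mul_le_mul (Real.rpow_le_rpow_of_nonpos (by linarith) (by linarith) (by linarith)) ?_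
      (by positivity) (by positivity)
    rw [Real.rpow_neg (by linarith), Real.rpow_two]
    exact inv_anti₀ (by positivity) (by linarith)
  rwa [integral_const_mul, hI, mul_one] at this

/-- The tail integral `∫_τ^∞ (s + σ²)^(-m) dσ`, for `τ > 0`, in homogeneous form. -/
def tail (m s τ : ℝ) : ℝ := τ ^ (1 - 2 * m) * unitTail m (s / τ ^ 2)

/-! ### The tail integral as a function of two variables -/

section Tail

variable {m s τ : ℝ}

theorem neg_one_lt_div_sq (hτ : 0 < τ) (hs : -τ ^ 2 < s) : -1 < s / τ ^ 2 := by
  rw [lt_div_iff₀ (by positivity)]; linarith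

theorem rpow_sub_two_mul_mul (hτ : 0 < τ) (hs : -τ ^ 2 < s) (m : ℝ) :
    τ ^ (-(2 * m)) * (s / τ ^ 2 + 1) ^ (-m) = (s + τ ^ 2) ^ (-m) := by
  have h := neg_one_lt_div_sq hτ hs
  have e : s + τ ^ 2 = τ ^ 2 * (s / τ ^ 2 + 1) := by field_simp
  rw [e, Real.mul_rpow (by positivity) (by linarith), ← Real.rpow_natCast τ 2, ← Real.rpow_mul hτ.le]
  push_cast
  congr 2
  ring

theorem hasDerivAt_tail_left (hm : 1 ≤ m) (hτ : 0 < τ) (hs : -τ ^ 2 < s) :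
    HasDerivAt (fun s => tail m s τ) (-m * tail (m + 1) s τ) s := by
  have h := ((hasDerivAt_unitTail hm (neg_one_lt_div_sq hτ hs)).comp s
    ((hasDerivAt_id s).div_const (τ ^ 2))).const_mul (τ ^ (1 - 2 * m))
  refine h.congr_deriv ?_
  have e : τ ^ (1 - 2 * (m + 1)) = τ ^ (1 - 2 * m) * (1 / τ ^ 2) := by
    rw [show 1 - 2 * (m + 1) = (1 - 2 * m) - (2 : ℕ) by push_cast; ring, Real.rpow_sub hτ,
      Real.rpow_natCast]
    ring
  simp only [tail, e]
  ring

/-- The recurrence for `unitTail` in homogeneous form. It is what removes the factor s from tails of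
higher order when the Laplacian is computed. -/
theorem tail_recurrence (hm : 1 ≤ m) (hτ : 0 < τ) (hs : -τ ^ 2 < s) :
    2 * m * s * tail (m + 1) s τ = (2 * m - 1) * tail m s τ - τ * (s + τ ^ 2) ^ (-m) := by
  have h := unitTail_recurrence hm (neg_one_lt_div_sq hτ hs)
  have e : τ ^ (1 - 2 * (m + 1)) = τ ^ (1 - 2 * m) * (1 / τ ^ 2) := by
    rw [show 1 - 2 * (m + 1) = (1 - 2 * m) - (2 : ℕ) by push_cast; ring, Real.rpow_sub hτ,
      Real.rpow_natCast]
    ring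
  have e2 : τ ^ (1 - 2 * m) = τ * τ ^ (-(2 * m)) := by
    rw [sub_eq_add_neg, Real.rpow_add hτ, Real.rpow_one]
  rw [← rpow_sub_two_mul_mul hτ hs, ← mul_assoc, ← e2]
  simp only [tail, e]
  linear_combination τ ^ (1 - 2 * m) * h

/-- In the homogeneous form the lower limit is fixed, so this comes from the chain rule, and the
recurrence collapses the result to the integrand at τ. -/
theorem hasDerivAt_tail_right (hm : 1 ≤ m) (hτ : 0 < τ) (hs : -τ ^ 2 < s) :
    HasDerivAt (fun τ => tail m s τ) (-(s + τ ^ 2) ^ (-m)) τ := by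
  have h1 := (hasDerivAt_id τ).rpow_const (p := 1 - 2 * m) (Or.inl hτ.ne')
  have h2 := (hasDerivAt_const τ s).div (hasDerivAt_pow 2 τ) (by positivity : τ ^ 2 ≠ 0)
  have h := h1.mul ((hasDerivAt_unitTail hm (neg_one_lt_div_sq hτ hs)).comp τ h2)
  refine h.congr_deriv ?_
  have hr := unitTail_recurrence hm (neg_one_lt_div_sq hτ hs)
  have e2 : τ ^ (1 - 2 * m) = τ * τ ^ (-(2 * m)) := by
    rw [sub_eq_add_neg, Real.rpow_add hτ, Real.rpow_one]
  rw [← rpow_sub_two_mul_mul hτ hs, show 1 - 2 * m - 1 = -(2 * m) by ring]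
  simp only [id, Function.comp, e2, Pi.div_apply]
  rw [show (1 : ℝ) * (1 - 2 * m) * τ ^ (-(2 * m)) * unitTail m (s / τ ^ 2)
      + τ * τ ^ (-(2 * m)) * (-m * unitTail (m + 1) (s / τ ^ 2) *
        ((0 * τ ^ 2 - s * (((2 : ℕ) : ℝ) * τ ^ (2 - 1))) / (τ ^ 2) ^ 2))
      = τ ^ (-(2 * m)) * ((1 - 2 * m) * unitTail m (s / τ ^ 2)
        + 2 * m * (s / τ ^ 2) * unitTail (m + 1) (s / τ ^ 2)) by
      push_cast; field_simp; ring]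
  rw [hr]
  ring

theorem tail_nonneg (hτ : 0 < τ) (hs : -τ ^ 2 < s) : 0 ≤ tail m s τ :=
  mul_nonneg (Real.rpow_nonneg hτ.le _) (unitTail_nonneg (neg_one_lt_div_sq hτ hs))

theorem tail_le (hm : 1 ≤ m) (hτ : 0 < τ) (hs : 0 ≤ s) : tail m s τ ≤ τ⁻¹ * (s + τ ^ 2) ^ (1 - m) := by
  have h := unitTail_le hm (x := s / τ ^ 2) (by positivity)
  have e := rpow_sub_two_mul_mul hτ (s := s) (by have : 0 < τ ^ 2 := by positivity
                                                 linarith) (m - 1)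
  rw [show -(m - 1) = 1 - m by ring] at e
  rw [← e, tail, ← mul_assoc, ← Real.rpow_neg_one, ← Real.rpow_add hτ,
    show -1 + -(2 * (m - 1)) = 1 - 2 * m by ring]
  exact mul_le_mul_of_nonneg_left h (Real.rpow_nonneg hτ.le _)

/-- Homogeneity reduces joint smoothness to smoothness in one variable. The range s > -τ² contains a
neighbourhood of s = 0, which is needed since s is later |x̄ - ξ|². -/
theorem contDiffAt_tail (hm : 1 ≤ m) (hτ : 0 < τ) (hs : -τ ^ 2 < s) :
    ContDiffAt ℝ ∞ (fun p : ℝ × ℝ => tail m p.1 p.2) (s, τ) := by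
  have h1 : ContDiffAt ℝ ∞ (fun p : ℝ × ℝ => p.2 ^ (1 - 2 * m)) (s, τ) :=
    contDiffAt_snd.rpow_const_of_ne hτ.ne'
  have h2 : ContDiffAt ℝ ∞ (fun p : ℝ × ℝ => p.1 / p.2 ^ 2) (s, τ) :=
    contDiffAt_fst.div (contDiffAt_snd.pow 2) (by simp [hτ.ne'])
  have h3 : ContDiffAt ℝ ∞ (unitTail m) (s / τ ^ 2) :=
    (contDiffOn_unitTail hm).contDiffAt (Ioi_mem_nhds (neg_one_lt_div_sq hτ hs))
  exact h1.mul (ContDiffAt.comp (g := unitTail m) (f := fun p : ℝ × ℝ => p.1 / p.2 ^ 2) (s, τ) h3 h2)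

end Tail

/-! ### Profiles of correctors -/

/-- Coefficients of a function
`(q₀ + q₁ τ + A s + B τ²) (s + τ²)^(-n/2) + (c₀ + c₁ τ + c₂ τ² + c₃ s) ∫_τ^∞ (s + σ²)^(-n/2-1) dσ`. -/
structure Profile where
  (q₀ q₁ A B c₀ c₁ c₂ c₃ : ℝ)

namespace Profile

variable (P : Profile) (n : ℕ) (s τ : ℝ)

def powCoeff : ℝ := P.q₀ + P.q₁ * τ + P.A * s + P.B * τ ^ 2

def tailCoeff : ℝ := P.c₀ + P.c₁ * τ + P.c₂ * τ ^ 2 + P.c₃ * s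

/-- The variable s stands for |x̄ - ξ|² and τ for ε + xₙ, so that s + τ² is the denominator of the
bubble. -/
def val : ℝ :=
  P.powCoeff s τ * (s + τ ^ 2) ^ (-(n / 2 : ℝ)) + P.tailCoeff s τ * tail (n / 2 + 1) s τ

def ds : ℝ :=
  P.A * (s + τ ^ 2) ^ (-(n / 2 : ℝ)) - n / 2 * P.powCoeff s τ * (s + τ ^ 2) ^ (-(n / 2 + 1 : ℝ))
    + P.c₃ * tail (n / 2 + 1) s τ - (n / 2 + 1) * P.tailCoeff s τ * tail (n / 2 + 2) s τ

def dss : ℝ :=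
  -n * P.A * (s + τ ^ 2) ^ (-(n / 2 + 1 : ℝ))
    + n / 2 * (n / 2 + 1) * P.powCoeff s τ * (s + τ ^ 2) ^ (-(n / 2 + 2 : ℝ))
    - 2 * (n / 2 + 1) * P.c₃ * tail (n / 2 + 2) s τ
    + (n / 2 + 1) * (n / 2 + 2) * P.tailCoeff s τ * tail (n / 2 + 3) s τ

/-- Differentiating the tail in τ gives a pure power, so no tails of higher order appear, unlike for
derivatives in s. -/
def dτ : ℝ :=
  (P.q₁ + 2 * P.B * τ) * (s + τ ^ 2) ^ (-(n / 2 : ℝ))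
    - (n * τ * P.powCoeff s τ + P.tailCoeff s τ) * (s + τ ^ 2) ^ (-(n / 2 + 1 : ℝ))
    + (P.c₁ + 2 * P.c₂ * τ) * tail (n / 2 + 1) s τ

def dττ : ℝ :=
  2 * P.B * (s + τ ^ 2) ^ (-(n / 2 : ℝ))
    - (2 * n * τ * (P.q₁ + 2 * P.B * τ) + n * P.powCoeff s τ
        + 2 * (P.c₁ + 2 * P.c₂ * τ)) * (s + τ ^ 2) ^ (-(n / 2 + 1 : ℝ))
    + (n + 2) * τ * (n * τ * P.powCoeff s τ + P.tailCoeff s τ) * (s + τ ^ 2) ^ (-(n / 2 + 2 : ℝ))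
    + 2 * P.c₂ * tail (n / 2 + 1) s τ

variable {n s τ}

theorem hasDerivAt_powCoeff_left : HasDerivAt (fun s => P.powCoeff s τ) P.A s := by
  unfold powCoeff
  have := (((hasDerivAt_id s).const_mul P.A).const_add (P.q₀ + P.q₁ * τ)).add_const (P.B * τ ^ 2)
  simpa using this

theorem hasDerivAt_tailCoeff_left : HasDerivAt (fun s => P.tailCoeff s τ) P.c₃ s := by
  unfold tailCoeff
  have := ((hasDerivAt_id s).const_mul P.c₃).const_add (P.c₀ + P.c₁ * τ + P.c₂ * τ ^ 2)
  simpa using this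

theorem hasDerivAt_powCoeff_right : HasDerivAt (fun τ => P.powCoeff s τ) (P.q₁ + 2 * P.B * τ) τ := by
  unfold powCoeff
  have := ((((hasDerivAt_id τ).const_mul P.q₁).const_add P.q₀).add_const (P.A * s)).add
    ((hasDerivAt_pow 2 τ).const_mul P.B)
  refine this.congr_deriv ?_
  norm_num; ring

theorem hasDerivAt_tailCoeff_right :
    HasDerivAt (fun τ => P.tailCoeff s τ) (P.c₁ + 2 * P.c₂ * τ) τ := by
  unfold tailCoeff
  have := ((((hasDerivAt_id τ).const_mul P.c₁).const_add P.c₀).add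
    ((hasDerivAt_pow 2 τ).const_mul P.c₂)).add_const (P.c₃ * s)
  refine this.congr_deriv ?_
  norm_num; ring

theorem hasDerivAt_rpow_left (h : 0 < s + τ ^ 2) (p : ℝ) :
    HasDerivAt (fun s => (s + τ ^ 2) ^ (-p)) (-p * (s + τ ^ 2) ^ (-(p + 1))) s := by
  have := ((hasDerivAt_id s).add_const (τ ^ 2)).rpow_const (p := -p) (Or.inl h.ne')
  refine this.congr_deriv ?_
  rw [show -(p + 1) = -p - 1 by ring]; simp

theorem hasDerivAt_rpow_right (h : 0 < s + τ ^ 2) (p : ℝ) :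
    HasDerivAt (fun τ => (s + τ ^ 2) ^ (-p)) (-2 * p * τ * (s + τ ^ 2) ^ (-(p + 1))) τ := by
  have := ((hasDerivAt_pow 2 τ).const_add s).rpow_const (p := -p) (Or.inl h.ne')
  refine this.congr_deriv ?_
  rw [show -(p + 1) = -p - 1 by ring]; push_cast; ring

theorem hasDerivAt_val_left (hτ : 0 < τ) (hs : -τ ^ 2 < s) :
    HasDerivAt (fun s => P.val n s τ) (P.ds n s τ) s := by
  have hn : (0 : ℝ) ≤ n := Nat.cast_nonneg n
  have h := ((P.hasDerivAt_powCoeff_left (s := s) (τ := τ)).mul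
    (hasDerivAt_rpow_left (s := s) (τ := τ) (by linarith) (n / 2))).add
    ((P.hasDerivAt_tailCoeff_left (s := s) (τ := τ)).mul
      (hasDerivAt_tail_left (m := n / 2 + 1) (by linarith) hτ hs))
  refine h.congr_deriv ?_
  rw [ds, show (n / 2 + 2 : ℝ) = n / 2 + 1 + 1 by ring]
  ring

theorem hasDerivAt_ds_left (hτ : 0 < τ) (hs : -τ ^ 2 < s) :
    HasDerivAt (fun s => P.ds n s τ) (P.dss n s τ) s := by
  have hn : (0 : ℝ) ≤ n := Nat.cast_nonneg n
  have h := ((((hasDerivAt_rpow_left (s := s) (τ := τ) (by linarith) (n / 2)).const_mul P.A).sub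
    (((P.hasDerivAt_powCoeff_left (s := s) (τ := τ)).const_mul (n / 2 : ℝ)).mul
    (hasDerivAt_rpow_left (s := s) (τ := τ) (by linarith) (n / 2 + 1)))).add
    ((hasDerivAt_tail_left (m := n / 2 + 1) (by linarith) hτ hs).const_mul P.c₃)).sub
    (((P.hasDerivAt_tailCoeff_left (s := s) (τ := τ)).const_mul (n / 2 + 1 : ℝ)).mul
      (hasDerivAt_tail_left (m := n / 2 + 2) (by linarith) hτ hs))
  refine h.congr_deriv ?_
  rw [dss, show (n / 2 + 2 : ℝ) = n / 2 + 1 + 1 by ring, show (n / 2 + 3 : ℝ) = n / 2 + 1 + 1 + 1 by ring]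
  ring

theorem hasDerivAt_val_right (hτ : 0 < τ) (hs : -τ ^ 2 < s) :
    HasDerivAt (fun τ => P.val n s τ) (P.dτ n s τ) τ := by
  have hn : (0 : ℝ) ≤ n := Nat.cast_nonneg n
  have h := ((P.hasDerivAt_powCoeff_right (s := s) (τ := τ)).mul
    (hasDerivAt_rpow_right (s := s) (τ := τ) (by linarith) (n / 2))).add
    ((P.hasDerivAt_tailCoeff_right (s := s) (τ := τ)).mul
      (hasDerivAt_tail_right (m := n / 2 + 1) (by linarith) hτ hs))
  refine h.congr_deriv ?_
  rw [dτ]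
  ring

theorem hasDerivAt_dτ_right (hτ : 0 < τ) (hs : -τ ^ 2 < s) :
    HasDerivAt (fun τ => P.dτ n s τ) (P.dττ n s τ) τ := by
  have hn : (0 : ℝ) ≤ n := Nat.cast_nonneg n
  have hq := ((hasDerivAt_id τ).const_mul (2 * P.B)).const_add P.q₁
  have hc := ((hasDerivAt_id τ).const_mul (2 * P.c₂)).const_add P.c₁
  have h := ((hq.mul (hasDerivAt_rpow_right (s := s) (τ := τ) (by linarith) (n / 2))).sub
    ((((((hasDerivAt_id τ).const_mul (n : ℝ)).mul (P.hasDerivAt_powCoeff_right (s := s) (τ := τ))).add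
      (P.hasDerivAt_tailCoeff_right (s := s) (τ := τ)))).mul
    (hasDerivAt_rpow_right (s := s) (τ := τ) (by linarith) (n / 2 + 1)))).add
    (hc.mul (hasDerivAt_tail_right (m := n / 2 + 1) (by linarith) hτ hs))
  refine h.congr_deriv ?_
  rw [dττ, show (n / 2 + 2 : ℝ) = n / 2 + 1 + 1 by ring]
  simp only [id, Pi.add_apply, Pi.mul_apply]
  ring

theorem contDiffAt_val (hτ : 0 < τ) (hs : -τ ^ 2 < s) :
    ContDiffAt ℝ ∞ (fun p : ℝ × ℝ => P.val n p.1 p.2) (s, τ) := by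
  have hn : (0 : ℝ) ≤ n := Nat.cast_nonneg n
  unfold val powCoeff tailCoeff
  have hd : ContDiffAt ℝ ∞ (fun p : ℝ × ℝ => (p.1 + p.2 ^ 2) ^ (-(n / 2 : ℝ))) (s, τ) :=
    (contDiffAt_fst.add (contDiffAt_snd.pow 2)).rpow_const_of_ne
      (by have : 0 < s + τ ^ 2 := by linarith
          exact this.ne')
  refine ContDiffAt.add (ContDiffAt.mul ?_ hd)
    (ContDiffAt.mul ?_ (contDiffAt_tail (by linarith) hτ hs)) <;> fun_prop

/-- The action of the Laplacian of `ℝⁿ` on `k · g`, where `g` is the profile and `k` is a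
homogeneous harmonic polynomial of degree `p` in the tangential variables. -/
theorem laplace_eq (hτ : 0 < τ) (hs : -τ ^ 2 < s) (p : ℕ) :
    4 * s * P.dss n s τ + (2 * (n - 1) + 4 * p) * P.ds n s τ + P.dττ n s τ =
      (-2 * n * (p - 1) * P.powCoeff s τ + (s + τ ^ 2) * ((2 * (n - 1) + 4 * p) * P.A + 2 * P.B)
        - n * (4 * s * P.A + 2 * τ * (P.q₁ + 2 * P.B * τ)) - 2 * (P.c₁ + 2 * P.c₂ * τ)
        + 4 * τ * P.c₃) * (s + τ ^ 2) ^ (-(n / 2 + 1 : ℝ))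
      + (2 * P.c₂ + (2 * (n - 1) + 4 * p - 4 * (n + 1)) * P.c₃) * tail (n / 2 + 1) s τ
      - (4 * p - 8) * ((n / 2 + 1) * P.tailCoeff s τ) * tail (n / 2 + 2) s τ := by
  have hn : (0 : ℝ) ≤ n := Nat.cast_nonneg n
  have hD : 0 < s + τ ^ 2 := by linarith
  have r1 := tail_recurrence (m := n / 2 + 1) (by linarith) hτ hs
  have r2 := tail_recurrence (m := n / 2 + 1 + 1) (by linarith) hτ hs
  have e0 : (s + τ ^ 2) ^ (-(n / 2 : ℝ)) = (s + τ ^ 2) ^ (-(n / 2 + 1 + 1 : ℝ)) * (s + τ ^ 2) ^ 2 := by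
    rw [← Real.rpow_natCast (s + τ ^ 2) 2, ← Real.rpow_add hD]; congr 1; push_cast; ring
  have e1 : (s + τ ^ 2) ^ (-(n / 2 + 1 : ℝ)) = (s + τ ^ 2) ^ (-(n / 2 + 1 + 1 : ℝ)) * (s + τ ^ 2) := by
    rw [← Real.rpow_add_one hD.ne']; congr 1; ring
  rw [dss, ds, dττ, show (n / 2 + 2 : ℝ) = n / 2 + 1 + 1 by ring,
    show (n / 2 + 3 : ℝ) = n / 2 + 1 + 1 + 1 by ring]
  rw [e0, e1]
  rw [e1] at r1
  unfold powCoeff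
  -- The term 4s · `dss` produces s times the tails of order n/2+2 and n/2+3; the two recurrences
  -- trade these for lower tails and pure powers.
  linear_combination 2 * (n / 2 + 1) * P.tailCoeff s τ * r2 - 4 * P.c₃ * r1

end Profile

/-! ### Uniform bounds for profiles -/

namespace Profile

/-- All coefficients are bounded by `L`. -/
structure BoundedBy (P : Profile) (L : ℝ) : Prop where
  q₀ : |P.q₀| ≤ L
  q₁ : |P.q₁| ≤ L
  A : |P.A| ≤ L
  B : |P.B| ≤ L
  c₀ : |P.c₀| ≤ L
  c₁ : |P.c₁| ≤ L
  c₂ : |P.c₂| ≤ L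
  c₃ : |P.c₃| ≤ L

theorem abs_quadratic_le {a b c d L s τ : ℝ} (ha : |a| ≤ L) (hb : |b| ≤ L) (hc : |c| ≤ L) (hd : |d| ≤ L)
    (hs : 0 ≤ s) (hτ : 1 / 2 ≤ τ) : |a + b * τ + c * s + d * τ ^ 2| ≤ 8 * L * (s + τ ^ 2) := by
  have hL : 0 ≤ L := (abs_nonneg _).trans ha
  have hτ0 : 0 ≤ τ := by linarith
  calc |a + b * τ + c * s + d * τ ^ 2| ≤ |a| + |b| * τ + |c| * s + |d| * τ ^ 2 := by
        refine (abs_add_le _ _).trans (add_le_add ((abs_add_le _ _).trans (add_le_add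
          ((abs_add_le _ _).trans (add_le_add le_rfl ?_)) ?_)) ?_)
        · rw [abs_mul, abs_of_nonneg hτ0]
        · rw [abs_mul, abs_of_nonneg hs]
        · rw [abs_mul, abs_of_nonneg (sq_nonneg τ)]
    _ ≤ L + L * τ + L * s + L * τ ^ 2 := by gcongr
    _ = L * (1 + τ + s + τ ^ 2) := by ring
    _ ≤ L * (8 * (s + τ ^ 2)) := by
        gcongr
        nlinarith
    _ = _ := by ring

variable {P : Profile} {n : ℕ} {s τ L : ℝ}

-- With D = s + τ² ≥ 1/4, the polynomial coefficients are O(L D), the tail of order n/2+1 is at most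
-- 2 D^(-n/2), and every surplus negative power of D is absorbed by 1 ≤ 4D. The constant is crude;
-- what counts is that it is linear in L and independent of s and τ.
set_option maxHeartbeats 1000000 in
theorem BoundedBy.bounds (hP : P.BoundedBy L) (hs : 0 ≤ s) (hτ : 1 / 2 ≤ τ) :
    |P.val n s τ| ≤ 600 * (n + 2) ^ 2 * L * ((s + τ ^ 2) * (s + τ ^ 2) ^ (-(n / 2 : ℝ))) ∧
    |P.ds n s τ| ≤ 600 * (n + 2) ^ 2 * L * ((s + τ ^ 2) * (s + τ ^ 2) ^ (-(n / 2 : ℝ))) ∧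
    |P.dss n s τ| ≤ 600 * (n + 2) ^ 2 * L * ((s + τ ^ 2) * (s + τ ^ 2) ^ (-(n / 2 : ℝ))) ∧
    |P.dτ n s τ| ≤ 600 * (n + 2) ^ 2 * L * ((s + τ ^ 2) * (s + τ ^ 2) ^ (-(n / 2 : ℝ))) ∧
    |P.dττ n s τ| ≤ 600 * (n + 2) ^ 2 * L * ((s + τ ^ 2) * (s + τ ^ 2) ^ (-(n / 2 : ℝ))) := by
  have hn : (0 : ℝ) ≤ n := Nat.cast_nonneg n
  have hL : 0 ≤ L := (abs_nonneg _).trans hP.A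
  have hτ0 : 0 < τ := by linarith
  have hp := abs_quadratic_le hP.q₀ hP.q₁ hP.A hP.B hs hτ
  have ht : |P.tailCoeff s τ| ≤ 8 * L * (s + τ ^ 2) := by
    have := abs_quadratic_le hP.c₀ hP.c₁ hP.c₃ hP.c₂ hs hτ
    rwa [show P.c₀ + P.c₁ * τ + P.c₃ * s + P.c₂ * τ ^ 2 = P.tailCoeff s τ by
      rw [tailCoeff]; ring] at this
  have hq' : |P.q₁ + 2 * P.B * τ| ≤ 10 * L * (s + τ ^ 2) := by
    refine (abs_add_le _ _).trans ?_
    rw [abs_mul, abs_mul, abs_of_pos hτ0, abs_two]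
    calc _ ≤ L + 2 * L * τ := by gcongr; exacts [hP.q₁, hP.B]
      _ = L * (1 + 2 * τ) := by ring
      _ ≤ L * (10 * (s + τ ^ 2)) := by gcongr; nlinarith
      _ = _ := by ring
  have hc' : |P.c₁ + 2 * P.c₂ * τ| ≤ 10 * L * (s + τ ^ 2) := by
    refine (abs_add_le _ _).trans ?_
    rw [abs_mul, abs_mul, abs_of_pos hτ0, abs_two]
    calc _ ≤ L + 2 * L * τ := by gcongr; exacts [hP.c₁, hP.c₂]
      _ = L * (1 + 2 * τ) := by ring
      _ ≤ L * (10 * (s + τ ^ 2)) := by gcongr; nlinarith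
      _ = _ := by ring
  change |P.powCoeff s τ| ≤ _ at hp
  set D := s + τ ^ 2 with hD
  have hD4 : 1 ≤ 4 * D := by nlinarith
  have hD0 : 0 < D := by linarith
  have hτD : τ ≤ 2 * D := by nlinarith
  set Z := D ^ (-(n / 2 : ℝ)) with hZ
  have hZ0 : 0 < Z := Real.rpow_pos_of_pos hD0 _
  have e1 : D ^ (-(n / 2 + 1 : ℝ)) * D = Z := by rw [← Real.rpow_add_one hD0.ne']; congr 1; ring
  have e2 : D ^ (-(n / 2 + 2 : ℝ)) * D = D ^ (-(n / 2 + 1 : ℝ)) := by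
    rw [← Real.rpow_add_one hD0.ne']; congr 1; ring
  set X1 := D ^ (-(n / 2 + 1 : ℝ)) with hX1
  set X2 := D ^ (-(n / 2 + 2 : ℝ)) with hX2
  have hX1p : 0 < X1 := Real.rpow_pos_of_pos hD0 _
  have hX2p : 0 < X2 := Real.rpow_pos_of_pos hD0 _
  have b1 : X1 ≤ 4 * Z := by nlinarith
  have b2 : X2 ≤ 4 * X1 := by nlinarith
  have hinv : τ⁻¹ ≤ 2 := by
    rw [inv_le_comm₀ hτ0 two_pos]; linarith
  have hsτ : -τ ^ 2 < s := by nlinarith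
  have T : ∀ m : ℝ, 1 ≤ m → 0 ≤ tail m s τ ∧ tail m s τ ≤ 2 * D ^ (1 - m) := fun m hm =>
    ⟨tail_nonneg hτ0 hsτ, (tail_le hm hτ0 hs).trans (by gcongr)⟩
  obtain ⟨t10, t1⟩ := T (n / 2 + 1) (by linarith)
  obtain ⟨t20, t2⟩ := T (n / 2 + 2) (by linarith)
  obtain ⟨t30, t3⟩ := T (n / 2 + 3) (by linarith)
  rw [show (1 - (n / 2 + 1) : ℝ) = -(n / 2) by ring, ← hZ] at t1
  rw [show (1 - (n / 2 + 2) : ℝ) = -(n / 2 + 1) by ring, ← hX1] at t2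
  rw [show (1 - (n / 2 + 3) : ℝ) = -(n / 2 + 2) by ring, ← hX2] at t3
  have b2' : X2 ≤ 16 * Z := by linarith
  have t2' : tail (n / 2 + 2) s τ ≤ 8 * Z := by linarith
  have t3' : tail (n / 2 + 3) s τ ≤ 32 * Z := by linarith
  have hLD : L ≤ 4 * (L * D) := by nlinarith
  have hW : 0 ≤ L * (D * Z) := by positivity
  have hnW : 0 ≤ n * (L * (D * Z)) := by positivity
  have hnnW : 0 ≤ n ^ 2 * (L * (D * Z)) := by positivity
  refine ⟨?_, ?_, ?_, ?_, ?_⟩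
  · calc |P.val n s τ| ≤ |P.powCoeff s τ| * Z + |P.tailCoeff s τ| * tail (n / 2 + 1) s τ := by
          rw [val]
          refine (abs_add_le _ _).trans (le_of_eq ?_)
          rw [abs_mul, abs_mul, abs_of_pos hZ0, abs_of_nonneg t10]
      _ ≤ 8 * L * D * Z + 8 * L * D * (2 * Z) := by gcongr
      _ ≤ _ := by linarith
  · calc |P.ds n s τ| ≤ |P.A| * Z + n / 2 * |P.powCoeff s τ| * X1 + |P.c₃| * tail (n / 2 + 1) s τ
          + (n / 2 + 1) * |P.tailCoeff s τ| * tail (n / 2 + 2) s τ := by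
          rw [ds]
          refine (abs_sub _ _).trans (add_le_add ((abs_add_le _ _).trans (add_le_add
            ((abs_sub _ _).trans (le_of_eq ?_)) (le_of_eq ?_))) (le_of_eq ?_))
          · rw [abs_mul, abs_mul, abs_mul, abs_of_pos hZ0, abs_of_pos hX1p,
              abs_of_nonneg (by positivity : (0 : ℝ) ≤ n / 2)]
          · rw [abs_mul, abs_of_nonneg t10]
          · rw [abs_mul, abs_mul, abs_of_nonneg t20, abs_of_nonneg (by positivity : (0 : ℝ) ≤ n / 2 + 1)]
      _ ≤ (4 * (L * D)) * Z + n / 2 * (8 * L * D) * (4 * Z) + (4 * (L * D)) * (2 * Z)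
          + (n / 2 + 1) * (8 * L * D) * (8 * Z) := by
          gcongr
          exacts [hP.A.trans hLD, hP.c₃.trans hLD]
      _ ≤ _ := by linarith
  · calc |P.dss n s τ| ≤ n * |P.A| * X1 + n / 2 * (n / 2 + 1) * |P.powCoeff s τ| * X2
          + 2 * (n / 2 + 1) * |P.c₃| * tail (n / 2 + 2) s τ
          + (n / 2 + 1) * (n / 2 + 2) * |P.tailCoeff s τ| * tail (n / 2 + 3) s τ := by
          rw [dss]
          refine (abs_add_le _ _).trans (add_le_add ((abs_sub _ _).trans (add_le_add
            ((abs_add_le _ _).trans (add_le_add (le_of_eq ?_) (le_of_eq ?_))) (le_of_eq ?_)))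
            (le_of_eq ?_))
          · rw [abs_mul, abs_mul, abs_neg, abs_of_pos hX1p, abs_of_nonneg hn]
          · rw [abs_mul, abs_mul, abs_of_pos hX2p,
              abs_of_nonneg (by positivity : (0 : ℝ) ≤ n / 2 * (n / 2 + 1))]
          · rw [abs_mul, abs_mul, abs_of_nonneg t20,
              abs_of_nonneg (by positivity : (0 : ℝ) ≤ 2 * (n / 2 + 1))]
          · rw [abs_mul, abs_mul, abs_of_nonneg t30,
              abs_of_nonneg (by positivity : (0 : ℝ) ≤ (n / 2 + 1) * (n / 2 + 2))]
      _ ≤ n * (4 * (L * D)) * (4 * Z) + n / 2 * (n / 2 + 1) * (8 * L * D) * (16 * Z)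
          + 2 * (n / 2 + 1) * (4 * (L * D)) * (8 * Z)
          + (n / 2 + 1) * (n / 2 + 2) * (8 * L * D) * (32 * Z) := by
          gcongr
          exacts [hP.A.trans hLD, hP.c₃.trans hLD]
      _ ≤ _ := by linarith
  · have hτX : τ * X1 ≤ 2 * Z := by nlinarith
    calc |P.dτ n s τ| ≤ |P.q₁ + 2 * P.B * τ| * Z + (n * |P.powCoeff s τ| * (τ * X1) +
          |P.tailCoeff s τ| * X1) + |P.c₁ + 2 * P.c₂ * τ| * tail (n / 2 + 1) s τ := by
          rw [dτ]
          refine (abs_add_le _ _).trans (add_le_add ((abs_sub _ _).trans (add_le_add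
            (le_of_eq ?_) ?_)) (le_of_eq ?_))
          · rw [abs_mul, abs_of_pos hZ0]
          · rw [abs_mul, abs_of_pos hX1p]
            calc _ ≤ (|n * τ * P.powCoeff s τ| + |P.tailCoeff s τ|) * X1 := by
                  gcongr; exact abs_add_le _ _
              _ = _ := by rw [abs_mul, abs_mul, abs_of_nonneg hn, abs_of_pos hτ0]; ring
          · rw [abs_mul, abs_of_nonneg t10]
      _ ≤ (10 * L * D) * Z + (n * (8 * L * D) * (2 * Z) + (8 * L * D) * (4 * Z))
          + (10 * L * D) * (2 * Z) := by
          gcongr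
      _ ≤ _ := by linarith
  · have hτX : τ * X1 ≤ 2 * Z := by nlinarith
    have hτX2 : τ * X2 ≤ 8 * Z := by nlinarith
    have hττX2 : τ ^ 2 * X2 ≤ 4 * Z := by nlinarith
    calc |P.dττ n s τ| ≤ 2 * |P.B| * Z + (2 * n * |P.q₁ + 2 * P.B * τ| * (τ * X1)
            + n * |P.powCoeff s τ| * X1 + 2 * |P.c₁ + 2 * P.c₂ * τ| * X1)
          + ((n + 2) * n * |P.powCoeff s τ| * (τ ^ 2 * X2) + (n + 2) * |P.tailCoeff s τ| * (τ * X2))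
          + 2 * |P.c₂| * tail (n / 2 + 1) s τ := by
          rw [dττ]
          refine (abs_add_le _ _).trans (add_le_add ((abs_add_le _ _).trans (add_le_add
            ((abs_sub _ _).trans (add_le_add (le_of_eq ?_) ?_)) ?_)) (le_of_eq ?_))
          · rw [abs_mul, abs_mul, abs_of_pos hZ0, abs_two]
          · rw [abs_mul, abs_of_pos hX1p]
            calc _ ≤ (|2 * n * τ * (P.q₁ + 2 * P.B * τ)| + |n * P.powCoeff s τ|
                  + |2 * (P.c₁ + 2 * P.c₂ * τ)|) * X1 := by
                  gcongr
                  exact (abs_add_le _ _).trans (add_le_add (abs_add_le _ _) le_rfl)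
              _ = _ := by
                rw [abs_mul, abs_mul, abs_mul, abs_mul, abs_mul, abs_of_nonneg hn, abs_of_pos hτ0,
                  abs_two]
                ring
          · rw [abs_mul, abs_of_pos hX2p, abs_mul, abs_mul, abs_of_pos hτ0,
              abs_of_nonneg (by positivity : (0 : ℝ) ≤ (n : ℝ) + 2)]
            calc _ ≤ (n + 2) * τ * (|n * τ * P.powCoeff s τ| + |P.tailCoeff s τ|) * X2 := by
                  gcongr
                  exact abs_add_le _ _
              _ = _ := by
                rw [abs_mul, abs_mul, abs_of_nonneg hn, abs_of_pos hτ0]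
                ring
          · rw [abs_mul, abs_mul, abs_of_nonneg t10, abs_two]
      _ ≤ 2 * (4 * (L * D)) * Z + (2 * n * (10 * L * D) * (2 * Z)
            + n * (8 * L * D) * (4 * Z) + 2 * (10 * L * D) * (4 * Z))
          + ((n + 2) * n * (8 * L * D) * (4 * Z) + (n + 2) * (8 * L * D) * (8 * Z))
          + 2 * (4 * (L * D)) * (2 * Z) := by
          gcongr
          exacts [hP.B.trans hLD, hP.c₂.trans hLD]
      _ ≤ _ := by linarith

end Profile

/-! ### Products of a tangential harmonic polynomial and a profile -/

/-- `k` is a harmonic polynomial, homogeneous of degree `p ≤ 3`, with first and second pure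
derivatives `k₁` and `k₂`, all of size at most `c (1 + |y|)³`. -/
structure IsSolidHarmonic {d : ℕ} (p : ℕ) (k : EuclideanSpace ℝ (Fin d) → ℝ)
    (k₁ k₂ : Fin d → EuclideanSpace ℝ (Fin d) → ℝ) (c : ℝ) : Prop where
  contDiff : ContDiff ℝ ∞ k
  hasDerivAt : ∀ i y, HasDerivAt (fun l : ℝ => k (y + l • EuclideanSpace.single i 1)) (k₁ i y) 0
  hasDerivAt' : ∀ i y, HasDerivAt (fun l : ℝ => k₁ i (y + l • EuclideanSpace.single i 1)) (k₂ i y) 0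
  euler : ∀ y, ∑ i, y i * k₁ i y = p * k y
  harmonic : ∀ y, ∑ i, k₂ i y = 0
  bound : ∀ y, |k y| ≤ c * (1 + ‖y‖) ^ 3
  bound₁ : ∀ i y, |k₁ i y| ≤ c * (1 + ‖y‖) ^ 3
  bound₂ : ∀ i y, |k₂ i y| ≤ c * (1 + ‖y‖) ^ 3

/-- `E` is a smooth decaying solution of `ΔE = S` in the half-space with
`∂ₙE + n ε den⁻¹ E = 0` on its boundary. -/
structure IsDecayingSolution {n : ℕ} (ξ : Bdry n) (ε : ℝ) (E S : Space n → ℝ) (r K C : ℝ) :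
    Prop where
  contDiff : ContDiff ℝ ∞ E
  bound : ∀ x ∈ halfSpace n, |E x| ≤ K * (1 + ‖x‖) ^ (-r)
  bound_fderiv : ∀ x ∈ halfSpace n, ‖fderiv ℝ E x‖ ≤ C * (1 + ‖x‖) ^ (-r)
  bound_tangential : ∀ i, ∀ x ∈ halfSpace n, |pd i (pd i E) x| ≤ C * (1 + ‖x‖) ^ (-r)
  bound_normal : ∀ x ∈ halfSpace n,
    |fderiv ℝ (fun x => fderiv ℝ E x (0, 1)) x (0, 1)| ≤ C * (1 + ‖x‖) ^ (-r)
  laplacian_eq : ∀ x ∈ halfSpace n, laplacian E x = S x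
  boundary : ∀ y : Bdry n, fderiv ℝ E (y, 0) (0, 1) = -(n * ε / den ξ ε (y, 0)) * E (y, 0)

section

variable {n : ℕ} {ξ : Bdry n} {ε : ℝ}

theorem pd_add {E F : Space n → ℝ} (hE : Differentiable ℝ E) (hF : Differentiable ℝ F)
    (i : Fin (n - 1)) : pd i (fun x => E x + F x) = fun x => pd i E x + pd i F x := by
  funext x
  simp only [pd]
  rw [fderiv_fun_add (hE x) (hF x)]; rfl

theorem contDiff_fderiv_apply {E : Space n → ℝ} (hE : ContDiff ℝ ∞ E) (v : Space n) :
    ContDiff ℝ ∞ fun x => fderiv ℝ E x v :=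
  (hE.fderiv_right (by simp)).clm_apply contDiff_const

theorem IsDecayingSolution.add {E F S T : Space n → ℝ} {r K K' C C' : ℝ}
    (hE : IsDecayingSolution ξ ε E S r K C) (hF : IsDecayingSolution ξ ε F T r K' C') :
    IsDecayingSolution ξ ε (fun x => E x + F x) (fun x => S x + T x) r (K + K') (C + C') := by
  have dE := hE.contDiff.differentiable (by simp)
  have dF := hF.contDiff.differentiable (by simp)
  have dE' := fun v => (contDiff_fderiv_apply hE.contDiff v).differentiable (by simp)
  have dF' := fun v => (contDiff_fderiv_apply hF.contDiff v).differentiable (by simp)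
  have e1 : ∀ v, (fun x => fderiv ℝ (fun x => E x + F x) x v) =
      fun x => fderiv ℝ E x v + fderiv ℝ F x v := fun v => by
    funext x
    rw [fderiv_fun_add (dE x) (dF x)]; rfl
  have e2 : ∀ v x, fderiv ℝ (fun x => fderiv ℝ E x v + fderiv ℝ F x v) x v =
      fderiv ℝ (fun x => fderiv ℝ E x v) x v + fderiv ℝ (fun x => fderiv ℝ F x v) x v := fun v x => by
    rw [fderiv_fun_add (dE' v x) (dF' v x)]; rfl
  have e3 : ∀ i x, pd i (pd i (fun x => E x + F x)) x = pd i (pd i E) x + pd i (pd i F) x :=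
    fun i x => by
      rw [pd_add dE dF]
      exact e2 _ x
  refine ⟨hE.contDiff.add hF.contDiff, fun x hx => ?_, fun x hx => ?_, fun i x hx => ?_,
    fun x hx => ?_, fun x hx => ?_, fun y => ?_⟩
  · rw [add_mul]
    exact (abs_add_le _ _).trans (add_le_add (hE.bound x hx) (hF.bound x hx))
  · rw [fderiv_fun_add (dE x) (dF x), add_mul]
    exact (norm_add_le _ _).trans (add_le_add (hE.bound_fderiv x hx) (hF.bound_fderiv x hx))
  · rw [e3, add_mul]
    exact (abs_add_le _ _).trans (add_le_add (hE.bound_tangential i x hx) (hF.bound_tangential i x hx))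
  · rw [e1, e2, add_mul]
    exact (abs_add_le _ _).trans (add_le_add (hE.bound_normal x hx) (hF.bound_normal x hx))
  · rw [← hE.laplacian_eq x hx, ← hF.laplacian_eq x hx]
    simp only [laplacian, e1, e2, e3, Finset.sum_add_distrib]
    ring
  · have := congrFun (e1 (0, 1)) (y, 0)
    rw [this, hE.boundary, hF.boundary]
    ring

/-- A function that is smooth beyond the boundary agrees near the half-space with a smooth
function. -/
theorem exists_contDiff_eq {E : Space n → ℝ} {δ : ℝ} (hδ : 0 < δ)
    (hE : ∀ x : Space n, -δ < x.2 → ContDiffAt ℝ ∞ E x) :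
    ∃ F : Space n → ℝ, ContDiff ℝ ∞ F ∧ ∀ x : Space n, -(δ / 4) < x.2 → F x = E x := by
  -- The cutoff vanishes for xₙ ≤ -δ/2 and equals 1 for xₙ ≥ -δ/4, so the values agree on a
  -- neighbourhood of the closed half-space and all derivatives agree up to the boundary.
  refine ⟨fun x => Real.smoothTransition (4 / δ * x.2 + 2) * E x, ?_, fun x hx => ?_⟩
  · refine contDiff_iff_contDiffAt.2 fun x => ?_
    rcases lt_or_ge (-δ) x.2 with h | h
    · refine ContDiffAt.mul ?_ (hE x h)
      exact (Real.smoothTransition.contDiff.comp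
        ((contDiff_const.mul contDiff_snd).add contDiff_const)).contDiffAt
    · have hev : (fun x : Space n => Real.smoothTransition (4 / δ * x.2 + 2) * E x) =ᶠ[𝓝 x]
          fun _ => 0 := by
        have ho : {z : Space n | z.2 < -(δ / 2)} ∈ 𝓝 x :=
          (isOpen_lt continuous_snd continuous_const).mem_nhds (show x.2 < -(δ / 2) by linarith)
        filter_upwards [ho] with z hz
        rw [Real.smoothTransition.zero_of_nonpos, zero_mul]
        have hz' : z.2 < -(δ / 2) := hz
        have : 4 / δ * z.2 ≤ 4 / δ * (-(δ / 2)) := by gcongr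
        have e : 4 / δ * (-(δ / 2)) = -2 := by field_simp; norm_num
        linarith
      exact contDiffAt_const.congr_of_eventuallyEq hev
  · have h1 : 4 / δ * (-(δ / 4)) ≤ 4 / δ * x.2 := by gcongr
    have e : 4 / δ * (-(δ / 4)) = -1 := by field_simp
    simp only
    rw [Real.smoothTransition.one_of_one_le (by linarith), one_mul]

/-- Partial derivatives are computed along lines from a formula that is only valid near x. -/
theorem fderiv_apply_eq_of_line {F G : Space n → ℝ} {x v : Space n} {c : ℝ}
    (hF : DifferentiableAt ℝ F x) (hFG : F =ᶠ[𝓝 x] G)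
    (hG : HasDerivAt (fun l : ℝ => G (x + l • v)) c 0) : fderiv ℝ F x v = c := by
  have h1 : HasDerivAt (fun l : ℝ => F (x + l • v)) (fderiv ℝ F x v) 0 :=
    hF.hasFDerivAt.hasLineDerivAt v
  have hc : Tendsto (fun l : ℝ => x + l • v) (𝓝 0) (𝓝 x) := by
    have : Continuous fun l : ℝ => x + l • v := by fun_prop
    simpa using this.tendsto 0
  exact h1.unique (hG.congr_of_eventuallyEq (hc.eventually hFG))

theorem opNorm_fderiv_le {E : Space n → ℝ} {x : Space n} {M : ℝ} (hn : 1 ≤ n) (hM : 0 ≤ M)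
    (ht : ∀ i, |pd i E x| ≤ M) (hν : |fderiv ℝ E x (0, 1)| ≤ M) : ‖fderiv ℝ E x‖ ≤ n * M := by
  refine ContinuousLinearMap.opNorm_le_bound _ (by positivity) fun v => ?_
  rw [fderiv_eq_sum, Real.norm_eq_abs]
  have h1 : ∀ i, |v.1 i| ≤ ‖v‖ := fun i => (PiLp.norm_apply_le v.1 i).trans (norm_fst_le v)
  have h2 : |v.2| ≤ ‖v‖ := norm_snd_le v
  calc _ ≤ ∑ i, |v.1 i * pd i E x| + |v.2 * fderiv ℝ E x (0, 1)| :=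
        (abs_add_le _ _).trans (add_le_add (Finset.abs_sum_le_sum_abs _ _) le_rfl)
    _ ≤ ∑ _i : Fin (n - 1), ‖v‖ * M + ‖v‖ * M := by
        gcongr with i
        · rw [abs_mul]; exact mul_le_mul (h1 i) (ht i) (abs_nonneg _) (norm_nonneg _)
        · rw [abs_mul]; exact mul_le_mul h2 hν (abs_nonneg _) (norm_nonneg _)
    _ = _ := by
        simp only [Finset.sum_const, Finset.card_univ, Fintype.card_fin, nsmul_eq_mul]
        rw [Nat.cast_sub hn]; push_cast; ring

/-- `k(x̄ - ξ) g(|x̄ - ξ|², ε + xₙ)`. -/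
def profileProduct (ξ : Bdry n) (ε : ℝ) (k : Bdry n → ℝ) (g : ℝ → ℝ → ℝ) (x : Space n) : ℝ :=
  k (x.1 - ξ) * g (‖x.1 - ξ‖ ^ 2) (ε + x.2)

theorem hasDerivAt_norm_sq_line (y : Bdry n) (i : Fin (n - 1)) :
    HasDerivAt (fun l : ℝ => ‖y + l • EuclideanSpace.single i (1 : ℝ)‖ ^ 2) (2 * y i) 0 := by
  have e : (fun l : ℝ => ‖y + l • EuclideanSpace.single i (1 : ℝ)‖ ^ 2) =
      fun l => ‖y‖ ^ 2 + 2 * y i * l + l ^ 2 := by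
    funext l
    rw [@norm_add_sq_real, real_inner_smul_right, EuclideanSpace.inner_single_right, norm_smul]
    simp
    ring
  rw [e]
  have := (((hasDerivAt_id (0 : ℝ)).const_mul (2 * y i)).const_add (‖y‖ ^ 2)).add (hasDerivAt_pow 2 0)
  exact this.congr_deriv (by simp)

theorem hasDerivAt_profile_line {g : ℝ → ℝ → ℝ} {y : Bdry n} {τ c : ℝ} (i : Fin (n - 1))
    (hg : HasDerivAt (fun s => g s τ) c (‖y‖ ^ 2)) :
    HasDerivAt (fun l : ℝ => g (‖y + l • EuclideanSpace.single i (1 : ℝ)‖ ^ 2) τ) (c * (2 * y i)) 0 := by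
  have h0 : HasDerivAt (fun s => g s τ) c
      ((fun l : ℝ => ‖y + l • EuclideanSpace.single i (1 : ℝ)‖ ^ 2) 0) := by simpa using hg
  exact h0.comp (h := fun l : ℝ => ‖y + l • EuclideanSpace.single i (1 : ℝ)‖ ^ 2) (0 : ℝ)
    (hasDerivAt_norm_sq_line y i)

theorem hasDerivAt_normal_line {g : ℝ → ℝ → ℝ} {s t c : ℝ} (hg : HasDerivAt (fun τ => g s τ) c (ε + t)) :
    HasDerivAt (fun l : ℝ => g s (ε + (t + l * 1))) c 0 := by
  have h0 : HasDerivAt (fun τ => g s τ) c ((fun l : ℝ => ε + (t + l * 1)) 0) := by simpa using hg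
  have h1 : HasDerivAt (fun l : ℝ => ε + (t + l * 1)) 1 0 := by
    have := (((hasDerivAt_id (0 : ℝ)).mul_const 1).const_add t).const_add ε
    simpa using this
  exact (h0.comp (h := fun l : ℝ => ε + (t + l * 1)) (0 : ℝ) h1).congr_deriv (mul_one c)

theorem hasDerivAt_coord_line (y : Bdry n) (i : Fin (n - 1)) :
    HasDerivAt (fun l : ℝ => (y + l • EuclideanSpace.single i (1 : ℝ)) i) 1 0 := by
  have := ((hasDerivAt_id (0 : ℝ)).mul_const 1).const_add (y i)
  simpa using this

variable {p : ℕ} {k : Bdry n → ℝ} {k₁ k₂ : Fin (n - 1) → Bdry n → ℝ} {c : ℝ}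

/-- For a harmonic k of degree p, harmonicity and Euler's identity turn the Laplacian of k(y)
g(|y|², τ) into k(y) times the operator in s and τ of `Profile.laplace_eq`. The decay rate n - 8 is
crude: k is bounded by a multiple of D³ and g by a multiple of D^(1-n/2). Only the bound on the
function itself is made explicit, because its linearity in L and c later yields the second order in
ξ. -/
theorem exists_isDecayingSolution (hn : 8 ≤ n) (hξ : ‖ξ‖ ≤ 1) (hε : 1 / 2 ≤ ε)
    (hk : IsSolidHarmonic p k k₁ k₂ c) {P : Profile} {L : ℝ} (hP : P.BoundedBy L)
    (hbd : ∀ s, 0 ≤ s → P.dτ n s ε = -(n * ε / (s + ε ^ 2)) * P.val n s ε) :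
    ∃ (F : Space n → ℝ) (C : ℝ), IsDecayingSolution ξ ε F
        (profileProduct ξ ε k fun s τ =>
          4 * s * P.dss n s τ + (2 * (n - 1) + 4 * p) * P.ds n s τ + P.dττ n s τ)
        (n - 8) (240000 * 25 ^ ((n : ℝ) / 2 - 4) * (n + 2) ^ 2 * L * c) C ∧
      ∀ x ∈ halfSpace n, F x = profileProduct ξ ε k (P.val n) x := by
  have hε0 : 0 < ε := by linarith
  have hL : 0 ≤ L := (abs_nonneg _).trans hP.A
  have hc : 0 ≤ c := by
    have := (abs_nonneg _).trans (hk.bound 0)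
    simpa using this
  have hsq : ∀ (y : Bdry n) (τ : ℝ), 0 < τ → -τ ^ 2 < ‖y‖ ^ 2 := fun y τ hτ => by
    have : 0 < τ ^ 2 := by positivity
    linarith [sq_nonneg ‖y‖]
  have hsm : ∀ x : Space n, -ε < x.2 → ContDiffAt ℝ ∞ (profileProduct ξ ε k (P.val n)) x := fun x hx => by
    have hτ : 0 < ε + x.2 := by linarith
    have hg := P.contDiffAt_val (n := n) hτ (hsq (x.1 - ξ) _ hτ)
    have hin : ContDiffAt ℝ ∞ (fun x : Space n => (‖x.1 - ξ‖ ^ 2, ε + x.2)) x :=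
      ContDiff.contDiffAt (((contDiff_fst.sub contDiff_const).norm_sq ℝ).prodMk
        (contDiff_const.add contDiff_snd))
    exact (hk.contDiff.comp (contDiff_fst.sub contDiff_const)).contDiffAt.mul
      (ContDiffAt.comp (g := fun p : ℝ × ℝ => P.val n p.1 p.2)
        (f := fun x : Space n => (‖x.1 - ξ‖ ^ 2, ε + x.2)) x hg hin)
  obtain ⟨F, hF, hFE⟩ := exists_contDiff_eq hε0 hsm
  have hUo : IsOpen {x : Space n | -(ε / 4) < x.2} := isOpen_lt continuous_const continuous_snd
  have hHU : ∀ x ∈ halfSpace n, -(ε / 4) < x.2 := fun x hx => by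
    have : 0 ≤ x.2 := hx
    linarith
  have hev : ∀ {A B : Space n → ℝ}, (∀ x : Space n, -(ε / 4) < x.2 → A x = B x) →
      ∀ x : Space n, -(ε / 4) < x.2 → A =ᶠ[𝓝 x] B := fun h x hx => by
    filter_upwards [hUo.mem_nhds hx] with z hz using h z hz
  -- tangential derivatives
  have d1 : ∀ i, ∀ x : Space n, -(ε / 4) < x.2 → pd i F x =
      k₁ i (x.1 - ξ) * P.val n (‖x.1 - ξ‖ ^ 2) (ε + x.2) +
        2 * (x.1 - ξ) i * k (x.1 - ξ) * P.ds n (‖x.1 - ξ‖ ^ 2) (ε + x.2) := fun i x hx => by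
    have hτ : 0 < ε + x.2 := by linarith
    refine fderiv_apply_eq_of_line (hF.differentiable (by simp) x) (hev hFE x hx) ?_
    have h := (hk.hasDerivAt i (x.1 - ξ)).mul (hasDerivAt_profile_line (g := P.val n)
      (y := x.1 - ξ) i (P.hasDerivAt_val_left hτ (hsq _ _ hτ)))
    refine (h.congr_deriv ?_).congr_of_eventuallyEq (Eventually.of_forall fun l => ?_)
    · simp only [zero_smul, add_zero]; ring
    · simp only [profileProduct, Prod.fst_add, Prod.smul_fst, Prod.snd_add, Prod.smul_snd, smul_zero,
        add_zero, Pi.mul_apply]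
      rw [add_sub_right_comm]
  have d2 : ∀ i, ∀ x : Space n, -(ε / 4) < x.2 → pd i (pd i F) x =
      k₂ i (x.1 - ξ) * P.val n (‖x.1 - ξ‖ ^ 2) (ε + x.2) +
        (4 * ((x.1 - ξ) i * k₁ i (x.1 - ξ)) + 2 * k (x.1 - ξ)) * P.ds n (‖x.1 - ξ‖ ^ 2) (ε + x.2) +
        4 * (x.1 - ξ) i ^ 2 * k (x.1 - ξ) * P.dss n (‖x.1 - ξ‖ ^ 2) (ε + x.2) := fun i x hx => by
    have hτ : 0 < ε + x.2 := by linarith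
    refine fderiv_apply_eq_of_line ((contDiff_fderiv_apply hF _).differentiable (by simp) x)
      (hev (d1 i) x hx) ?_
    have hv := hasDerivAt_profile_line (g := P.val n)
      (y := x.1 - ξ) i (P.hasDerivAt_val_left hτ (hsq _ _ hτ))
    have hs := hasDerivAt_profile_line (g := P.ds n)
      (y := x.1 - ξ) i (P.hasDerivAt_ds_left hτ (hsq _ _ hτ))
    have h := ((hk.hasDerivAt' i (x.1 - ξ)).mul hv).add
      ((((hasDerivAt_coord_line (x.1 - ξ) i).const_mul 2).mul (hk.hasDerivAt i (x.1 - ξ))).mul hs)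
    refine (h.congr_deriv ?_).congr_of_eventuallyEq (Eventually.of_forall fun l => ?_)
    · simp only [zero_smul, add_zero, Pi.mul_apply]; ring
    · simp only [Prod.fst_add, Prod.smul_fst, Prod.snd_add, Prod.smul_snd, smul_zero,
        add_zero, Pi.mul_apply, Pi.add_apply]
      rw [add_sub_right_comm]
  -- normal derivatives
  have n1 : ∀ x : Space n, -(ε / 4) < x.2 → fderiv ℝ F x (0, 1) =
      k (x.1 - ξ) * P.dτ n (‖x.1 - ξ‖ ^ 2) (ε + x.2) := fun x hx => by
    have hτ : 0 < ε + x.2 := by linarith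
    refine fderiv_apply_eq_of_line (hF.differentiable (by simp) x) (hev hFE x hx) ?_
    have h := (hasDerivAt_normal_line (P.hasDerivAt_val_right (n := n) hτ
      (hsq (x.1 - ξ) _ hτ))).const_mul (k (x.1 - ξ))
    refine h.congr_of_eventuallyEq (Eventually.of_forall fun l => ?_)
    simp [profileProduct]
  have n2 : ∀ x : Space n, -(ε / 4) < x.2 → fderiv ℝ (fun x => fderiv ℝ F x (0, 1)) x (0, 1) =
      k (x.1 - ξ) * P.dττ n (‖x.1 - ξ‖ ^ 2) (ε + x.2) := fun x hx => by
    have hτ : 0 < ε + x.2 := by linarith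
    refine fderiv_apply_eq_of_line ((contDiff_fderiv_apply hF _).differentiable (by simp) x)
      (hev n1 x hx) ?_
    have h := (hasDerivAt_normal_line (P.hasDerivAt_dτ_right (n := n) hτ
      (hsq (x.1 - ξ) _ hτ))).const_mul (k (x.1 - ξ))
    refine h.congr_of_eventuallyEq (Eventually.of_forall fun l => ?_)
    simp
  -- size of the factors
  set M := 600 * ((n : ℝ) + 2) ^ 2 * L with hM
  have hM0 : 0 ≤ M := by positivity
  have hsize : ∀ x ∈ halfSpace n, ∀ κ q : ℝ, 0 ≤ κ → |q| ≤ κ * c * M * den ξ ε x ^ 3 *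
      (den ξ ε x * den ξ ε x ^ (-(n / 2 : ℝ))) →
      |q| ≤ κ * c * M * 25 ^ ((n : ℝ) / 2 - 4) * (1 + ‖x‖) ^ (-((n : ℝ) - 8)) := by
    intro x hx κ q hκ hq
    have hD := den_pos hε0 hx (ξ := ξ)
    have e : den ξ ε x ^ 3 * (den ξ ε x * den ξ ε x ^ (-(n / 2 : ℝ))) =
        den ξ ε x ^ (-((n : ℝ) / 2 - 4)) := by
      rw [← mul_assoc, ← pow_succ, ← Real.rpow_natCast, ← Real.rpow_add hD]
      congr 1; push_cast; ring
    have h := den_rpow_neg_le hξ hε hx (β := (n : ℝ) / 2 - 4) (by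
      have : (8 : ℝ) ≤ n := by exact_mod_cast hn
      linarith)
    rw [show 2 * ((n : ℝ) / 2 - 4) = n - 8 by ring] at h
    calc |q| ≤ κ * c * M * den ξ ε x ^ (-((n : ℝ) / 2 - 4)) := by rw [← e, ← mul_assoc]; exact hq
      _ ≤ κ * c * M * (25 ^ ((n : ℝ) / 2 - 4) * (1 + ‖x‖) ^ (-((n : ℝ) - 8))) := by gcongr
      _ = _ := by ring
  have hfac : ∀ x ∈ halfSpace n, 1 / 4 ≤ den ξ ε x ∧ ‖x.1 - ξ‖ ^ 2 ≤ den ξ ε x ∧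
      (1 + ‖x.1 - ξ‖) ^ 3 ≤ 100 * den ξ ε x ^ 2 ∧ (1 + ‖x.1 - ξ‖) ^ 4 ≤ 100 * den ξ ε x ^ 2 := by
    intro x hx
    have hx2 : 0 ≤ x.2 := hx
    have h0 := norm_nonneg (x.1 - ξ)
    have h1 : 1 / 4 + ‖x.1 - ξ‖ ^ 2 ≤ den ξ ε x := by unfold den; nlinarith
    have h2 : (1 + ‖x.1 - ξ‖) ^ 2 ≤ 10 * den ξ ε x := by nlinarith [sq_nonneg (1 - ‖x.1 - ξ‖)]
    have h4 : (1 + ‖x.1 - ξ‖) ^ 4 ≤ 100 * den ξ ε x ^ 2 := by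
      calc (1 + ‖x.1 - ξ‖) ^ 4 = ((1 + ‖x.1 - ξ‖) ^ 2) ^ 2 := by ring
        _ ≤ (10 * den ξ ε x) ^ 2 := by gcongr
        _ = _ := by ring
    refine ⟨by nlinarith, by linarith, le_trans ?_ h4, h4⟩
    exact pow_le_pow_right₀ (by linarith) (by norm_num)
  have hDe : ∀ x : Space n, ‖x.1 - ξ‖ ^ 2 + (ε + x.2) ^ 2 = den ξ ε x := fun x => by
    unfold den; ring
  have hb : ∀ x ∈ halfSpace n, _ := fun x (hx : 0 ≤ x.2) =>
    hP.bounds (n := n) (s := ‖x.1 - ξ‖ ^ 2) (τ := ε + x.2) (sq_nonneg _) (by linarith)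
  simp only [hDe] at hb
  rw [← hM] at hb
  have habs : ∀ x ∈ halfSpace n, ∀ κ a g : ℝ, 0 ≤ κ → |a| ≤ κ * c * den ξ ε x ^ 3 →
      |g| ≤ M * (den ξ ε x * den ξ ε x ^ (-(n / 2 : ℝ))) →
      |a * g| ≤ κ * c * M * den ξ ε x ^ 3 * (den ξ ε x * den ξ ε x ^ (-(n / 2 : ℝ))) := by
    intro x hx κ a g hκ ha hg
    have hD := den_pos hε0 hx (ξ := ξ)
    rw [abs_mul]
    calc |a| * |g| ≤ (κ * c * den ξ ε x ^ 3) *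
          (M * (den ξ ε x * den ξ ε x ^ (-(n / 2 : ℝ)))) :=
          mul_le_mul ha hg (abs_nonneg _) (by positivity)
      _ = _ := by ring
  -- The factor 400 is 100 from (1+|y|)³ ≤ 100 D² times 4 from 1 ≤ 4D; with the 600 of the profile
  -- bounds it makes 240000.
  have hcub : ∀ x ∈ halfSpace n, ∀ b : ℝ, |b| ≤ c * (1 + ‖x.1 - ξ‖) ^ 3 →
      |b| ≤ 400 * c * den ξ ε x ^ 3 := by
    intro x hx b h
    obtain ⟨f1, -, f3, -⟩ := hfac x hx
    calc |b| ≤ c * (100 * den ξ ε x ^ 2) := h.trans (by gcongr)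
      _ ≤ c * (100 * den ξ ε x ^ 2) * (4 * den ξ ε x) :=
        le_mul_of_one_le_right (by positivity) (by linarith)
      _ = _ := by ring
  have hcub' : ∀ x ∈ halfSpace n, ∀ b : ℝ, ∀ i, |b| ≤ c * (1 + ‖x.1 - ξ‖) ^ 3 →
      |(x.1 - ξ) i * b| ≤ 400 * c * den ξ ε x ^ 3 := by
    intro x hx b i h
    obtain ⟨f1, -, -, f4⟩ := hfac x hx
    have hi : |(x.1 - ξ) i| ≤ 1 + ‖x.1 - ξ‖ := by
      have := PiLp.norm_apply_le (x.1 - ξ) i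
      rw [Real.norm_eq_abs] at this; linarith
    have h0 := norm_nonneg (x.1 - ξ)
    calc |(x.1 - ξ) i * b| ≤ (1 + ‖x.1 - ξ‖) * (c * (1 + ‖x.1 - ξ‖) ^ 3) := by
          rw [abs_mul]; exact mul_le_mul hi h (abs_nonneg _) (by linarith)
      _ = c * (1 + ‖x.1 - ξ‖) ^ 4 := by ring
      _ ≤ c * (100 * den ξ ε x ^ 2) := by gcongr
      _ ≤ c * (100 * den ξ ε x ^ 2) * (4 * den ξ ε x) :=
        le_mul_of_one_le_right (by positivity) (by linarith)
      _ = _ := by ring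
  have hsq' : ∀ x ∈ halfSpace n, ∀ i,
      |4 * (x.1 - ξ) i ^ 2 * k (x.1 - ξ)| ≤ 400 * c * den ξ ε x ^ 3 := by
    intro x hx i
    obtain ⟨-, f2, f3, -⟩ := hfac x hx
    have hi : (x.1 - ξ) i ^ 2 ≤ den ξ ε x := by
      have := PiLp.norm_apply_le (x.1 - ξ) i
      rw [Real.norm_eq_abs] at this
      rw [← sq_abs]
      exact (pow_le_pow_left₀ (abs_nonneg _) this 2).trans f2
    have hk0 := (hk.bound (x.1 - ξ)).trans (mul_le_mul_of_nonneg_left f3 hc)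
    have hD := den_pos hε0 hx (ξ := ξ)
    rw [abs_mul, abs_of_nonneg (by positivity)]
    calc 4 * (x.1 - ξ) i ^ 2 * |k (x.1 - ξ)| ≤ 4 * den ξ ε x * (c * (100 * den ξ ε x ^ 2)) := by
          gcongr
      _ = _ := by ring
  have hmono : ∀ {κ κ' : ℝ}, κ ≤ κ' → ∀ x : Space n,
      κ * c * M * 25 ^ ((n : ℝ) / 2 - 4) * (1 + ‖x‖) ^ (-((n : ℝ) - 8)) ≤
        κ' * c * M * 25 ^ ((n : ℝ) / 2 - 4) * (1 + ‖x‖) ^ (-((n : ℝ) - 8)) := fun h x => by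
    gcongr
  have b1 : ∀ i, ∀ x ∈ halfSpace n, |pd i F x| ≤
      3200 * c * M * 25 ^ ((n : ℝ) / 2 - 4) * (1 + ‖x‖) ^ (-((n : ℝ) - 8)) := by
    intro i x hx
    obtain ⟨v0, v1, v2, v3, v4⟩ := hb x hx
    rw [d1 i x (hHU x hx)]
    refine hsize x hx _ _ (by norm_num) ?_
    have t1 := habs x hx 400 _ _ (by norm_num) (hcub x hx _ (hk.bound₁ i _)) v0
    have t2 := habs x hx 800 (2 * (x.1 - ξ) i * k (x.1 - ξ)) _ (by norm_num) (by
      have := hcub' x hx _ i (hk.bound _)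
      rw [mul_assoc 2, abs_mul, abs_two]; linarith) v1
    have hD := den_pos hε0 hx (ξ := ξ)
    have hnn : 0 ≤ c * M * den ξ ε x ^ 3 * (den ξ ε x * den ξ ε x ^ (-(n / 2 : ℝ))) := by positivity
    refine (abs_add_le _ _).trans ?_
    linarith
  have b2 : ∀ i, ∀ x ∈ halfSpace n, |pd i (pd i F) x| ≤
      3200 * c * M * 25 ^ ((n : ℝ) / 2 - 4) * (1 + ‖x‖) ^ (-((n : ℝ) - 8)) := by
    intro i x hx
    obtain ⟨v0, v1, v2, v3, v4⟩ := hb x hx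
    rw [d2 i x (hHU x hx)]
    refine hsize x hx _ _ (by norm_num) ?_
    have t1 := habs x hx 400 _ _ (by norm_num) (hcub x hx _ (hk.bound₂ i _)) v0
    have t2 := habs x hx 2400 (4 * ((x.1 - ξ) i * k₁ i (x.1 - ξ)) + 2 * k (x.1 - ξ)) _
      (by norm_num) (by
        have u1 := hcub' x hx _ i (hk.bound₁ i _)
        have u2 := hcub x hx _ (hk.bound _)
        refine (abs_add_le _ _).trans ?_
        rw [abs_mul, abs_mul 2, abs_two, abs_of_nonneg (by norm_num : (0 : ℝ) ≤ 4)]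
        linarith) v1
    have t3 := habs x hx 400 _ _ (by norm_num) (hsq' x hx i) v2
    refine (abs_add_le _ _).trans ?_
    have := abs_add_le (k₂ i (x.1 - ξ) * P.val n (‖x.1 - ξ‖ ^ 2) (ε + x.2))
      ((4 * ((x.1 - ξ) i * k₁ i (x.1 - ξ)) + 2 * k (x.1 - ξ)) *
        P.ds n (‖x.1 - ξ‖ ^ 2) (ε + x.2))
    linarith
  have c1 : ∀ x ∈ halfSpace n, |fderiv ℝ F x (0, 1)| ≤
      3200 * c * M * 25 ^ ((n : ℝ) / 2 - 4) * (1 + ‖x‖) ^ (-((n : ℝ) - 8)) := by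
    intro x hx
    obtain ⟨v0, v1, v2, v3, v4⟩ := hb x hx
    rw [n1 x (hHU x hx)]
    exact (hsize x hx _ _ (by norm_num) (habs x hx 400 _ _ (by norm_num)
      (hcub x hx _ (hk.bound _)) v3)).trans (hmono (by norm_num) x)
  have hK0 : ∀ x : Space n, 0 ≤
      3200 * c * M * 25 ^ ((n : ℝ) / 2 - 4) * (1 + ‖x‖) ^ (-((n : ℝ) - 8)) := fun x => by
    positivity
  have hn1 : (1 : ℝ) ≤ n := by exact_mod_cast (by omega : 1 ≤ n)
  refine ⟨F, n * (3200 * c * M * 25 ^ ((n : ℝ) / 2 - 4)), ⟨hF, fun x hx => ?_, fun x hx => ?_,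
    fun i x hx => ?_, fun x hx => ?_, fun x hx => ?_, fun y => ?_⟩, fun x hx => hFE x (hHU x hx)⟩
  · obtain ⟨v0, v1, v2, v3, v4⟩ := hb x hx
    rw [hFE x (hHU x hx)]
    refine (hsize x hx _ _ (by norm_num) (habs x hx 400 _ _ (by norm_num)
      (hcub x hx _ (hk.bound _)) v0)).trans (le_of_eq ?_)
    rw [hM]; ring
  · rw [mul_assoc (n : ℝ)]
    exact opNorm_fderiv_le (by omega) (hK0 x) (fun i => b1 i x hx) (c1 x hx)
  · rw [mul_assoc (n : ℝ)]
    exact (b2 i x hx).trans (le_mul_of_one_le_left (hK0 x) hn1)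
  · rw [mul_assoc (n : ℝ)]
    obtain ⟨v0, v1, v2, v3, v4⟩ := hb x hx
    rw [n2 x (hHU x hx)]
    exact ((hsize x hx _ _ (by norm_num) (habs x hx 400 _ _ (by norm_num)
      (hcub x hx _ (hk.bound _)) v4)).trans (hmono (by norm_num) x)).trans
        (le_mul_of_one_le_left (hK0 x) hn1)
  · have hx' := hHU x hx
    have hs : ∑ i, (x.1 - ξ) i ^ 2 = ‖x.1 - ξ‖ ^ 2 := (EuclideanSpace.real_norm_sq_eq _).symm
    have hsum : ∑ i, pd i (pd i F) x =
        (∑ i, k₂ i (x.1 - ξ)) * P.val n (‖x.1 - ξ‖ ^ 2) (ε + x.2) +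
        (4 * (∑ i, (x.1 - ξ) i * k₁ i (x.1 - ξ)) + (n - 1) * (2 * k (x.1 - ξ))) *
          P.ds n (‖x.1 - ξ‖ ^ 2) (ε + x.2) +
        4 * (∑ i, (x.1 - ξ) i ^ 2) * k (x.1 - ξ) * P.dss n (‖x.1 - ξ‖ ^ 2) (ε + x.2) := by
      have e : ((n : ℝ) - 1) * (2 * k (x.1 - ξ)) = ∑ _i : Fin (n - 1), 2 * k (x.1 - ξ) := by
        rw [Finset.sum_const, Finset.card_univ, Fintype.card_fin, nsmul_eq_mul,
          Nat.cast_sub (by omega), Nat.cast_one]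
      rw [e, Finset.mul_sum, ← Finset.sum_add_distrib, Finset.sum_mul, Finset.sum_mul,
        Finset.mul_sum, Finset.sum_mul, Finset.sum_mul, ← Finset.sum_add_distrib,
        ← Finset.sum_add_distrib]
      exact Finset.sum_congr rfl fun i _ => d2 i x hx'
    -- Harmonicity removes the `val` term, and Euler's identity supplies the 4p in the coefficient
    -- of `ds`.
    rw [laplacian, hsum, n2 x hx', hk.harmonic, hk.euler, hs]
    simp only [profileProduct]
    ring
  · have h0 : -(ε / 4) < ((y, 0) : Space n).2 := by simpa using hε0
    rw [n1 _ h0, hFE _ h0]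
    have := hbd (‖y - ξ‖ ^ 2) (sq_nonneg _)
    have hd : den ξ ε ((y, 0) : Space n) = ‖y - ξ‖ ^ 2 + ε ^ 2 := by simp [den, add_comm]
    simp only [profileProduct, add_zero]
    rw [this, hd]
    ring

end

/-! ### Quadratic and cubic harmonic polynomials -/

section

variable {d : ℕ}

/-- The quadratic form `∑ Q_{ij} yⁱ yʲ`. -/
def quadForm (Q : Fin d → Fin d → ℝ) (y : EuclideanSpace ℝ (Fin d)) : ℝ :=
  ∑ i, ∑ j, Q i j * y i * y j

/-- The linear form `∑ⱼ Q_{ij} yʲ`. -/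
def rowForm (Q : Fin d → Fin d → ℝ) (i : Fin d) (y : EuclideanSpace ℝ (Fin d)) : ℝ :=
  ∑ j, Q i j * y j

theorem quadForm_eq (Q : Fin d → Fin d → ℝ) (y : EuclideanSpace ℝ (Fin d)) :
    quadForm Q y = ∑ i, y i * rowForm Q i y := by
  simp only [quadForm, rowForm, Finset.mul_sum]
  exact Finset.sum_congr rfl fun i _ => Finset.sum_congr rfl fun j _ => by ring

theorem rowForm_add_smul_single (Q : Fin d → Fin d → ℝ) (i j : Fin d) (y : EuclideanSpace ℝ (Fin d))
    (l : ℝ) : rowForm Q i (y + l • EuclideanSpace.single j 1) = rowForm Q i y + l * Q i j := by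
  simp [rowForm, mul_add, Finset.sum_add_distrib, PiLp.single_apply, mul_comm]

theorem quadForm_add_smul_single {Q : Fin d → Fin d → ℝ} (hQ : ∀ i j, Q i j = Q j i) (i : Fin d)
    (y : EuclideanSpace ℝ (Fin d)) (l : ℝ) :
    quadForm Q (y + l • EuclideanSpace.single i 1) =
      quadForm Q y + l * (2 * rowForm Q i y) + l ^ 2 * Q i i := by
  rw [quadForm_eq, quadForm_eq]
  simp only [rowForm_add_smul_single, PiLp.add_apply, PiLp.smul_apply, PiLp.single_apply,
    smul_eq_mul, mul_ite, mul_one, mul_zero, add_mul, mul_add, ite_mul, zero_mul,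
    Finset.sum_add_distrib, Finset.sum_ite_eq', Finset.mem_univ, if_true]
  have : ∑ j, y j * (l * Q j i) = l * rowForm Q i y := by
    rw [rowForm, Finset.mul_sum]
    exact Finset.sum_congr rfl fun j _ => by rw [hQ j i]; ring
  rw [this]
  ring

theorem abs_rowForm_le (Q : Fin d → Fin d → ℝ) (i : Fin d) (y : EuclideanSpace ℝ (Fin d)) :
    |rowForm Q i y| ≤ (∑ j, |Q i j|) * ‖y‖ := by
  rw [rowForm, Finset.sum_mul]
  refine (Finset.abs_sum_le_sum_abs _ _).trans (Finset.sum_le_sum fun j _ => ?_)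
  rw [abs_mul]
  exact mul_le_mul_of_nonneg_left (PiLp.norm_apply_le y j) (abs_nonneg _)

theorem abs_quadForm_le (Q : Fin d → Fin d → ℝ) (y : EuclideanSpace ℝ (Fin d)) :
    |quadForm Q y| ≤ (∑ i, ∑ j, |Q i j|) * ‖y‖ ^ 2 := by
  rw [quadForm_eq, Finset.sum_mul]
  refine (Finset.abs_sum_le_sum_abs _ _).trans (Finset.sum_le_sum fun i _ => ?_)
  rw [abs_mul]
  calc |y i| * |rowForm Q i y| ≤ ‖y‖ * ((∑ j, |Q i j|) * ‖y‖) :=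
        mul_le_mul (PiLp.norm_apply_le y i) (abs_rowForm_le Q i y) (abs_nonneg _) (norm_nonneg _)
    _ = _ := by ring

theorem contDiff_quadForm (Q : Fin d → Fin d → ℝ) : ContDiff ℝ ∞ (quadForm Q) := by
  unfold quadForm
  fun_prop

theorem hasDerivAt_zero_of_quadratic {f : ℝ → ℝ} {a b c : ℝ} (h : ∀ l, f l = a + l * b + l ^ 2 * c) :
    HasDerivAt f b 0 := by
  rw [funext h]
  have := (((hasDerivAt_id (0 : ℝ)).mul_const b).const_add a).add
    ((hasDerivAt_pow 2 (0 : ℝ)).mul_const c)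
  exact this.congr_deriv (by simp)

variable {Q : Fin d → Fin d → ℝ} {ξ : EuclideanSpace ℝ (Fin d)}

theorem inner_eq_sum_mul (x y : EuclideanSpace ℝ (Fin d)) : inner ℝ x y = ∑ i, x i * y i := by
  rw [PiLp.inner_apply]
  exact Finset.sum_congr rfl fun i _ => by simp [mul_comm]

theorem abs_entry_le (Q : Fin d → Fin d → ℝ) (i j : Fin d) : |Q i j| ≤ ∑ i, ∑ j, |Q i j| :=
  (Finset.single_le_sum (f := fun j => |Q i j|) (fun _ _ => abs_nonneg _) (Finset.mem_univ j)).trans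
    (Finset.single_le_sum (f := fun i => ∑ j, |Q i j|)
      (fun _ _ => Finset.sum_nonneg fun _ _ => abs_nonneg _) (Finset.mem_univ i))

theorem abs_row_le (Q : Fin d → Fin d → ℝ) (i : Fin d) : ∑ j, |Q i j| ≤ ∑ i, ∑ j, |Q i j| :=
  Finset.single_le_sum (f := fun i => ∑ j, |Q i j|)
    (fun _ _ => Finset.sum_nonneg fun _ _ => abs_nonneg _) (Finset.mem_univ i)

theorem isSolidHarmonic_quadForm (hQ : ∀ i j, Q i j = Q j i) (htr : ∑ i, Q i i = 0) :
    IsSolidHarmonic 2 (quadForm Q) (fun i y => 2 * rowForm Q i y) (fun i _ => 2 * Q i i)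
      (6 * ∑ i, ∑ j, |Q i j|) := by
  set q := ∑ i, ∑ j, |Q i j| with hq
  have hq0 : 0 ≤ q := Finset.sum_nonneg fun _ _ => Finset.sum_nonneg fun _ _ => abs_nonneg _
  have key : ∀ (y : EuclideanSpace ℝ (Fin d)) {b : ℝ}, b ≤ 6 * q * (1 + ‖y‖ + ‖y‖ ^ 2) →
      b ≤ 6 * q * (1 + ‖y‖) ^ 3 := fun y b hb => by
    refine hb.trans (mul_le_mul_of_nonneg_left ?_ (by positivity))
    nlinarith [norm_nonneg y, pow_nonneg (norm_nonneg y) 3, sq_nonneg ‖y‖]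
  have h0 := fun y : EuclideanSpace ℝ (Fin d) => norm_nonneg y
  refine ⟨contDiff_quadForm Q, fun i y => ?_, fun i y => ?_, fun y => ?_, fun y => ?_, fun y => ?_,
    fun i y => ?_, fun i y => ?_⟩
  · exact hasDerivAt_zero_of_quadratic fun l => quadForm_add_smul_single hQ i y l
  · refine hasDerivAt_zero_of_quadratic (a := 2 * rowForm Q i y) (c := 0) fun l => ?_
    rw [rowForm_add_smul_single]; ring
  · rw [quadForm_eq, Finset.mul_sum]
    exact Finset.sum_congr rfl fun i _ => by push_cast; ring
  · rw [← Finset.mul_sum, htr, mul_zero]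
  · refine key y ((abs_quadForm_le Q y).trans ?_)
    rw [← hq]
    nlinarith [h0 y, sq_nonneg ‖y‖, mul_nonneg hq0 (h0 y), mul_nonneg hq0 (sq_nonneg ‖y‖)]
  · refine key y ?_
    rw [abs_mul, abs_two]
    have := (abs_rowForm_le Q i y).trans (mul_le_mul_of_nonneg_right (abs_row_le Q i) (h0 y))
    nlinarith [h0 y, sq_nonneg ‖y‖, mul_nonneg hq0 (h0 y), mul_nonneg hq0 (sq_nonneg ‖y‖)]
  · refine key y ?_
    rw [abs_mul, abs_two]
    have := abs_entry_le Q i i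
    nlinarith [h0 y, sq_nonneg ‖y‖, mul_nonneg hq0 (h0 y), mul_nonneg hq0 (sq_nonneg ‖y‖)]

/-- The Laplacian of (ξ·y) Q(y) is 4 ξ·(Qy) plus a multiple of the trace of Q, and ξ·(Qy) = y·(Qξ) =
0. -/
theorem isSolidHarmonic_inner_mul_quadForm (hQ : ∀ i j, Q i j = Q j i) (htr : ∑ i, Q i i = 0)
    (hξ : ‖ξ‖ ≤ 1) (hQξ : ∀ i, rowForm Q i ξ = 0) :
    IsSolidHarmonic 3 (fun y => inner ℝ ξ y * quadForm Q y)
      (fun i y => ξ i * quadForm Q y + inner ℝ ξ y * (2 * rowForm Q i y))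
      (fun i y => 4 * (ξ i * rowForm Q i y) + 2 * (inner ℝ ξ y * Q i i))
      (6 * ∑ i, ∑ j, |Q i j|) := by
  set q := ∑ i, ∑ j, |Q i j| with hq
  have hq0 : 0 ≤ q := Finset.sum_nonneg fun _ _ => Finset.sum_nonneg fun _ _ => abs_nonneg _
  have h0 := fun y : EuclideanSpace ℝ (Fin d) => norm_nonneg y
  have hi : ∀ y, |inner ℝ ξ y| ≤ ‖y‖ := fun y =>
    (abs_real_inner_le_norm ξ y).trans (mul_le_of_le_one_left (h0 y) hξ)
  have hξi : ∀ i, |ξ i| ≤ 1 := fun i => (PiLp.norm_apply_le ξ i).trans hξ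
  have hr : ∀ i y, |rowForm Q i y| ≤ q * ‖y‖ := fun i y =>
    (abs_rowForm_le Q i y).trans (mul_le_mul_of_nonneg_right (abs_row_le Q i) (h0 y))
  have hline : ∀ (y : EuclideanSpace ℝ (Fin d)) i (l : ℝ),
      inner ℝ ξ (y + l • EuclideanSpace.single i 1) = inner ℝ ξ y + l * ξ i := fun y i l => by
    rw [inner_add_right, real_inner_smul_right, EuclideanSpace.inner_single_right]
    simp
  have hd1 : ∀ i (y : EuclideanSpace ℝ (Fin d)),
      HasDerivAt (fun l : ℝ => inner ℝ ξ (y + l • EuclideanSpace.single i (1 : ℝ))) (ξ i) 0 :=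
    fun i y => hasDerivAt_zero_of_quadratic (c := 0) (a := inner ℝ ξ y) fun l => by
      rw [hline]; ring
  have hd2 : ∀ i (y : EuclideanSpace ℝ (Fin d)),
      HasDerivAt (fun l : ℝ => quadForm Q (y + l • EuclideanSpace.single i (1 : ℝ)))
        (2 * rowForm Q i y) 0 :=
    fun i y => hasDerivAt_zero_of_quadratic fun l => quadForm_add_smul_single hQ i y l
  have hd3 : ∀ i (y : EuclideanSpace ℝ (Fin d)),
      HasDerivAt (fun l : ℝ => 2 * rowForm Q i (y + l • EuclideanSpace.single i (1 : ℝ)))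
        (2 * Q i i) 0 :=
    fun i y => hasDerivAt_zero_of_quadratic (c := 0) (a := 2 * rowForm Q i y) fun l => by
      rw [rowForm_add_smul_single]; ring
  have hsym : ∀ y, ∑ i, ξ i * rowForm Q i y = 0 := fun y => by
    have : ∑ i, ξ i * rowForm Q i y = ∑ i, y i * rowForm Q i ξ := by
      simp only [rowForm, Finset.mul_sum]
      rw [Finset.sum_comm]
      refine Finset.sum_congr rfl fun i _ => Finset.sum_congr rfl fun j _ => ?_
      rw [hQ j i]; ring
    rw [this]
    simp [hQξ]
  have key : ∀ (y : EuclideanSpace ℝ (Fin d)) {b : ℝ},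
      b ≤ 6 * q * (‖y‖ + ‖y‖ ^ 2 + ‖y‖ ^ 3) → b ≤ 6 * q * (1 + ‖y‖) ^ 3 := fun y b hb => by
    refine hb.trans (mul_le_mul_of_nonneg_left ?_ (by positivity))
    nlinarith [norm_nonneg y, pow_nonneg (norm_nonneg y) 3, sq_nonneg ‖y‖]
  have hpow : ∀ (y : EuclideanSpace ℝ (Fin d)), 0 ≤ q * ‖y‖ ∧ 0 ≤ q * ‖y‖ ^ 2 ∧ 0 ≤ q * ‖y‖ ^ 3 :=
    fun y => ⟨by positivity, by positivity, by positivity⟩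
  refine ⟨(contDiff_const.inner ℝ contDiff_id).mul (contDiff_quadForm Q), fun i y => ?_,
    fun i y => ?_, fun y => ?_, fun y => ?_, fun y => ?_, fun i y => ?_, fun i y => ?_⟩
  · exact ((hd1 i y).mul (hd2 i y)).congr_deriv (by simp)
  · exact (((hd2 i y).const_mul (ξ i)).add ((hd1 i y).mul (hd3 i y))).congr_deriv (by
      simp only [zero_smul, add_zero]; ring)
  · have e1 : ∑ i, y i * (ξ i * quadForm Q y + inner ℝ ξ y * (2 * rowForm Q i y)) =
        (∑ i, ξ i * y i) * quadForm Q y + 2 * inner ℝ ξ y * ∑ i, y i * rowForm Q i y := by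
      rw [Finset.sum_mul, Finset.mul_sum, ← Finset.sum_add_distrib]
      exact Finset.sum_congr rfl fun i _ => by ring
    rw [e1, ← quadForm_eq, ← inner_eq_sum_mul]
    push_cast; ring
  · rw [Finset.sum_add_distrib, ← Finset.mul_sum, ← Finset.mul_sum, ← Finset.mul_sum, htr, hsym]
    ring
  · refine key y ?_
    rw [abs_mul]
    have := mul_le_mul (hi y) (abs_quadForm_le Q y) (abs_nonneg _) (h0 y)
    rw [← hq] at this
    obtain ⟨p1, p2, p3⟩ := hpow y
    nlinarith
  · refine key y ((abs_add_le _ _).trans ?_)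
    rw [abs_mul, abs_mul, abs_mul 2, abs_two]
    have u1 := mul_le_mul (hξi i) (abs_quadForm_le Q y) (abs_nonneg _) zero_le_one
    rw [← hq] at u1
    have u2 := mul_le_mul (hi y) (hr i y) (abs_nonneg _) (h0 y)
    obtain ⟨p1, p2, p3⟩ := hpow y
    nlinarith
  · refine key y ((abs_add_le _ _).trans ?_)
    rw [abs_mul, abs_mul, abs_mul 2, abs_mul, abs_two, abs_of_nonneg (by norm_num : (0 : ℝ) ≤ 4)]
    have u1 := mul_le_mul (hξi i) (hr i y) (abs_nonneg _) zero_le_one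
    have u2 := mul_le_mul (hi y) (abs_entry_le Q i i) (abs_nonneg _) (h0 y)
    rw [← hq] at u2
    obtain ⟨p1, p2, p3⟩ := hpow y
    nlinarith

end

/-! ### The two profiles -/

namespace Profile

/-- The profile of the solution with right-hand side `ρ₀ + ρ₁ s` times `(s + τ²)^(-n/2-1)` for
quadratic harmonic polynomials. -/
def quadratic (n : ℕ) (ε ρ₀ ρ₁ : ℝ) : Profile where
  q₀ := -ρ₀ / (2 * n) - ρ₁ * ((n + 3) * (3 * n - 2) * ε ^ 2 / (12 * n * (n - 2) * (n - 1)))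
  q₁ := ρ₁ * ((n + 3) * ε / (12 * (n - 2)) * (2 / n - 1 / (n - 1)))
  A := -ρ₁ * ((3 * n - 1) / (12 * n * (n - 2)))
  B := -ρ₁ * ((n + 3) / (12 * n * (n - 2)))
  c₀ := -ρ₁ * ((n + 3) * n * ε ^ 3 / (6 * (n - 2) * (n - 1)))
  c₁ := ρ₁ * ((n + 3) * (3 * n - 2) * ε ^ 2 / (12 * (n - 2) * (n - 1)))
  c₂ := -ρ₁ * ((n + 3) * ε / (12 * (n - 2)))
  c₃ := -ρ₁ * ((n + 3) * ε / (12 * (n - 2) * (n - 1)))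

/-- The profile of the solution with right-hand side `ρ (s + τ²)^(-n/2-1)` for cubic harmonic
polynomials. -/
def cubic (n : ℕ) (ρ : ℝ) : Profile := ⟨-ρ / (4 * n), 0, 0, 0, 0, 0, 0, 0⟩

variable {n : ℕ} {s τ ε : ℝ} (ρ₀ ρ₁ ρ : ℝ)

/-- A single power suffices: for p = 3 the operator multiplies the constant q₀ by -2n(p-1) = -4n. -/
theorem cubic_laplace_eq (hn : 3 ≤ n) (hτ : 0 < τ) (hs : -τ ^ 2 < s) :
    4 * s * (cubic n ρ).dss n s τ + (2 * (n - 1) + 4 * (3 : ℕ)) * (cubic n ρ).ds n s τ +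
      (cubic n ρ).dττ n s τ = ρ * (s + τ ^ 2) ^ (-(n / 2 + 1 : ℝ)) := by
  rw [laplace_eq _ hτ hs]
  have : (0 : ℝ) < n := by exact_mod_cast (by omega : 0 < n)
  simp only [cubic, powCoeff, tailCoeff]
  push_cast
  field_simp
  ring

/-- For p = 2 the function k (s + σ²)^(-n/2-1) is the Kelvin transform of the harmonic polynomial k,
so k times the tail of order n/2+1 is harmonic; this is why the term with 4p - 8 drops out. The
other tail term vanishes because c₂ = (n-1) c₃, and the rest is a comparison of coefficients. -/
theorem quadratic_laplace_eq (hn : 3 ≤ n) (hτ : 0 < τ) (hs : -τ ^ 2 < s) :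
    4 * s * (quadratic n ε ρ₀ ρ₁).dss n s τ +
      (2 * (n - 1) + 4 * (2 : ℕ)) * (quadratic n ε ρ₀ ρ₁).ds n s τ +
      (quadratic n ε ρ₀ ρ₁).dττ n s τ = (ρ₀ + ρ₁ * s) * (s + τ ^ 2) ^ (-(n / 2 + 1 : ℝ)) := by
  rw [laplace_eq _ hτ hs]
  have h3 : (3 : ℝ) ≤ n := by exact_mod_cast hn
  have h0 : (n : ℝ) ≠ 0 := by positivity
  have h1 : (n : ℝ) - 1 ≠ 0 := by linarith
  have h2 : (n : ℝ) - 2 ≠ 0 := by linarith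
  have e1 : 2 * (quadratic n ε ρ₀ ρ₁).c₂ +
      (2 * (n - 1) + 4 * (2 : ℕ) - 4 * (n + 1)) * (quadratic n ε ρ₀ ρ₁).c₃ = 0 := by
    simp only [quadratic]; push_cast; field_simp; ring
  rw [e1]
  have e2 : ((4 : ℝ) * (2 : ℕ) - 8) = 0 := by norm_num
  rw [e2, zero_mul, zero_mul, zero_mul, sub_zero, add_zero]
  congr 1
  simp only [quadratic, powCoeff]
  push_cast
  field_simp
  ring

/-- The pure power D^(-n/2) already satisfies the Robin condition. What remains is matched
separately for D^(-n/2) and for the tail, which gives the two hypotheses. -/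
theorem dτ_eq_of_coeff {P : Profile} (hε : 0 < ε) (hs : 0 ≤ s)
    (h1 : P.tailCoeff s ε = (P.q₁ + 2 * P.B * ε) * (s + ε ^ 2))
    (h2 : P.c₁ + 2 * P.c₂ * ε = -n * ε * (P.q₁ + 2 * P.B * ε)) :
    P.dτ n s ε = -(n * ε / (s + ε ^ 2)) * P.val n s ε := by
  have hD : 0 < s + ε ^ 2 := by positivity
  have e1 : (s + ε ^ 2) ^ (-(n / 2 : ℝ)) = (s + ε ^ 2) ^ (-(n / 2 + 1 : ℝ)) * (s + ε ^ 2) := by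
    rw [← Real.rpow_add_one hD.ne']; congr 1; ring
  rw [dτ, val, h1, h2, e1]
  field_simp
  ring

theorem cubic_boundary (hε : 0 < ε) (hs : 0 ≤ s) :
    (cubic n ρ).dτ n s ε = -(n * ε / (s + ε ^ 2)) * (cubic n ρ).val n s ε :=
  dτ_eq_of_coeff hε hs (by simp [cubic, tailCoeff]) (by simp [cubic])

theorem quadratic_boundary (hn : 3 ≤ n) (hε : 0 < ε) (hs : 0 ≤ s) :
    (quadratic n ε ρ₀ ρ₁).dτ n s ε =
      -(n * ε / (s + ε ^ 2)) * (quadratic n ε ρ₀ ρ₁).val n s ε := by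
  have h3 : (3 : ℝ) ≤ n := by exact_mod_cast hn
  have h0 : (n : ℝ) ≠ 0 := by positivity
  have h1 : (n : ℝ) - 1 ≠ 0 := by linarith
  have h2 : (n : ℝ) - 2 ≠ 0 := by linarith
  refine dτ_eq_of_coeff hε hs ?_ ?_
  · simp only [quadratic, tailCoeff]
    field_simp
    ring
  · simp only [quadratic]
    field_simp
    ring

/-- Coefficients that depend continuously on a parameter in a compact set are bounded. -/
theorem exists_boundedBy {T : Type*} [TopologicalSpace T] {K : Set T} (hK : IsCompact K)
    (P : T → Profile) (h₁ : ContinuousOn (fun t => (P t).q₀) K)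
    (h₂ : ContinuousOn (fun t => (P t).q₁) K) (h₃ : ContinuousOn (fun t => (P t).A) K)
    (h₄ : ContinuousOn (fun t => (P t).B) K) (h₅ : ContinuousOn (fun t => (P t).c₀) K)
    (h₆ : ContinuousOn (fun t => (P t).c₁) K) (h₇ : ContinuousOn (fun t => (P t).c₂) K)
    (h₈ : ContinuousOn (fun t => (P t).c₃) K) : ∃ L, ∀ t ∈ K, (P t).BoundedBy L := by
  have hc : ContinuousOn (fun t => |(P t).q₀| + |(P t).q₁| + |(P t).A| + |(P t).B| + |(P t).c₀| +
      |(P t).c₁| + |(P t).c₂| + |(P t).c₃|) K :=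
    (((((((h₁.abs.add h₂.abs).add h₃.abs).add h₄.abs).add h₅.abs).add h₆.abs).add h₇.abs).add h₈.abs)
  obtain ⟨L, hL⟩ := hK.exists_bound_of_continuousOn hc
  refine ⟨L, fun t ht => ?_⟩
  have h := (le_abs_self _).trans (hL t ht)
  have a1 := abs_nonneg (P t).q₀
  have a2 := abs_nonneg (P t).q₁
  have a3 := abs_nonneg (P t).A
  have a4 := abs_nonneg (P t).B
  have a5 := abs_nonneg (P t).c₀
  have a6 := abs_nonneg (P t).c₁
  have a7 := abs_nonneg (P t).c₂
  have a8 := abs_nonneg (P t).c₃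
  constructor <;> linarith

end Profile

/-! ### Orthogonality on the boundary -/

/-- A continuous radial function that decays like `|y|^(-r)`. -/
structure IsRadialDecay {d : ℕ} (g : EuclideanSpace ℝ (Fin d) → ℝ) (r : ℝ) : Prop where
  continuous : Continuous g
  radial : ∃ G : ℝ → ℝ, ∀ y, g y = G ‖y‖
  bound : ∃ C, ∀ y, |g y| ≤ C * (1 + ‖y‖) ^ (-r)

/-! ### Integrals of radial functions against harmonic polynomials -/

section

variable {d : ℕ} {g g' : EuclideanSpace ℝ (Fin d) → ℝ} {r r' : ℝ}

namespace IsRadialDecay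

theorem mul (h : IsRadialDecay g r) (h' : IsRadialDecay g' r') :
    IsRadialDecay (fun y => g y * g' y) (r + r') := by
  obtain ⟨G, hG⟩ := h.radial
  obtain ⟨G', hG'⟩ := h'.radial
  obtain ⟨C, hC⟩ := h.bound
  obtain ⟨C', hC'⟩ := h'.bound
  refine ⟨h.continuous.mul h'.continuous, ⟨fun s => G s * G' s, fun y => by rw [hG, hG']⟩,
    ⟨C * C', fun y => ?_⟩⟩
  have h0 : 0 < 1 + ‖y‖ := by positivity
  rw [abs_mul, neg_add, Real.rpow_add h0]
  calc |g y| * |g' y| ≤ (C * (1 + ‖y‖) ^ (-r)) * (C' * (1 + ‖y‖) ^ (-r')) :=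
        mul_le_mul (hC y) (hC' y) (abs_nonneg _) ((abs_nonneg _).trans (hC y))
    _ = _ := by ring

theorem isRotationInvariant (h : IsRadialDecay g r) :
    IsRotationInvariant (volume : Measure (EuclideanSpace ℝ (Fin d))) id g where
  exists_lift A := by
    obtain ⟨G, hG⟩ := h.radial
    exact ⟨A.toMeasurableEquiv, A.measurePreserving, fun x => rfl, fun x => by
      rw [hG, hG]; congr 1; exact A.norm_map x⟩
  measurable_pos := measurable_id
  measurable_density := h.continuous.aestronglyMeasurable

theorem integrable_mul (h : IsRadialDecay g r) {p : EuclideanSpace ℝ (Fin d) → ℝ}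
    (hp : Continuous p) {c : ℝ} {k : ℕ} (hb : ∀ y, |p y| ≤ c * (1 + ‖y‖) ^ k)
    (hr : (d : ℝ) + k < r) : Integrable fun y => p y * g y := by
  obtain ⟨C, hC⟩ := h.bound
  have hi : Integrable (fun y : EuclideanSpace ℝ (Fin d) => (1 + ‖y‖) ^ (-(r - k))) :=
    integrable_one_add_norm (by rw [finrank_euclideanSpace_fin]; linarith)
  refine (hi.const_mul (c * C)).mono' (hp.mul h.continuous).aestronglyMeasurable
    (ae_of_all _ fun y => ?_)
  have h0 : 0 < 1 + ‖y‖ := by positivity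
  rw [Real.norm_eq_abs, abs_mul]
  calc |p y| * |g y| ≤ (c * (1 + ‖y‖) ^ k) * (C * (1 + ‖y‖) ^ (-r)) :=
        mul_le_mul (hb y) (hC y) (abs_nonneg _) ((abs_nonneg _).trans (hb y))
    _ = c * C * ((1 + ‖y‖) ^ (k : ℝ) * (1 + ‖y‖) ^ (-r)) := by rw [Real.rpow_natCast]; ring
    _ = _ := by rw [← Real.rpow_add h0]; congr 2; ring

variable {Q : Fin d → Fin d → ℝ} {ξ : EuclideanSpace ℝ (Fin d)}

theorem integrable_quadForm_mul (h : IsRadialDecay g r) (hr : (d : ℝ) + 4 < r) :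
    Integrable fun y => quadForm Q y * g y := by
  refine h.integrable_mul (contDiff_quadForm Q).continuous (k := 4) (c := ∑ i, ∑ j, |Q i j|)
    (fun y => (abs_quadForm_le Q y).trans (mul_le_mul_of_nonneg_left ?_ ?_)) (by push_cast; linarith)
  · have := norm_nonneg y
    calc ‖y‖ ^ 2 ≤ (1 + ‖y‖) ^ 2 := by gcongr; linarith
      _ ≤ (1 + ‖y‖) ^ 4 := pow_le_pow_right₀ (by linarith) (by norm_num)
  · exact Finset.sum_nonneg fun _ _ => Finset.sum_nonneg fun _ _ => abs_nonneg _

theorem integrable_inner_mul_quadForm_mul (h : IsRadialDecay g r) (hr : (d : ℝ) + 4 < r) :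
    Integrable fun y => inner ℝ ξ y * quadForm Q y * g y := by
  have hq : 0 ≤ ∑ i, ∑ j, |Q i j| :=
    Finset.sum_nonneg fun _ _ => Finset.sum_nonneg fun _ _ => abs_nonneg _
  refine h.integrable_mul ((contDiff_const.inner ℝ contDiff_id).mul (contDiff_quadForm Q)).continuous
    (k := 4) (c := ‖ξ‖ * ∑ i, ∑ j, |Q i j|) (fun y => ?_) (by push_cast; linarith)
  have h0 := norm_nonneg y
  rw [abs_mul]
  calc |inner ℝ ξ y| * |quadForm Q y| ≤ (‖ξ‖ * ‖y‖) * ((∑ i, ∑ j, |Q i j|) * ‖y‖ ^ 2) :=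
        mul_le_mul (abs_real_inner_le_norm _ _) (abs_quadForm_le Q y) (abs_nonneg _) (by positivity)
    _ = (‖ξ‖ * ∑ i, ∑ j, |Q i j|) * ‖y‖ ^ 3 := by ring
    _ ≤ (‖ξ‖ * ∑ i, ∑ j, |Q i j|) * (1 + ‖y‖) ^ 4 := by
        refine mul_le_mul_of_nonneg_left ?_ (by positivity)
        calc ‖y‖ ^ 3 ≤ (1 + ‖y‖) ^ 3 := by gcongr; linarith
          _ ≤ (1 + ‖y‖) ^ 4 := pow_le_pow_right₀ (by linarith) (by norm_num)

theorem integrable_coord_mul_quadForm_mul (h : IsRadialDecay g r) (hr : (d : ℝ) + 4 < r) (k : Fin d) :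
    Integrable fun y => y k * quadForm Q y * g y := by
  have := h.integrable_inner_mul_quadForm_mul (Q := Q) (ξ := EuclideanSpace.single k 1) hr
  simpa [EuclideanSpace.inner_single_left] using this

theorem integrable_coord_mul_inner_mul_quadForm_mul (h : IsRadialDecay g r) (hr : (d : ℝ) + 4 < r)
    (k : Fin d) : Integrable fun y => y k * (inner ℝ ξ y * quadForm Q y) * g y := by
  have hq : 0 ≤ ∑ i, ∑ j, |Q i j| :=
    Finset.sum_nonneg fun _ _ => Finset.sum_nonneg fun _ _ => abs_nonneg _
  have hc := (contDiff_quadForm Q).continuous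
  refine h.integrable_mul (p := fun y => y k * (inner ℝ ξ y * quadForm Q y)) (by fun_prop)
    (k := 4) (c := ‖ξ‖ * ∑ i, ∑ j, |Q i j|) (fun y => ?_) (by push_cast; linarith)
  have h0 := norm_nonneg y
  rw [abs_mul, abs_mul]
  calc |y k| * (|inner ℝ ξ y| * |quadForm Q y|) ≤
        ‖y‖ * ((‖ξ‖ * ‖y‖) * ((∑ i, ∑ j, |Q i j|) * ‖y‖ ^ 2)) :=
        mul_le_mul (PiLp.norm_apply_le y k) (mul_le_mul (abs_real_inner_le_norm _ _)
          (abs_quadForm_le Q y) (abs_nonneg _) (by positivity)) (by positivity) (norm_nonneg y)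
    _ = (‖ξ‖ * ∑ i, ∑ j, |Q i j|) * ‖y‖ ^ 4 := by ring
    _ ≤ (‖ξ‖ * ∑ i, ∑ j, |Q i j|) * (1 + ‖y‖) ^ 4 := by
        refine mul_le_mul_of_nonneg_left ?_ (by positivity)
        gcongr; linarith

/-- A trace-free quadratic form has mean zero on spheres. -/
theorem integral_quadForm_mul (h : IsRadialDecay g r) (hr : (d : ℝ) + 4 < r)
    (htr : ∑ i, Q i i = 0) : ∫ y, quadForm Q y * g y = 0 := by
  rcases Nat.eq_zero_or_pos d with rfl | hd
  · simp [quadForm]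
  have hi : Integrable (fun y => ‖id y‖ ^ 2 * g y) :=
    h.integrable_mul (c := 1) (k := 2) (by simp only [id]; fun_prop) (fun y => by
      rw [abs_of_nonneg (by positivity), one_mul]
      exact pow_le_pow_left₀ (norm_nonneg _) (by simp) 2) (by push_cast; linarith)
  have := h.isRotationInvariant.integral_quadratic hd hi Q
  simpa [htr, quadForm] using this

theorem integral_inner_mul_quadForm_mul (h : IsRadialDecay g r) :
    ∫ y, inner ℝ ξ y * quadForm Q y * g y = 0 := by
  refine h.isRotationInvariant.integral_odd (F := fun y => inner ℝ ξ y * quadForm Q y) fun y => ?_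
  simp [quadForm, inner_neg_right]

theorem integral_coord_mul_quadForm_mul (h : IsRadialDecay g r) (k : Fin d) :
    ∫ y, y k * quadForm Q y * g y = 0 := by
  refine h.isRotationInvariant.integral_odd (F := fun y => y k * quadForm Q y) fun y => ?_
  simp [quadForm]

/-- A product of harmonics of degree one and three: the pairing formula involves only the trace of Q
and Qξ, and both vanish. -/
theorem integral_coord_mul_inner_mul_quadForm_mul (h : IsRadialDecay g r) (hr : (d : ℝ) + 4 < r)
    (hQ : ∀ i j, Q i j = Q j i) (htr : ∑ i, Q i i = 0) (hQξ : ∀ i, rowForm Q i ξ = 0) (k : Fin d) :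
    ∫ y, y k * (inner ℝ ξ y * quadForm Q y) * g y = 0 := by
  have hd : 0 < d := k.pos
  have hi : Integrable (fun y => ‖id y‖ ^ 4 * g y) :=
    h.integrable_mul (c := 1) (k := 4) (by simp only [id]; fun_prop) (fun y => by
      rw [abs_of_nonneg (by positivity), one_mul]
      exact pow_le_pow_left₀ (norm_nonneg _) (by simp) 4) (by push_cast; linarith)
  have := h.isRotationInvariant.integral_quartic hd hi
    (fun a b i j => (if a = k then 1 else 0) * ξ b * Q i j)
  have e : ∀ y : EuclideanSpace ℝ (Fin d), ∑ a, ∑ b, ∑ i, ∑ j,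
      (if a = k then 1 else 0) * ξ b * Q i j * y a * y b * y i * y j =
      y k * (inner ℝ ξ y * quadForm Q y) := fun y => by
    have : y k = ∑ a, (if a = k then 1 else 0) * y a := by simp
    rw [this, inner_eq_sum_mul, quadForm, Finset.sum_mul]
    refine Finset.sum_congr rfl fun a _ => ?_
    rw [Finset.sum_mul, Finset.mul_sum]
    refine Finset.sum_congr rfl fun b _ => ?_
    rw [Finset.mul_sum, Finset.mul_sum]
    refine Finset.sum_congr rfl fun i _ => ?_
    rw [Finset.mul_sum, Finset.mul_sum]
    exact Finset.sum_congr rfl fun j _ => by ring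
  have e2 : ∑ a, ∑ b, ((if a = k then 1 else 0) * ξ a * Q b b +
      (if a = k then 1 else 0) * ξ b * Q a b + (if a = k then 1 else 0) * ξ b * Q b a) = 0 := by
    have : ∀ a, ∑ b, ((if a = k then 1 else 0) * ξ a * Q b b +
        (if a = k then 1 else 0) * ξ b * Q a b + (if a = k then 1 else 0) * ξ b * Q b a) =
        (if a = k then 1 else 0) * (ξ a * ∑ b, Q b b + 2 * rowForm Q a ξ) := fun a => by
      rw [rowForm, mul_add, Finset.mul_sum, Finset.mul_sum, Finset.mul_sum, Finset.mul_sum,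
        ← Finset.sum_add_distrib]
      refine Finset.sum_congr rfl fun b _ => ?_
      rw [hQ b a]; ring
    rw [Finset.sum_congr rfl fun a _ => this a]
    simp [htr, hQξ]
  simp only [id, e, e2] at this
  rw [this]; simp

end IsRadialDecay

end

/-! ### Orthogonality to the functions φ on the boundary -/

section

variable {n : ℕ} {ξ : Bdry n} {ε : ℝ} {Q : Fin (n - 1) → Fin (n - 1) → ℝ}

theorem isRadialDecay_of_le (hε : 1 / 2 ≤ ε) {g : Bdry n → ℝ} (hc : Continuous g)
    (hr : ∃ G : ℝ → ℝ, ∀ y, g y = G ‖y‖) {C β : ℝ} (hβ : 0 ≤ β)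
    (hb : ∀ y, |g y| ≤ C * (‖y‖ ^ 2 + ε ^ 2) ^ (-β)) : IsRadialDecay g (2 * β) := by
  refine ⟨hc, hr, ⟨|C| * 25 ^ β, fun y => (hb y).trans ?_⟩⟩
  have h := den_rpow_neg_le (n := n) (ξ := 0) (x := (y, 0)) (by simp) hε le_rfl hβ
  have e : den 0 ε ((y, 0) : Space n) = ‖y‖ ^ 2 + ε ^ 2 := by simp [den, add_comm]
  have e' : ‖((y, 0) : Space n)‖ = ‖y‖ := by simp [Prod.norm_def]
  rw [e, e'] at h
  have h0 : (0 : ℝ) ≤ (‖y‖ ^ 2 + ε ^ 2) ^ (-β) := by positivity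
  calc C * (‖y‖ ^ 2 + ε ^ 2) ^ (-β) ≤ |C| * (25 ^ β * (1 + ‖y‖) ^ (-(2 * β))) :=
        mul_le_mul (le_abs_self C) h h0 (abs_nonneg _)
    _ = _ := by ring

/-- The value of `φ_(0,ε,n)` on the boundary. -/
theorem isRadialDecay_phiNormal (hε : 1 / 2 ≤ ε) :
    IsRadialDecay (fun y : Bdry n => phiNormal 0 ε (y, 0)) n := by
  have hε0 : 0 < ε := by linarith
  have hD : ∀ y : Bdry n, 0 < ‖y‖ ^ 2 + ε ^ 2 := fun y => by positivity
  have e : (fun y : Bdry n => phiNormal 0 ε (y, 0)) = fun y =>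
      (ε / (‖y‖ ^ 2 + ε ^ 2)) ^ ((n : ℝ) / 2) * ((ε ^ 2 - ‖y‖ ^ 2) / (‖y‖ ^ 2 + ε ^ 2)) := by
    funext y; simp [phiNormal, den, add_comm]
  have := isRadialDecay_of_le (n := n) hε (g := fun y : Bdry n => phiNormal 0 ε (y, 0)) (β := n / 2)
    (C := ε ^ ((n : ℝ) / 2)) ?_ ?_ (by positivity) ?_
  · rwa [show 2 * ((n : ℝ) / 2) = n by ring] at this
  · rw [e]
    refine Continuous.mul (Continuous.rpow_const ?_ fun y => Or.inl (div_pos hε0 (hD y)).ne') ?_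
    · exact continuous_const.div (by fun_prop) fun y => (hD y).ne'
    · exact Continuous.div (by fun_prop) (by fun_prop) fun y => (hD y).ne'
  · exact ⟨fun s => (ε / (s ^ 2 + ε ^ 2)) ^ ((n : ℝ) / 2) * ((ε ^ 2 - s ^ 2) / (s ^ 2 + ε ^ 2)),
      congrFun e⟩
  · intro y
    rw [congrFun e y, abs_mul, Real.div_rpow hε0.le (hD y).le, Real.rpow_neg (hD y).le]
    have h1 : |(ε ^ 2 - ‖y‖ ^ 2) / (‖y‖ ^ 2 + ε ^ 2)| ≤ 1 := by
      rw [abs_div, abs_of_pos (hD y), div_le_one (hD y), abs_le]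
      constructor <;> nlinarith [sq_nonneg ‖y‖, sq_nonneg ε]
    rw [abs_of_nonneg (by have := hD y; positivity), div_eq_mul_inv]
    exact mul_le_of_le_one_right (by have := hD y; positivity) h1

/-- The coordinate y_k is split off from φ_(0,ε,k), so that a radial function remains. -/
theorem isRadialDecay_phiTangential (hε : 1 / 2 ≤ ε) :
    IsRadialDecay (fun y : Bdry n =>
      (ε / (‖y‖ ^ 2 + ε ^ 2)) ^ ((n : ℝ) / 2) * (2 * ε / (‖y‖ ^ 2 + ε ^ 2))) n := by
  have hε0 : 0 < ε := by linarith
  have hD : ∀ y : Bdry n, 0 < ‖y‖ ^ 2 + ε ^ 2 := fun y => by positivity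
  have := isRadialDecay_of_le (n := n) hε (g := fun y : Bdry n =>
      (ε / (‖y‖ ^ 2 + ε ^ 2)) ^ ((n : ℝ) / 2) * (2 * ε / (‖y‖ ^ 2 + ε ^ 2))) (β := n / 2)
    (C := ε ^ ((n : ℝ) / 2) * (2 / ε)) ?_ ?_ (by positivity) ?_
  · rwa [show 2 * ((n : ℝ) / 2) = n by ring] at this
  · refine Continuous.mul (Continuous.rpow_const ?_ fun y => Or.inl (div_pos hε0 (hD y)).ne') ?_
    · exact continuous_const.div (by fun_prop) fun y => (hD y).ne'
    · exact Continuous.div (by fun_prop) (by fun_prop) fun y => (hD y).ne'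
  · exact ⟨fun s => (ε / (s ^ 2 + ε ^ 2)) ^ ((n : ℝ) / 2) * (2 * ε / (s ^ 2 + ε ^ 2)), fun y => rfl⟩
  · intro y
    have hy := hD y
    rw [abs_of_nonneg (by positivity), Real.div_rpow hε0.le hy.le, Real.rpow_neg hy.le, div_eq_mul_inv]
    have h1 : 2 * ε / (‖y‖ ^ 2 + ε ^ 2) ≤ 2 / ε := by
      rw [div_le_div_iff₀ hy hε0]; nlinarith [sq_nonneg ‖y‖]
    calc _ ≤ ε ^ ((n : ℝ) / 2) * ((‖y‖ ^ 2 + ε ^ 2) ^ ((n : ℝ) / 2))⁻¹ * (2 / ε) :=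
          mul_le_mul_of_nonneg_left h1 (by positivity)
      _ = _ := by ring

/-- Boundary values built from harmonic polynomials of degree two and three are orthogonal to the
kernel of the linearized boundary operator. -/
theorem orthogonal_of_harmonic (hn : 8 ≤ n) (hε : 1 / 2 ≤ ε) (hQ : ∀ i j, Q i j = Q j i)
    (htr : ∑ i, Q i i = 0) (hQξ : ∀ i, rowForm Q i ξ = 0) {g₂ g₃ : Bdry n → ℝ}
    (h₂ : IsRadialDecay g₂ (n - 2)) (h₃ : IsRadialDecay g₃ (n - 2)) {E : Bdry n → ℝ}
    (hE : ∀ y, E y = quadForm Q (y - ξ) * g₂ (y - ξ) +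
      inner ℝ ξ (y - ξ) * quadForm Q (y - ξ) * g₃ (y - ξ)) :
    (∫ y : Bdry n, phiNormal ξ ε (y, 0) * E y = 0) ∧
    ∀ k, ∫ y : Bdry n, phiTangential ξ ε k (y, 0) * E y = 0 := by
  have h8 : (8 : ℝ) ≤ n := by exact_mod_cast hn
  have hd : ((n - 1 : ℕ) : ℝ) = n - 1 := by rw [Nat.cast_sub (by omega), Nat.cast_one]
  have hr : ((n - 1 : ℕ) : ℝ) + 4 < n + (n - 2) := by rw [hd]; linarith
  constructor
  · have w₂ := (isRadialDecay_phiNormal (n := n) hε).mul h₂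
    have w₃ := (isRadialDecay_phiNormal (n := n) hε).mul h₃
    have e : ∀ y : Bdry n, phiNormal ξ ε (y, 0) * E y =
        (fun z => quadForm Q z * (phiNormal 0 ε (z, 0) * g₂ z) +
          inner ℝ ξ z * quadForm Q z * (phiNormal 0 ε (z, 0) * g₃ z)) (y - ξ) := fun y => by
      rw [hE]
      simp only [phiNormal, den, sub_zero]
      ring
    rw [integral_congr_ae (ae_of_all _ e), integral_sub_right_eq_self (fun z : Bdry n =>
      quadForm Q z * (phiNormal 0 ε (z, 0) * g₂ z) +
          inner ℝ ξ z * quadForm Q z * (phiNormal 0 ε (z, 0) * g₃ z)) ξ,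
      integral_add (w₂.integrable_quadForm_mul hr) (w₃.integrable_inner_mul_quadForm_mul hr),
      w₂.integral_quadForm_mul hr htr, w₃.integral_inner_mul_quadForm_mul, add_zero]
  · intro k
    have w₂ := (isRadialDecay_phiTangential (n := n) hε).mul h₂
    have w₃ := (isRadialDecay_phiTangential (n := n) hε).mul h₃
    set φ : Bdry n → ℝ := fun y =>
      (ε / (‖y‖ ^ 2 + ε ^ 2)) ^ ((n : ℝ) / 2) * (2 * ε / (‖y‖ ^ 2 + ε ^ 2)) with hφ
    have e : ∀ y : Bdry n, phiTangential ξ ε k (y, 0) * E y =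
        (fun z : Bdry n => z k * quadForm Q z * (φ z * g₂ z) +
          z k * (inner ℝ ξ z * quadForm Q z) * (φ z * g₃ z)) (y - ξ) := fun y => by
      rw [hE]
      simp only [phiTangential, den, hφ, PiLp.sub_apply, add_zero]
      rw [add_comm (ε ^ 2)]
      ring
    rw [integral_congr_ae (ae_of_all _ e), integral_sub_right_eq_self (fun z : Bdry n =>
      z k * quadForm Q z * (φ z * g₂ z) + z k * (inner ℝ ξ z * quadForm Q z) * (φ z * g₃ z)) ξ,
      integral_add (w₂.integrable_coord_mul_quadForm_mul hr k)
        (w₃.integrable_coord_mul_inner_mul_quadForm_mul hr k),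
      w₂.integral_coord_mul_quadForm_mul, w₃.integral_coord_mul_inner_mul_quadForm_mul hr hQ htr hQξ,
      add_zero]

end

/-! ### Explicit correctors -/

section

variable {n : ℕ}

theorem Profile.BoundedBy.isRadialDecay_val {P : Profile} {L ε : ℝ} (hP : P.BoundedBy L) (hn : 2 ≤ n)
    (hε : 1 / 2 ≤ ε) : IsRadialDecay (fun y : Bdry n => P.val n (‖y‖ ^ 2) ε) (n - 2) := by
  have hε0 : 0 < ε := by linarith
  have h2 : (2 : ℝ) ≤ n := by exact_mod_cast hn
  have := isRadialDecay_of_le (n := n) hε (g := fun y : Bdry n => P.val n (‖y‖ ^ 2) ε)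
    (β := (n : ℝ) / 2 - 1) (C := 600 * (n + 2) ^ 2 * L) ?_ ⟨fun s => P.val n (s ^ 2) ε, fun y => rfl⟩
    (by linarith) ?_
  · rwa [show 2 * ((n : ℝ) / 2 - 1) = n - 2 by ring] at this
  · refine continuous_iff_continuousAt.2 fun y => ?_
    have hs : -ε ^ 2 < ‖y‖ ^ 2 := by
      have : 0 < ε ^ 2 := by positivity
      linarith [sq_nonneg ‖y‖]
    have hg := (P.contDiffAt_val (n := n) hε0 hs).continuousAt
    exact ContinuousAt.comp (g := fun p : ℝ × ℝ => P.val n p.1 p.2)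
      (f := fun y : Bdry n => (‖y‖ ^ 2, ε)) hg (by fun_prop)
  · intro y
    have hD : 0 < ‖y‖ ^ 2 + ε ^ 2 := by positivity
    refine (hP.bounds (n := n) (sq_nonneg ‖y‖) hε).1.trans (le_of_eq ?_)
    congr 1
    rw [mul_comm, ← Real.rpow_add_one hD.ne']
    congr 1; ring

/-- The right-hand side splits into (κ(a - |ξ|²) - κ|y|²) Q(y), solved by the quadratic profile, and
-2κ (ξ·y) Q(y), solved by the cubic one. The profile coefficients are continuous in (ε, |ξ|²) on a
compact set, so one constant L serves for all parameters, and the bound is linear in Q. -/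
theorem exists_uniform_solution (hn : 8 ≤ n) {κ : ℝ → ℝ}
    (hκ : ContinuousOn κ (Set.Icc (1 / 2) 2)) (a : ℝ) :
    ∃ L, ∀ (ξ : Bdry n) (ε : ℝ) (Q : Fin (n - 1) → Fin (n - 1) → ℝ), ‖ξ‖ ≤ 1 →
      ε ∈ Set.Icc (1 / 2 : ℝ) 2 → (∀ i j, Q i j = Q j i) → ∑ i, Q i i = 0 →
      (∀ i, rowForm Q i ξ = 0) → ∃ (E : Space n → ℝ) (C : ℝ),
        IsDecayingSolution ξ ε E (fun x => κ ε * quadForm Q (x.1 - ξ) *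
          (a - ‖ξ‖ ^ 2 - ‖x.1 - ξ‖ ^ 2 - 2 * inner ℝ ξ (x.1 - ξ)) *
            den ξ ε x ^ (-(n / 2 + 1 : ℝ))) (n - 8) (L * ∑ i, ∑ j, |Q i j|) C ∧
        (∫ y : Bdry n, phiNormal ξ ε (y, 0) * E (y, 0) = 0) ∧
        ∀ k, ∫ y : Bdry n, phiTangential ξ ε k (y, 0) * E (y, 0) = 0 := by
  set K : Set (ℝ × ℝ) := Set.Icc (1 / 2) 2 ×ˢ Set.Icc 0 1
  have hK : IsCompact K := isCompact_Icc.prod isCompact_Icc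
  obtain ⟨θ, hθ⟩ : ∃ θ : ℝ × ℝ → ℝ, ∀ t, θ t = κ t.1 := ⟨fun t => κ t.1, fun t => rfl⟩
  have hθ' : ContinuousOn θ K := by
    rw [funext hθ]
    exact hκ.comp continuousOn_fst fun t ht => ht.1
  obtain ⟨L₂, hL₂⟩ := Profile.exists_boundedBy hK
    (fun t => Profile.quadratic n t.1 (θ t * (a - t.2)) (-θ t))
    (by simp only [Profile.quadratic]; fun_prop) (by simp only [Profile.quadratic]; fun_prop)
    (by simp only [Profile.quadratic]; fun_prop) (by simp only [Profile.quadratic]; fun_prop)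
    (by simp only [Profile.quadratic]; fun_prop) (by simp only [Profile.quadratic]; fun_prop)
    (by simp only [Profile.quadratic]; fun_prop) (by simp only [Profile.quadratic]; fun_prop)
  obtain ⟨L₃, hL₃⟩ := Profile.exists_boundedBy hK
    (fun t => Profile.cubic n (-2 * θ t))
    (by simp only [Profile.cubic]; fun_prop) (by simp only [Profile.cubic]; fun_prop)
    (by simp only [Profile.cubic]; fun_prop) (by simp only [Profile.cubic]; fun_prop)
    (by simp only [Profile.cubic]; fun_prop) (by simp only [Profile.cubic]; fun_prop)
    (by simp only [Profile.cubic]; fun_prop) (by simp only [Profile.cubic]; fun_prop)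
  refine ⟨240000 * 25 ^ ((n : ℝ) / 2 - 4) * (n + 2) ^ 2 * L₂ * 6 +
    240000 * 25 ^ ((n : ℝ) / 2 - 4) * (n + 2) ^ 2 * L₃ * 6, fun ξ ε Q hξ hε hQ htr hQξ => ?_⟩
  have ht : ((ε, ‖ξ‖ ^ 2) : ℝ × ℝ) ∈ K :=
    ⟨hε, ⟨sq_nonneg _, pow_le_one₀ (norm_nonneg _) hξ⟩⟩
  have hP₂ := hL₂ _ ht
  have hP₃ := hL₃ _ ht
  simp only [hθ] at hP₂ hP₃
  set P₂ := Profile.quadratic n ε (κ ε * (a - ‖ξ‖ ^ 2)) (-κ ε)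
  set P₃ := Profile.cubic n (-2 * κ ε)
  have hε0 : 0 < ε := by linarith [hε.1]
  obtain ⟨E₂, C₂, h₂, e₂⟩ := exists_isDecayingSolution hn hξ hε.1 (isSolidHarmonic_quadForm hQ htr) hP₂
    fun s hs => Profile.quadratic_boundary _ _ (by omega) hε0 hs
  obtain ⟨E₃, C₃, h₃, e₃⟩ := exists_isDecayingSolution hn hξ hε.1
    (isSolidHarmonic_inner_mul_quadForm hQ htr hξ hQξ) hP₃
    fun s hs => Profile.cubic_boundary _ hε0 hs
  have hadd := h₂.add h₃
  refine ⟨fun x => E₂ x + E₃ x, C₂ + C₃, ⟨hadd.contDiff, ?_, hadd.bound_fderiv,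
    hadd.bound_tangential, hadd.bound_normal, ?_, hadd.boundary⟩, ?_⟩
  · intro x hx
    refine (hadd.bound x hx).trans (le_of_eq ?_)
    ring
  · intro x hx
    rw [hadd.laplacian_eq x hx]
    have hx2 : 0 ≤ x.2 := hx
    have hτ : 0 < ε + x.2 := by linarith
    have hs : -(ε + x.2) ^ 2 < ‖x.1 - ξ‖ ^ 2 := by
      have : 0 < (ε + x.2) ^ 2 := by positivity
      linarith [sq_nonneg ‖x.1 - ξ‖]
    simp only [profileProduct]
    rw [Profile.quadratic_laplace_eq _ _ (by omega) hτ hs, Profile.cubic_laplace_eq _ (by omega) hτ hs,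
      show ‖x.1 - ξ‖ ^ 2 + (ε + x.2) ^ 2 = den ξ ε x by unfold den; ring]
    ring
  · refine orthogonal_of_harmonic (E := fun y => E₂ (y, 0) + E₃ (y, 0)) hn hε.1 hQ htr hQξ
      (hP₂.isRadialDecay_val (by omega) hε.1) (hP₃.isRadialDecay_val (by omega) hε.1) fun y => ?_
    have hy : ((y, 0) : Space n) ∈ halfSpace n := le_refl (0 : ℝ)
    simp only [e₂ _ hy, e₃ _ hy, profileProduct, add_zero]

end

/-! ### Derivatives of the bubble -/

section

variable {n : ℕ} {ξ : Bdry n} {ε : ℝ}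

theorem hasDerivAt_den_rpow_line {x : Space n} (hx : -ε < x.2) (β : ℝ) (i : Fin (n - 1)) :
    HasDerivAt (fun l : ℝ => den ξ ε (x + l • (EuclideanSpace.single i 1, 0)) ^ (-β))
      (-2 * β * (x.1 - ξ) i * den ξ ε x ^ (-(β + 1))) 0 := by
  have hD := den_pos_of_neg_lt (ξ := ξ) hx
  have e : (fun l : ℝ => den ξ ε (x + l • (EuclideanSpace.single i 1, 0))) = fun l =>
      (ε + x.2) ^ 2 + ‖x.1 - ξ + l • EuclideanSpace.single i (1 : ℝ)‖ ^ 2 := by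
    funext l
    simp [den, add_sub_right_comm]
  have h : HasDerivAt (fun l : ℝ => den ξ ε (x + l • (EuclideanSpace.single i 1, 0)))
      (2 * (x.1 - ξ) i) 0 := by
    rw [e]; exact (hasDerivAt_norm_sq_line (x.1 - ξ) i).const_add _
  have h0 : den ξ ε (x + (0 : ℝ) • (EuclideanSpace.single i 1, 0)) = den ξ ε x := by simp
  have := h.rpow_const (p := -β) (Or.inl (by rw [h0]; exact hD.ne'))
  refine this.congr_deriv ?_
  rw [h0, show -β - 1 = -(β + 1) by ring]
  ring

theorem bubble_eq {x : Space n} (hε : 0 < ε) (hx : -ε < x.2) :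
    bubble ξ ε x = ε ^ (((n : ℝ) - 2) / 2) * den ξ ε x ^ (-(((n : ℝ) - 2) / 2)) := by
  have hD := den_pos_of_neg_lt (ξ := ξ) hx
  rw [bubble, Real.div_rpow hε.le hD.le, Real.rpow_neg hD.le, div_eq_mul_inv]

theorem differentiableAt_den_rpow {x : Space n} (hx : -ε < x.2) (β : ℝ) :
    DifferentiableAt ℝ (fun x : Space n => den ξ ε x ^ β) x :=
  (contDiff_den.differentiable (by simp) x).rpow_const (Or.inl (den_pos_of_neg_lt hx).ne')

theorem isOpen_neg_lt : IsOpen {x : Space n | -ε < x.2} := isOpen_lt continuous_const continuous_snd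

theorem eventuallyEq_of_neg_lt {F G : Space n → ℝ} (h : ∀ x : Space n, -ε < x.2 → F x = G x)
    {x : Space n} (hx : -ε < x.2) : F =ᶠ[𝓝 x] G := by
  filter_upwards [isOpen_neg_lt.mem_nhds hx] with z hz using h z hz

theorem pd_bubble (hε : 0 < ε) (i : Fin (n - 1)) {x : Space n} (hx : -ε < x.2) :
    pd i (bubble ξ ε) x = -(n - 2) * ε ^ (((n : ℝ) - 2) / 2) * ((x.1 - ξ) i *
      den ξ ε x ^ (-(n / 2 : ℝ))) := by
  have hev := eventuallyEq_of_neg_lt (fun z hz => bubble_eq (ξ := ξ) hε hz) hx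
  rw [pd, hev.fderiv_eq]
  refine fderiv_apply_eq_of_line ((differentiableAt_den_rpow hx _).const_mul _) EventuallyEq.rfl ?_
  refine ((hasDerivAt_den_rpow_line hx _ i).const_mul _).congr_deriv ?_
  rw [show ((n : ℝ) - 2) / 2 + 1 = n / 2 by ring]
  ring

theorem pd_pd_bubble (hε : 0 < ε) (i j : Fin (n - 1)) {x : Space n} (hx : -ε < x.2) :
    pd i (pd j (bubble ξ ε)) x = -(n - 2) * ε ^ (((n : ℝ) - 2) / 2) *
      ((if i = j then 1 else 0) * den ξ ε x ^ (-(n / 2 : ℝ)) -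
        n * (x.1 - ξ) i * (x.1 - ξ) j * den ξ ε x ^ (-(n / 2 + 1 : ℝ))) := by
  have hev := eventuallyEq_of_neg_lt (fun z hz => pd_bubble (ξ := ξ) hε j hz) hx
  rw [pd, hev.fderiv_eq]
  refine fderiv_apply_eq_of_line (DifferentiableAt.const_mul (DifferentiableAt.mul (by fun_prop)
    (differentiableAt_den_rpow hx _)) _) EventuallyEq.rfl ?_
  have hc : HasDerivAt (fun l : ℝ => (((x + l • (EuclideanSpace.single i (1 : ℝ), (0 : ℝ))).1 - ξ) j))
      (if i = j then 1 else 0) 0 := by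
    refine hasDerivAt_zero_of_quadratic (a := (x.1 - ξ) j) (c := 0) fun l => ?_
    by_cases h : i = j
    · subst h; simp; ring
    · simp [h, Ne.symm h]
  refine ((hc.mul (hasDerivAt_den_rpow_line hx _ i)).const_mul _).congr_deriv ?_
  simp only [zero_smul, add_zero]
  ring

end

/-! ### The tangential part of the Weyl tensor -/

/-- The algebraic properties of the tangential components of the Weyl tensor. -/
structure IsTangentialCurvature {d : ℕ} (R : Fin d → Fin d → Fin d → Fin d → ℝ) : Prop where
  antisymm_left : ∀ i j k l, R i j k l = -R j i k l
  antisymm_right : ∀ i j k l, R i j k l = -R i j l k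
  pair_symm : ∀ i j k l, R i j k l = R k l i j
  bianchi : ∀ i j k l, R i j k l + R i k l j + R i l j k = 0
  traceFree : ∀ k l, ∑ i, R i k i l = 0

section

variable {d : ℕ} {R : Fin d → Fin d → Fin d → Fin d → ℝ}

/-- `∑ R_{ikjl} xᵏ xˡ`. -/
def curvForm (R : Fin d → Fin d → Fin d → Fin d → ℝ) (i j : Fin d)
    (x : EuclideanSpace ℝ (Fin d)) : ℝ := ∑ k, ∑ l, R i k j l * x k * x l

theorem sum_antisymm {A : Fin d → Fin d → ℝ} (hA : ∀ i j, A i j = -A j i) (y : Fin d → ℝ) :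
    ∑ i, ∑ j, A i j * y i * y j = 0 := by
  have h : ∑ i, ∑ j, A i j * y i * y j = -∑ i, ∑ j, A i j * y i * y j := by
    conv_rhs => rw [Finset.sum_comm]
    rw [← Finset.sum_neg_distrib]
    refine Finset.sum_congr rfl fun i _ => ?_
    rw [← Finset.sum_neg_distrib]
    refine Finset.sum_congr rfl fun j _ => ?_
    rw [hA i j]; ring
  linarith

theorem eq_zero_of_quadForm_eq_zero {S : Fin d → Fin d → ℝ} (hS : ∀ i j, S i j = S j i)
    (h : ∀ y, quadForm S y = 0) (i j : Fin d) : S i j = 0 := by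
  have hdiag : ∀ i, S i i = 0 := fun i => by
    have := h (EuclideanSpace.single i 1)
    simpa [quadForm, PiLp.single_apply] using this
  have hz := h (EuclideanSpace.single j 1 + (1 : ℝ) • EuclideanSpace.single i 1)
  rw [quadForm_add_smul_single hS, h, hdiag] at hz
  simpa [rowForm, PiLp.single_apply] using hz

namespace IsTangentialCurvature

theorem curvForm_symm (hR : IsTangentialCurvature R) (i j : Fin d) (x : EuclideanSpace ℝ (Fin d)) :
    curvForm R i j x = curvForm R j i x := by
  rw [curvForm, curvForm, Finset.sum_comm]
  refine Finset.sum_congr rfl fun l _ => Finset.sum_congr rfl fun k _ => ?_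
  rw [hR.pair_symm i k j l]; ring

theorem sum_curvForm_diag (hR : IsTangentialCurvature R) (x : EuclideanSpace ℝ (Fin d)) :
    ∑ i, curvForm R i i x = 0 := by
  simp only [curvForm]
  rw [Finset.sum_comm]
  refine Finset.sum_eq_zero fun k _ => ?_
  rw [Finset.sum_comm]
  refine Finset.sum_eq_zero fun l _ => ?_
  rw [← Finset.sum_mul, ← Finset.sum_mul, hR.traceFree, zero_mul, zero_mul]

/-- This is H_{ij}(x) x_j = 0: two copies of x meet an antisymmetric pair of indices. -/
theorem rowForm_curvForm_self (hR : IsTangentialCurvature R) (x : EuclideanSpace ℝ (Fin d)) (i : Fin d) :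
    rowForm (fun i j => curvForm R i j x) i x = 0 := by
  have e : rowForm (fun i j => curvForm R i j x) i x =
      ∑ k, x k * ∑ j, ∑ l, R i k j l * x j * x l := by
    simp only [rowForm, curvForm, Finset.sum_mul, Finset.mul_sum]
    rw [Finset.sum_comm]
    refine Finset.sum_congr rfl fun k _ => Finset.sum_congr rfl fun j _ =>
      Finset.sum_congr rfl fun l _ => by ring
  rw [e]
  refine Finset.sum_eq_zero fun k _ => ?_
  rw [sum_antisymm (A := fun j l => R i k j l) (fun j l => hR.antisymm_right i k j l), mul_zero]

/-- `H_{ij}(y + ξ) yⁱ yʲ = H_{ij}(ξ) yⁱ yʲ`. -/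
theorem quadForm_curvForm_add (hR : IsTangentialCurvature R) (ξ y : EuclideanSpace ℝ (Fin d)) :
    quadForm (fun i j => curvForm R i j (y + ξ)) y = quadForm (fun i j => curvForm R i j ξ) y := by
  have h1 : ∀ j l, ∑ i, ∑ k, R i k j l * y i * y k = 0 := fun j l =>
    sum_antisymm (A := fun i k => R i k j l) (fun i k => hR.antisymm_left i k j l) y
  have h2 : ∀ i k, ∑ j, ∑ l, R i k j l * y j * y l = 0 := fun i k =>
    sum_antisymm (A := fun j l => R i k j l) (fun j l => hR.antisymm_right i k j l) y
  have c1 : ∑ i, ∑ j, ∑ k, ∑ l, R i k j l * y k * (y l + ξ l) * y i * y j = 0 := by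
    calc _ = ∑ j, ∑ l, (∑ i, ∑ k, R i k j l * y i * y k) * ((y l + ξ l) * y j) := by
          simp only [Finset.sum_mul]
          rw [Finset.sum_comm]
          refine Finset.sum_congr rfl fun j _ => ?_
          conv_rhs => rw [Finset.sum_comm]
          refine Finset.sum_congr rfl fun i _ => ?_
          rw [Finset.sum_comm]
          refine Finset.sum_congr rfl fun l _ => Finset.sum_congr rfl fun k _ => by ring
      _ = 0 := by simp [h1]
  have c2 : ∑ i, ∑ j, ∑ k, ∑ l, R i k j l * ξ k * y l * y i * y j = 0 := by
    calc _ = ∑ i, ∑ k, (∑ j, ∑ l, R i k j l * y j * y l) * (ξ k * y i) := by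
          simp only [Finset.sum_mul]
          refine Finset.sum_congr rfl fun i _ => ?_
          rw [Finset.sum_comm]
          refine Finset.sum_congr rfl fun k _ => Finset.sum_congr rfl fun j _ =>
            Finset.sum_congr rfl fun l _ => by ring
      _ = 0 := by simp [h2]
  have e : quadForm (fun i j => curvForm R i j (y + ξ)) y =
      ∑ i, ∑ j, ∑ k, ∑ l, R i k j l * y k * (y l + ξ l) * y i * y j +
      ∑ i, ∑ j, ∑ k, ∑ l, R i k j l * ξ k * y l * y i * y j +
      quadForm (fun i j => curvForm R i j ξ) y := by
    simp only [quadForm, curvForm, Finset.sum_mul, ← Finset.sum_add_distrib, PiLp.add_apply]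
    refine Finset.sum_congr rfl fun i _ => Finset.sum_congr rfl fun j _ =>
      Finset.sum_congr rfl fun k _ => Finset.sum_congr rfl fun l _ => by ring
  rw [e, c1, c2, zero_add, zero_add]

end IsTangentialCurvature

theorem sum_abs_curvForm_le (R : Fin d → Fin d → Fin d → Fin d → ℝ) (x : EuclideanSpace ℝ (Fin d)) :
    ∑ i, ∑ j, |curvForm R i j x| ≤ (∑ i, ∑ j, ∑ k, ∑ l, |R i k j l|) * ‖x‖ ^ 2 := by
  rw [Finset.sum_mul]
  refine Finset.sum_le_sum fun i _ => ?_
  rw [Finset.sum_mul]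
  exact Finset.sum_le_sum fun j _ => abs_quadForm_le (fun k l => R i k j l) x

end

/-! ### The tangential part of W and the source term -/

section

variable {n : ℕ} {W : Fin n → Fin n → Fin n → Fin n → ℝ}

/-- The tangential components of `W`. -/
def tangentialPart (W : Fin n → Fin n → Fin n → Fin n → ℝ) (i j k l : Fin (n - 1)) : ℝ :=
  W (tan i) (tan j) (tan k) (tan l)

theorem tensorH_eq (i j : Fin (n - 1)) (x : Space n) :
    tensorH W i j x = curvForm (tangentialPart W) i j x.1 := rfl

/-- The traces of W also include the normal index, so trace-freeness in the tangential indices has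
to come from the vanishing of ∑ H_{ii}; polarization gives it for each pair of indices. -/
theorem IsWeyl.isTangentialCurvature (hW : IsWeyl W)
    (htr : ∀ x : Space n, ∑ i, tensorH W i i x = 0) : IsTangentialCurvature (tangentialPart W) where
  antisymm_left _ _ _ _ := hW.antisymm_left _ _ _ _
  antisymm_right _ _ _ _ := hW.antisymm_right _ _ _ _
  pair_symm _ _ _ _ := hW.pair_symm _ _ _ _
  bianchi _ _ _ _ := hW.bianchi _ _ _ _
  traceFree := by
    refine eq_zero_of_quadForm_eq_zero (S := fun k l => ∑ i, tangentialPart W i k i l)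
      (fun k l => Finset.sum_congr rfl fun i _ => hW.pair_symm _ _ _ _) fun y => ?_
    rw [← htr (y, 0)]
    simp only [quadForm, tensorH, Finset.sum_mul]
    conv_rhs => rw [Finset.sum_comm]
    refine Finset.sum_congr rfl fun k _ => ?_
    conv_rhs => rw [Finset.sum_comm]
    rfl

theorem eval_fPoly_one (a : ℕ → ℝ) (s : ℝ) : (fPoly 1 a).eval s = a 0 + a 1 * s := by
  rw [fPoly_one]; simp

/-- The δ_{ij} part of the Hessian of the bubble is killed by the trace of H. In the other part
H_{ij}(x) may be replaced by H_{ij}(ξ), which exhibits the source as quadratic in ξ. -/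
theorem source_eq (hW : IsWeyl W) (htr : ∀ x : Space n, ∑ i, tensorH W i i x = 0) (d : ℕ)
    (a : ℕ → ℝ) {ξ : Bdry n} {ε : ℝ} (hε : 0 < ε) {x : Space n} (hx : -ε < x.2) :
    source W d a ξ ε x = n * (n - 2) * ε ^ (((n : ℝ) - 2) / 2) *
      quadForm (fun i j => curvForm (tangentialPart W) i j ξ) (x.1 - ξ) *
      (fPoly d a).eval (‖x.1‖ ^ 2) * den ξ ε x ^ (-(n / 2 + 1 : ℝ)) := by
  have hR := hW.isTangentialCurvature htr
  have hq := hR.quadForm_curvForm_add ξ (x.1 - ξ)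
  rw [sub_add_cancel] at hq
  have htr' := hR.sum_curvForm_diag x.1
  have key : source W d a ξ ε x = -(n - 2) * ε ^ (((n : ℝ) - 2) / 2) * (fPoly d a).eval (‖x.1‖ ^ 2) *
      ((∑ i, curvForm (tangentialPart W) i i x.1) * den ξ ε x ^ (-(n / 2 : ℝ)) -
        n * quadForm (fun i j => curvForm (tangentialPart W) i j x.1) (x.1 - ξ) *
          den ξ ε x ^ (-(n / 2 + 1 : ℝ))) := by
    have hd : ∀ i, curvForm (tangentialPart W) i i x.1 =
        ∑ j, (if i = j then curvForm (tangentialPart W) i j x.1 else 0) := fun i => by simp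
    rw [Finset.sum_congr rfl fun i _ => hd i]
    simp only [source, quadForm, Finset.mul_sum, Finset.sum_mul, ← Finset.sum_sub_distrib]
    refine Finset.sum_congr rfl fun i _ => Finset.sum_congr rfl fun j _ => ?_
    rw [pd_pd_bubble hε i j hx, tensorHbar, tensorH_eq]
    split_ifs <;> ring
  rw [key, htr', hq]
  ring

end

/-! ### The contribution of the corrector -/

section

variable {n : ℕ} {W : Fin n → Fin n → Fin n → Fin n → ℝ} {d : ℕ} {a : ℕ → ℝ} {ξ : Bdry n} {ε : ℝ}

/-- Two correctors pair with the source in the same way. -/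
theorem IsCorrector.integral_source_mul {z z' : Space n → ℝ} (hz : IsCorrector W d a ξ ε z)
    (hz' : IsCorrector W d a ξ ε z') :
    ∫ x in halfSpace n, source W d a ξ ε x * z x = ∫ x in halfSpace n, source W d a ξ ε x * z' x := by
  obtain ⟨dz, tz, hm, he⟩ := hz
  obtain ⟨dz', tz', hm', he'⟩ := hz'
  -- Each equation is tested with the other solution. The bilinear form is symmetric, so the
  -- pairings agree and uniqueness of the corrector is not needed.
  have h1 := he _ _ _ hm'
  have h2 := he' _ _ _ hm
  have e1 : ∫ x in halfSpace n, dot (dz x) (dz' x) = ∫ x in halfSpace n, dot (dz' x) (dz x) :=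
    integral_congr_ae (ae_of_all _ fun x => dot_comm _ _)
  have e2 : ∫ y : Bdry n, n * bubble ξ ε (y, 0) ^ (2 / ((n : ℝ) - 2)) * tz y * tz' y =
      ∫ y : Bdry n, n * bubble ξ ε (y, 0) ^ (2 / ((n : ℝ) - 2)) * tz' y * tz y :=
    integral_congr_ae (ae_of_all _ fun y => by ring)
  rw [e1, e2, h2] at h1
  linarith

/-- The chosen `corrector` may be replaced by any explicit solution, whose existence also rules out
the default value 0 in the definition. -/
theorem integral_source_mul_corrector {z : Space n → ℝ} (hz : IsCorrector W d a ξ ε z) :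
    ∫ x in halfSpace n, source W d a ξ ε x * corrector W d a ξ ε x =
      ∫ x in halfSpace n, source W d a ξ ε x * z x := by
  have h : ∃ z, IsCorrector W d a ξ ε z := ⟨z, hz⟩
  have e : corrector W d a ξ ε = h.choose := by rw [corrector, dif_pos h]
  rw [e]
  exact h.choose_spec.integral_source_mul hz

/-- Identifies the boundary coefficient n u^(2/(n-2)) of the weak problem with the Robin coefficient
nε/D. -/
theorem bubble_boundary_rpow (hn : 3 ≤ n) (hε : 0 < ε) (y : Bdry n) :
    bubble ξ ε (y, 0) ^ (2 / ((n : ℝ) - 2)) = ε / den ξ ε (y, 0) := by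
  have hD : 0 < den ξ ε ((y, 0) : Space n) := den_pos hε le_rfl
  have h2 : (n : ℝ) - 2 ≠ 0 := by
    have : (3 : ℝ) ≤ n := by exact_mod_cast hn
    linarith
  rw [bubble, ← Real.rpow_mul (by positivity), show ((n : ℝ) - 2) / 2 * (2 / ((n : ℝ) - 2)) = 1 by
    field_simp, Real.rpow_one]

/-- A decaying solution of the linearized problem that is orthogonal to the kernel is a corrector. -/
theorem IsDecayingSolution.isCorrector {E S : Space n → ℝ} {r K C : ℝ}
    (h : IsDecayingSolution ξ ε E S r K C) (hn : 3 ≤ n) (hr : (n : ℝ) + 2 < 2 * r) (hε : 0 < ε)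
    (hS : ∀ x ∈ halfSpace n, S x = source W d a ξ ε x)
    (hν : ∫ y : Bdry n, phiNormal ξ ε (y, 0) * E (y, 0) = 0)
    (ht : ∀ k, ∫ y : Bdry n, phiTangential ξ ε k (y, 0) * E (y, 0) = 0) :
    IsCorrector W d a ξ ε E := by
  have hp : ∀ x : Space n, (0 : ℝ) ≤ (1 + ‖x‖) ^ (-r) := fun x => by positivity
  refine ⟨grad E, fun y => E (y, 0), ⟨memSigma_of_decay (C := max K C) hn hr h.contDiff
    (fun x hx => (h.bound x hx).trans (mul_le_mul_of_nonneg_right (le_max_left _ _) (hp x)))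
    (fun x hx => (h.bound_fderiv x hx).trans (mul_le_mul_of_nonneg_right (le_max_right _ _) (hp x))),
    hν, ht⟩, fun ψ dψ tψ hψ => ?_⟩
  rw [hψ.toMemSigma.integral_dot_grad hn hr h.contDiff h.bound_fderiv h.bound_tangential h.bound_normal]
  have e1 : ∫ x in halfSpace n, ψ x * laplacian E x = ∫ x in halfSpace n, source W d a ξ ε x * ψ x :=
    setIntegral_congr_fun (measurableSet_halfSpace n) fun x hx => by
      rw [h.laplacian_eq x hx, hS x hx, mul_comm]
  have e2 : ∫ y : Bdry n, tψ y * fderiv ℝ E (y, 0) (0, 1) =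
      -∫ y : Bdry n, n * bubble ξ ε (y, 0) ^ (2 / ((n : ℝ) - 2)) * E (y, 0) * tψ y := by
    rw [← integral_neg]
    refine integral_congr_ae (ae_of_all _ fun y => ?_)
    simp only
    rw [h.boundary, bubble_boundary_rpow hn hε]
    ring
  rw [e1, e2]
  ring

/-- The numerator has degree four in x̄, two from Q and two from f, against a decay of order n + 2.
-/
theorem exists_abs_source_le (hn : 3 ≤ n) (hW : IsWeyl W)
    (htr : ∀ x : Space n, ∑ i, tensorH W i i x = 0) (ha₁ : a 1 = -1) :
    ∃ C, ∀ (ξ : Bdry n) (ε : ℝ), ‖ξ‖ ≤ 1 → ε ∈ Set.Icc (1 / 2 : ℝ) 2 → ∀ x ∈ halfSpace n,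
      |source W 1 a ξ ε x| ≤ C * ‖ξ‖ ^ 2 * (1 + ‖x‖) ^ (-((n : ℝ) - 2)) := by
  obtain ⟨κ, hκ⟩ := (isCompact_Icc (a := (1 / 2 : ℝ)) (b := 2)).exists_bound_of_continuousOn
    (f := fun ε : ℝ => n * (n - 2) * ε ^ (((n : ℝ) - 2) / 2))
    (continuousOn_const.mul (continuousOn_id.rpow_const fun x hx => Or.inl (by
      have : (1 / 2 : ℝ) ≤ x := hx.1
      simp only [id]; linarith)))
  set N := ∑ i, ∑ j, ∑ k, ∑ l, |tangentialPart W i k j l|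
  have hN : 0 ≤ N := Finset.sum_nonneg fun _ _ => Finset.sum_nonneg fun _ _ =>
    Finset.sum_nonneg fun _ _ => Finset.sum_nonneg fun _ _ => abs_nonneg _
  have hcurv : ∀ ξ : Bdry n, ∑ i, ∑ j, |curvForm (tangentialPart W) i j ξ| ≤ N * ‖ξ‖ ^ 2 :=
    sum_abs_curvForm_le _
  clear_value N
  refine ⟨κ * N * (|a 0| + 1) * 25 ^ ((n : ℝ) / 2 + 1), fun ξ ε hξ hε x hx => ?_⟩
  have hε0 : 0 < ε := by linarith [hε.1]
  have hx2 : 0 ≤ x.2 := hx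
  have hκε := hκ ε hε
  rw [Real.norm_eq_abs] at hκε
  have hκ0 := (abs_nonneg _).trans hκε
  have h0 := norm_nonneg x
  have hx1 : ‖x.1‖ ≤ ‖x‖ := norm_fst_le x
  have hx1' : ‖x.1‖ ≤ 1 + ‖x‖ := hx1.trans (by linarith)
  have hy : ‖x.1 - ξ‖ ≤ 1 + ‖x‖ := (norm_sub_le _ _).trans (by linarith)
  have hq : |quadForm (fun i j => curvForm (tangentialPart W) i j ξ) (x.1 - ξ)| ≤
      N * ‖ξ‖ ^ 2 * (1 + ‖x‖) ^ 2 :=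
    (abs_quadForm_le _ _).trans (mul_le_mul (hcurv ξ)
      (pow_le_pow_left₀ (norm_nonneg _) hy 2) (by positivity)
      (mul_nonneg hN (sq_nonneg _)))
  have hf : |(fPoly 1 a).eval (‖x.1‖ ^ 2)| ≤ (|a 0| + 1) * (1 + ‖x‖) ^ 2 := by
    rw [eval_fPoly_one, ha₁]
    have h1 : ‖x.1‖ ^ 2 ≤ (1 + ‖x‖) ^ 2 := pow_le_pow_left₀ (norm_nonneg _) hx1' 2
    have h2 : 1 ≤ (1 + ‖x‖) ^ 2 := one_le_pow₀ (by linarith)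
    calc |a 0 + -1 * ‖x.1‖ ^ 2| ≤ |a 0| + |-1 * ‖x.1‖ ^ 2| := abs_add_le _ _
      _ = |a 0| * 1 + ‖x.1‖ ^ 2 := by
          rw [abs_mul (-1), abs_neg, abs_one, abs_of_nonneg (sq_nonneg ‖x.1‖)]; ring
      _ ≤ |a 0| * (1 + ‖x‖) ^ 2 + (1 + ‖x‖) ^ 2 := by gcongr
      _ = _ := by ring
  have hD := den_rpow_neg_le hξ hε.1 hx2 (β := (n : ℝ) / 2 + 1) (by positivity)
  have hp : 0 < 1 + ‖x‖ := by linarith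
  have hD0 : 0 ≤ den ξ ε x ^ (-(n / 2 + 1 : ℝ)) := by have := den_pos hε0 hx2 (ξ := ξ); positivity
  rw [source_eq hW htr 1 a hε0 (by linarith), abs_mul, abs_mul, abs_mul, abs_of_nonneg hD0]
  calc _ ≤ κ * (N * ‖ξ‖ ^ 2 * (1 + ‖x‖) ^ 2) * ((|a 0| + 1) * (1 + ‖x‖) ^ 2) *
        (25 ^ ((n : ℝ) / 2 + 1) * (1 + ‖x‖) ^ (-(2 * ((n : ℝ) / 2 + 1)))) := by
        gcongr
    _ = κ * N * (|a 0| + 1) * 25 ^ ((n : ℝ) / 2 + 1) * ‖ξ‖ ^ 2 *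
        ((1 + ‖x‖) ^ ((4 : ℕ) : ℝ) * (1 + ‖x‖) ^ (-(2 * ((n : ℝ) / 2 + 1)))) := by
        rw [Real.rpow_natCast]; ring
    _ = _ := by
        rw [← Real.rpow_add hp]
        congr 2; push_cast; ring

/-- The corrector contributes only to fourth order in `ξ`. -/
theorem exists_abs_integral_source_mul_corrector_le (hn : 19 ≤ n) (hW : IsWeyl W)
    (htr : ∀ x : Space n, ∑ i, tensorH W i i x = 0) (ha₁ : a 1 = -1) :
    ∃ C, ∀ (ξ : Bdry n) (ε : ℝ), ‖ξ‖ ≤ 1 → ε ∈ Set.Icc (1 / 2 : ℝ) 2 →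
      |∫ x in halfSpace n, source W 1 a ξ ε x * corrector W 1 a ξ ε x| ≤ C * ‖ξ‖ ^ 4 := by
  have hR := hW.isTangentialCurvature htr
  have hn' : (19 : ℝ) ≤ n := by exact_mod_cast hn
  obtain ⟨L, hL⟩ := exists_uniform_solution (n := n) (by omega)
    (κ := fun ε : ℝ => n * (n - 2) * ε ^ (((n : ℝ) - 2) / 2))
    (continuousOn_const.mul (continuousOn_id.rpow_const fun x hx => Or.inl (by
      have : (1 / 2 : ℝ) ≤ x := hx.1
      simp only [id]; linarith))) (a 0)
  obtain ⟨C, hC⟩ := exists_abs_source_le (a := a) (by omega) hW htr ha₁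
  set N := ∑ i, ∑ j, ∑ k, ∑ l, |tangentialPart W i k j l|
  have hi : IntegrableOn (fun x : Space n => (1 + ‖x‖) ^ (-((n : ℝ) - 2) + -((n : ℝ) - 8)))
      (halfSpace n) := by
    have := integrable_one_add_norm (E := Space n) (μ := volume) (r := (n : ℝ) - 2 + (n - 8))
      (by rw [finrank_space (by omega)]; linarith)
    rw [← neg_add]
    exact this.integrableOn
  set I := ∫ x in halfSpace n, (1 + ‖x‖) ^ (-((n : ℝ) - 2) + -((n : ℝ) - 8))
  refine ⟨C * (|L| * N) * I, fun ξ ε hξ hε => ?_⟩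
  have hε0 : 0 < ε := by linarith [hε.1]
  obtain ⟨E, C', hE, hν, ht⟩ := hL ξ ε (fun i j => curvForm (tangentialPart W) i j ξ) hξ hε
    (fun i j => hR.curvForm_symm i j ξ) (hR.sum_curvForm_diag ξ) (hR.rowForm_curvForm_self ξ)
  -- The decay rate n - 8 must exceed (n+2)/2 for Green's formula, that is n ≥ 19.
  have hcorr : IsCorrector W 1 a ξ ε E := hE.isCorrector (by omega) (by linarith) hε0 (fun x hx => by
    have hx2 : 0 ≤ x.2 := hx
    rw [source_eq hW htr 1 a hε0 (by linarith), eval_fPoly_one, ha₁]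
    have : ‖x.1‖ ^ 2 = ‖ξ‖ ^ 2 + 2 * inner ℝ ξ (x.1 - ξ) + ‖x.1 - ξ‖ ^ 2 := by
      rw [← norm_add_sq_real, add_sub_cancel]
    rw [this]
    ring) hν ht
  rw [integral_source_mul_corrector hcorr, ← Real.norm_eq_abs]
  refine (norm_integral_le_of_norm_le (hi.const_mul (C * (|L| * N) * ‖ξ‖ ^ 4)) ?_).trans (le_of_eq ?_)
  · refine (ae_restrict_iff' (measurableSet_halfSpace n)).2 (ae_of_all _ fun x hx => ?_)
    have hp : 0 < 1 + ‖x‖ := by positivity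
    have h1 := hC ξ ε hξ hε x hx
    have h2 := hE.bound x hx
    -- The solution is linear in H(ξ), hence of second order in ξ; together with the source this
    -- gives order four.
    have h3 : L * ∑ i, ∑ j, |curvForm (tangentialPart W) i j ξ| ≤ |L| * N * ‖ξ‖ ^ 2 := by
      rw [mul_assoc]
      exact mul_le_mul (le_abs_self L) (sum_abs_curvForm_le _ ξ)
        (Finset.sum_nonneg fun _ _ => Finset.sum_nonneg fun _ _ => abs_nonneg _) (abs_nonneg _)
    rw [Real.norm_eq_abs, abs_mul, Real.rpow_add hp]
    calc |source W 1 a ξ ε x| * |E x| ≤ (C * ‖ξ‖ ^ 2 * (1 + ‖x‖) ^ (-((n : ℝ) - 2))) *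
          ((|L| * N * ‖ξ‖ ^ 2) * (1 + ‖x‖) ^ (-((n : ℝ) - 8))) := by
          refine mul_le_mul h1 (h2.trans ?_) (abs_nonneg _) ((abs_nonneg _).trans h1)
          exact mul_le_mul_of_nonneg_right h3 (by positivity)
      _ = _ := by ring
  · rw [integral_const_mul]; ring

end

/-! ### Integrals of polynomials against powers of the denominator -/

/-- `g` is integrable with integral `v`. -/
structure IntegratesTo {X : Type*} [MeasurableSpace X] (μ : Measure X) (g : X → ℝ) (v : ℝ) : Prop where
  integrable : Integrable g μ
  integral_eq : ∫ x, g x ∂μ = v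

namespace IntegratesTo

variable {X : Type*} [MeasurableSpace X] {μ : Measure X} {g g' : X → ℝ} {v v' : ℝ}

theorem add (h : IntegratesTo μ g v) (h' : IntegratesTo μ g' v') :
    IntegratesTo μ (fun x => g x + g' x) (v + v') :=
  ⟨h.integrable.add h'.integrable, by
    rw [integral_add h.integrable h'.integrable, h.integral_eq, h'.integral_eq]⟩

theorem const_mul (h : IntegratesTo μ g v) (c : ℝ) : IntegratesTo μ (fun x => c * g x) (c * v) :=
  ⟨h.integrable.const_mul c, by rw [integral_const_mul, h.integral_eq]⟩

theorem sum {ι : Type*} {s : Finset ι} {g : ι → X → ℝ} {v : ι → ℝ}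
    (h : ∀ i ∈ s, IntegratesTo μ (g i) (v i)) :
    IntegratesTo μ (fun x => ∑ i ∈ s, g i x) (∑ i ∈ s, v i) :=
  ⟨integrable_finsetSum s fun i hi => (h i hi).integrable, by
    rw [integral_finsetSum s fun i hi => (h i hi).integrable]
    exact Finset.sum_congr rfl fun i hi => (h i hi).integral_eq⟩

theorem congr (h : IntegratesTo μ g v) (hg : ∀ x, g' x = g x) (hv : v = v') :
    IntegratesTo μ g' v' := by
  rw [funext hg, ← hv]; exact h

end IntegratesTo

/-- `F ξ y` vanishes to order `k` at `ξ = 0` and grows at most like `|y|^m`. -/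
structure IsJet {E : Type*} [NormedAddCommGroup E] (k m : ℕ) (F : E → E → ℝ) : Prop where
  continuous : ∀ ξ, Continuous (F ξ)
  bound : ∃ C, ∀ ξ y, ‖ξ‖ ≤ 1 → |F ξ y| ≤ C * ‖ξ‖ ^ k * (1 + ‖y‖) ^ m

namespace IsJet

variable {E : Type*} [NormedAddCommGroup E] {k k' m m' : ℕ} {F G : E → E → ℝ}

theorem mul (hF : IsJet k m F) (hG : IsJet k' m' G) :
    IsJet (k + k') (m + m') fun ξ y => F ξ y * G ξ y := by
  obtain ⟨C, hC⟩ := hF.bound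
  obtain ⟨C', hC'⟩ := hG.bound
  refine ⟨fun ξ => (hF.continuous ξ).mul (hG.continuous ξ), ⟨C * C', fun ξ y hξ => ?_⟩⟩
  rw [abs_mul]
  calc |F ξ y| * |G ξ y| ≤ (C * ‖ξ‖ ^ k * (1 + ‖y‖) ^ m) * (C' * ‖ξ‖ ^ k' * (1 + ‖y‖) ^ m') :=
        mul_le_mul (hC ξ y hξ) (hC' ξ y hξ) (abs_nonneg _) ((abs_nonneg _).trans (hC ξ y hξ))
    _ = _ := by ring

theorem congr (hF : IsJet k m F) (h : ∀ ξ y, G ξ y = F ξ y) : IsJet k m G := by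
  rwa [funext fun ξ => funext fun y => h ξ y]

theorem add (hF : IsJet k m F) (hG : IsJet k m G) : IsJet k m fun ξ y => F ξ y + G ξ y := by
  obtain ⟨C, hC⟩ := hF.bound
  obtain ⟨C', hC'⟩ := hG.bound
  refine ⟨fun ξ => (hF.continuous ξ).add (hG.continuous ξ), ⟨C + C', fun ξ y hξ => ?_⟩⟩
  rw [add_mul, add_mul]
  exact (abs_add_le _ _).trans (add_le_add (hC ξ y hξ) (hC' ξ y hξ))

theorem const_mul (hF : IsJet k m F) (c : ℝ) : IsJet k m fun ξ y => c * F ξ y := by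
  obtain ⟨C, hC⟩ := hF.bound
  refine ⟨fun ξ => (hF.continuous ξ).const_mul c, ⟨|c| * C, fun ξ y hξ => ?_⟩⟩
  rw [abs_mul, mul_assoc, mul_assoc, ← mul_assoc C]
  exact mul_le_mul_of_nonneg_left (hC ξ y hξ) (abs_nonneg _)

theorem sub (hF : IsJet k m F) (hG : IsJet k m G) : IsJet k m fun ξ y => F ξ y - G ξ y := by
  refine ⟨fun ξ => (hF.continuous ξ).sub (hG.continuous ξ), ?_⟩
  obtain ⟨C, hC⟩ := (hF.add (hG.const_mul (-1))).bound
  exact ⟨C, fun ξ y hξ => by simpa [sub_eq_add_neg] using hC ξ y hξ⟩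

theorem sum {ι : Type*} {s : Finset ι} {F : ι → E → E → ℝ} (h : ∀ i ∈ s, IsJet k m (F i)) :
    IsJet k m fun ξ y => ∑ i ∈ s, F i ξ y := by
  classical
  induction s using Finset.induction_on with
  | empty => exact ⟨fun ξ => by simpa using continuous_const, ⟨0, by simp⟩⟩
  | insert i s hi ih =>
    simp only [Finset.sum_insert hi]
    exact (h i (Finset.mem_insert_self i s)).add (ih fun j hj => h j (Finset.mem_insert_of_mem hj))

theorem mono (hF : IsJet k m F) (hk : k' ≤ k) (hm : m ≤ m') : IsJet k' m' F := by
  obtain ⟨C, hC⟩ := hF.bound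
  refine ⟨hF.continuous, ⟨|C|, fun ξ y hξ => (hC ξ y hξ).trans ?_⟩⟩
  have h0 := norm_nonneg y
  have h1 : ‖ξ‖ ^ k ≤ ‖ξ‖ ^ k' := pow_le_pow_of_le_one (norm_nonneg _) hξ hk
  have h2 : (1 + ‖y‖) ^ m ≤ (1 + ‖y‖) ^ m' := pow_le_pow_right₀ (by linarith) hm
  calc C * ‖ξ‖ ^ k * (1 + ‖y‖) ^ m ≤ |C| * ‖ξ‖ ^ k * (1 + ‖y‖) ^ m := by gcongr; exact le_abs_self C
    _ ≤ |C| * ‖ξ‖ ^ k' * (1 + ‖y‖) ^ m' := by gcongr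

theorem const (c : ℝ) : IsJet 0 0 fun _ _ : E => c :=
  ⟨fun _ => continuous_const, ⟨|c|, by simp⟩⟩

theorem norm_sq : IsJet 0 2 fun _ y : E => ‖y‖ ^ 2 := by
  refine ⟨fun _ => by fun_prop, ⟨1, fun ξ y _ => ?_⟩⟩
  rw [abs_of_nonneg (by positivity), pow_zero, one_mul, one_mul]
  exact pow_le_pow_left₀ (norm_nonneg _) (by simp) 2

theorem norm_sq_left : IsJet 2 0 fun ξ _ : E => ‖ξ‖ ^ 2 :=
  ⟨fun _ => continuous_const, ⟨1, fun ξ y _ => by rw [abs_of_nonneg (by positivity)]; simp⟩⟩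

theorem coord {d : ℕ} (i : Fin d) : IsJet 0 1 fun _ y : EuclideanSpace ℝ (Fin d) => y i := by
  refine ⟨fun _ => by fun_prop, ⟨1, fun ξ y _ => ?_⟩⟩
  have := PiLp.norm_apply_le y i
  rw [Real.norm_eq_abs] at this
  simp only [pow_zero, one_mul, pow_one]; linarith

theorem coord_left {d : ℕ} (i : Fin d) : IsJet 1 0 fun ξ _ : EuclideanSpace ℝ (Fin d) => ξ i :=
  ⟨fun _ => continuous_const, ⟨1, fun ξ y _ => by simpa using PiLp.norm_apply_le ξ i⟩⟩

end IsJet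

/-! ### Half-space integrals of quadratic and quartic polynomials -/

section

variable {n : ℕ} {ε : ℝ}

/-- The moment `∫ |x̄|^k den^(-β)` over the half-space. -/
def moment (n : ℕ) (ε : ℝ) (k : ℕ) (β : ℝ) : ℝ :=
  ∫ x in halfSpace n, ‖x.1‖ ^ k * den 0 ε x ^ (-β)

theorem integratesTo_norm_pow (hn : 1 ≤ n) (hε : 1 / 2 ≤ ε) (k : ℕ) {β : ℝ} (hβ : (n : ℝ) + k < 2 * β) :
    IntegratesTo (volume.restrict (halfSpace n)) (fun x : Space n => ‖x.1‖ ^ k * den 0 ε x ^ (-β))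
      (moment n ε k β) :=
  ⟨integrableOn_mul_den_rpow hn hε (p := fun y => ‖y‖ ^ k) (by fun_prop) (C := 1) (fun y => by
    rw [abs_of_nonneg (by positivity), one_mul]
    exact pow_le_pow_left₀ (norm_nonneg _) (by simp) k) hβ, rfl⟩

theorem integratesTo_quadForm (hn : 2 ≤ n) (hε : 1 / 2 ≤ ε) (k : ℕ) {β : ℝ}
    (hβ : (n : ℝ) + (k + 2 : ℕ) < 2 * β) (r : Fin (n - 1) → Fin (n - 1) → ℝ) :
    IntegratesTo (volume.restrict (halfSpace n))
      (fun x : Space n => quadForm r x.1 * (‖x.1‖ ^ k * den 0 ε x ^ (-β)))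
      ((∑ i, r i i) / (n - 1 : ℕ) * moment n ε (k + 2) β) := by
  have hI := (isRotationInvariant_den (n := n) (ε := ε) β).mul_radial k
  have hm := integratesTo_norm_pow (by omega) hε (k + 2) hβ
  have e : (fun x : Space n => ‖x.1‖ ^ 2 * (‖x.1‖ ^ k * den 0 ε x ^ (-β))) =
      fun x => ‖x.1‖ ^ (k + 2) * den 0 ε x ^ (-β) := by funext x; ring
  have hi : Integrable (fun x : Space n => ‖x.1‖ ^ 2 * (‖x.1‖ ^ k * den 0 ε x ^ (-β)))
      (volume.restrict (halfSpace n)) := by rw [e]; exact hm.integrable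
  refine ⟨?_, ?_⟩
  · simp only [quadForm, Finset.sum_mul]
    refine integrable_finsetSum _ fun i _ => integrable_finsetSum _ fun j _ => ?_
    have := (hI.integrable_coord_mul_coord hi (EuclideanSpace.single i 1)
      (EuclideanSpace.single j 1)).const_mul (r i j)
    refine this.congr (ae_of_all _ fun x => ?_)
    simp [EuclideanSpace.inner_single_left]
    ring
  · have := hI.integral_quadratic (by omega) hi r
    rw [e] at this
    exact this

theorem quadForm_mul_quadForm {d : ℕ} (r r' : Fin d → Fin d → ℝ) (y : EuclideanSpace ℝ (Fin d)) :
    quadForm r y * quadForm r' y =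
      ∑ i, ∑ j, ∑ k, ∑ l, r i j * r' k l * y i * y j * y k * y l := by
  simp only [quadForm, Finset.sum_mul]
  refine Finset.sum_congr rfl fun i _ => Finset.sum_congr rfl fun j _ => ?_
  simp only [Finset.mul_sum]
  exact Finset.sum_congr rfl fun k _ => Finset.sum_congr rfl fun l _ => by ring

theorem integratesTo_quadForm_mul_quadForm (hn : 2 ≤ n) (hε : 1 / 2 ≤ ε) (k : ℕ) {β : ℝ}
    (hβ : (n : ℝ) + (k + 4 : ℕ) < 2 * β) (r r' : Fin (n - 1) → Fin (n - 1) → ℝ) :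
    IntegratesTo (volume.restrict (halfSpace n))
      (fun x : Space n => quadForm r x.1 * quadForm r' x.1 * (‖x.1‖ ^ k * den 0 ε x ^ (-β)))
      (((∑ i, r i i) * (∑ i, r' i i) + ∑ i, ∑ j, r i j * (r' i j + r' j i)) /
        ((n - 1 : ℕ) * ((n - 1 : ℕ) + 2)) * moment n ε (k + 4) β) := by
  have hI := (isRotationInvariant_den (n := n) (ε := ε) β).mul_radial k
  have hm := integratesTo_norm_pow (by omega) hε (k + 4) hβ
  have e : (fun x : Space n => ‖x.1‖ ^ 4 * (‖x.1‖ ^ k * den 0 ε x ^ (-β))) =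
      fun x => ‖x.1‖ ^ (k + 4) * den 0 ε x ^ (-β) := by funext x; ring
  have hi : Integrable (fun x : Space n => ‖x.1‖ ^ 4 * (‖x.1‖ ^ k * den 0 ε x ^ (-β)))
      (volume.restrict (halfSpace n)) := by rw [e]; exact hm.integrable
  simp only [quadForm_mul_quadForm]
  refine ⟨?_, ?_⟩
  · simp only [Finset.sum_mul]
    refine integrable_finsetSum _ fun i _ => integrable_finsetSum _ fun j _ =>
      integrable_finsetSum _ fun p _ => integrable_finsetSum _ fun q _ => ?_
    have := (hI.integrable_coord_mul_coord_mul_coord_mul_coord hi (EuclideanSpace.single i 1)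
      (EuclideanSpace.single j 1) (EuclideanSpace.single p 1)
      (EuclideanSpace.single q 1)).const_mul (r i j * r' p q)
    refine this.congr (ae_of_all _ fun x => ?_)
    simp [EuclideanSpace.inner_single_left]
    ring
  · have := hI.integral_quartic (by omega) hi (fun i j p q => r i j * r' p q)
    rw [e] at this
    rw [this, moment, Finset.sum_mul]
    congr 2
    rw [← Finset.sum_add_distrib]
    refine Finset.sum_congr rfl fun i _ => ?_
    rw [Finset.mul_sum, ← Finset.sum_add_distrib]
    exact Finset.sum_congr rfl fun j _ => by ring

theorem IsJet.integrable_mul_den {k m : ℕ} {F : Bdry n → Bdry n → ℝ} (hF : IsJet k m F) (hn : 1 ≤ n)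
    (hε : 1 / 2 ≤ ε) {β : ℝ} (hβ : (n : ℝ) + m < 2 * β) {ξ : Bdry n} (hξ : ‖ξ‖ ≤ 1) :
    Integrable (fun x : Space n => F ξ x.1 * den 0 ε x ^ (-β)) (volume.restrict (halfSpace n)) := by
  obtain ⟨C, hC⟩ := hF.bound
  exact integrableOn_mul_den_rpow hn hε (hF.continuous ξ) (fun y => hC ξ y hξ) hβ

theorem IsJet.integratesTo_zero {k m : ℕ} {F : Bdry n → Bdry n → ℝ} (hF : IsJet k m F) (hn : 1 ≤ n)
    (hε : 1 / 2 ≤ ε) {β : ℝ} (hβ : (n : ℝ) + m < 2 * β) {ξ : Bdry n} (hξ : ‖ξ‖ ≤ 1)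
    (hodd : ∀ y, F ξ (-y) = -F ξ y) :
    IntegratesTo (volume.restrict (halfSpace n)) (fun x : Space n => F ξ x.1 * den 0 ε x ^ (-β)) 0 :=
  ⟨hF.integrable_mul_den hn hε hβ hξ, (isRotationInvariant_den (n := n) (ε := ε) β).integral_odd hodd⟩

theorem den_zero_half_le (hε : 1 / 2 ≤ ε) {x : Space n} (hx : x ∈ halfSpace n) :
    den 0 (1 / 2) x ≤ den 0 ε x := by
  have hx2 : 0 ≤ x.2 := hx
  unfold den
  gcongr

/-- The denominator increases with ε, so the weight for ε = 1/2 dominates and the constant is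
uniform in ε. -/
theorem IsJet.exists_abs_integral_le {k m : ℕ} {F : Bdry n → Bdry n → ℝ} (hF : IsJet k m F)
    (hn : 1 ≤ n) {β : ℝ} (hβ : (n : ℝ) + m < 2 * β) :
    ∃ C, ∀ (ξ : Bdry n) (ε : ℝ), ‖ξ‖ ≤ 1 → 1 / 2 ≤ ε →
      |∫ x in halfSpace n, F ξ x.1 * den 0 ε x ^ (-β)| ≤ C * ‖ξ‖ ^ k := by
  obtain ⟨C, hC⟩ := hF.bound
  have hβ0 : 0 ≤ β := by
    have := (Nat.cast_nonneg n : (0 : ℝ) ≤ n)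
    have := (Nat.cast_nonneg m : (0 : ℝ) ≤ m)
    linarith
  have hi := integrableOn_mul_den_rpow hn (le_refl (1 / 2 : ℝ)) (p := fun y : Bdry n => (1 + ‖y‖) ^ m)
    (by fun_prop) (C := 1) (k := m) (fun y => by rw [one_mul, abs_of_nonneg (by positivity)]) hβ
  refine ⟨C * ∫ x in halfSpace n, (1 + ‖x.1‖) ^ m * den 0 (1 / 2) x ^ (-β), fun ξ ε hξ hε => ?_⟩
  rw [← Real.norm_eq_abs]
  refine (norm_integral_le_of_norm_le (hi.const_mul (C * ‖ξ‖ ^ k)) ?_).trans (le_of_eq ?_)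
  · refine (ae_restrict_iff' (measurableSet_halfSpace n)).2 (ae_of_all _ fun x hx => ?_)
    have hD := den_pos (ξ := (0 : Bdry n)) (by norm_num : (0 : ℝ) < 1 / 2) hx
    have h1 : den 0 ε x ^ (-β) ≤ den 0 (1 / 2) x ^ (-β) :=
      Real.rpow_le_rpow_of_nonpos hD (den_zero_half_le hε hx) (by linarith)
    have h0 : 0 ≤ den 0 ε x ^ (-β) :=
      Real.rpow_nonneg (hD.le.trans (den_zero_half_le hε hx)) _
    rw [Real.norm_eq_abs, abs_mul, abs_of_nonneg h0]
    calc _ ≤ (C * ‖ξ‖ ^ k * (1 + ‖x.1‖) ^ m) * den 0 (1 / 2) x ^ (-β) :=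
          mul_le_mul (hC ξ _ hξ) h1 h0 ((abs_nonneg _).trans (hC ξ _ hξ))
      _ = _ := by ring
  · rw [integral_const_mul]; ring

theorem integral_halfSpace_translate (ξ : Bdry n) (g : Space n → ℝ) :
    ∫ x in halfSpace n, g x = ∫ x in halfSpace n, g (x.1 + ξ, x.2) := by
  have hH := measurableSet_halfSpace n
  rw [← integral_indicator hH, ← integral_indicator hH,
    ← integral_add_right_eq_self _ ((ξ, 0) : Space n)]
  refine integral_congr_ae (ae_of_all _ fun x => ?_)
  have e : x + ((ξ, 0) : Space n) = (x.1 + ξ, x.2) := by ext1 <;> simp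
  by_cases hx : 0 ≤ x.2 <;> simp [e, Set.indicator, halfSpace, hx]

end

/-! ### The derivatives of `H̄` and their expansion -/

section

variable {d : ℕ} {R : Fin d → Fin d → Fin d → Fin d → ℝ}

/-- `R_{iljm} + R_{imjl}`. -/
def symCurv (R : Fin d → Fin d → Fin d → Fin d → ℝ) (i j l m : Fin d) : ℝ := R i l j m + R i m j l

/-- The polarization of `curvForm`. -/
def polarForm (R : Fin d → Fin d → Fin d → Fin d → ℝ) (i j : Fin d)
    (ξ y : EuclideanSpace ℝ (Fin d)) : ℝ := ∑ l, (∑ m, symCurv R i j l m * ξ m) * y l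

/-- `∑ V_{ijlm} V_{ijlp}`, where `V` is `symCurv`. -/
def normMatrix (R : Fin d → Fin d → Fin d → Fin d → ℝ) (m p : Fin d) : ℝ :=
  ∑ i, ∑ j, ∑ l, symCurv R i j l m * symCurv R i j l p

theorem symCurv_comm_right (i j l m : Fin d) : symCurv R i j l m = symCurv R i j m l := add_comm _ _

theorem normMatrix_symm (m p : Fin d) : normMatrix R m p = normMatrix R p m := by
  simp only [normMatrix, mul_comm]

theorem curvForm_add (i j : Fin d) (y ξ : EuclideanSpace ℝ (Fin d)) :
    curvForm R i j (y + ξ) = curvForm R i j y + polarForm R i j ξ y + curvForm R i j ξ := by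
  have e : polarForm R i j ξ y = ∑ k, ∑ l, (R i k j l * y k * ξ l + R i k j l * ξ k * y l) := by
    simp only [polarForm, symCurv, Finset.sum_mul, add_mul, Finset.sum_add_distrib]
    congr 1
    · exact Finset.sum_congr rfl fun k _ => Finset.sum_congr rfl fun l _ => by ring
    · rw [Finset.sum_comm]
  rw [e]
  simp only [curvForm, ← Finset.sum_add_distrib, PiLp.add_apply]
  exact Finset.sum_congr rfl fun k _ => Finset.sum_congr rfl fun l _ => by ring

theorem curvForm_smul (i j : Fin d) (c : ℝ) (ξ : EuclideanSpace ℝ (Fin d)) :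
    curvForm R i j (c • ξ) = c ^ 2 * curvForm R i j ξ := by
  simp only [curvForm, Finset.mul_sum, PiLp.smul_apply, smul_eq_mul]
  exact Finset.sum_congr rfl fun k _ => Finset.sum_congr rfl fun l _ => by ring

theorem polarForm_smul_left (i j : Fin d) (c : ℝ) (ξ y : EuclideanSpace ℝ (Fin d)) :
    polarForm R i j (c • ξ) y = c * polarForm R i j ξ y := by
  simp only [polarForm, Finset.mul_sum, Finset.sum_mul, PiLp.smul_apply, smul_eq_mul]
  exact Finset.sum_congr rfl fun k _ => Finset.sum_congr rfl fun l _ => by ring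

theorem polarForm_self (i j : Fin d) (y : EuclideanSpace ℝ (Fin d)) :
    polarForm R i j y y = 2 * curvForm R i j y := by
  have h := curvForm_add (R := R) i j y y
  rw [← two_smul ℝ y, curvForm_smul] at h
  linarith

theorem polarForm_single (i j m : Fin d) (y : EuclideanSpace ℝ (Fin d)) :
    polarForm R i j (EuclideanSpace.single m 1) y = ∑ l, symCurv R i j m l * y l := by
  simp only [polarForm, PiLp.single_apply, mul_ite, mul_one, mul_zero, Finset.sum_ite_eq',
    Finset.mem_univ, if_true]
  exact Finset.sum_congr rfl fun l _ => by rw [symCurv_comm_right]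

theorem quadForm_normMatrix (y : EuclideanSpace ℝ (Fin d)) :
    quadForm (normMatrix R) y = ∑ i, ∑ j, ∑ l, (∑ m, symCurv R i j l m * y m) ^ 2 := by
  have e : ∀ i j l, (∑ m, symCurv R i j l m * y m) ^ 2 =
      ∑ m, ∑ p, symCurv R i j l m * symCurv R i j l p * (y m * y p) := fun i j l => by
    rw [sq, Finset.sum_mul_sum]
    exact Finset.sum_congr rfl fun k _ => Finset.sum_congr rfl fun l _ => by ring
  simp only [e, quadForm, normMatrix, Finset.sum_mul]
  have s3 : ∀ f : Fin d → Fin d → Fin d → Fin d → Fin d → ℝ,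
      ∑ m, ∑ p, ∑ i, ∑ j, ∑ l, f m p i j l = ∑ i, ∑ j, ∑ l, ∑ m, ∑ p, f m p i j l := fun f => by
    simp only [← Finset.sum_product', Finset.univ_product_univ]
    refine Fintype.sum_equiv ⟨fun t => ⟨t.2.2.1, t.2.2.2.1, t.2.2.2.2, t.1, t.2.1⟩,
      fun t => ⟨t.2.2.2.1, t.2.2.2.2, t.1, t.2.1, t.2.2.1⟩, fun _ => rfl, fun _ => rfl⟩ _ _ fun _ => rfl
  rw [s3]
  exact Finset.sum_congr rfl fun i _ => Finset.sum_congr rfl fun j _ => Finset.sum_congr rfl fun l _ =>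
    Finset.sum_congr rfl fun m _ => Finset.sum_congr rfl fun p _ => by ring

/-- `∑ (∂ₗ H̄_{ij})²` as a function on the boundary. -/
def gradSq (R : Fin d → Fin d → Fin d → Fin d → ℝ) (b : ℝ) (x : EuclideanSpace ℝ (Fin d)) : ℝ :=
  (b - ‖x‖ ^ 2) ^ 2 * quadForm (normMatrix R) x +
    (12 * ‖x‖ ^ 2 - 8 * b) * ∑ i, ∑ j, curvForm R i j x ^ 2

/-- Leibniz' rule squared. Since H is homogeneous of degree two, Euler's identity turns the cross
term into -8(b - |x|²) H², which together with 4|x|² H² gives the factor 12|x|² - 8b. -/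
theorem sum_sq_derivative (b : ℝ) (x : EuclideanSpace ℝ (Fin d)) :
    ∑ i, ∑ j, ∑ l, ((b - ‖x‖ ^ 2) * polarForm R i j (EuclideanSpace.single l 1) x -
      2 * x l * curvForm R i j x) ^ 2 = gradSq R b x := by
  rw [gradSq, quadForm_normMatrix, Finset.mul_sum, Finset.mul_sum, ← Finset.sum_add_distrib]
  refine Finset.sum_congr rfl fun i _ => ?_
  rw [Finset.mul_sum, Finset.mul_sum, ← Finset.sum_add_distrib]
  refine Finset.sum_congr rfl fun j _ => ?_
  have h1 : ∑ l, x l * polarForm R i j (EuclideanSpace.single l 1) x = 2 * curvForm R i j x := by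
    rw [← polarForm_self]
    simp only [polarForm_single]
    rw [polarForm]
    exact Finset.sum_congr rfl fun l _ => mul_comm _ _
  have h2 : ∑ l, x l ^ 2 = ‖x‖ ^ 2 := (EuclideanSpace.real_norm_sq_eq _).symm
  calc _ = (b - ‖x‖ ^ 2) ^ 2 * ∑ l, polarForm R i j (EuclideanSpace.single l 1) x ^ 2 -
        4 * (b - ‖x‖ ^ 2) * curvForm R i j x * ∑ l, x l * polarForm R i j (EuclideanSpace.single l 1) x +
        4 * curvForm R i j x ^ 2 * ∑ l, x l ^ 2 := by
        simp only [Finset.mul_sum, ← Finset.sum_add_distrib, ← Finset.sum_sub_distrib]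
        exact Finset.sum_congr rfl fun l _ => by ring
    _ = _ := by
        rw [h1, h2]
        simp only [polarForm_single]
        ring

end

/-! ### The gradient of H̄ through the tangential curvature -/

section

variable {n : ℕ} {W : Fin n → Fin n → Fin n → Fin n → ℝ} {a : ℕ → ℝ}

theorem tensorHbar_eq (ha₁ : a 1 = -1) (i j : Fin (n - 1)) (x : Space n) :
    tensorHbar W 1 a i j x = (a 0 - ‖x.1‖ ^ 2) * curvForm (tangentialPart W) i j x.1 := by
  rw [tensorHbar, tensorH_eq, eval_fPoly_one, ha₁]; ring

theorem pd_tensorHbar (ha₁ : a 1 = -1) (i j l : Fin (n - 1)) (x : Space n) :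
    pd l (tensorHbar W 1 a i j) x = (a 0 - ‖x.1‖ ^ 2) *
      polarForm (tangentialPart W) i j (EuclideanSpace.single l 1) x.1 -
        2 * x.1 l * curvForm (tangentialPart W) i j x.1 := by
  have hd : Differentiable ℝ (tensorHbar W 1 a i j) := by
    rw [funext (tensorHbar_eq ha₁ i j)]
    unfold curvForm
    refine Differentiable.mul ?_ (by fun_prop)
    exact ((contDiff_const.sub (contDiff_fst.norm_sq ℝ)).differentiable (n := 1) (by simp))
  refine fderiv_apply_eq_of_line (hd x)
    (Eventually.of_forall (tensorHbar_eq ha₁ i j)) ?_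
  have h1 := (hasDerivAt_norm_sq_line x.1 l).const_sub (a 0)
  have h2 : HasDerivAt (fun t : ℝ => curvForm (tangentialPart W) i j
      (x.1 + t • EuclideanSpace.single l 1))
      (polarForm (tangentialPart W) i j (EuclideanSpace.single l 1) x.1) 0 := by
    refine hasDerivAt_zero_of_quadratic (a := curvForm (tangentialPart W) i j x.1)
      (c := curvForm (tangentialPart W) i j (EuclideanSpace.single l 1)) fun t => ?_
    rw [curvForm_add, polarForm_smul_left, curvForm_smul]
  refine (h1.mul h2).congr_deriv ?_
  simp only [zero_smul, add_zero]
  ring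

theorem sum_sq_pd_tensorHbar (ha₁ : a 1 = -1) (x : Space n) :
    ∑ i, ∑ j, ∑ l, pd l (tensorHbar W 1 a i j) x ^ 2 = gradSq (tangentialPart W) (a 0) x.1 := by
  rw [← sum_sq_derivative]
  simp only [pd_tensorHbar ha₁]

end

/-! ### Expansion of the squared gradient in the centre -/

section

variable {d : ℕ} (R : Fin d → Fin d → Fin d → Fin d → ℝ) (b : ℝ)

/-- The bilinear form of `normMatrix`. -/
def normPolar (ξ y : EuclideanSpace ℝ (Fin d)) : ℝ := ∑ q, rowForm (normMatrix R) q ξ * y q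

/-- The part of `gradSq R b (y + ξ)` of first order in `ξ`. -/
def gradSqFirst (ξ y : EuclideanSpace ℝ (Fin d)) : ℝ :=
  2 * ((b - ‖y‖ ^ 2) * (b - ‖y‖ ^ 2) * normPolar R ξ y)
    - 4 * ((b - ‖y‖ ^ 2) * (inner ℝ ξ y * quadForm (normMatrix R) y))
    + 2 * ((12 * ‖y‖ ^ 2 - 8 * b) * ∑ i, ∑ j, curvForm R i j y * polarForm R i j ξ y)
    + 24 * (inner ℝ ξ y * ∑ i, ∑ j, curvForm R i j y * curvForm R i j y)

/-- The part of `gradSq R b (y + ξ)` of second order in `ξ`. -/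
def gradSqSecond (ξ y : EuclideanSpace ℝ (Fin d)) : ℝ :=
  (b - ‖y‖ ^ 2) ^ 2 * quadForm (normMatrix R) ξ
    - 8 * (b - ‖y‖ ^ 2) * (inner ℝ ξ y * normPolar R ξ y)
    + 4 * (inner ℝ ξ y ^ 2 * quadForm (normMatrix R) y)
    - 2 * (b - ‖y‖ ^ 2) * ‖ξ‖ ^ 2 * quadForm (normMatrix R) y
    + (12 * ‖y‖ ^ 2 - 8 * b) * (∑ i, ∑ j, polarForm R i j ξ y ^ 2
      + 2 * ∑ i, ∑ j, curvForm R i j ξ * curvForm R i j y)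
    + 48 * ∑ i, ∑ j, curvForm R i j y * (inner ℝ ξ y * polarForm R i j ξ y)
    + 12 * ‖ξ‖ ^ 2 * ∑ i, ∑ j, curvForm R i j y * curvForm R i j y

variable {R} {b}

theorem quadForm_normMatrix_add (y ξ : EuclideanSpace ℝ (Fin d)) :
    quadForm (normMatrix R) (y + ξ) =
      quadForm (normMatrix R) y + 2 * normPolar R ξ y + quadForm (normMatrix R) ξ := by
  have h1 : normPolar R ξ y = ∑ i, y i * rowForm (normMatrix R) i ξ := by
    simp only [normPolar, mul_comm]
  have h2 : normPolar R ξ y = ∑ i, ξ i * rowForm (normMatrix R) i y := by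
    rw [h1]
    simp only [rowForm, Finset.mul_sum]
    rw [Finset.sum_comm]
    refine Finset.sum_congr rfl fun i _ => Finset.sum_congr rfl fun j _ => ?_
    rw [normMatrix_symm]; ring
  have h3 : ∀ i, rowForm (normMatrix R) i (y + ξ) =
      rowForm (normMatrix R) i y + rowForm (normMatrix R) i ξ := fun i => by
    simp [rowForm, mul_add, Finset.sum_add_distrib]
  rw [two_mul]
  nth_rw 1 [h1]
  rw [h2, quadForm_eq, quadForm_eq, quadForm_eq]
  simp only [← Finset.sum_add_distrib, h3, PiLp.add_apply]
  exact Finset.sum_congr rfl fun i _ => by ring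

theorem isJet_inner : IsJet 1 1 fun ξ y : EuclideanSpace ℝ (Fin d) => (inner ℝ ξ y : ℝ) := by
  refine ⟨fun ξ => by fun_prop, ⟨1, fun ξ y _ => (abs_real_inner_le_norm ξ y).trans ?_⟩⟩
  rw [pow_one, pow_one, one_mul]
  exact mul_le_mul_of_nonneg_left (by linarith) (norm_nonneg _)

theorem isJet_quadForm (r : Fin d → Fin d → ℝ) :
    IsJet 0 2 fun _ y : EuclideanSpace ℝ (Fin d) => quadForm r y :=
  IsJet.sum fun i _ => IsJet.sum fun j _ =>
    (((IsJet.coord i).const_mul (r i j)).mul (IsJet.coord j))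

theorem isJet_quadForm_left (r : Fin d → Fin d → ℝ) :
    IsJet 2 0 fun ξ _ : EuclideanSpace ℝ (Fin d) => quadForm r ξ :=
  IsJet.sum fun i _ => IsJet.sum fun j _ =>
    (((IsJet.coord_left i).const_mul (r i j)).mul (IsJet.coord_left j))

theorem isJet_curvForm (i j : Fin d) :
    IsJet 0 2 fun _ y : EuclideanSpace ℝ (Fin d) => curvForm R i j y :=
  isJet_quadForm fun k l => R i k j l

theorem isJet_curvForm_left (i j : Fin d) :
    IsJet 2 0 fun ξ _ : EuclideanSpace ℝ (Fin d) => curvForm R i j ξ :=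
  isJet_quadForm_left fun k l => R i k j l

theorem isJet_polarForm (i j : Fin d) :
    IsJet 1 1 fun ξ y : EuclideanSpace ℝ (Fin d) => polarForm R i j ξ y :=
  IsJet.sum fun l _ => (IsJet.sum fun m _ => (IsJet.coord_left m).const_mul _).mul (IsJet.coord l)

theorem isJet_normPolar : IsJet 1 1 fun ξ y : EuclideanSpace ℝ (Fin d) => normPolar R ξ y :=
  IsJet.sum fun l _ => (IsJet.sum fun m _ => (IsJet.coord_left m).const_mul _).mul (IsJet.coord l)

theorem isJet_factor : IsJet 0 2 fun _ y : EuclideanSpace ℝ (Fin d) => b - ‖y‖ ^ 2 :=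
  ((IsJet.const b).mono le_rfl (by norm_num)).sub IsJet.norm_sq

theorem isJet_factor' : IsJet 0 2 fun _ y : EuclideanSpace ℝ (Fin d) => 12 * ‖y‖ ^ 2 - 8 * b :=
  (IsJet.norm_sq.const_mul 12).sub ((IsJet.const (8 * b)).mono le_rfl (by norm_num))

theorem isJet_gradSqFirst : IsJet 1 6 fun ξ y : EuclideanSpace ℝ (Fin d) => gradSqFirst R b ξ y :=
  (((((((isJet_factor.mul isJet_factor).mul isJet_normPolar).const_mul 2).mono le_rfl
    (by norm_num)).sub (((isJet_factor.mul (isJet_inner.mul (isJet_quadForm _))).const_mul 4).mono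
      le_rfl (by norm_num))).add
    (((isJet_factor'.mul (IsJet.sum fun i _ => IsJet.sum fun j _ =>
      (isJet_curvForm i j).mul (isJet_polarForm i j))).const_mul 2).mono le_rfl (by norm_num)))).add
    (((isJet_inner.mul (IsJet.sum fun i _ => IsJet.sum fun j _ =>
      (isJet_curvForm i j).mul (isJet_curvForm i j))).const_mul 24).mono le_rfl (by norm_num))

/-- This parity removes the first-order part after integration against a density that is even in x̄.
-/
theorem gradSqFirst_neg (ξ y : EuclideanSpace ℝ (Fin d)) :
    gradSqFirst R b ξ (-y) = -gradSqFirst R b ξ y := by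
  have h1 : ∀ i j, curvForm R i j (-y) = curvForm R i j y := fun i j => by simp [curvForm]
  have h2 : ∀ i j, polarForm R i j ξ (-y) = -polarForm R i j ξ y := fun i j => by simp [polarForm]
  have h3 : normPolar R ξ (-y) = -normPolar R ξ y := by simp [normPolar]
  have h4 : quadForm (normMatrix R) (-y) = quadForm (normMatrix R) y := by simp [quadForm]
  simp only [gradSqFirst, h1, h2, h3, h4, norm_neg, inner_neg_right, mul_neg, Finset.sum_neg_distrib]
  ring

/-- Each factor of `gradSq` is a polynomial in y and ξ. The summands j1 to j6 collect the products
whose total order in ξ is at least three; none grows faster than degree six in y. -/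
theorem isJet_gradSq_remainder : IsJet 3 6 fun ξ y : EuclideanSpace ℝ (Fin d) =>
    gradSq R b (y + ξ) - gradSq R b y - gradSqFirst R b ξ y - gradSqSecond R b ξ y := by
  have jl := isJet_inner (d := d)
  have jZ := IsJet.norm_sq_left (E := EuclideanSpace ℝ (Fin d))
  have jf := isJet_factor (d := d) (b := b)
  have jψ := isJet_factor' (d := d) (b := b)
  have jT0 := isJet_quadForm (normMatrix R)
  have jT1 := isJet_normPolar (R := R)
  have jT2 := isJet_quadForm_left (normMatrix R)
  have jS1 : IsJet 1 3 fun ξ y : EuclideanSpace ℝ (Fin d) =>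
      ∑ i, ∑ j, curvForm R i j y * polarForm R i j ξ y :=
    IsJet.sum fun i _ => IsJet.sum fun j _ => (isJet_curvForm i j).mul (isJet_polarForm i j)
  have jS2 : IsJet 2 2 fun ξ y : EuclideanSpace ℝ (Fin d) =>
      ∑ i, ∑ j, polarForm R i j ξ y * polarForm R i j ξ y :=
    IsJet.sum fun i _ => IsJet.sum fun j _ => (isJet_polarForm i j).mul (isJet_polarForm i j)
  have jS2' : IsJet 2 2 fun ξ y : EuclideanSpace ℝ (Fin d) =>
      ∑ i, ∑ j, curvForm R i j ξ * curvForm R i j y :=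
    IsJet.sum fun i _ => IsJet.sum fun j _ => (isJet_curvForm_left i j).mul (isJet_curvForm i j)
  have jS3 : IsJet 3 1 fun ξ y : EuclideanSpace ℝ (Fin d) =>
      ∑ i, ∑ j, polarForm R i j ξ y * curvForm R i j ξ :=
    IsJet.sum fun i _ => IsJet.sum fun j _ => (isJet_polarForm i j).mul (isJet_curvForm_left i j)
  have jS4 : IsJet 4 0 fun ξ _ : EuclideanSpace ℝ (Fin d) =>
      ∑ i, ∑ j, curvForm R i j ξ * curvForm R i j ξ :=
    IsJet.sum fun i _ => IsJet.sum fun j _ => (isJet_curvForm_left i j).mul (isJet_curvForm_left i j)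
  have j1 := ((jf.mul (jl.mul jT2)).const_mul (-4)).mono (k' := 3) (m' := 6) (by norm_num) (by norm_num)
  have j2a := (((jl.mul jl).const_mul 4).mono (k' := 2) (m' := 2) (by norm_num) (by norm_num)).sub
    ((jf.mul jZ).const_mul 2)
  have j2b := ((jT1.const_mul 2).mono (k' := 1) (m' := 1) (by norm_num) (by norm_num)).add
    (jT2.mono (k' := 1) (m' := 1) (by norm_num) (by norm_num))
  have j2 := (j2a.mul j2b).mono (k' := 3) (m' := 6) (by norm_num) (by norm_num)
  have j3a := (((jl.mul jZ).const_mul 4).mono (k' := 3) (m' := 1) (by norm_num) (by norm_num)).add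
    ((jZ.mul jZ).mono (k' := 3) (m' := 1) (by norm_num) (by norm_num))
  have j3b := (jT0.add ((jT1.const_mul 2).mono (k' := 0) (m' := 2) (by norm_num) (by norm_num))).add
    (jT2.mono (k' := 0) (m' := 2) (by norm_num) (by norm_num))
  have j3 := (j3a.mul j3b).mono (k' := 3) (m' := 6) (by norm_num) (by norm_num)
  have jS34 := ((jS3.const_mul 2).mono (k' := 3) (m' := 1) (by norm_num) (by norm_num)).add
    (jS4.mono (k' := 3) (m' := 1) (by norm_num) (by norm_num))
  have j4 := (jψ.mul jS34).mono (k' := 3) (m' := 6) (by norm_num) (by norm_num)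
  have jS24 := (jS2.add (jS2'.const_mul 2)).add (jS34.mono (k' := 2) (m' := 2) (by norm_num) (by norm_num))
  have j5 := ((jl.mul jS24).const_mul 24).mono (k' := 3) (m' := 6) (by norm_num) (by norm_num)
  have jS14 := ((jS1.const_mul 2).mono (k' := 1) (m' := 3) (by norm_num) (by norm_num)).add
    (jS24.mono (k' := 1) (m' := 3) (by norm_num) (by norm_num))
  have j6 := ((jZ.mul jS14).const_mul 12).mono (k' := 3) (m' := 6) (by norm_num) (by norm_num)
  have j := ((((j1.add j2).add j3).add j4).add j5).add j6
  refine j.congr fun ξ y => ?_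
  have hs : ‖y + ξ‖ ^ 2 = ‖y‖ ^ 2 + 2 * inner ℝ ξ y + ‖ξ‖ ^ 2 := by
    rw [norm_add_sq_real, real_inner_comm]
  have hS : ∑ i, ∑ j, curvForm R i j (y + ξ) ^ 2 =
      ∑ i, ∑ j, curvForm R i j y * curvForm R i j y +
      2 * (∑ i, ∑ j, curvForm R i j y * polarForm R i j ξ y) +
      ∑ i, ∑ j, polarForm R i j ξ y * polarForm R i j ξ y +
      2 * (∑ i, ∑ j, curvForm R i j ξ * curvForm R i j y) +
      2 * (∑ i, ∑ j, polarForm R i j ξ y * curvForm R i j ξ) +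
      ∑ i, ∑ j, curvForm R i j ξ * curvForm R i j ξ := by
    simp only [curvForm_add, Finset.mul_sum, ← Finset.sum_add_distrib]
    exact Finset.sum_congr rfl fun i _ => Finset.sum_congr rfl fun j _ => by ring
  have hl : ∑ i, ∑ j, curvForm R i j y * (inner ℝ ξ y * polarForm R i j ξ y) =
      inner ℝ ξ y * ∑ i, ∑ j, curvForm R i j y * polarForm R i j ξ y := by
    simp only [Finset.mul_sum]
    exact Finset.sum_congr rfl fun i _ => Finset.sum_congr rfl fun j _ => by ring
  rw [gradSq, gradSq, gradSqFirst, gradSqSecond, hs, hS, quadForm_normMatrix_add, hl]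
  simp only [sq (curvForm R _ _ _), sq (polarForm R _ _ _ _)]
  generalize ∑ i, ∑ j, curvForm R i j y * curvForm R i j y = S0
  generalize ∑ i, ∑ j, curvForm R i j y * polarForm R i j ξ y = S1
  generalize ∑ i, ∑ j, polarForm R i j ξ y * polarForm R i j ξ y = S2
  generalize ∑ i, ∑ j, curvForm R i j ξ * curvForm R i j y = S2'
  generalize ∑ i, ∑ j, polarForm R i j ξ y * curvForm R i j ξ = S3
  generalize ∑ i, ∑ j, curvForm R i j ξ * curvForm R i j ξ = S4
  generalize quadForm (normMatrix R) y = T0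
  generalize quadForm (normMatrix R) ξ = T2
  generalize normPolar R ξ y = T1
  ring

end

/-! ### Contractions of the symmetrized curvature -/

section

variable {d : ℕ} {R : Fin d → Fin d → Fin d → Fin d → ℝ}

/-- `∑ V_{ijlm}²`, where `V` is `symCurv`. -/
def curvNorm (R : Fin d → Fin d → Fin d → Fin d → ℝ) : ℝ := ∑ i, normMatrix R i i

theorem curvForm_eq_quadForm (i j : Fin d) (y : EuclideanSpace ℝ (Fin d)) :
    curvForm R i j y = quadForm (fun k l => R i k j l) y := rfl

theorem sum_sum_sum_sum_comm (f : Fin d → Fin d → Fin d → Fin d → ℝ) :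
    ∑ i, ∑ j, ∑ l, ∑ m, f i j l m = ∑ m, ∑ i, ∑ j, ∑ l, f i j l m := by
  simp only [← Finset.sum_product', Finset.univ_product_univ]
  exact Fintype.sum_equiv ⟨fun t => ⟨t.2.2.2, t.1, t.2.1, t.2.2.1⟩,
    fun t => ⟨t.2.1, t.2.2.1, t.2.2.2, t.1⟩, fun _ => rfl, fun _ => rfl⟩ _ _ fun _ => rfl

theorem curvNorm_eq : curvNorm R = ∑ i, ∑ j, ∑ l, ∑ m, symCurv R i j l m ^ 2 := by
  rw [sum_sum_sum_sum_comm]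
  simp only [curvNorm, normMatrix, sq]

theorem IsTangentialCurvature.sum_diag_eq_zero (hR : IsTangentialCurvature R) (i j : Fin d) :
    ∑ k, R i k j k = 0 := by
  rw [← hR.traceFree i j]
  exact Finset.sum_congr rfl fun k _ => by rw [hR.antisymm_left, hR.antisymm_right, neg_neg]

/-- The symmetrized tensor inherits the exchange of its two pairs, which lets a contraction in the
first pair be read as one in the second. -/
theorem IsTangentialCurvature.symCurv_pair (hR : IsTangentialCurvature R) (i j l m : Fin d) :
    symCurv R i j l m = symCurv R l m i j := by
  have h1 : R i l j m = R l i m j := by rw [hR.antisymm_left, hR.antisymm_right, neg_neg]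
  have h2 : R i m j l = R l j m i := by
    rw [hR.antisymm_left, hR.antisymm_right, neg_neg, hR.pair_symm]
  rw [symCurv, symCurv, h1, h2]

/-- `∑ R_{ipjq} (R_{ipjq} + R_{iqjp})` is half of the norm. -/
theorem sum_curv_mul_symCurv (R : Fin d → Fin d → Fin d → Fin d → ℝ) :
    ∑ i, ∑ j, ∑ p, ∑ q, R i p j q * symCurv R i j p q = curvNorm R / 2 := by
  have h : ∀ i j, ∑ p, ∑ q, R i q j p * symCurv R i j p q = ∑ p, ∑ q, R i p j q * symCurv R i j p q :=
    fun i j => by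
      rw [Finset.sum_comm]
      exact Finset.sum_congr rfl fun p _ => Finset.sum_congr rfl fun q _ => by
        rw [symCurv_comm_right]
  have h2 : curvNorm R = ∑ i, ∑ j, ((∑ p, ∑ q, R i p j q * symCurv R i j p q) +
      ∑ p, ∑ q, R i q j p * symCurv R i j p q) := by
    rw [curvNorm_eq]
    refine Finset.sum_congr rfl fun i _ => Finset.sum_congr rfl fun j _ => ?_
    simp only [← Finset.sum_add_distrib]
    refine Finset.sum_congr rfl fun p _ => Finset.sum_congr rfl fun q _ => ?_
    rw [sq]; nth_rw 1 [symCurv]; ring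
  simp only [h, ← two_mul, ← Finset.mul_sum] at h2
  linarith

/-- Interchanging p and q in one of the two terms symmetrizes R into `symCurv`, and the sum becomes
a sum of squares. -/
theorem sum_curv_mul_polar (R : Fin d → Fin d → Fin d → Fin d → ℝ) (ξ : EuclideanSpace ℝ (Fin d)) :
    ∑ i, ∑ j, ∑ p, ∑ q, R i p j q * (ξ p * (∑ m, symCurv R i j q m * ξ m) +
      ξ q * ∑ m, symCurv R i j p m * ξ m) = quadForm (normMatrix R) ξ := by
  rw [quadForm_normMatrix]
  refine Finset.sum_congr rfl fun i _ => Finset.sum_congr rfl fun j _ => ?_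
  have e : ∀ q, (∑ m, symCurv R i j q m * ξ m) ^ 2 =
      ∑ p, (R i p j q + R i q j p) * ξ p * ∑ m, symCurv R i j q m * ξ m := fun q => by
    rw [sq]; nth_rw 1 [Finset.sum_mul]
    exact Finset.sum_congr rfl fun p _ => by rw [symCurv_comm_right, symCurv]
  simp only [e]
  simp only [mul_add, add_mul, Finset.sum_add_distrib]
  congr 1
  · rw [Finset.sum_comm]
    exact Finset.sum_congr rfl fun p _ => Finset.sum_congr rfl fun q _ => by ring
  · exact Finset.sum_congr rfl fun p _ => Finset.sum_congr rfl fun q _ => by ring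

end

/-! ### Integrals of the terms of order zero and two -/

section

variable {n : ℕ} {ε β : ℝ} {R : Fin (n - 1) → Fin (n - 1) → Fin (n - 1) → Fin (n - 1) → ℝ}

/-- Lebesgue measure on the half-space. -/
abbrev halfSpaceVolume (n : ℕ) : Measure (Space n) := volume.restrict (halfSpace n)

theorem integratesTo_normMatrix (hn : 2 ≤ n) (hε : 1 / 2 ≤ ε) (k : ℕ) (hβ : (n : ℝ) + (k + 2 : ℕ) < 2 * β) :
    IntegratesTo (halfSpaceVolume n) (fun x => quadForm (normMatrix R) x.1 * (‖x.1‖ ^ k * den 0 ε x ^ (-β)))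
      (curvNorm R / (n - 1 : ℕ) * moment n ε (k + 2) β) :=
  integratesTo_quadForm hn hε k hβ _

theorem integratesTo_inner_mul_normPolar (hn : 2 ≤ n) (hε : 1 / 2 ≤ ε) (k : ℕ)
    (hβ : (n : ℝ) + (k + 2 : ℕ) < 2 * β) (ξ : Bdry n) :
    IntegratesTo (halfSpaceVolume n) (fun x => inner ℝ ξ x.1 * normPolar R ξ x.1 * (‖x.1‖ ^ k * den 0 ε x ^ (-β)))
      (quadForm (normMatrix R) ξ / (n - 1 : ℕ) * moment n ε (k + 2) β) := by
  refine (integratesTo_quadForm hn hε k hβ fun p q => ξ p * rowForm (normMatrix R) q ξ).congr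
    (fun x => ?_) ?_
  · congr 1
    rw [inner_eq_sum_mul, normPolar, Finset.sum_mul_sum, quadForm]
    exact Finset.sum_congr rfl fun p _ => Finset.sum_congr rfl fun q _ => by ring
  · rw [quadForm_eq]

theorem integratesTo_polarForm_sq (hn : 2 ≤ n) (hε : 1 / 2 ≤ ε) (k : ℕ)
    (hβ : (n : ℝ) + (k + 2 : ℕ) < 2 * β) (ξ : Bdry n) :
    IntegratesTo (halfSpaceVolume n) (fun x => (∑ i, ∑ j, polarForm R i j ξ x.1 ^ 2) *
      (‖x.1‖ ^ k * den 0 ε x ^ (-β)))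
      (quadForm (normMatrix R) ξ / (n - 1 : ℕ) * moment n ε (k + 2) β) := by
  refine (IntegratesTo.sum (s := Finset.univ) fun i _ => IntegratesTo.sum (s := Finset.univ) fun j _ =>
    integratesTo_quadForm hn hε k hβ
      fun p q => (∑ m, symCurv R i j p m * ξ m) * ∑ m, symCurv R i j q m * ξ m).congr
    (fun x => ?_) ?_
  · simp only [← Finset.sum_mul]
    congr 1
    refine Finset.sum_congr rfl fun i _ => Finset.sum_congr rfl fun j _ => ?_
    rw [polarForm, sq, Finset.sum_mul_sum, quadForm]
    exact Finset.sum_congr rfl fun p _ => Finset.sum_congr rfl fun q _ => by ring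
  · simp only [← Finset.sum_mul, ← Finset.sum_div]
    rw [quadForm_normMatrix]
    simp only [sq]

/-- Each component H_{ij} is a trace-free quadratic form and has mean zero on spheres. -/
theorem integratesTo_curvForm_mul_const (hR : IsTangentialCurvature R) (hn : 2 ≤ n) (hε : 1 / 2 ≤ ε)
    (k : ℕ) (hβ : (n : ℝ) + (k + 2 : ℕ) < 2 * β) (c : Fin (n - 1) → Fin (n - 1) → ℝ) :
    IntegratesTo (halfSpaceVolume n) (fun x => (∑ i, ∑ j, c i j * curvForm R i j x.1) *
      (‖x.1‖ ^ k * den 0 ε x ^ (-β))) 0 := by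
  refine (IntegratesTo.sum (s := Finset.univ) fun i _ => IntegratesTo.sum (s := Finset.univ) fun j _ =>
    (integratesTo_quadForm hn hε k hβ fun p q => R i p j q).const_mul (c i j)).congr
    (fun x => ?_) ?_
  · simp only [Finset.sum_mul, curvForm_eq_quadForm]
    exact Finset.sum_congr rfl fun p _ => Finset.sum_congr rfl fun q _ => by ring
  · simp [hR.sum_diag_eq_zero]

theorem integratesTo_inner_sq_mul_normMatrix (hn : 2 ≤ n) (hε : 1 / 2 ≤ ε) (k : ℕ)
    (hβ : (n : ℝ) + (k + 4 : ℕ) < 2 * β) (ξ : Bdry n) :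
    IntegratesTo (halfSpaceVolume n) (fun x => inner ℝ ξ x.1 ^ 2 * quadForm (normMatrix R) x.1 *
      (‖x.1‖ ^ k * den 0 ε x ^ (-β)))
      ((‖ξ‖ ^ 2 * curvNorm R + 2 * quadForm (normMatrix R) ξ) /
        ((n - 1 : ℕ) * ((n - 1 : ℕ) + 2)) * moment n ε (k + 4) β) := by
  refine (integratesTo_quadForm_mul_quadForm hn hε k hβ (fun p q => ξ p * ξ q) (normMatrix R)).congr
    (fun x => ?_) ?_
  · congr 2
    rw [inner_eq_sum_mul, sq, Finset.sum_mul_sum, quadForm]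
    exact Finset.sum_congr rfl fun p _ => Finset.sum_congr rfl fun q _ => by ring
  · congr 3
    · rw [EuclideanSpace.real_norm_sq_eq, curvNorm]
      simp only [sq]
    · rw [quadForm, Finset.mul_sum]
      refine Finset.sum_congr rfl fun p _ => ?_
      rw [Finset.mul_sum]
      refine Finset.sum_congr rfl fun q _ => ?_
      rw [normMatrix_symm q p]; ring

/-- In the pairing formula the product of traces drops out because R_{ikjk} sums to zero; the two
remaining pairings are those of `sum_curv_mul_polar`. -/
theorem integratesTo_curvForm_mul_polarForm (hR : IsTangentialCurvature R) (hn : 2 ≤ n)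
    (hε : 1 / 2 ≤ ε) (k : ℕ) (hβ : (n : ℝ) + (k + 4 : ℕ) < 2 * β) (ξ : Bdry n) :
    IntegratesTo (halfSpaceVolume n) (fun x => (∑ i, ∑ j, curvForm R i j x.1 * (inner ℝ ξ x.1 * polarForm R i j ξ x.1)) *
      (‖x.1‖ ^ k * den 0 ε x ^ (-β)))
      (quadForm (normMatrix R) ξ / ((n - 1 : ℕ) * ((n - 1 : ℕ) + 2)) * moment n ε (k + 4) β) := by
  refine (IntegratesTo.sum (s := Finset.univ) fun i _ => IntegratesTo.sum (s := Finset.univ) fun j _ =>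
    integratesTo_quadForm_mul_quadForm hn hε k hβ (fun p q => R i p j q)
      fun p q => ξ p * ∑ m, symCurv R i j q m * ξ m).congr (fun x => ?_) ?_
  · simp only [← Finset.sum_mul]
    congr 1
    refine Finset.sum_congr rfl fun i _ => Finset.sum_congr rfl fun j _ => ?_
    congr 1
    rw [inner_eq_sum_mul, polarForm, Finset.sum_mul_sum, quadForm]
    exact Finset.sum_congr rfl fun p _ => Finset.sum_congr rfl fun q _ => by ring
  · simp only [hR.sum_diag_eq_zero, zero_mul, zero_add, ← Finset.sum_mul, ← Finset.sum_div]
    rw [sum_curv_mul_polar]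

theorem integratesTo_curvForm_sq (hR : IsTangentialCurvature R) (hn : 2 ≤ n)
    (hε : 1 / 2 ≤ ε) (k : ℕ) (hβ : (n : ℝ) + (k + 4 : ℕ) < 2 * β) :
    IntegratesTo (halfSpaceVolume n) (fun x => (∑ i, ∑ j, curvForm R i j x.1 * curvForm R i j x.1) *
      (‖x.1‖ ^ k * den 0 ε x ^ (-β)))
      (curvNorm R / 2 / ((n - 1 : ℕ) * ((n - 1 : ℕ) + 2)) * moment n ε (k + 4) β) := by
  refine (IntegratesTo.sum (s := Finset.univ) fun i _ => IntegratesTo.sum (s := Finset.univ) fun j _ =>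
    integratesTo_quadForm_mul_quadForm hn hε k hβ (fun p q => R i p j q) fun p q => R i p j q).congr
      (fun x => ?_) ?_
  · simp only [← Finset.sum_mul]
    rfl
  · simp only [hR.sum_diag_eq_zero, zero_mul, zero_add, ← Finset.sum_mul, ← Finset.sum_div]
    rw [← sum_curv_mul_symCurv]
    rfl

theorem integratesTo_gradSq (hR : IsTangentialCurvature R) (hn : 2 ≤ n) (hε : 1 / 2 ≤ ε)
    (hβ : (n : ℝ) + 6 < 2 * β) (b : ℝ) :
    IntegratesTo (halfSpaceVolume n) (fun x => gradSq R b x.1 * den 0 ε x ^ (-β))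
      (curvNorm R / (n - 1 : ℕ) * (b ^ 2 * moment n ε 2 β - 2 * b * moment n ε 4 β + moment n ε 6 β) +
        curvNorm R / 2 / ((n - 1 : ℕ) * ((n - 1 : ℕ) + 2)) *
          (12 * moment n ε 6 β - 8 * b * moment n ε 4 β)) := by
  have t0 := integratesTo_normMatrix (R := R) hn hε 0 (β := β) (by push_cast; linarith)
  have t2 := integratesTo_normMatrix (R := R) hn hε 2 (β := β) (by push_cast; linarith)
  have t4 := integratesTo_normMatrix (R := R) hn hε 4 (β := β) (by push_cast; linarith)
  have s0 := integratesTo_curvForm_sq hR hn hε 0 (β := β) (by push_cast; linarith)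
  have s2 := integratesTo_curvForm_sq hR hn hε 2 (β := β) (by push_cast; linarith)
  refine (((((t0.const_mul (b ^ 2)).add (t2.const_mul (-2 * b))).add t4).add
    (s2.const_mul 12)).add (s0.const_mul (-8 * b))).congr (fun x => ?_) ?_
  · simp only [gradSq, sq (curvForm R _ _ _)]
    ring
  · ring

theorem integratesTo_gradSqSecond (hR : IsTangentialCurvature R) (hn : 2 ≤ n) (hε : 1 / 2 ≤ ε)
    (hβ : (n : ℝ) + 6 < 2 * β) (b : ℝ) (ξ : Bdry n) :
    IntegratesTo (halfSpaceVolume n) (fun x => gradSqSecond R b ξ x.1 * den 0 ε x ^ (-β))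
      (quadForm (normMatrix R) ξ *
        (b ^ 2 * moment n ε 0 β - 2 * b * moment n ε 2 β + moment n ε 4 β
          + (20 * moment n ε 4 β - 16 * b * moment n ε 2 β) / (n - 1 : ℕ)
          + 56 * moment n ε 4 β / ((n - 1 : ℕ) * ((n - 1 : ℕ) + 2))) +
       ‖ξ‖ ^ 2 * curvNorm R * ((2 * moment n ε 4 β - 2 * b * moment n ε 2 β) / (n - 1 : ℕ) +
          10 * moment n ε 4 β / ((n - 1 : ℕ) * ((n - 1 : ℕ) + 2)))) := by
  have p0 := integratesTo_norm_pow (n := n) (by omega) hε 0 (β := β) (by push_cast; linarith)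
  have p2 := integratesTo_norm_pow (n := n) (by omega) hε 2 (β := β) (by push_cast; linarith)
  have p4 := integratesTo_norm_pow (n := n) (by omega) hε 4 (β := β) (by push_cast; linarith)
  have t0 := integratesTo_normMatrix (R := R) hn hε 0 (β := β) (by push_cast; linarith)
  have t2 := integratesTo_normMatrix (R := R) hn hε 2 (β := β) (by push_cast; linarith)
  have l0 := integratesTo_inner_mul_normPolar (R := R) hn hε 0 (β := β) (by push_cast; linarith) ξ
  have l2 := integratesTo_inner_mul_normPolar (R := R) hn hε 2 (β := β) (by push_cast; linarith) ξ
  have q0 := integratesTo_polarForm_sq (R := R) hn hε 0 (β := β) (by push_cast; linarith) ξ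
  have q2 := integratesTo_polarForm_sq (R := R) hn hε 2 (β := β) (by push_cast; linarith) ξ
  have c0 := integratesTo_curvForm_mul_const hR hn hε 0 (β := β) (by push_cast; linarith)
    fun i j => curvForm R i j ξ
  have c2 := integratesTo_curvForm_mul_const hR hn hε 2 (β := β) (by push_cast; linarith)
    fun i j => curvForm R i j ξ
  have w0 := integratesTo_inner_sq_mul_normMatrix (R := R) hn hε 0 (β := β) (by push_cast; linarith) ξ
  have v0 := integratesTo_curvForm_mul_polarForm hR hn hε 0 (β := β) (by push_cast; linarith) ξ
  have s0 := integratesTo_curvForm_sq hR hn hε 0 (β := β) (by push_cast; linarith)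
  have h1 := (((p0.const_mul (b ^ 2)).add (p2.const_mul (-2 * b))).add p4).const_mul
    (quadForm (normMatrix R) ξ)
  have h2 := ((l0.const_mul (-8 * b)).add (l2.const_mul 8)).add (w0.const_mul 4)
  have h3 := (t0.const_mul (-2 * b * ‖ξ‖ ^ 2)).add (t2.const_mul (2 * ‖ξ‖ ^ 2))
  have h4 := ((q2.const_mul 12).add (q0.const_mul (-8 * b))).add
    ((c2.const_mul 24).add (c0.const_mul (-16 * b)))
  have h5 := (v0.const_mul 48).add (s0.const_mul (12 * ‖ξ‖ ^ 2))
  refine ((((h1.add h2).add h3).add h4).add h5).congr (fun x => ?_) ?_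
  · simp only [gradSqSecond]
    ring
  · ring

end

/-! ### The contraction of H̄ with the translation vector -/

section

variable {d : ℕ} (R : Fin d → Fin d → Fin d → Fin d → ℝ) (b : ℝ)

/-- `∑ₗ (∑ᵢ H̄_{il} ξⁱ)²`. -/
def contractSq (ξ x : EuclideanSpace ℝ (Fin d)) : ℝ :=
  (b - ‖x‖ ^ 2) ^ 2 * ∑ l, (∑ i, curvForm R i l x * ξ i) ^ 2

variable {R} {b}

/-- Two factors ξ are explicit already, so moving the argument from y + ξ to y costs one order more.
-/
theorem isJet_contractSq_remainder : IsJet 3 8 fun ξ y : EuclideanSpace ℝ (Fin d) =>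
    contractSq R b ξ (y + ξ) - contractSq R b ξ y := by
  have jl := isJet_inner (d := d)
  have jZ := IsJet.norm_sq_left (E := EuclideanSpace ℝ (Fin d))
  have jf := isJet_factor (d := d) (b := b)
  have jη := ((jl.const_mul 2).mono (k' := 1) (m' := 1) (by norm_num) (by norm_num)).add
    (jZ.mono (k' := 1) (m' := 1) (by norm_num) (by norm_num))
  have j0 : ∀ l, IsJet 1 2 fun ξ y : EuclideanSpace ℝ (Fin d) => ∑ i, curvForm R i l y * ξ i :=
    fun l => IsJet.sum fun i _ => (isJet_curvForm i l).mul (IsJet.coord_left i)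
  have j1 : ∀ l, IsJet 2 1 fun ξ y : EuclideanSpace ℝ (Fin d) =>
      ∑ i, (polarForm R i l ξ y + curvForm R i l ξ) * ξ i := fun l => IsJet.sum fun i _ =>
    ((isJet_polarForm i l).add ((isJet_curvForm_left i l).mono (by norm_num) (by norm_num))).mul
      (IsJet.coord_left i)
  have ja : IsJet 3 8 fun ξ y : EuclideanSpace ℝ (Fin d) =>
      ∑ l, (((2 * inner ℝ ξ y + ‖ξ‖ ^ 2) * ((2 * inner ℝ ξ y + ‖ξ‖ ^ 2) - 2 * (b - ‖y‖ ^ 2))) *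
        ((∑ i, curvForm R i l y * ξ i + ∑ i, (polarForm R i l ξ y + curvForm R i l ξ) * ξ i) *
          (∑ i, curvForm R i l y * ξ i + ∑ i, (polarForm R i l ξ y + curvForm R i l ξ) * ξ i))) := by
    refine IsJet.sum fun l _ => ?_
    have t1 := jη.mul ((jη.mono (k' := 0) (m' := 2) (by norm_num) (by norm_num)).sub (jf.const_mul 2))
    have t2 := (j0 l).add ((j1 l).mono (k' := 1) (m' := 2) (by norm_num) (by norm_num))
    exact (t1.mul (t2.mul t2)).mono (by norm_num) (by norm_num)
  have jb : IsJet 3 8 fun ξ y : EuclideanSpace ℝ (Fin d) =>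
      ∑ l, ((b - ‖y‖ ^ 2) * (b - ‖y‖ ^ 2) * ((∑ i, (polarForm R i l ξ y + curvForm R i l ξ) * ξ i) *
        (2 * (∑ i, curvForm R i l y * ξ i) +
          ∑ i, (polarForm R i l ξ y + curvForm R i l ξ) * ξ i))) := by
    refine IsJet.sum fun l _ => ?_
    have t2 := ((j0 l).const_mul 2).add ((j1 l).mono (k' := 1) (m' := 2) (by norm_num) (by norm_num))
    exact ((jf.mul jf).mul ((j1 l).mul t2)).mono (by norm_num) (by norm_num)
  refine (ja.add jb).congr fun ξ y => ?_
  have hs : ‖y + ξ‖ ^ 2 = ‖y‖ ^ 2 + 2 * inner ℝ ξ y + ‖ξ‖ ^ 2 := by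
    rw [norm_add_sq_real, real_inner_comm]
  have hc : ∀ l, ∑ i, curvForm R i l (y + ξ) * ξ i =
      ∑ i, curvForm R i l y * ξ i + ∑ i, (polarForm R i l ξ y + curvForm R i l ξ) * ξ i := fun l => by
    rw [← Finset.sum_add_distrib]
    exact Finset.sum_congr rfl fun i _ => by rw [curvForm_add]; ring
  rw [contractSq, contractSq, hs, Finset.mul_sum, Finset.mul_sum, ← Finset.sum_add_distrib,
    ← Finset.sum_sub_distrib]
  refine Finset.sum_congr rfl fun l _ => ?_
  rw [hc]
  ring

/-- Symmetrizing in (p, q) doubles the left-hand side and produces R_{iplq} + R_{iqlp}, which by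
pair symmetry is an entry of `symCurv` with i in the last place. -/
theorem sum_contract_curv (hR : IsTangentialCurvature R) (ξ : EuclideanSpace ℝ (Fin d)) :
    ∑ l, ∑ p, ∑ q, (∑ i, R i p l q * ξ i) * (∑ i, R i p l q * ξ i + ∑ i, R i q l p * ξ i) =
      quadForm (normMatrix R) ξ / 2 := by
  have hV : ∀ l p q, ∑ i, R i p l q * ξ i + ∑ i, R i q l p * ξ i = ∑ m, symCurv R p q l m * ξ m :=
    fun l p q => by
      rw [← Finset.sum_add_distrib]
      refine Finset.sum_congr rfl fun i _ => ?_
      rw [symCurv_comm_right, hR.symCurv_pair, symCurv]; ring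
  have hsym : ∀ l, ∑ p, ∑ q, (∑ i, R i q l p * ξ i) * (∑ i, R i p l q * ξ i + ∑ i, R i q l p * ξ i) =
      ∑ p, ∑ q, (∑ i, R i p l q * ξ i) * (∑ i, R i p l q * ξ i + ∑ i, R i q l p * ξ i) := fun l => by
    rw [Finset.sum_comm]
    exact Finset.sum_congr rfl fun p _ => Finset.sum_congr rfl fun q _ => by ring
  have h2 : quadForm (normMatrix R) ξ =
      ∑ l, (∑ p, ∑ q, (∑ i, R i p l q * ξ i) * (∑ i, R i p l q * ξ i + ∑ i, R i q l p * ξ i) +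
        ∑ p, ∑ q, (∑ i, R i q l p * ξ i) * (∑ i, R i p l q * ξ i + ∑ i, R i q l p * ξ i)) := by
    rw [quadForm_normMatrix]
    have : ∀ f : Fin d → Fin d → Fin d → ℝ, ∑ p, ∑ q, ∑ l, f p q l = ∑ l, ∑ p, ∑ q, f p q l :=
      fun f => by
        rw [Finset.sum_comm]
        conv_rhs => rw [Finset.sum_comm]
        rw [Finset.sum_comm]
        exact Finset.sum_congr rfl fun p _ => Finset.sum_comm
    rw [this]
    refine Finset.sum_congr rfl fun l _ => ?_
    simp only [← Finset.sum_add_distrib]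
    refine Finset.sum_congr rfl fun p _ => Finset.sum_congr rfl fun q _ => ?_
    rw [← add_mul, ← Finset.sum_add_distrib, ← sq]
    congr 1
    rw [← hV, ← Finset.sum_add_distrib]
  simp only [hsym, ← two_mul, ← Finset.mul_sum] at h2
  linarith

end

section

variable {n : ℕ} {ε β : ℝ} {R : Fin (n - 1) → Fin (n - 1) → Fin (n - 1) → Fin (n - 1) → ℝ}

theorem integratesTo_sum_sq_contract (hR : IsTangentialCurvature R) (hn : 2 ≤ n) (hε : 1 / 2 ≤ ε)
    (k : ℕ) (hβ : (n : ℝ) + (k + 4 : ℕ) < 2 * β) (ξ : Bdry n) :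
    IntegratesTo (halfSpaceVolume n) (fun x => (∑ l, (∑ i, curvForm R i l x.1 * ξ i) ^ 2) *
      (‖x.1‖ ^ k * den 0 ε x ^ (-β)))
      (quadForm (normMatrix R) ξ / 2 / ((n - 1 : ℕ) * ((n - 1 : ℕ) + 2)) * moment n ε (k + 4) β) := by
  refine (IntegratesTo.sum (s := Finset.univ) fun l _ =>
    integratesTo_quadForm_mul_quadForm hn hε k hβ (fun p q => ∑ i, R i p l q * ξ i)
      fun p q => ∑ i, R i p l q * ξ i).congr (fun x => ?_) ?_
  · rw [Finset.sum_mul]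
    refine Finset.sum_congr rfl fun l _ => ?_
    rw [← sq]
    congr 2
    simp only [curvForm, quadForm, Finset.sum_mul]
    rw [Finset.sum_comm]
    refine Finset.sum_congr rfl fun p _ => ?_
    rw [Finset.sum_comm]
    exact Finset.sum_congr rfl fun q _ => Finset.sum_congr rfl fun i _ => by ring
  · have h0 : ∀ l, ∑ p, ∑ i, R i p l p * ξ i = 0 := fun l => by
      rw [Finset.sum_comm]
      simp [← Finset.sum_mul, hR.sum_diag_eq_zero]
    simp only [h0, zero_mul, zero_add, ← Finset.sum_mul, ← Finset.sum_div]
    rw [sum_contract_curv hR]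

theorem integratesTo_contractSq (hR : IsTangentialCurvature R) (hn : 2 ≤ n) (hε : 1 / 2 ≤ ε)
    (hβ : (n : ℝ) + 8 < 2 * β) (b : ℝ) (ξ : Bdry n) :
    IntegratesTo (halfSpaceVolume n) (fun x => contractSq R b ξ x.1 * den 0 ε x ^ (-β))
      (quadForm (normMatrix R) ξ / 2 / ((n - 1 : ℕ) * ((n - 1 : ℕ) + 2)) *
        (b ^ 2 * moment n ε 4 β - 2 * b * moment n ε 6 β + moment n ε 8 β)) := by
  have t0 := integratesTo_sum_sq_contract hR hn hε 0 (β := β) (by push_cast; linarith) ξ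
  have t2 := integratesTo_sum_sq_contract hR hn hε 2 (β := β) (by push_cast; linarith) ξ
  have t4 := integratesTo_sum_sq_contract hR hn hε 4 (β := β) (by push_cast; linarith) ξ
  refine (((t0.const_mul (b ^ 2)).add (t2.const_mul (-2 * b))).add t4).congr (fun x => ?_) ?_
  · simp only [contractSq]
    ring
  · ring

end

/-! ### Expansion of the auxiliary function -/

section

variable {n : ℕ} {W : Fin n → Fin n → Fin n → Fin n → ℝ} {a : ℕ → ℝ} {ξ : Bdry n} {ε : ℝ}

theorem IsTangentialCurvature.sum_curvForm_mul_self {d : ℕ} {R : Fin d → Fin d → Fin d → Fin d → ℝ}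
    (hR : IsTangentialCurvature R) (x : EuclideanSpace ℝ (Fin d)) (l : Fin d) :
    ∑ i, curvForm R i l x * x i = 0 := by
  rw [← hR.rowForm_curvForm_self x l, rowForm]
  exact Finset.sum_congr rfl fun i _ => by rw [hR.curvForm_symm]

theorem rpow_half_mul_self {s c : ℝ} (hs : 0 < s) : s ^ (c / 2) * s ^ (c / 2) = s ^ c := by
  rw [← Real.rpow_add hs, add_halves]

/-- The tangential gradient of the bubble is a multiple of x̄ - ξ, and H_{il}(x) x_i = 0, so only
the contraction with ξ survives. -/
theorem sum_tensorHbar_mul_pd_bubble (hW : IsWeyl W)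
    (htr : ∀ x : Space n, ∑ i, tensorH W i i x = 0) (ha₁ : a 1 = -1) (hε : 0 < ε) {x : Space n}
    (hx : x ∈ halfSpace n) :
    ∑ i, ∑ j, ∑ l, tensorHbar W 1 a i l x * tensorHbar W 1 a j l x *
      pd i (bubble ξ ε) x * pd j (bubble ξ ε) x =
      (n - 2) ^ 2 * ε ^ ((n : ℝ) - 2) *
        (contractSq (tangentialPart W) (a 0) ξ x.1 * den ξ ε x ^ (-(n : ℝ))) := by
  have hR := hW.isTangentialCurvature htr
  have hx2 : 0 ≤ x.2 := hx
  have hD := den_pos hε hx2 (ξ := ξ)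
  set c := (n - 2) * ε ^ (((n : ℝ) - 2) / 2) * (a 0 - ‖x.1‖ ^ 2) * den ξ ε x ^ (-(n / 2 : ℝ)) with hc
  have h1 : ∀ l, ∑ i, tensorHbar W 1 a i l x * pd i (bubble ξ ε) x =
      c * ∑ i, curvForm (tangentialPart W) i l x.1 * ξ i := fun l => by
    have h2 : ∀ i, tensorHbar W 1 a i l x * pd i (bubble ξ ε) x =
        c * (curvForm (tangentialPart W) i l x.1 * ξ i) -
          c * (curvForm (tangentialPart W) i l x.1 * x.1 i) := fun i => by
      rw [tensorHbar_eq ha₁, pd_bubble hε i (by linarith : -ε < x.2), hc, PiLp.sub_apply]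
      ring
    rw [Finset.sum_congr rfl fun i _ => h2 i, Finset.sum_sub_distrib, ← Finset.mul_sum,
      ← Finset.mul_sum, hR.sum_curvForm_mul_self, mul_zero, sub_zero]
  have h3 : ∑ i, ∑ j, ∑ l, tensorHbar W 1 a i l x * tensorHbar W 1 a j l x *
      pd i (bubble ξ ε) x * pd j (bubble ξ ε) x =
      ∑ l, (∑ i, tensorHbar W 1 a i l x * pd i (bubble ξ ε) x) *
        ∑ j, tensorHbar W 1 a j l x * pd j (bubble ξ ε) x := by
    simp only [Finset.sum_mul_sum]
    conv_rhs => rw [Finset.sum_comm]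
    refine Finset.sum_congr rfl fun i _ => ?_
    conv_rhs => rw [Finset.sum_comm]
    exact Finset.sum_congr rfl fun j _ => Finset.sum_congr rfl fun l _ => by ring
  have h4 : c * c = (n - 2) ^ 2 * ε ^ ((n : ℝ) - 2) * (a 0 - ‖x.1‖ ^ 2) ^ 2 * den ξ ε x ^ (-(n : ℝ)) := by
    rw [← rpow_half_mul_self hε, ← rpow_half_mul_self hD, hc, neg_div]
    ring
  rw [h3, contractSq]
  simp only [h1]
  have h5 : ∀ l, c * (∑ i, curvForm (tangentialPart W) i l x.1 * ξ i) *
      (c * ∑ i, curvForm (tangentialPart W) i l x.1 * ξ i) =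
      c * c * (∑ i, curvForm (tangentialPart W) i l x.1 * ξ i) ^ 2 := fun l => by ring
  simp only [h5, ← Finset.mul_sum]
  rw [h4]
  ring

theorem bubble_sq (hε : 0 < ε) {x : Space n} (hx : x ∈ halfSpace n) :
    bubble ξ ε x ^ 2 = ε ^ ((n : ℝ) - 2) * den ξ ε x ^ (-((n : ℝ) - 2)) := by
  have hx2 : 0 ≤ x.2 := hx
  have hD := den_pos hε hx2 (ξ := ξ)
  rw [bubble_eq hε (by linarith : -ε < x.2), ← rpow_half_mul_self (c := (n : ℝ) - 2) hε,
    ← rpow_half_mul_self (c := -((n : ℝ) - 2)) hD, neg_div]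
  ring

theorem den_translate (ξ : Bdry n) (ε : ℝ) (x : Space n) :
    den ξ ε ((x.1 + ξ, x.2) : Space n) = den 0 ε x := by simp [den]

/-- The translation by ξ moves the dependence on ξ from the weights, which become rotation
invariant, to the polynomials. -/
theorem auxF_eq (hW : IsWeyl W) (htr : ∀ x : Space n, ∑ i, tensorH W i i x = 0) (ha₁ : a 1 = -1)
    (hε : 0 < ε) (ξ : Bdry n) :
    auxF W 1 a ξ ε = 1 / 2 * ((n - 2) ^ 2 * ε ^ ((n : ℝ) - 2)) *
        (∫ x in halfSpace n, contractSq (tangentialPart W) (a 0) ξ (x.1 + ξ) * den 0 ε x ^ (-(n : ℝ)))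
      - ((n : ℝ) - 2) / (16 * (n - 1)) * ε ^ ((n : ℝ) - 2) *
        (∫ x in halfSpace n, gradSq (tangentialPart W) (a 0) (x.1 + ξ) * den 0 ε x ^ (-((n : ℝ) - 2)))
      + ∫ x in halfSpace n, source W 1 a ξ ε x * corrector W 1 a ξ ε x := by
  have hH := measurableSet_halfSpace n
  have e1 := setIntegral_congr_fun (μ := volume) hH fun x hx =>
    sum_tensorHbar_mul_pd_bubble (ξ := ξ) hW htr ha₁ hε hx
  have e2 : ∫ x in halfSpace n, (∑ i, ∑ j, ∑ l, pd l (tensorHbar W 1 a i j) x ^ 2) * bubble ξ ε x ^ 2 =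
      ∫ x in halfSpace n, ε ^ ((n : ℝ) - 2) *
        (gradSq (tangentialPart W) (a 0) x.1 * den ξ ε x ^ (-((n : ℝ) - 2))) :=
    setIntegral_congr_fun hH fun x hx => by
      simp only [sum_sq_pd_tensorHbar ha₁, bubble_sq hε hx]; ring
  rw [auxF, e1, e2, integral_const_mul, integral_const_mul, integral_halfSpace_translate ξ,
    integral_halfSpace_translate ξ fun x => gradSq (tangentialPart W) (a 0) x.1 * _]
  simp only [den_translate]
  have : ((n : ℝ) - 2) / (4 * (n - 1)) / 4 = (n - 2) / (16 * (n - 1)) := by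
    rw [div_div]; ring_nf
  rw [this]
  ring

/-- The part of order zero in `ξ` of the auxiliary function. -/
def auxZero (R : Fin (n - 1) → Fin (n - 1) → Fin (n - 1) → Fin (n - 1) → ℝ) (b ε : ℝ) : ℝ :=
  -(((n : ℝ) - 2) / (16 * (n - 1)) * ε ^ ((n : ℝ) - 2) *
    ∫ x in halfSpace n, gradSq R b x.1 * den 0 ε x ^ (-((n : ℝ) - 2)))

/-- The part of order two in `ξ` of the auxiliary function. -/
def auxSecond (R : Fin (n - 1) → Fin (n - 1) → Fin (n - 1) → Fin (n - 1) → ℝ) (b : ℝ) (ξ : Bdry n)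
    (ε : ℝ) : ℝ :=
  1 / 2 * ((n - 2) ^ 2 * ε ^ ((n : ℝ) - 2)) *
      (∫ x in halfSpace n, contractSq R b ξ x.1 * den 0 ε x ^ (-(n : ℝ)))
    - ((n : ℝ) - 2) / (16 * (n - 1)) * ε ^ ((n : ℝ) - 2) *
      ∫ x in halfSpace n, gradSqSecond R b ξ x.1 * den 0 ε x ^ (-((n : ℝ) - 2))

/-- The contraction term starts at second order, the gradient term loses its odd first-order part,
and the corrector is of fourth order. All remainders are uniform for ε between 1/2 and 2. -/
theorem exists_abs_auxF_sub_le (hn : 19 ≤ n) (hW : IsWeyl W)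
    (htr : ∀ x : Space n, ∑ i, tensorH W i i x = 0) (ha₁ : a 1 = -1) :
    ∃ C, ∀ (ξ : Bdry n) (ε : ℝ), ‖ξ‖ ≤ 1 → ε ∈ Set.Icc (1 / 2 : ℝ) 2 →
      |auxF W 1 a ξ ε - (auxZero (tangentialPart W) (a 0) ε +
        auxSecond (tangentialPart W) (a 0) ξ ε)| ≤ C * ‖ξ‖ ^ 3 := by
  have hR := hW.isTangentialCurvature htr
  set R := tangentialPart W
  have hn' : (19 : ℝ) ≤ n := by exact_mod_cast hn
  -- Integrability of the two remainders, of growth 8 and 6, against the weights D^(-n) and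
  -- D^(-(n-2)).
  have hβ1 : (n : ℝ) + (8 : ℕ) < 2 * n := by push_cast; linarith
  have hβ2 : (n : ℝ) + (6 : ℕ) < 2 * (n - 2) := by push_cast; linarith
  obtain ⟨C₁, hC₁⟩ := (isJet_contractSq_remainder (R := R) (b := a 0)).exists_abs_integral_le
    (n := n) (by omega) hβ1
  obtain ⟨C₂, hC₂⟩ := (isJet_gradSq_remainder (R := R) (b := a 0)).exists_abs_integral_le
    (n := n) (by omega) hβ2
  obtain ⟨C₃, hC₃⟩ := exists_abs_integral_source_mul_corrector_le (a := a) hn hW htr ha₁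
  refine ⟨1 / 2 * ((n - 2) ^ 2 * 2 ^ ((n : ℝ) - 2)) * C₁ +
    ((n : ℝ) - 2) / (16 * (n - 1)) * 2 ^ ((n : ℝ) - 2) * C₂ + |C₃|, fun ξ ε hξ hε => ?_⟩
  have hε0 : 0 < ε := by linarith [hε.1]
  have hε1 := hε.1
  have hεp : ε ^ ((n : ℝ) - 2) ≤ 2 ^ ((n : ℝ) - 2) :=
    Real.rpow_le_rpow hε0.le hε.2 (by linarith)
  have i1 : ∫ x in halfSpace n, contractSq R (a 0) ξ (x.1 + ξ) * den 0 ε x ^ (-(n : ℝ)) =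
      (∫ x in halfSpace n, contractSq R (a 0) ξ x.1 * den 0 ε x ^ (-(n : ℝ))) +
      ∫ x in halfSpace n, (contractSq R (a 0) ξ (x.1 + ξ) - contractSq R (a 0) ξ x.1) *
        den 0 ε x ^ (-(n : ℝ)) := by
    rw [← integral_add (integratesTo_contractSq hR (by omega) hε1 (by linarith) _ ξ).integrable
      (isJet_contractSq_remainder.integrable_mul_den (by omega) hε1 hβ1 hξ)]
    exact integral_congr_ae (ae_of_all _ fun x => by simp only; ring)
  have i2 : ∫ x in halfSpace n, gradSq R (a 0) (x.1 + ξ) * den 0 ε x ^ (-((n : ℝ) - 2)) =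
      (∫ x in halfSpace n, gradSq R (a 0) x.1 * den 0 ε x ^ (-((n : ℝ) - 2))) +
      (∫ x in halfSpace n, gradSqSecond R (a 0) ξ x.1 * den 0 ε x ^ (-((n : ℝ) - 2))) +
      ∫ x in halfSpace n, (gradSq R (a 0) (x.1 + ξ) - gradSq R (a 0) x.1 - gradSqFirst R (a 0) ξ x.1
        - gradSqSecond R (a 0) ξ x.1) * den 0 ε x ^ (-((n : ℝ) - 2)) := by
    have t0 := (integratesTo_gradSq hR (by omega) hε1 (β := (n : ℝ) - 2) (by linarith) (a 0)).integrable
    have t1 := isJet_gradSqFirst (R := R) (b := a 0).integratesTo_zero (n := n) (by omega) hε1 hβ2 hξ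
      (gradSqFirst_neg ξ)
    have t2 := (integratesTo_gradSqSecond hR (by omega) hε1 (β := (n : ℝ) - 2) (by linarith)
      (a 0) ξ).integrable
    have t3 := (isJet_gradSq_remainder (R := R) (b := a 0)).integrable_mul_den (n := n) (by omega)
      hε1 hβ2 hξ
    have e : ∀ x : Space n, gradSq R (a 0) (x.1 + ξ) * den 0 ε x ^ (-((n : ℝ) - 2)) =
        (gradSq R (a 0) x.1 * den 0 ε x ^ (-((n : ℝ) - 2)) +
          gradSqSecond R (a 0) ξ x.1 * den 0 ε x ^ (-((n : ℝ) - 2)) +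
          (gradSq R (a 0) (x.1 + ξ) - gradSq R (a 0) x.1 - gradSqFirst R (a 0) ξ x.1
            - gradSqSecond R (a 0) ξ x.1) * den 0 ε x ^ (-((n : ℝ) - 2))) +
          gradSqFirst R (a 0) ξ x.1 * den 0 ε x ^ (-((n : ℝ) - 2)) := fun x => by ring
    have key := (((IntegratesTo.mk t0 rfl).add (IntegratesTo.mk t2 rfl)).add
      (IntegratesTo.mk t3 rfl)).add t1
    rw [integral_congr_ae (ae_of_all _ e), key.integral_eq, add_zero]
  rw [auxF_eq hW htr ha₁ hε0, i1, i2, auxZero, auxSecond]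
  have h1 := hC₁ ξ ε hξ hε1
  have h2 := hC₂ ξ ε hξ hε1
  have h3 : |∫ x in halfSpace n, source W 1 a ξ ε x * corrector W 1 a ξ ε x| ≤ |C₃| * ‖ξ‖ ^ 3 :=
    (hC₃ ξ ε hξ hε).trans (mul_le_mul (le_abs_self _)
      (pow_le_pow_of_le_one (norm_nonneg _) hξ (by norm_num)) (by positivity) (abs_nonneg _))
  generalize (∫ x in halfSpace n, (contractSq R (a 0) ξ (x.1 + ξ) - contractSq R (a 0) ξ x.1) *
        den 0 ε x ^ (-(n : ℝ))) = r₁ at *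
  generalize (∫ x in halfSpace n, (gradSq R (a 0) (x.1 + ξ) - gradSq R (a 0) x.1 -
    gradSqFirst R (a 0) ξ x.1 - gradSqSecond R (a 0) ξ x.1) * den 0 ε x ^ (-((n : ℝ) - 2))) = r₂ at *
  generalize (∫ x in halfSpace n, source W 1 a ξ ε x * corrector W 1 a ξ ε x) = r₃ at *
  have k1 : |1 / 2 * ((n - 2) ^ 2 * ε ^ ((n : ℝ) - 2)) * r₁| ≤
      1 / 2 * ((n - 2) ^ 2 * 2 ^ ((n : ℝ) - 2)) * C₁ * ‖ξ‖ ^ 3 := by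
    rw [abs_mul, abs_of_nonneg (by positivity), mul_assoc _ C₁]
    exact mul_le_mul (by gcongr) h1 (abs_nonneg _) (by positivity)
  have hc0 : 0 ≤ ((n : ℝ) - 2) / (16 * (n - 1)) := div_nonneg (by linarith) (by linarith)
  have k2 : |((n : ℝ) - 2) / (16 * (n - 1)) * ε ^ ((n : ℝ) - 2) * r₂| ≤
      ((n : ℝ) - 2) / (16 * (n - 1)) * 2 ^ ((n : ℝ) - 2) * C₂ * ‖ξ‖ ^ 3 := by
    rw [abs_mul, abs_of_nonneg (by positivity), mul_assoc _ C₂]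
    exact mul_le_mul (by gcongr) h2 (abs_nonneg _) (by positivity)
  have key := (abs_add_le (1 / 2 * ((n - 2) ^ 2 * ε ^ ((n : ℝ) - 2)) * r₁ -
    ((n : ℝ) - 2) / (16 * (n - 1)) * ε ^ ((n : ℝ) - 2) * r₂) r₃).trans
    (add_le_add_left ((abs_sub _ _).trans (add_le_add k1 k2)) _)
  refine (le_of_eq (congrArg abs ?_)).trans (key.trans ?_)
  · ring
  · linarith

end

/-! ### The leading terms of the auxiliary function -/

section

variable {n : ℕ} {W : Fin n → Fin n → Fin n → Fin n → ℝ} {a : ℕ → ℝ} {ξ : Bdry n} {ε : ℝ}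
  {R : Fin (n - 1) → Fin (n - 1) → Fin (n - 1) → Fin (n - 1) → ℝ}

/-- The prefactor ε^(n-2) makes the dependence on ε an honest power ε^(k+2); for even k this is a
power of s = ε². -/
theorem rpow_mul_moment (hn : 2 ≤ n) (hε : 1 / 2 ≤ ε) (k : ℕ) (hk : (n : ℝ) + k < 2 * (n - 2)) :
    ε ^ ((n : ℝ) - 2) * moment n ε k (n - 2) =
      ε ^ (k + 2) * (radialMoment (n - 1) k (n - 2) / (n - 4 - k)) := by
  have hε0 : 0 < ε := by linarith
  rw [moment, integral_halfSpace_norm_pow_mul_den hn hε k hk, ← Real.rpow_natCast ε (k + 2)]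
  have e : ε ^ ((k + 2 : ℕ) : ℝ) = ε ^ ((n : ℝ) - 2) * ε ^ ((n : ℝ) + k - 2 * (n - 2)) := by
    rw [← Real.rpow_add hε0]; congr 1; push_cast; ring
  rw [e, show 2 * ((n : ℝ) - 2) - n - k = n - 4 - k by ring]
  ring

/-- Two steps of `radialMoment_succ` lead from (k, n-2) to (k+4, n), so both integrals in F are
expressed by the same moments. -/
theorem rpow_mul_moment_add_four (hn : 3 ≤ n) (hε : 1 / 2 ≤ ε) (k : ℕ)
    (hk : (n : ℝ) + k < 2 * (n - 2)) :
    ε ^ ((n : ℝ) - 2) * moment n ε (k + 4) n = ε ^ (k + 2) * ((n - 1 + k) * (n + 1 + k) /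
      (4 * (n - 1) * (n - 2)) * (radialMoment (n - 1) k (n - 2) / (n - 4 - k))) := by
  have hε0 : 0 < ε := by linarith
  have hn' : (3 : ℝ) ≤ n := by exact_mod_cast hn
  have hd : ((n - 1 : ℕ) : ℝ) = n - 1 := by rw [Nat.cast_sub (by omega)]; simp
  have h1 := radialMoment_succ (d := n - 1) (k := k) (by omega) (β := (n : ℝ) - 2) (by rw [hd]; linarith)
  have h2 := radialMoment_succ (d := n - 1) (k := k + 2) (by omega) (β := (n : ℝ) - 2 + 1)
    (by rw [hd]; push_cast; linarith)
  rw [hd] at h1 h2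
  rw [show (n : ℝ) - 2 + 1 + 1 = n by ring] at h2
  rw [moment, integral_halfSpace_norm_pow_mul_den (by omega) hε (k + 4) (by push_cast; linarith),
    ← Real.rpow_natCast ε (k + 2)]
  have e : ε ^ ((k + 2 : ℕ) : ℝ) = ε ^ ((n : ℝ) - 2) * ε ^ ((n : ℝ) + (k + 4 : ℕ) - 2 * n) := by
    rw [← Real.rpow_add hε0]; congr 1; push_cast; ring
  have h3 : radialMoment (n - 1) (k + 4) n = (n - 1 + k) * (n + 1 + k) /
      (4 * (n - 1) * (n - 2)) * radialMoment (n - 1) k (n - 2) := by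
    have ha : (n : ℝ) - 1 ≠ 0 := by linarith
    have hb : (n : ℝ) - 2 ≠ 0 := by linarith
    push_cast at h2
    rw [div_mul_eq_mul_div, eq_div_iff (by positivity)]
    linear_combination (-2 * ((n : ℝ) - 2)) * h2 - ((n : ℝ) + 1 + k) * h1
  rw [e, h3, show 2 * (n : ℝ) - n - (k + 4 : ℕ) = n - 4 - k by push_cast; ring]
  ring

theorem radialMoment_two (hn : 53 ≤ n) : radialMoment (n - 1) 2 ((n : ℝ) - 2) =
    (n - 1) / (n - 5) * radialMoment (n - 1) 0 ((n : ℝ) - 2) := by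
  have hn' : (53 : ℝ) ≤ n := by exact_mod_cast hn
  have hd : ((n - 1 : ℕ) : ℝ) = n - 1 := by rw [Nat.cast_sub (by omega)]; simp
  have h := radialMoment_add_two (d := n - 1) (k := 0) (by omega) (β := (n : ℝ) - 2)
    (by rw [hd]; push_cast; linarith)
  rw [hd, zero_add] at h
  rw [div_mul_eq_mul_div, eq_div_iff (by linarith)]
  push_cast at h
  linear_combination h

theorem radialMoment_four (hn : 53 ≤ n) : radialMoment (n - 1) 4 ((n : ℝ) - 2) =
    (n + 1) / (n - 7) * radialMoment (n - 1) 2 ((n : ℝ) - 2) := by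
  have hn' : (53 : ℝ) ≤ n := by exact_mod_cast hn
  have hd : ((n - 1 : ℕ) : ℝ) = n - 1 := by rw [Nat.cast_sub (by omega)]; simp
  have h := radialMoment_add_two (d := n - 1) (k := 2) (by omega) (β := (n : ℝ) - 2)
    (by rw [hd]; push_cast; linarith)
  rw [hd] at h
  rw [div_mul_eq_mul_div, eq_div_iff (by linarith)]
  push_cast at h
  linear_combination h

theorem radialMoment_six (hn : 53 ≤ n) : radialMoment (n - 1) 6 ((n : ℝ) - 2) =
    (n + 3) / (n - 9) * radialMoment (n - 1) 4 ((n : ℝ) - 2) := by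
  have hn' : (53 : ℝ) ≤ n := by exact_mod_cast hn
  have hd : ((n - 1 : ℕ) : ℝ) = n - 1 := by rw [Nat.cast_sub (by omega)]; simp
  have h := radialMoment_add_two (d := n - 1) (k := 4) (by omega) (β := (n : ℝ) - 2)
    (by rw [hd]; push_cast; linarith)
  rw [hd] at h
  rw [div_mul_eq_mul_div, eq_div_iff (by linarith)]
  push_cast at h
  linear_combination h

/-- The pairing formula combines the two parts of `gradSq` into the coefficients (n+1) a₀², -(2n+6)
a₀ and n+7, which are the α_q; the moments of order 2, 4, 6 supply the products in I and the powers
s², s³, s⁴. -/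
theorem auxZero_eq (hn : 53 ≤ n) (hR : IsTangentialCurvature R) (hε : 1 / 2 ≤ ε) (ha₁ : a 1 = -1) :
    auxZero R (a 0) ε = -((n - 2) / (16 * (n - 1)) * (curvNorm R / ((n - 1) * (n + 1)) *
      radialMoment (n - 1) 0 ((n : ℝ) - 2)) * polyI n 1 a (ε ^ 2)) := by
  have hn' : (53 : ℝ) ≤ n := by exact_mod_cast hn
  have hd : ((n - 1 : ℕ) : ℝ) = n - 1 := by rw [Nat.cast_sub (by omega)]; simp
  have k2 := rpow_mul_moment (n := n) (by omega) hε 2 (by push_cast; linarith)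
  have k4 := rpow_mul_moment (n := n) (by omega) hε 4 (by push_cast; linarith)
  have k6 := rpow_mul_moment (n := n) (by omega) hε 6 (by push_cast; linarith)
  rw [radialMoment_six hn, radialMoment_four hn, radialMoment_two hn] at k6
  rw [radialMoment_four hn, radialMoment_two hn] at k4
  rw [radialMoment_two hn] at k2
  rw [auxZero, (integratesTo_gradSq hR (by omega) hε (β := (n : ℝ) - 2) (by linarith) (a 0)).integral_eq,
    polyI_one, ha₁, hd]
  generalize moment n ε 2 ((n : ℝ) - 2) = M2 at *
  generalize moment n ε 4 ((n : ℝ) - 2) = M4 at *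
  generalize moment n ε 6 ((n : ℝ) - 2) = M6 at *
  generalize ε ^ ((n : ℝ) - 2) = E at *
  generalize radialMoment (n - 1) 0 ((n : ℝ) - 2) = m at *
  generalize curvNorm R = N at *
  generalize a 0 = b at *
  generalize (n : ℝ) = x at *
  push_cast at k2 k4 k6
  have e : x / 1 = x := div_one x
  have key : (x - 2) / (16 * (x - 1)) * E * (N / (x - 1) * (b ^ 2 * M2 - 2 * b * M4 + M6) +
      N / 2 / ((x - 1) * (x - 1 + 2)) * (12 * M6 - 8 * b * M4)) =
      (x - 2) / (16 * (x - 1)) * (N / ((x - 1) * (x + 1))) * ((x + 1) * b ^ 2 * (E * M2) -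
        (2 * x + 6) * b * (E * M4) + (x + 7) * (E * M6)) := by
    have h1 : x - 1 ≠ 0 := by linarith
    have h2 : x + 1 ≠ 0 := by linarith
    have h3 : x - 1 + 2 ≠ 0 := by linarith
    field_simp
    ring
  rw [key, k2, k4, k6]
  rw [show x - 4 - 2 = x - 6 by ring, show x - 4 - 4 = x - 8 by ring, show x - 4 - 6 = x - 10 by ring]
  ring

/-- The terms with b² from the two integrals cancel, so no ε² remains and everything is expressed by
the moment of order two. -/
theorem auxSecond_eq (hn : 53 ≤ n) (hR : IsTangentialCurvature R) (hε : 1 / 2 ≤ ε) (b : ℝ) (ξ : Bdry n) :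
    auxSecond R b ξ ε = (n - 2) / (16 * (n - 1) ^ 2) * radialMoment (n - 1) 2 ((n : ℝ) - 2) *
      (quadForm (normMatrix R) ξ * (8 * b * ε ^ 4 / (n - 6) -
        12 * (n + 5) / ((n - 7) * (n - 8)) * ε ^ 6) +
      curvNorm R * ‖ξ‖ ^ 2 * (2 * b * ε ^ 4 / (n - 6) -
        2 * (n + 6) / ((n - 7) * (n - 8)) * ε ^ 6)) := by
  have hn' : (53 : ℝ) ≤ n := by exact_mod_cast hn
  have hd : ((n - 1 : ℕ) : ℝ) = n - 1 := by rw [Nat.cast_sub (by omega)]; simp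
  have k0 := rpow_mul_moment (n := n) (by omega) hε 0 (by push_cast; linarith)
  have k2 := rpow_mul_moment (n := n) (by omega) hε 2 (by push_cast; linarith)
  have k4 := rpow_mul_moment (n := n) (by omega) hε 4 (by push_cast; linarith)
  have l0 := rpow_mul_moment_add_four (n := n) (by omega) hε 0 (by push_cast; linarith)
  have l2 := rpow_mul_moment_add_four (n := n) (by omega) hε 2 (by push_cast; linarith)
  have l4 := rpow_mul_moment_add_four (n := n) (by omega) hε 4 (by push_cast; linarith)
  norm_num only [] at l0 l2 l4
  rw [radialMoment_four hn] at k4 l4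
  rw [auxSecond, (integratesTo_gradSqSecond hR (by omega) hε (β := (n : ℝ) - 2) (by linarith) b ξ).integral_eq,
    (integratesTo_contractSq hR (by omega) hε (β := (n : ℝ)) (by linarith) b ξ).integral_eq, hd]
  generalize moment n ε 0 ((n : ℝ) - 2) = M0 at *
  generalize moment n ε 2 ((n : ℝ) - 2) = M2 at *
  generalize moment n ε 4 ((n : ℝ) - 2) = M4 at *
  generalize moment n ε 4 n = L0 at *
  generalize moment n ε 6 n = L2 at *
  generalize moment n ε 8 n = L4 at *
  generalize ε ^ ((n : ℝ) - 2) = E at *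
  generalize radialMoment (n - 1) 0 ((n : ℝ) - 2) = m0 at *
  generalize radialMoment (n - 1) 2 ((n : ℝ) - 2) = m at *
  generalize curvNorm R = N at *
  generalize quadForm (normMatrix R) ξ = T at *
  generalize ‖ξ‖ ^ 2 = q at *
  generalize (n : ℝ) = x at *
  push_cast at k0 k2 k4 l0 l2 l4
  have h1 : x - 1 ≠ 0 := by linarith
  have h1' : x - 2 ≠ 0 := by linarith
  have h2 : x + 1 ≠ 0 := by linarith
  have h4 : x - 4 ≠ 0 := by linarith
  have h6 : x - 6 ≠ 0 := by linarith
  have h7 : x - 7 ≠ 0 := by linarith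
  have h8 : x - 8 ≠ 0 := by linarith
  rw [show x - 1 + 2 = x + 1 by ring]
  have key : 1 / 2 * ((x - 2) ^ 2 * E) * (T / 2 / ((x - 1) * (x + 1)) *
      (b ^ 2 * L0 - 2 * b * L2 + L4)) - (x - 2) / (16 * (x - 1)) * E * (T * (b ^ 2 * M0 - 2 * b * M2 + M4 +
        (20 * M4 - 16 * b * M2) / (x - 1) + 56 * M4 / ((x - 1) * (x + 1))) + q * N *
        ((2 * M4 - 2 * b * M2) / (x - 1) + 10 * M4 / ((x - 1) * (x + 1)))) =
      1 / 2 * (x - 2) ^ 2 * (T / 2 / ((x - 1) * (x + 1)) *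
      (b ^ 2 * (E * L0) - 2 * b * (E * L2) + E * L4)) -
      (x - 2) / (16 * (x - 1)) * (T * (b ^ 2 * (E * M0) - 2 * b * (E * M2) + (E * M4) +
        (20 * (E * M4) - 16 * b * (E * M2)) / (x - 1) + 56 * (E * M4) / ((x - 1) * (x + 1))) + q * N *
        ((2 * (E * M4) - 2 * b * (E * M2)) / (x - 1) + 10 * (E * M4) / ((x - 1) * (x + 1)))) := by
    ring
  rw [key, k0, k2, k4, l0, l2, l4]
  rw [show x - 4 - 2 = x - 6 by ring, show x - 4 - 4 = x - 8 by ring, sub_zero]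
  field_simp
  ring

theorem radialMoment_pos_of_le (hn : 53 ≤ n) {k : ℕ} (hk : k ≤ 2) :
    0 < radialMoment (n - 1) k ((n : ℝ) - 2) := by
  have hn' : (53 : ℝ) ≤ n := by exact_mod_cast hn
  have hk' : (k : ℝ) ≤ 2 := by exact_mod_cast hk
  refine radialMoment_pos (by omega) ?_
  rw [Nat.cast_sub (by omega)]
  push_cast
  linarith

/-- At ε = 1 the coefficient of the form T is -4(n-5)/(n+3) J(1), positive by the hypothesis on b;
that of N|ξ|² is positive since n + 6 ≤ 3(n+5)/2. The form T is only known to be nonnegative, so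
definiteness comes from N > 0. Continuity in ε gives a uniform δ. -/
theorem exists_mul_norm_sq_le_auxSecond (hn : 53 ≤ n) (hR : IsTangentialCurvature R)
    (hN : 0 < curvNorm R) {b : ℝ}
    (hb : 3 / 2 * (((n : ℝ) + 5) * (n - 6)) / ((n - 7) * (n - 8)) < b) :
    ∃ δ > 0, ∀ᶠ ε : ℝ in 𝓝 1, ∀ ξ : Bdry n, δ * ‖ξ‖ ^ 2 ≤ auxSecond R b ξ ε := by
  have hn' : (53 : ℝ) ≤ n := by exact_mod_cast hn
  have hm := radialMoment_pos_of_le hn le_rfl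
  have h78 : 0 < ((n : ℝ) - 7) * (n - 8) := mul_pos (by linarith) (by linarith)
  have hb' : 3 / 2 * (n + 5) / ((n - 7) * (n - 8)) < b / ((n : ℝ) - 6) := by
    rw [lt_div_iff₀ (by linarith)]
    refine lt_of_eq_of_lt ?_ hb
    ring
  have hA : 0 < 8 * b * 1 ^ 4 / ((n : ℝ) - 6) - 12 * (n + 5) / ((n - 7) * (n - 8)) * 1 ^ 6 := by
    have e1 : 8 * b * 1 ^ 4 / ((n : ℝ) - 6) = 8 * (b / (n - 6)) := by ring
    have e2 : 12 * ((n : ℝ) + 5) / ((n - 7) * (n - 8)) * 1 ^ 6 =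
      8 * (3 / 2 * (n + 5) / ((n - 7) * (n - 8))) := by ring
    rw [e1, e2]
    linarith
  have hB : 0 < 2 * b * 1 ^ 4 / ((n : ℝ) - 6) - 2 * (n + 6) / ((n - 7) * (n - 8)) * 1 ^ 6 := by
    have e1 : 2 * b * 1 ^ 4 / ((n : ℝ) - 6) = 2 * (b / (n - 6)) := by ring
    have e2 : 2 * ((n : ℝ) + 6) / ((n - 7) * (n - 8)) * 1 ^ 6 =
      2 * ((n + 6) / ((n - 7) * (n - 8))) := by ring
    have h : ((n : ℝ) + 6) / ((n - 7) * (n - 8)) ≤ 3 / 2 * (n + 5) / ((n - 7) * (n - 8)) :=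
      div_le_div_of_nonneg_right (by linarith) h78.le
    rw [e1, e2]
    linarith
  have hc : 0 < ((n : ℝ) - 2) / (16 * (n - 1) ^ 2) * radialMoment (n - 1) 2 ((n : ℝ) - 2) :=
    mul_pos (div_pos (by linarith) (mul_pos (by norm_num) (pow_pos (by linarith) 2))) hm
  set B := 2 * b * 1 ^ 4 / ((n : ℝ) - 6) - 2 * (n + 6) / ((n - 7) * (n - 8)) * 1 ^ 6
  set c := ((n : ℝ) - 2) / (16 * (n - 1) ^ 2) * radialMoment (n - 1) 2 ((n : ℝ) - 2)
  have hcA : Continuous fun ε : ℝ => 8 * b * ε ^ 4 / ((n : ℝ) - 6) -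
    12 * (n + 5) / ((n - 7) * (n - 8)) * ε ^ 6 := by fun_prop
  have hcB : Continuous fun ε : ℝ => 2 * b * ε ^ 4 / ((n : ℝ) - 6) -
    2 * (n + 6) / ((n - 7) * (n - 8)) * ε ^ 6 := by fun_prop
  refine ⟨c * (curvNorm R * (B / 2)), by positivity, ?_⟩
  filter_upwards [hcA.continuousAt.eventually (lt_mem_nhds hA),
    hcB.continuousAt.eventually (lt_mem_nhds (show B / 2 < B by linarith)),
    lt_mem_nhds (show (1 / 2 : ℝ) < 1 by norm_num)] with ε h1 h2 h3 ξ
  rw [auxSecond_eq hn hR h3.le, mul_assoc]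
  refine mul_le_mul_of_nonneg_left ?_ hc.le
  have hT : 0 ≤ quadForm (normMatrix R) ξ := by rw [quadForm_normMatrix]; positivity
  have h4 := mul_nonneg hT h1.le
  have h5 := mul_le_mul_of_nonneg_left h2.le (mul_nonneg hN.le (sq_nonneg ‖ξ‖))
  calc curvNorm R * (B / 2) * ‖ξ‖ ^ 2 = curvNorm R * ‖ξ‖ ^ 2 * (B / 2) := by ring
    _ ≤ _ := by linarith

theorem eventually_polyI_lt (h1 : deriv (polyI n 1 a) 1 = 0)
    (h2 : deriv (deriv (polyI n 1 a)) 1 < 0) :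
    ∀ᶠ s : ℝ in 𝓝 1, s ≠ 1 → polyI n 1 a s < polyI n 1 a 1 := by
  rw [(hasDerivAt_polyI_one n a 1).deriv] at h1
  rw [deriv_deriv_polyI_one] at h2
  simp only [polyI_one]
  generalize ((n : ℝ) + 1) * a 0 ^ 2 / (n - 6) * ((n - 1) / (n - 5)) = p at *
  generalize (2 * (n : ℝ) + 6) * (a 0 * a 1) / (n - 8) * ((n - 1) / (n - 5) * ((n + 1) / (n - 7)))
    = q at *
  generalize ((n : ℝ) + 7) * a 1 ^ 2 / (n - 10) *
      ((n - 1) / (n - 5) * ((n + 1) / (n - 7)) * ((n + 3) / (n - 9))) = r at *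
  -- For a combination of s², s³, s⁴ one has I(s) - I(1) = (s-1) I'(1) + (s-1)² h(s) with this h,
  -- and h(1) = I''(1)/2 < 0.
  have hc : Continuous fun s : ℝ => p + q * (s + 2) + r * (s ^ 2 + 2 * s + 3) := by fun_prop
  filter_upwards [hc.continuousAt.eventually
    (gt_mem_nhds (show p + q * (1 + 2) + r * (1 ^ 2 + 2 * 1 + 3) < 0 by linarith))] with s hs hs1
  have h3 : 0 < (s - 1) ^ 2 := by positivity [sub_ne_zero.2 hs1]
  have h4 := mul_neg_of_pos_of_neg h3 hs
  linear_combination h4 + (s - 1) * h1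

theorem eventually_auxZero_lt (hn : 53 ≤ n) (hR : IsTangentialCurvature R) (hN : 0 < curvNorm R)
    (ha₁ : a 1 = -1) (h1 : deriv (polyI n 1 a) 1 = 0) (h2 : deriv (deriv (polyI n 1 a)) 1 < 0) :
    ∀ᶠ ε : ℝ in 𝓝 1, ε ≠ 1 → auxZero R (a 0) 1 < auxZero R (a 0) ε := by
  have hn' : (53 : ℝ) ≤ n := by exact_mod_cast hn
  have hm := radialMoment_pos_of_le hn (Nat.zero_le 2)
  have ht : Tendsto (fun ε : ℝ => ε ^ 2) (𝓝 1) (𝓝 1) := by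
    simpa using (continuous_pow 2).tendsto (1 : ℝ)
  filter_upwards [ht.eventually (eventually_polyI_lt h1 h2),
    lt_mem_nhds (show (1 / 2 : ℝ) < 1 by norm_num)] with ε hs hε hε1
  rw [auxZero_eq hn hR hε.le ha₁, auxZero_eq hn hR (by norm_num) ha₁, one_pow]
  have hc : 0 < ((n : ℝ) - 2) / (16 * (n - 1)) * (curvNorm R / ((n - 1) * (n + 1)) *
      radialMoment (n - 1) 0 ((n : ℝ) - 2)) :=
    mul_pos (div_pos (by linarith) (by linarith))
      (mul_pos (div_pos hN (mul_pos (by linarith) (by linarith))) hm)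
  -- The case ε² = 1 with ε ≠ 1 is excluded because ε > 1/2.
  refine neg_lt_neg (mul_lt_mul_of_pos_left (hs fun h => hε1 ?_) hc)
  nlinarith

theorem tangentialNormSq_eq : tangentialNormSq W = curvNorm (tangentialPart W) := by
  rw [curvNorm_eq]
  rfl

/-- Close to (0, 1) the quadratic gain δ|ξ|² beats the cubic remainder C|ξ|³ when ξ ≠ 0, while for ξ
= 0 the strict minimum of the zeroth-order part decides. -/
theorem eventually_auxF_lt (hn : 53 ≤ n) (hW : IsWeyl W)
    (htr : ∀ x : Space n, ∑ i, tensorH W i i x = 0) (hN : 0 < tangentialNormSq W)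
    (ha₁ : a 1 = -1) (h1 : deriv (polyI n 1 a) 1 = 0) (h2 : deriv (deriv (polyI n 1 a)) 1 < 0)
    (hb : 3 / 2 * (((n : ℝ) + 5) * (n - 6)) / ((n - 7) * (n - 8)) < a 0) :
    ∀ᶠ p : Bdry n × ℝ in 𝓝[≠] (0, 1), auxF W 1 a 0 1 < auxF W 1 a p.1 p.2 := by
  have hR := hW.isTangentialCurvature htr
  rw [tangentialNormSq_eq] at hN
  obtain ⟨C, hC⟩ := exists_abs_auxF_sub_le (a := a) (by omega) hW htr ha₁
  obtain ⟨δ, hδ, hsec⟩ := exists_mul_norm_sq_le_auxSecond hn hR hN hb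
  have hzero := eventually_auxZero_lt hn hR hN ha₁ h1 h2
  have ht1 : Tendsto (fun p : Bdry n × ℝ => ‖p.1‖) (𝓝 (0, 1)) (𝓝 0) := by
    simpa using (continuous_fst.norm).tendsto ((0 : Bdry n), (1 : ℝ))
  have ht2 : Tendsto (fun p : Bdry n × ℝ => p.2) (𝓝 (0, 1)) (𝓝 1) := continuous_snd.tendsto _
  have ht3 : Tendsto (fun p : Bdry n × ℝ => C * ‖p.1‖) (𝓝 (0, 1)) (𝓝 0) := by
    simpa using ht1.const_mul C
  -- At ξ = 0 the cubic error bound is zero, so the expansion is an equality there.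
  have h01 : auxF W 1 a 0 1 = auxZero (tangentialPart W) (a 0) 1 := by
    have h := hC 0 1 (by simp) (by norm_num)
    have hs : auxSecond (tangentialPart W) (a 0) (0 : Bdry n) 1 = 0 := by
      rw [auxSecond_eq hn hR (by norm_num), quadForm_normMatrix]
      simp
    rw [hs, norm_zero, zero_pow three_ne_zero, mul_zero, add_zero] at h
    exact sub_eq_zero.1 (abs_nonpos_iff.1 h)
  rw [h01, eventually_nhdsWithin_iff]
  filter_upwards [ht1.eventually (gt_mem_nhds one_pos), ht3.eventually (gt_mem_nhds hδ),
    ht2.eventually hsec, ht2.eventually hzero,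
    ht2.eventually (Icc_mem_nhds (show (1 / 2 : ℝ) < 1 by norm_num) one_lt_two)] with p e1 e2 e3 e4 e5 hp
  have h3 := (abs_le.1 (hC p.1 p.2 e1.le e5)).1
  have h4 := e3 p.1
  have h5 : auxZero (tangentialPart W) (a 0) 1 ≤ auxZero (tangentialPart W) (a 0) p.2 := by
    rcases eq_or_ne p.2 1 with h | h
    · rw [h]
    · exact (e4 h).le
  have h6 : (δ - C * ‖p.1‖) * ‖p.1‖ ^ 2 = δ * ‖p.1‖ ^ 2 - C * ‖p.1‖ ^ 3 := by ring
  by_cases hξ : p.1 = 0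
  · have h7 := e4 fun h => hp (Prod.ext hξ h)
    rw [hξ, norm_zero] at h3 h4
    rw [hξ]
    linarith
  · have h7 : 0 < (δ - C * ‖p.1‖) * ‖p.1‖ ^ 2 :=
      mul_pos (by linarith) (pow_pos (norm_pos_iff.2 hξ) 2)
    linarith

end

end HalfSpaceBubble

end

theorem mainTheorem6 (n : ℕ) (hn : 53 ≤ n) (a : ℕ → ℝ) (ha₁ : a 1 = -1)
    (ha₀ : a 0 = ((n : ℝ) + 3) * (n - 6) / (2 * (n - 7) * (n - 8)) *
      (3 + Real.sqrt (9 - 8 * ((n : ℝ) - 7) * (n - 8) ^ 2 * (n + 7) /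
        ((n + 3) * (n - 6) * (n - 9) * (n - 10))))) :
    deriv (HalfSpaceBubble.polyI n 1 a) 1 = 0 ∧
    deriv (deriv (HalfSpaceBubble.polyI n 1 a)) 1 < 0 ∧
    HalfSpaceBubble.polyJ n 1 a 1 < 0 ∧
    ∀ W : Fin n → Fin n → Fin n → Fin n → ℝ, HalfSpaceBubble.IsWeyl W →
      (∀ x : HalfSpaceBubble.Space n, ∑ i, HalfSpaceBubble.tensorH W i i x = 0) →
      0 < HalfSpaceBubble.tangentialNormSq W →
      ∀ᶠ p : HalfSpaceBubble.Bdry n × ℝ in 𝓝[≠] (0, 1),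
        HalfSpaceBubble.auxF W 1 a 0 1 < HalfSpaceBubble.auxF W 1 a p.1 p.2 := by
  obtain ⟨h1, h2, h3, h4⟩ := HalfSpaceBubble.polyI_polyJ_facts n hn a ha₁ ha₀
  exact ⟨h1, h2, h3, fun W hW htr hN =>
    HalfSpaceBubble.eventually_auxF_lt hn hW htr hN ha₁ h1 h2 h4⟩
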